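/- Let $g\ge 0$ and $n\ge 1$ with $2g-2+n>0$. A *stable ribbon graph of type $(g,n)$* is a finite connected graph $\gamma$ (vertices, edges, half-edges) together with, for every vertex $v$, a compact connected oriented topological surface $S_v$ with nonempty boundary, in whose boundary circles the half-edges at $v$ are embedded. It is required that a disk $S_v$ carries at least three half-edges and an annulus $S_v$ at least one, and that the surface obtained by gluing a strip to $\coprod_v S_v$ along every edge has genus $g$ and $n$ boundary circles. (The graph with one vertex and no edge is included.) Isomorphisms are bijections of half-edges preserving vertices and edges, together with orientation-preserving homeomorphisms of the surfaces $S_v$ compatible with the embedded half-edges. The contraction $\gamma/e$ of an edge or loop $e$ is obtained by gluing the surface(s) at the ends of $e$ along a strip. Consider stable ribbon graphs of type $(g,n)$ whose edges are coloured black or white. For a black edge $e$, let $e\backslash\gamma$ be $\gamma$ with $e$ recoloured white. Give $[0,\infty]$ the smooth structure of $[0,1]$ by means of $x\mapsto \frac1{1-x}-1$. Let $\mathcal L^\infty_{g,n}$ be the orbi-cell complex obtained from the cubes $[0,\infty]^{E_{\mathrm{Black}}(\gamma)}$ by identifying them along isomorphisms, the face $\{x_e=0\}$ of $\gamma$ with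 the cube of $\gamma/e$, and the face $\{x_e=\infty\}$ with the cube of $e\backslash\gamma$. * An *orbi-cellular $k$-form* $\omega\in\Omega^k(\mathcal L^\infty_{g,n})$ assigns to every coloured graph $\gamma$ a smooth real $k$-form $\omega_\gamma$ on $[0,\infty]^{E_{\mathrm{Black}}(\gamma)}$, compatibly with isomorphisms (in particular $\mathrm{Aut}(\gamma)$-invariant), such that $\omega_\gamma$ restricts to $\omega_{\gamma/e}$ on $\{x_e=0\}$ and to $\omega_{e\backslash\gamma}$ on $\{x_e=\infty\}$ for every black edge $e$. With the exterior derivative these form a cochain complex $\Omega^\bullet(\mathcal L^\infty_{g,n})$. * An *orbi-cellular $k$-cochain* $c\in C^k(\mathcal L^\infty_{g,n})$ assigns a real number to every coloured graph with $k$ black edges together with an ordering of its black edges, depends only on the isomorphism class, and changes by $\operatorname{sgn}\pi$ when the ordering is permuted by $\pi$. The differential is $$(\delta c)(\gamma;e_0,\dots,e_k)=\sum_{i=0}^k(-1)^i\bigl[c(e_i\backslash\gamma;e_0,\dots,\widehat{e_i},\dots,e_k)-c(\gamma/e_i;e_0,\dots,\widehat{e_i},\dots,e_k)\bigr].$$ **Theorem.**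 $\Omega^\bullet(\mathcal L^\infty_{g,n})$ and $C^\bullet(\mathcal L^\infty_{g,n})$ are cochain complexes, and integrating $\omega_\gamma$ over the oriented cube $[0,\infty]^{E_{\mathrm{Black}}(\gamma)}$ defines a map of complexes $$\int:\Omega^\bullet(\mathcal L^\infty_{g,n})\to C^\bullet(\mathcal L^\infty_{g,n}),$$ which is a quasi-isomorphism. Hence $\Omega^\bullet(\mathcal L^\infty_{g,n})$ computes the cohomology of the space $\mathcal L^\infty_{g,n}$: for every $k$, $H^k(\Omega^\bullet(\mathcal L^\infty_{g,n}))$ is isomorphic to the singular cohomology $H^k(\mathcal L^\infty_{g,n};\mathbb R)$. -/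

import Mathlib

open Equiv CategoryTheory

namespace OrbiCell

section Permutations

/-- The cycle of `x` under the permutation `π`, as a set; a fixed point forms a cycle of its own. -/
def cyc {α : Type} (π : Perm α) (x : α) : Set α := {y | π.SameCycle x y}

/-- The number of cycles of `π` (fixed points included) that meet the set `P`. -/
noncomputable def numCycles {α : Type} (π : Perm α) (P : Set α) : ℕ := (cyc π '' P).ncard

open Classical in
/-- Take `a` out of its cycle: `a` becomes a fixed point and the predecessor of `a` is now followed
by the successor of `a`. -/
noncomputable def unlink {α : Type} (a : α) (π : Perm α) : Perm α := swap a (π a) * π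

open Classical in
theorem unlink_apply {α : Type} (a : α) (π : Perm α) (x : α) :
    unlink a π x = if x = a then a else if π x = a then π a else π x := by
  unfold unlink
  by_cases h : x = a
  · subst h; simp
  · by_cases h' : π x = a
    · simp [h, h']
    · simp only [Perm.mul_apply, h, h', if_false]
      exact swap_apply_of_ne_of_ne h' (fun e => h (π.injective e))

theorem unlink_self {α : Type} (a : α) (π : Perm α) : unlink a π a = a := by
  simp [unlink_apply]

theorem cyc_eq_iff {α : Type} (π : Perm α) (x y : α) : cyc π x = cyc π y ↔ π.SameCycle x y := by
  constructor
  · intro h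
    have : y ∈ cyc π y := Perm.SameCycle.refl π y
    rw [← h] at this; exact this
  · intro h; ext z; exact ⟨fun k => h.symm.trans k, fun k => h.trans k⟩

theorem sameCycle_closed {α : Type} [Finite α] (π : Perm α) (S : Set α) (hS : ∀ x ∈ S, π x ∈ S)
    {x y : α} (h : π.SameCycle x y) (hx : x ∈ S) : y ∈ S := by
  obtain ⟨i, -, rfl⟩ := h.exists_pow_eq'
  clear h
  induction i with
  | zero => simpa using hx
  | succ n ih => rw [pow_succ', Perm.mul_apply]; exact hS _ ih

theorem sameCycle_of_step {α : Type} [Finite α] (π ρ : Perm α)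
    (h : ∀ x, ρ.SameCycle x (π x)) {x y : α} (hxy : π.SameCycle x y) : ρ.SameCycle x y :=
  sameCycle_closed π {z | ρ.SameCycle x z} (fun z hz => Perm.SameCycle.trans hz (h z)) hxy
    (Perm.SameCycle.refl ρ x)

theorem sameCycle_step {α : Type} (π : Perm α) (x : α) : π.SameCycle x (π x) := ⟨1, by simp⟩

theorem sameCycle_unlink {α : Type} [Finite α] (a : α) (π : Perm α) {x y : α} (hx : x ≠ a)
    (hy : y ≠ a) : (unlink a π).SameCycle x y ↔ π.SameCycle x y := by
  constructor
  · refine sameCycle_of_step _ _ fun z => ?_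
    rw [unlink_apply]
    split_ifs with h1 h2
    · subst h1; exact Perm.SameCycle.refl _ _
    · have := sameCycle_step π (π z)
      rw [h2] at this
      exact (h2 ▸ sameCycle_step π z : π.SameCycle z a).trans this
    · exact sameCycle_step π z
  · intro h
    have key := sameCycle_closed π
      {z | (z ≠ a → (unlink a π).SameCycle x z) ∧ (z = a → (unlink a π).SameCycle x (π a))}
      (fun z hz => ?_) h ⟨fun _ => Perm.SameCycle.refl _ _, fun e => absurd e hx⟩
    · exact key.1 hy
    · by_cases hza : z = a
      · subst hza
        exact ⟨fun _ => hz.2 rfl, fun _ => hz.2 rfl⟩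
      · have h1 := (hz.1 hza).trans (sameCycle_step (unlink a π) z)
        rw [unlink_apply, if_neg hza] at h1
        refine ⟨fun hne => ?_, fun he => ?_⟩
        · rwa [if_neg hne] at h1
        · rwa [if_pos he] at h1

theorem ncard_image_congr {α β γ δ : Type} (F : α → β) (G : γ → δ) (i : γ → α) (Q : Set γ)
    (h : ∀ x ∈ Q, ∀ y ∈ Q, F (i x) = F (i y) ↔ G x = G y) :
    (F '' (i '' Q)).ncard = (G '' Q).ncard := by
  rw [Set.image_image]
  have hc : ∀ s ∈ (fun x => F (i x)) '' Q, ∃ x ∈ Q, F (i x) = s := fun s hs => hs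
  choose f hfQ hf using hc
  refine Set.ncard_congr (fun s hs => G (f s hs)) (fun s hs => ⟨_, hfQ s hs, rfl⟩) ?_ ?_
  · intro s t hs ht e
    rw [← hf s hs, ← hf t ht]
    exact (h _ (hfQ s hs) _ (hfQ t ht)).2 e
  · rintro _ ⟨x, hx, rfl⟩
    exact ⟨F (i x), ⟨x, hx, rfl⟩, (h _ (hfQ _ _) _ hx).1 (hf _ _)⟩

theorem numCycles_congr {α : Type} (π ρ : Perm α) (Q : Set α)
    (h : ∀ x ∈ Q, ∀ y ∈ Q, π.SameCycle x y ↔ ρ.SameCycle x y) :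
    numCycles π Q = numCycles ρ Q := by
  have := ncard_image_congr (cyc π) (cyc ρ) id Q
    (fun x hx y hy => by simpa [cyc_eq_iff] using h x hx y hy)
  simpa [numCycles] using this

open Classical in
theorem numCycles_unlink {α : Type} [Finite α] (a : α) (π : Perm α) (P : Set α) (ha : a ∈ P)
    (hπ : π a ∈ P) :
    numCycles π P = numCycles (unlink a π) (P \ {a}) + if π a = a then 1 else 0 := by
  rw [← numCycles_congr π (unlink a π) (P \ {a})
    (fun x hx y hy => (sameCycle_unlink a π hx.2 hy.2).symm)]
  unfold numCycles
  split_ifs with h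
  · have e : cyc π '' P = insert (cyc π a) (cyc π '' (P \ {a})) := by
      rw [← Set.image_insert_eq, Set.insert_sdiff_singleton, Set.insert_eq_of_mem ha]
    rw [e, Set.ncard_insert_of_notMem _ (Set.toFinite _)]
    rintro ⟨x, hx, hxa⟩
    rw [cyc_eq_iff] at hxa
    exact hx.2 (sameCycle_closed π {a} (fun y hy => by simp_all) hxa.symm rfl)
  · congr 1
    apply subset_antisymm
    · rintro _ ⟨x, hx, rfl⟩
      by_cases hxa : x = a
      · subst hxa
        exact ⟨π x, ⟨hπ, h⟩, ((cyc_eq_iff _ _ _).2 (sameCycle_step π x)).symm⟩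
      · exact ⟨x, ⟨hx, hxa⟩, rfl⟩
    · exact Set.image_mono Set.sdiff_subset

open Classical in
theorem not_sameCycle_mul_swap {α : Type} [Finite α] (π : Perm α) {a b : α} (hab : a ≠ b)
    (h : π.SameCycle a b) : ¬ (π * swap a b).SameCycle a b := by
  -- the cycle of `b` runs through `π a, π (π a), …` and closes up at `b`
  have hex : ∃ m : ℕ, 0 < m ∧ (π ^ m) a = b := by
    obtain ⟨i, hi, -, e⟩ := h.exists_pow_eq''
    exact ⟨i, hi, e⟩
  obtain ⟨hm0, hm⟩ := Nat.find_spec hex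
  have hmin := fun j (hj : j < Nat.find hex) => Nat.find_min hex hj
  set m := Nat.find hex
  intro hs
  have hne : ∀ j, 0 < j → j ≤ m → (π ^ j) a ≠ a := by
    intro j hj hjm e
    have hlt : j < m := lt_of_le_of_ne hjm (fun k => hab (by rw [← e, k, hm]))
    refine hmin (m - j) (by omega) ⟨by omega, ?_⟩
    rw [← hm, show m = (m - j) + j by omega, pow_add, Perm.mul_apply, e]
    congr 2; omega
  have key := sameCycle_closed (π * swap a b) {z | ∃ j, 0 < j ∧ j ≤ m ∧ (π ^ j) a = z} ?_ hs.symm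
    ⟨m, hm0, le_rfl, hm⟩
  · obtain ⟨j, h0, hj, e⟩ := key
    exact hne j h0 hj e
  · rintro _ ⟨j, h0, hj, rfl⟩
    rcases hj.lt_or_eq with hlt | rfl
    · refine ⟨j + 1, by omega, by omega, ?_⟩
      rw [Perm.mul_apply, swap_apply_of_ne_of_ne (hne j h0 hj) (fun e => hmin j hlt ⟨h0, e⟩),
        pow_succ', Perm.mul_apply]
    · refine ⟨1, by omega, by omega, ?_⟩
      rw [hm, Perm.mul_apply, swap_apply_right, pow_one]

open Classical in
theorem sameCycle_mul_swap {α : Type} [Finite α] (π : Perm α) {a b : α}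
    (h : ¬ π.SameCycle a b) : (π * swap a b).SameCycle a b := by
  set ρ := π * swap a b
  by_contra hcon
  have h1 : ρ.SameCycle a (π b) := by
    have := sameCycle_step ρ a
    simpa [ρ] using this
  have k2 := sameCycle_closed π {z | ρ.SameCycle a z ∧ π.SameCycle b z} (fun z hz => ?_)
    (sameCycle_step π b).symm ⟨h1, sameCycle_step π b⟩
  · exact hcon k2.1
  · have hzb : z ≠ b := fun e => hcon (e ▸ hz.1)
    have hza : z ≠ a := fun e => h (e ▸ hz.2).symm
    have := sameCycle_step ρ z
    rw [show ρ z = π z by simp [ρ, swap_apply_of_ne_of_ne hza hzb]] at this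
    exact ⟨hz.1.trans this, hz.2.trans (sameCycle_step π z)⟩

open Classical in
theorem numCycles_merge {α : Type} [Finite α] (π : Perm α) {a b : α} (P : Set α) (ha : a ∈ P)
    (hb : b ∈ P) (h : ¬ π.SameCycle a b) :
    numCycles π P = numCycles (π * swap a b) P + 1 := by
  set ρ := π * swap a b with hρ
  have hab : ρ.SameCycle a b := sameCycle_mul_swap π h
  have hsw : ∀ z, ρ.SameCycle z (swap a b z) := fun z => by
    rw [swap_apply_def]
    split_ifs with h1 h2
    · exact h1 ▸ hab
    · exact h2 ▸ hab.symm
    · exact Perm.SameCycle.refl _ _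
  have hle : ∀ {x y}, π.SameCycle x y → ρ.SameCycle x y := fun hxy => by
    refine sameCycle_of_step π ρ (fun z => ?_) hxy
    have := (hsw z).trans (sameCycle_step ρ (swap a b z))
    simpa [hρ] using this
  have hge : ∀ {x y}, ρ.SameCycle x y → ¬ π.SameCycle x a → π.SameCycle y a ∨ π.SameCycle x y ∨
      π.SameCycle y b := fun {x y} hxy hxa => by
    refine sameCycle_closed ρ {z | π.SameCycle z a ∨ π.SameCycle x z ∨ π.SameCycle z b}
      (fun z hz => ?_) hxy (Or.inr (Or.inl (Perm.SameCycle.refl _ _)))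
    by_cases h1 : z = a
    · subst h1
      right; right
      simpa [hρ] using (sameCycle_step π b).symm
    by_cases h2 : z = b
    · subst h2
      left
      simpa [hρ] using (sameCycle_step π a).symm
    have e : ρ z = π z := by simp [hρ, swap_apply_of_ne_of_ne h1 h2]
    show π.SameCycle (ρ z) a ∨ π.SameCycle x (ρ z) ∨ π.SameCycle (ρ z) b
    rw [e]
    rcases hz with hz | hz | hz
    · exact Or.inl ((sameCycle_step π z).symm.trans hz)
    · exact Or.inr (Or.inl (hz.trans (sameCycle_step π z)))
    · exact Or.inr (Or.inr ((sameCycle_step π z).symm.trans hz))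
  -- points outside the cycle of `a` represent all cycles of `ρ`, once each
  have e1 : numCycles π P = numCycles π {x ∈ P | ¬ π.SameCycle x a} + 1 := by
    have e : cyc π '' P = insert (cyc π a) (cyc π '' {x ∈ P | ¬ π.SameCycle x a}) := by
      apply subset_antisymm
      · rintro _ ⟨x, hx, rfl⟩
        by_cases hxa : π.SameCycle x a
        · exact Or.inl ((cyc_eq_iff _ _ _).2 hxa)
        · exact Or.inr ⟨x, ⟨hx, hxa⟩, rfl⟩
      · rintro _ (rfl | ⟨x, hx, rfl⟩)
        · exact ⟨a, ha, rfl⟩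
        · exact ⟨x, hx.1, rfl⟩
    unfold numCycles
    rw [e, Set.ncard_insert_of_notMem _ (Set.toFinite _)]
    rintro ⟨x, hx, hxa⟩
    exact hx.2 ((cyc_eq_iff _ _ _).1 hxa)
  have e2 : numCycles ρ P = numCycles ρ {x ∈ P | ¬ π.SameCycle x a} := by
    unfold numCycles
    congr 1
    apply subset_antisymm
    · rintro _ ⟨x, hx, rfl⟩
      by_cases hxa : π.SameCycle x a
      · refine ⟨b, ⟨hb, fun k => h k.symm⟩, ((cyc_eq_iff _ _ _).2 ?_)⟩
        exact hab.symm.trans (hle hxa).symm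
      · exact ⟨x, ⟨hx, hxa⟩, rfl⟩
    · exact Set.image_mono (fun x hx => hx.1)
  rw [e1, e2]
  congr 1
  refine numCycles_congr _ _ _ fun x hx y hy => ⟨hle, fun hxy => ?_⟩
  rcases hge hxy hx.2 with k | k | k
  · exact absurd k hy.2
  · exact k
  · rcases hge hxy.symm hy.2 with k' | k' | k'
    · exact absurd k' hx.2
    · exact k'.symm
    · exact k'.trans k.symm

open Classical in
theorem numCycles_split {α : Type} [Finite α] (π : Perm α) {a b : α} (hab : a ≠ b) (P : Set α)
    (ha : a ∈ P) (hb : b ∈ P) (h : π.SameCycle a b) :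
    numCycles (π * swap a b) P = numCycles π P + 1 := by
  have := numCycles_merge (π * swap a b) P ha hb (not_sameCycle_mul_swap π hab h)
  simpa [mul_assoc] using this

theorem numCycles_subtypePerm {α : Type} [Finite α] (π : Perm α) {p : α → Prop}
    (hp : ∀ x, p (π x) ↔ p x) (Q : Set {x // p x}) :
    numCycles (π.subtypePerm hp) Q = numCycles π (Subtype.val '' Q) :=
  (ncard_image_congr (cyc π) (cyc (π.subtypePerm hp)) Subtype.val Q fun x _ y _ => by
    rw [cyc_eq_iff, cyc_eq_iff, Perm.sameCycle_subtypePerm]).symm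

theorem numCycles_congr_of_eqOn {α : Type} [Finite α] (π ρ : Perm α) (S : Set α)
    (hS : ∀ x ∈ S, π x ∈ S) (h : ∀ x ∈ S, ρ x = π x) : numCycles ρ S = numCycles π S := by
  refine numCycles_congr _ _ _ fun x hx y _ => ⟨fun k => ?_, fun k => ?_⟩
  · exact (sameCycle_closed ρ {z | z ∈ S ∧ π.SameCycle x z} (fun z hz => by
      rw [h z hz.1]
      exact ⟨hS z hz.1, hz.2.trans (sameCycle_step π z)⟩) k ⟨hx, Perm.SameCycle.refl _ _⟩).2
  · exact (sameCycle_closed π {z | z ∈ S ∧ ρ.SameCycle x z} (fun z hz => by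
      have := hz.2.trans (sameCycle_step ρ z)
      rw [h z hz.1] at this
      exact ⟨hS z hz.1, this⟩) k ⟨hx, Perm.SameCycle.refl _ _⟩).2

theorem numCycles_union {α : Type} [Finite α] (π : Perm α) (S T : Set α)
    (hS : ∀ x ∈ S, π x ∈ S) (hST : Disjoint S T) :
    numCycles π (S ∪ T) = numCycles π S + numCycles π T := by
  unfold numCycles
  rw [Set.image_union, Set.ncard_union_eq _ (Set.toFinite _) (Set.toFinite _)]
  rw [Set.disjoint_left]
  rintro _ ⟨x, hx, rfl⟩ ⟨y, hy, e⟩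
  exact Set.disjoint_left.1 hST (sameCycle_closed π S hS ((cyc_eq_iff _ _ _).1 e.symm) hx) hy

end Permutations
open Classical in
theorem finsum_collapse {V M : Type} [Finite V] [AddCommMonoid M] (v w : V) (F : V → M)
    (F' : {u // u = v ∨ u ≠ w} → M) (c : M)
    (h : ∀ u : {u // u = v ∨ u ≠ w}, u.1 ≠ v → F' u = F u.1)
    (hv : F' ⟨v, Or.inl rfl⟩ = F v + (if v = w then 0 else F w) + c) :
    ∑ᶠ u, F' u = ∑ᶠ u, F u + c := by
  have := Fintype.ofFinite V
  set G : V → M := fun u => if u = v then F' ⟨v, Or.inl rfl⟩ else if u = w then 0 else F u with hG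
  have e1 : ∑ᶠ u, F' u = ∑ u, G u := by
    rw [finsum_eq_sum_of_fintype, ← Finset.sum_filter_add_sum_filter_not Finset.univ
      (fun u => u = v ∨ u ≠ w) G]
    rw [Finset.sum_eq_zero (s := Finset.univ.filter (fun u => ¬ (u = v ∨ u ≠ w)))]
    · rw [add_zero, Finset.sum_subtype (p := fun u => u = v ∨ u ≠ w) _ (by simp)]
      refine Finset.sum_congr rfl fun u _ => ?_
      simp only [hG]
      by_cases huv : u.1 = v
      · rw [if_pos huv]; congr 1; exact Subtype.ext huv
      · rw [if_neg huv, if_neg (u.2.resolve_left huv), h u huv]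
    · intro u hu
      simp only [Finset.mem_filter, not_or, not_not] at hu
      simp only [hG]
      rw [if_neg hu.2.1, if_pos hu.2.2]
  rw [e1, finsum_eq_sum_of_fintype]
  rw [← Finset.add_sum_erase _ G (Finset.mem_univ v), ← Finset.add_sum_erase _ F (Finset.mem_univ v)]
  have e2 : ∀ u ∈ Finset.univ.erase v, G u = if u = w then 0 else F u := fun u hu => by
    simp [hG, Finset.ne_of_mem_erase hu]
  rw [Finset.sum_congr rfl e2]
  have e3 : G v = F v + (if v = w then 0 else F w) + c := by simp [hG, hv]
  rw [e3]
  by_cases hvw : v = w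
  · rw [if_pos hvw, add_zero, Finset.sum_congr rfl (g := F)]
    · ac_rfl
    · intro u hu
      rw [if_neg (fun k => Finset.ne_of_mem_erase hu (k.trans hvw.symm))]
  · rw [if_neg hvw]
    have hw : w ∈ Finset.univ.erase v := by simp [Ne.symm hvw]
    rw [← Finset.add_sum_erase _ _ hw, ← Finset.add_sum_erase _ F hw, if_pos rfl, zero_add,
      Finset.sum_congr rfl (g := F)]
    · ac_rfl
    · intro u hu
      rw [if_neg (Finset.ne_of_mem_erase hu)]

/-- A finite graph whose vertices carry topological types of compact connected oriented surfaces
with half-edges embedded in their boundaries.  The surface `S_v` at the vertex `v` is recorded by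
its genus, by the cyclic order of the half-edges on each boundary circle that carries some (these
cyclic orders are the cycles of the permutation `rot`), and by the number `freeBdry v` of boundary
circles that carry no half-edge. -/
structure SurfaceGraph : Type 1 where
  /-- half-edges -/
  H : Type
  /-- vertices -/
  V : Type
  /-- edges -/
  E : Type
  finH : Finite H
  finV : Finite V
  finE : Finite E
  /-- the vertex at which a half-edge is incident -/
  vert : H → V
  /-- the edge to which a half-edge belongs -/
  edge : H → E
  /-- the other half of the same edge -/
  opp : Perm H
  opp_ne : ∀ x, opp x ≠ x
  edge_eq_iff : ∀ x y, edge x = edge y ↔ y = x ∨ y = opp x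
  edge_surj : Function.Surjective edge
  /-- the next half-edge on the same boundary circle of the same vertex surface -/
  rot : Perm H
  vert_rot : ∀ x, vert (rot x) = vert x
  /-- the genus of the vertex surface -/
  genus : V → ℕ
  /-- the number of boundary circles of the vertex surface without half-edges -/
  freeBdry : V → ℕ

attribute [instance] SurfaceGraph.finH SurfaceGraph.finV SurfaceGraph.finE

namespace SurfaceGraph

/-- The number of boundary circles of the vertex surface `S_v`. -/
noncomputable def numBdry (γ : SurfaceGraph) (v : γ.V) : ℕ :=
  numCycles γ.rot {x | γ.vert x = v} + γ.freeBdry v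

/-- The number of half-edges at `v`. -/
noncomputable def valency (γ : SurfaceGraph) (v : γ.V) : ℕ := {x | γ.vert x = v}.ncard

/-- The number of boundary circles of the surface obtained by gluing a strip to the vertex surfaces
along every edge; these circles are the marked points of the associated stable curve. -/
noncomputable def numFaces (γ : SurfaceGraph) : ℕ :=
  numCycles (γ.rot * γ.opp) Set.univ + ∑ᶠ v, γ.freeBdry v

/-- The Euler characteristic of the surface obtained by gluing a strip to the vertex surfaces along
every edge. -/
noncomputable def eulerChar (γ : SurfaceGraph) : ℤ :=
  ∑ᶠ v, (2 - 2 * (γ.genus v : ℤ) - (γ.numBdry v : ℤ)) - (Nat.card γ.E : ℤ)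

/-- Every vertex surface has nonempty boundary and is stable: with `a = 2 * genus + numBdry - 1`
(the first Betti number of the surface), `2 * a + valency - 2 > 0`.  So disks need at least three
half-edges and annuli at least one, and there is no other restriction. -/
structure IsStable (γ : SurfaceGraph) : Prop where
  bdry_pos : ∀ v, 0 < γ.numBdry v
  stable : ∀ v, 4 < 4 * γ.genus v + 2 * γ.numBdry v + γ.valency v

/-- The graph is nonempty and any two of its vertices are joined by a path of edges. -/
structure IsConnected (γ : SurfaceGraph) : Prop where
  nonempty : Nonempty γ.V
  path : ∀ v w, Relation.ReflTransGen (fun a b => ∃ x, γ.vert x = a ∧ γ.vert (γ.opp x) = b) v w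

/-- `γ` is a (connected) stable ribbon graph of type `(g, n)`: the surface glued from it has genus
`g` and `n` boundary circles. -/
structure IsStableRibbon (γ : SurfaceGraph) (g n : ℕ) : Prop extends
    γ.IsStable, γ.IsConnected where
  faces : γ.numFaces = n
  euler : γ.eulerChar = 2 - 2 * (g : ℤ) - (n : ℤ)

/-- An isomorphism: a bijection of half-edges, together with the bijections of vertices and of edges
under it, such that corresponding vertex surfaces are homeomorphic (preserving the orientations and
the embedded half-edges). -/
structure Iso (γ γ' : SurfaceGraph) where
  onH : γ.H ≃ γ'.H
  onV : γ.V ≃ γ'.V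
  onE : γ.E ≃ γ'.E
  vert_onH : ∀ x, γ'.vert (onH x) = onV (γ.vert x)
  edge_onH : ∀ x, γ'.edge (onH x) = onE (γ.edge x)
  rot_onH : ∀ x, γ'.rot (onH x) = onH (γ.rot x)
  genus_onV : ∀ v, γ'.genus (onV v) = γ.genus v
  freeBdry_onV : ∀ v, γ'.freeBdry (onV v) = γ.freeBdry v

section Contraction

theorem opp_opp (γ : SurfaceGraph) (x : γ.H) : γ.opp (γ.opp x) = x := by
  have h1 : γ.edge x = γ.edge (γ.opp x) := (γ.edge_eq_iff _ _).2 (Or.inr rfl)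
  rcases (γ.edge_eq_iff _ _).1 h1.symm with h | h
  · exact absurd h.symm (γ.opp_ne x)
  · exact h.symm

theorem edge_opp (γ : SurfaceGraph) (x : γ.H) : γ.edge (γ.opp x) = γ.edge x :=
  ((γ.edge_eq_iff _ _).2 (Or.inr rfl)).symm

theorem edge_ne_iff (γ : SurfaceGraph) (h x : γ.H) :
    γ.edge x ≠ γ.edge h ↔ x ≠ h ∧ x ≠ γ.opp h := by
  rw [Ne, eq_comm, γ.edge_eq_iff, not_or]

open Classical in
/-- The cyclic orders after gluing a strip along the edge `{h, opp h}`.  Gluing the strip composes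
`rot` with the transposition of `h` and `opp h`; then both ends of the edge are removed.  If
`h` and `opp h` lie on different circles `(h A)` and `(opp h B)`, the result is the circle `(A B)`;
if they lie on the same circle `(h A opp h B)`, the results are the circles `(A)` and `(B)`. -/
noncomputable def rotAfter (γ : SurfaceGraph) (h : γ.H) : Perm γ.H :=
  unlink (γ.opp h) (unlink h (γ.rot * swap h (γ.opp h)))

theorem rotAfter_fix (γ : SurfaceGraph) (h : γ.H) :
    γ.rotAfter h h = h ∧ γ.rotAfter h (γ.opp h) = γ.opp h := by
  refine ⟨?_, unlink_self _ _⟩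
  rw [rotAfter, unlink_apply, if_neg (γ.opp_ne h).symm, unlink_self, if_neg (γ.opp_ne h).symm]

theorem rotAfter_mem (γ : SurfaceGraph) (h x : γ.H) :
    γ.edge (γ.rotAfter h x) ≠ γ.edge h ↔ γ.edge x ≠ γ.edge h := by
  rw [edge_ne_iff, edge_ne_iff]
  refine and_congr (not_congr ⟨fun e => ?_, fun e => ?_⟩) (not_congr ⟨fun e => ?_, fun e => ?_⟩)
  · exact (γ.rotAfter h).injective (e.trans (γ.rotAfter_fix h).1.symm)
  · rw [e, (γ.rotAfter_fix h).1]
  · exact (γ.rotAfter h).injective (e.trans (γ.rotAfter_fix h).2.symm)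
  · rw [e, (γ.rotAfter_fix h).2]

open Classical in
/-- The vertex of `γ/e` that carries `x`; the vertex of `opp h` has been merged into that of `h`. -/
noncomputable def vertAfter (γ : SurfaceGraph) (h x : γ.H) :
    {v : γ.V // v = γ.vert h ∨ v ≠ γ.vert (γ.opp h)} :=
  if hx : γ.vert x = γ.vert (γ.opp h) then ⟨γ.vert h, Or.inl rfl⟩ else ⟨γ.vert x, Or.inr hx⟩

open Classical in
theorem vertAfter_val (γ : SurfaceGraph) (h x : γ.H) : (γ.vertAfter h x).1 =
    if γ.vert x = γ.vert (γ.opp h) then γ.vert h else γ.vert x := by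
  unfold vertAfter; split_ifs <;> rfl

theorem vertAfter_congr (γ : SurfaceGraph) (h : γ.H) {x y : γ.H} (e : γ.vert x = γ.vert y) :
    γ.vertAfter h x = γ.vertAfter h y := by
  rw [Subtype.ext_iff, vertAfter_val, vertAfter_val, e]

open Classical in
theorem vertAfter_rotAfter (γ : SurfaceGraph) (h x : γ.H) :
    γ.vertAfter h (γ.rotAfter h x) = γ.vertAfter h x := by
  have aux : ∀ (a : γ.H) (π : Perm γ.H), (∀ y, γ.vertAfter h (π y) = γ.vertAfter h y) →
      ∀ y, γ.vertAfter h (unlink a π y) = γ.vertAfter h y := by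
    intro a π hπ y
    rw [unlink_apply]
    split_ifs with h1 h2
    · rw [h1]
    · rw [hπ, ← h2, hπ]
    · exact hπ y
  refine aux _ _ (aux _ _ fun y => ?_) x
  rw [Perm.mul_apply, γ.vertAfter_congr h (γ.vert_rot _), swap_apply_def]
  have e : γ.vertAfter h (γ.opp h) = γ.vertAfter h h := by
    rw [Subtype.ext_iff, vertAfter_val, vertAfter_val, if_pos rfl]
    split_ifs <;> rfl
  split_ifs with h1 h2
  · rw [e, h1]
  · rw [h2, e]
  · rfl

open Classical in
/-- The number of boundary circles without half-edges that gluing the strip creates. -/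
noncomputable def newFree (γ : SurfaceGraph) (h : γ.H) : ℕ :=
  (if γ.rot (γ.opp h) = h then 1 else 0) + (if γ.rot h = γ.opp h then 1 else 0) +
    (if γ.rot h = h ∧ γ.rot (γ.opp h) = γ.opp h then 1 else 0)

open Classical in
/-- The contraction of the edge of `h`: the surfaces at its two ends (or the one surface at both
ends) are glued along a strip.  Interchanging `h` and `opp h` gives a canonically isomorphic graph.
The glued surface is the vertex `vert h` of the new graph.  Its genus is the sum of the genera of
the glued surfaces, plus one if the strip joins two different circles of one surface. -/
noncomputable def contractAt (γ : SurfaceGraph) (h : γ.H) : SurfaceGraph where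
  H := {x : γ.H // γ.edge x ≠ γ.edge h}
  V := {v : γ.V // v = γ.vert h ∨ v ≠ γ.vert (γ.opp h)}
  E := {e : γ.E // e ≠ γ.edge h}
  finH := inferInstance
  finV := inferInstance
  finE := inferInstance
  vert x := γ.vertAfter h x
  edge x := ⟨γ.edge x, x.2⟩
  opp := γ.opp.subtypePerm fun x => by rw [edge_opp]
  opp_ne x e := γ.opp_ne x (congrArg Subtype.val e)
  edge_eq_iff x y := by simpa [Subtype.ext_iff] using γ.edge_eq_iff x y
  edge_surj e := by
    obtain ⟨x, hx⟩ := γ.edge_surj e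
    exact ⟨⟨x, hx ▸ e.2⟩, Subtype.ext hx⟩
  rot := (γ.rotAfter h).subtypePerm (γ.rotAfter_mem h)
  vert_rot x := γ.vertAfter_rotAfter h x
  genus v :=
    if v.1 = γ.vert h then
      if γ.vert h = γ.vert (γ.opp h) then
        γ.genus (γ.vert h) + if γ.rot.SameCycle h (γ.opp h) then 0 else 1
      else γ.genus (γ.vert h) + γ.genus (γ.vert (γ.opp h))
    else γ.genus v
  freeBdry v :=
    if v.1 = γ.vert h then
      γ.freeBdry (γ.vert h) +
        (if γ.vert h = γ.vert (γ.opp h) then 0 else γ.freeBdry (γ.vert (γ.opp h))) + γ.newFree h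
    else γ.freeBdry v

open Classical in
theorem numCycles_unlink_unlink (γ : SurfaceGraph) (h : γ.H) (π : Perm γ.H)
    (e0 : π h = γ.rot (γ.opp h)) (e1 : π (γ.opp h) = γ.rot h) (P : Set γ.H) (h0 : h ∈ P)
    (h1 : γ.opp h ∈ P) (hP0 : γ.rot h ∈ P) (hP1 : γ.rot (γ.opp h) ∈ P) :
    numCycles π P = numCycles (unlink (γ.opp h) (unlink h π)) (P ∩ {x | γ.edge x ≠ γ.edge h}) +
      γ.newFree h := by
  have hne := γ.opp_ne h
  have hinj : γ.rot h ≠ γ.rot (γ.opp h) := fun e => hne (γ.rot.injective e).symm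
  have hu : unlink h π (γ.opp h) = if γ.rot h = h then γ.rot (γ.opp h) else γ.rot h := by
    rw [unlink_apply, if_neg hne, e0, e1]
  have hset : (P \ {h}) \ {γ.opp h} = P ∩ {x | γ.edge x ≠ γ.edge h} := by
    ext x
    have := γ.edge_ne_iff h x
    simp only [Set.mem_sdiff, Set.mem_singleton_iff, Set.mem_inter_iff]
    rw [and_assoc]
    exact and_congr_right fun _ => this.symm
  rw [numCycles_unlink h π P h0 (e0 ▸ hP1),
    numCycles_unlink (γ.opp h) (unlink h π) (P \ {h}) ⟨h1, hne⟩, hset, hu, e0, newFree]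
  · by_cases c1 : γ.rot h = h
    · have c2 : γ.rot (γ.opp h) ≠ h := fun e => hinj (c1.trans e.symm)
      have c3 : γ.rot h ≠ γ.opp h := fun e => hne (e.symm.trans c1)
      simp [c1, c2, hne.symm]
    · simp [c1]; ring
  · rw [hu]
    split_ifs with c
    · exact ⟨hP1, fun e => hinj (c.trans e.symm)⟩
    · exact ⟨hP0, c⟩

open Classical in
theorem numFaces_contractAt (γ : SurfaceGraph) (h : γ.H) :
    (γ.contractAt h).numFaces = γ.numFaces := by
  have hne := γ.opp_ne h
  have e2 : ∑ᶠ v, (γ.contractAt h).freeBdry v = ∑ᶠ v, γ.freeBdry v + γ.newFree h := by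
    refine finsum_collapse (γ.vert h) (γ.vert (γ.opp h)) γ.freeBdry _ _ (fun u hu => ?_) ?_
    · exact if_neg hu
    · exact if_pos rfl
  have hmem : ∀ x, γ.edge ((unlink (γ.opp h) (unlink h (γ.rot * γ.opp))) x) ≠ γ.edge h ↔
      γ.edge x ≠ γ.edge h := by
    have f1 : unlink (γ.opp h) (unlink h (γ.rot * γ.opp)) h = h := by
      rw [unlink_apply, if_neg hne.symm, unlink_self, if_neg hne.symm]
    have f2 := unlink_self (γ.opp h) (unlink h (γ.rot * γ.opp))
    intro x
    rw [edge_ne_iff, edge_ne_iff]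
    refine and_congr (not_congr ⟨fun e => ?_, fun e => ?_⟩) (not_congr ⟨fun e => ?_, fun e => ?_⟩)
    · exact Equiv.injective _ (e.trans f1.symm)
    · rw [e, f1]
    · exact Equiv.injective _ (e.trans f2.symm)
    · rw [e, f2]
  have e3 : (γ.contractAt h).rot * (γ.contractAt h).opp =
      (unlink (γ.opp h) (unlink h (γ.rot * γ.opp))).subtypePerm hmem := by
    refine Equiv.ext fun x => Subtype.ext ?_
    obtain ⟨x, hx⟩ := x
    have hx' := (γ.edge_ne_iff h x).1 hx
    have hox : γ.opp x ≠ h ∧ γ.opp x ≠ γ.opp h :=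
      (γ.edge_ne_iff h _).1 (by rw [edge_opp]; exact hx)
    show γ.rotAfter h (γ.opp x) = unlink (γ.opp h) (unlink h (γ.rot * γ.opp)) x
    simp only [rotAfter, unlink_apply, Perm.mul_apply, if_neg hx'.1, if_neg hx'.2, if_neg hox.1,
      if_neg hox.2, swap_apply_of_ne_of_ne hox.1 hox.2, swap_apply_left, swap_apply_right,
      γ.opp_opp]
    congr
  have e1 : numCycles ((γ.contractAt h).rot * (γ.contractAt h).opp) Set.univ + γ.newFree h =
      numCycles (γ.rot * γ.opp) Set.univ := by
    rw [e3, γ.numCycles_unlink_unlink h (γ.rot * γ.opp) rfl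
      (by rw [Perm.mul_apply, γ.opp_opp]) Set.univ trivial trivial trivial trivial]
    congr 1
    refine (numCycles_subtypePerm _ hmem _).trans ?_
    congr 1
    ext x
    exact ⟨fun ⟨y, _, e⟩ => ⟨trivial, e ▸ y.2⟩, fun hx => ⟨⟨x, hx.2⟩, trivial, rfl⟩⟩
  rw [numFaces, numFaces, e2, ← e1]
  ring

theorem vertAfter_eq_iff (γ : SurfaceGraph) (h x : γ.H)
    (v : {v : γ.V // v = γ.vert h ∨ v ≠ γ.vert (γ.opp h)}) (hv : v.1 ≠ γ.vert h) :
    γ.vertAfter h x = v ↔ γ.vert x = v.1 := by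
  classical
  rw [Subtype.ext_iff, vertAfter_val]
  split_ifs with c
  · exact ⟨fun e => absurd e.symm hv, fun e => absurd (e.symm.trans c) (v.2.resolve_left hv)⟩
  · rfl

theorem vertAfter_eq_vert (γ : SurfaceGraph) (h x : γ.H)
    (v : {v : γ.V // v = γ.vert h ∨ v ≠ γ.vert (γ.opp h)}) (hv : v.1 = γ.vert h) :
    γ.vertAfter h x = v ↔ γ.vert x = γ.vert h ∨ γ.vert x = γ.vert (γ.opp h) := by
  classical
  rw [Subtype.ext_iff, vertAfter_val, hv]
  split_ifs with c
  · simp [c]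
  · simp [c]

theorem image_fiber_old (γ : SurfaceGraph) (h : γ.H)
    (v : {v : γ.V // v = γ.vert h ∨ v ≠ γ.vert (γ.opp h)}) (hv : v.1 ≠ γ.vert h) :
    Subtype.val '' {x : {x : γ.H // γ.edge x ≠ γ.edge h} | γ.vertAfter h x = v} =
      {x | γ.vert x = v.1} := by
  ext x
  constructor
  · rintro ⟨y, hy, rfl⟩
    exact (γ.vertAfter_eq_iff h y v hv).1 hy
  · intro hx
    refine ⟨⟨x, (γ.edge_ne_iff h x).2 ⟨?_, ?_⟩⟩, (γ.vertAfter_eq_iff h x v hv).2 hx, rfl⟩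
    · rintro rfl; exact hv hx.symm
    · rintro rfl; exact v.2.resolve_left hv hx.symm

theorem image_fiber_new (γ : SurfaceGraph) (h : γ.H)
    (v : {v : γ.V // v = γ.vert h ∨ v ≠ γ.vert (γ.opp h)}) (hv : v.1 = γ.vert h) :
    Subtype.val '' {x : {x : γ.H // γ.edge x ≠ γ.edge h} | γ.vertAfter h x = v} =
      {x | γ.vert x = γ.vert h ∨ γ.vert x = γ.vert (γ.opp h)} ∩ {x | γ.edge x ≠ γ.edge h} := by
  ext x
  constructor
  · rintro ⟨y, hy, rfl⟩
    exact ⟨(γ.vertAfter_eq_vert h y v hv).1 hy, y.2⟩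
  · rintro ⟨hx, hx'⟩
    exact ⟨⟨x, hx'⟩, (γ.vertAfter_eq_vert h x v hv).2 hx, rfl⟩

open Classical in
theorem numBdry_contractAt_old (γ : SurfaceGraph) (h : γ.H) (v : (γ.contractAt h).V)
    (hv : v.1 ≠ γ.vert h) : (γ.contractAt h).numBdry v = γ.numBdry v.1 := by
  unfold numBdry
  congr 1
  · refine (numCycles_subtypePerm (γ.rotAfter h) (γ.rotAfter_mem h) _).trans ?_
    refine (congrArg (numCycles (γ.rotAfter h)) (γ.image_fiber_old h v hv)).trans ?_
    refine numCycles_congr_of_eqOn _ _ _ (fun x hx => (γ.vert_rot x).trans hx) fun x hx => ?_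
    have k : ∀ y, γ.vert y = v.1 → y ≠ h ∧ y ≠ γ.opp h := fun y hy =>
      ⟨fun e => hv (by rw [← hy, e]), fun e => v.2.resolve_left hv (by rw [← hy, e])⟩
    have k1 := k x hx
    have k2 := k (γ.rot x) ((γ.vert_rot x).trans hx)
    simp only [rotAfter, unlink_apply, Perm.mul_apply, if_neg k1.1, if_neg k1.2,
      swap_apply_of_ne_of_ne k1.1 k1.2, if_neg k2.1, if_neg k2.2]
  · exact if_neg hv

open Classical in
/-- The strip raises or lowers the number of boundary circles by one. -/
theorem numBdry_contractAt_new (γ : SurfaceGraph) (h : γ.H) (v : (γ.contractAt h).V)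
    (hv : v.1 = γ.vert h) :
    (γ.contractAt h).numBdry v + (if γ.rot.SameCycle h (γ.opp h) then 0 else 1) =
      γ.numBdry (γ.vert h) +
        (if γ.vert h = γ.vert (γ.opp h) then 0 else γ.numBdry (γ.vert (γ.opp h))) +
        (if γ.rot.SameCycle h (γ.opp h) then 1 else 0) := by
  set P : Set γ.H := {x | γ.vert x = γ.vert h ∨ γ.vert x = γ.vert (γ.opp h)} with hPdef
  have hP0 : h ∈ P := Or.inl rfl
  have hP1 : γ.opp h ∈ P := Or.inr rfl
  have e1 : numCycles (γ.contractAt h).rot {x | (γ.contractAt h).vert x = v} + γ.newFree h =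
      numCycles (γ.rot * swap h (γ.opp h)) P := by
    rw [γ.numCycles_unlink_unlink h (γ.rot * swap h (γ.opp h)) (by simp) (by simp) P hP0 hP1
      (Or.inl (γ.vert_rot _)) (Or.inr (γ.vert_rot _))]
    congr 1
    refine (numCycles_subtypePerm (γ.rotAfter h) (γ.rotAfter_mem h) _).trans ?_
    rw [← γ.image_fiber_new h v hv]
    rfl
  have e2 : numCycles (γ.rot * swap h (γ.opp h)) P +
      (if γ.rot.SameCycle h (γ.opp h) then 0 else 1) = numCycles γ.rot P +
      (if γ.rot.SameCycle h (γ.opp h) then 1 else 0) := by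
    split_ifs with c
    · exact numCycles_split γ.rot (γ.opp_ne h).symm P hP0 hP1 c
    · exact (numCycles_merge γ.rot P hP0 hP1 c).symm
  have e3 : numCycles γ.rot P = numCycles γ.rot {x | γ.vert x = γ.vert h} +
      (if γ.vert h = γ.vert (γ.opp h) then 0 else
        numCycles γ.rot {x | γ.vert x = γ.vert (γ.opp h)}) := by
    split_ifs with c
    · rw [hPdef, ← c]; simp
    · rw [← numCycles_union]
      · rfl
      · exact fun x hx => (γ.vert_rot x).trans hx
      · rw [Set.disjoint_left]
        exact fun x hx hx' => c (hx.symm.trans hx')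
  have e4 : (γ.contractAt h).freeBdry v = γ.freeBdry (γ.vert h) +
        (if γ.vert h = γ.vert (γ.opp h) then 0 else γ.freeBdry (γ.vert (γ.opp h))) +
        γ.newFree h := if_pos hv
  unfold numBdry
  rw [e4]
  split_ifs at * <;> omega

open Classical in
theorem genus_contractAt_new (γ : SurfaceGraph) (h : γ.H) (v : (γ.contractAt h).V)
    (hv : v.1 = γ.vert h) : (γ.contractAt h).genus v =
      if γ.vert h = γ.vert (γ.opp h) then
        γ.genus (γ.vert h) + if γ.rot.SameCycle h (γ.opp h) then 0 else 1
      else γ.genus (γ.vert h) + γ.genus (γ.vert (γ.opp h)) := if_pos hv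

theorem vert_eq_of_sameCycle (γ : SurfaceGraph) {x y : γ.H} (h : γ.rot.SameCycle x y) :
    γ.vert y = γ.vert x :=
  sameCycle_closed γ.rot {z | γ.vert z = γ.vert x} (fun z hz => (γ.vert_rot z).trans hz) h rfl

open Classical in
theorem valency_contractAt_new (γ : SurfaceGraph) (h : γ.H) (v : (γ.contractAt h).V)
    (hv : v.1 = γ.vert h) : (γ.contractAt h).valency v + 2 = γ.valency (γ.vert h) +
      (if γ.vert h = γ.vert (γ.opp h) then 0 else γ.valency (γ.vert (γ.opp h))) := by
  set P : Set γ.H := {x | γ.vert x = γ.vert h ∨ γ.vert x = γ.vert (γ.opp h)} with hPdef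
  have e1 : (γ.contractAt h).valency v = (P ∩ {x | γ.edge x ≠ γ.edge h}).ncard := by
    rw [← γ.image_fiber_new h v hv, Set.ncard_image_of_injective _ Subtype.val_injective]
    rfl
  have e2 : (P ∩ {x | γ.edge x ≠ γ.edge h}).ncard + 2 = P.ncard := by
    rw [← Set.ncard_pair (γ.opp_ne h).symm, ← Set.ncard_union_eq _ (Set.toFinite _) (Set.toFinite _)]
    · congr 1
      ext x
      have := γ.edge_ne_iff h x
      simp only [Set.mem_union, Set.mem_inter_iff, Set.mem_insert_iff, Set.mem_singleton_iff]
      constructor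
      · rintro (hx | rfl | rfl)
        · exact hx.1
        · exact Or.inl rfl
        · exact Or.inr rfl
      · intro hx
        by_cases c : x = h ∨ x = γ.opp h
        · exact Or.inr c
        · exact Or.inl ⟨hx, this.2 (not_or.1 c)⟩
    · rw [Set.disjoint_left]
      rintro x ⟨-, hx⟩ hx'
      exact (not_or.2 ((γ.edge_ne_iff h x).1 hx)) hx'
  rw [e1, e2]
  unfold valency
  split_ifs with c
  · rw [hPdef, ← c]; simp
  · rw [← Set.ncard_union_eq _ (Set.toFinite _) (Set.toFinite _)]
    · rfl
    · rw [Set.disjoint_left]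
      exact fun x hx hx' => c (hx.symm.trans hx')

theorem valency_contractAt_old (γ : SurfaceGraph) (h : γ.H) (v : (γ.contractAt h).V)
    (hv : v.1 ≠ γ.vert h) : (γ.contractAt h).valency v = γ.valency v.1 := by
  unfold valency
  rw [← γ.image_fiber_old h v hv, Set.ncard_image_of_injective _ Subtype.val_injective]
  rfl

open Classical in
theorem eulerChar_contractAt (γ : SurfaceGraph) (h : γ.H) :
    (γ.contractAt h).eulerChar = γ.eulerChar := by
  have e1 : ∑ᶠ v, (2 - 2 * ((γ.contractAt h).genus v : ℤ) - ((γ.contractAt h).numBdry v : ℤ)) =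
      ∑ᶠ v, (2 - 2 * (γ.genus v : ℤ) - (γ.numBdry v : ℤ)) + (-1) := by
    refine finsum_collapse (γ.vert h) (γ.vert (γ.opp h))
      (fun v => 2 - 2 * (γ.genus v : ℤ) - (γ.numBdry v : ℤ)) _ _ (fun u hu => ?_) ?_
    · rw [γ.numBdry_contractAt_old h u hu, show (γ.contractAt h).genus u = γ.genus u.1 from
        if_neg hu]
    · have hb := γ.numBdry_contractAt_new h ⟨γ.vert h, Or.inl rfl⟩ rfl
      have hg := γ.genus_contractAt_new h ⟨γ.vert h, Or.inl rfl⟩ rfl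
      have hs : γ.rot.SameCycle h (γ.opp h) → γ.vert h = γ.vert (γ.opp h) :=
        fun k => (γ.vert_eq_of_sameCycle k).symm
      by_cases c1 : γ.vert h = γ.vert (γ.opp h) <;>
      by_cases c2 : γ.rot.SameCycle h (γ.opp h) <;>
      simp only [if_pos, if_neg, c1, c2, not_false_iff] at hb hg ⊢ <;>
      first
        | omega
        | exact absurd (hs c2) c1
  have e2 : (Nat.card (γ.contractAt h).E : ℤ) + 1 = Nat.card γ.E := by
    have : Nat.card γ.E = Nat.card {e : γ.E // e = γ.edge h} + Nat.card {e : γ.E // e ≠ γ.edge h} := by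
      rw [← Nat.card_sum]
      exact Nat.card_congr (Equiv.sumCompl _).symm
    have h1 : Nat.card {e : γ.E // e = γ.edge h} = 1 := by simp
    have h2 : Nat.card (γ.contractAt h).E = Nat.card {e : γ.E // e ≠ γ.edge h} := rfl
    omega
  unfold eulerChar
  rw [e1]
  omega

open Classical in
theorem isStable_contractAt (γ : SurfaceGraph) (h : γ.H) (hγ : γ.IsStable) :
    (γ.contractAt h).IsStable := by
  have hs : γ.rot.SameCycle h (γ.opp h) → γ.vert h = γ.vert (γ.opp h) :=
    fun k => (γ.vert_eq_of_sameCycle k).symm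
  have p1 := hγ.bdry_pos (γ.vert h)
  have p2 := hγ.bdry_pos (γ.vert (γ.opp h))
  have s1 := hγ.stable (γ.vert h)
  have s2 := hγ.stable (γ.vert (γ.opp h))
  -- two different circles on one surface
  have p3 : γ.vert h = γ.vert (γ.opp h) → ¬ γ.rot.SameCycle h (γ.opp h) →
      2 ≤ γ.numBdry (γ.vert h) := fun c1 c2 => by
    refine le_trans ?_ (Nat.le_add_right _ _)
    rw [numCycles, ← Set.ncard_pair (fun e => c2 ((cyc_eq_iff _ _ _).1 e))]
    refine Set.ncard_le_ncard ?_ (Set.toFinite _)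
    rintro _ (rfl | rfl)
    · exact ⟨h, rfl, rfl⟩
    · exact ⟨γ.opp h, c1.symm, rfl⟩
  refine ⟨fun v => ?_, fun v => ?_⟩
  · by_cases hv : v.1 = γ.vert h
    · have hb := γ.numBdry_contractAt_new h v hv
      by_cases c1 : γ.vert h = γ.vert (γ.opp h) <;>
      by_cases c2 : γ.rot.SameCycle h (γ.opp h)
      · simp only [if_pos c1, if_pos c2] at hb; omega
      · simp only [if_pos c1, if_neg c2] at hb
        have := p3 c1 c2
        omega
      · exact absurd (hs c2) c1
      · simp only [if_neg c1, if_neg c2] at hb; omega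
    · rw [γ.numBdry_contractAt_old h v hv]; exact hγ.bdry_pos _
  · by_cases hv : v.1 = γ.vert h
    · have hb := γ.numBdry_contractAt_new h v hv
      have hg := γ.genus_contractAt_new h v hv
      have hn := γ.valency_contractAt_new h v hv
      by_cases c1 : γ.vert h = γ.vert (γ.opp h) <;>
      by_cases c2 : γ.rot.SameCycle h (γ.opp h)
      · simp only [if_pos c1, if_pos c2] at hb hg hn; omega
      · simp only [if_pos c1, if_neg c2] at hb hg hn; omega
      · exact absurd (hs c2) c1
      · simp only [if_neg c1, if_neg c2] at hb hg hn; omega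
    · rw [γ.numBdry_contractAt_old h v hv, γ.valency_contractAt_old h v hv,
        show (γ.contractAt h).genus v = γ.genus v.1 from if_neg hv]
      exact hγ.stable _

theorem isConnected_contractAt (γ : SurfaceGraph) (h : γ.H) (hγ : γ.IsConnected) :
    (γ.contractAt h).IsConnected := by
  classical
  -- the class of a vertex in the contracted graph
  let q : γ.V → (γ.contractAt h).V := fun v =>
    if hv : v = γ.vert (γ.opp h) then ⟨γ.vert h, Or.inl rfl⟩ else ⟨v, Or.inr hv⟩
  have hq : ∀ x, q (γ.vert x) = γ.vertAfter h x := fun x => rfl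
  have hq' : ∀ v : (γ.contractAt h).V, ∃ u, q u = v := by
    rintro ⟨v, hv⟩
    by_cases c : v = γ.vert (γ.opp h)
    · refine ⟨v, ?_⟩
      have hvh : v = γ.vert h := hv.resolve_right (not_not.2 c)
      exact (dif_pos c).trans (Subtype.ext hvh.symm)
    · exact ⟨v, dif_neg c⟩
  refine ⟨⟨⟨γ.vert h, Or.inl rfl⟩⟩, fun v w => ?_⟩
  obtain ⟨a, rfl⟩ := hq' v
  obtain ⟨b, rfl⟩ := hq' w
  have hab := hγ.path a b
  induction hab with
  | refl => exact Relation.ReflTransGen.refl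
  | tail _ hst ih =>
    obtain ⟨x, rfl, rfl⟩ := hst
    refine ih.trans ?_
    rw [hq, hq]
    by_cases c : γ.edge x = γ.edge h
    · have hh : γ.vertAfter h (γ.opp h) = γ.vertAfter h h := by
        rw [Subtype.ext_iff, vertAfter_val, vertAfter_val, if_pos rfl]
        split_ifs <;> rfl
      have e : γ.vertAfter h (γ.opp x) = γ.vertAfter h x := by
        rcases (γ.edge_eq_iff h x).1 c.symm with rfl | rfl
        · exact hh
        · rw [γ.opp_opp]; exact hh.symm
      rw [e]
      exact Relation.ReflTransGen.refl
    · exact Relation.ReflTransGen.single ⟨⟨x, c⟩, rfl, rfl⟩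

/-- Contraction of an edge does not change the type `(g, n)`. -/
theorem isStableRibbon_contractAt (γ : SurfaceGraph) (h : γ.H) {g n : ℕ}
    (hγ : γ.IsStableRibbon g n) : (γ.contractAt h).IsStableRibbon g n where
  toIsStable := γ.isStable_contractAt h hγ.toIsStable
  toIsConnected := γ.isConnected_contractAt h hγ.toIsConnected
  faces := (γ.numFaces_contractAt h).trans hγ.faces
  euler := (γ.eulerChar_contractAt h).trans hγ.euler

end Contraction
end SurfaceGraph

/-- A stable ribbon graph of type `(g, n)` with black and white edges; `white` is the set of white
edges (the edges of infinite length).  These graphs index the orbi-cells of `L^∞_{g,n}`. -/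
structure Cell (g n : ℕ) : Type 1 where
  graph : SurfaceGraph
  isStableRibbon : graph.IsStableRibbon g n
  white : Set graph.E

namespace Cell

/-- The type of black edges; its cardinality is the dimension of the orbi-cell. -/
def Black {g n : ℕ} (γ : Cell g n) : Type := {e : γ.graph.E // e ∉ γ.white}

instance {g n : ℕ} (γ : Cell g n) : Finite γ.Black :=
  inferInstanceAs (Finite {e : γ.graph.E // e ∉ γ.white})

noncomputable instance {g n : ℕ} (γ : Cell g n) : Fintype γ.Black := Fintype.ofFinite _

/-- Isomorphisms of stable ribbon graphs with black and white edges. -/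
structure Iso {g n : ℕ} (γ γ' : Cell g n) extends SurfaceGraph.Iso γ.graph γ'.graph where
  white_onE : ∀ e, onE e ∈ γ'.white ↔ e ∈ γ.white

/-- The bijection between black edges given by an isomorphism. -/
def Iso.onBlack {g n : ℕ} {γ γ' : Cell g n} (φ : Iso γ γ') : γ.Black ≃ γ'.Black :=
  φ.onE.subtypeEquiv fun e => not_congr (φ.white_onE e).symm

/-- A half-edge of the edge `e`. -/
noncomputable def half {g n : ℕ} (γ : Cell g n) (e : γ.Black) : γ.graph.H :=
  (γ.graph.edge_surj e.1).choose

theorem edge_half {g n : ℕ} (γ : Cell g n) (e : γ.Black) : γ.graph.edge (γ.half e) = e.1 :=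
  (γ.graph.edge_surj e.1).choose_spec

/-- The graph `γ/e`: contract the black edge (or loop) `e`. -/
noncomputable def contract {g n : ℕ} (γ : Cell g n) (e : γ.Black) : Cell g n where
  graph := γ.graph.contractAt (γ.half e)
  isStableRibbon := γ.graph.isStableRibbon_contractAt (γ.half e) γ.isStableRibbon
  white := {f | f.1 ∈ γ.white}

/-- The graph `e\γ`: replace the black edge `e` by a white one. -/
def whiten {g n : ℕ} (γ : Cell g n) (e : γ.Black) : Cell g n where
  graph := γ.graph
  isStableRibbon := γ.isStableRibbon
  white := insert e.1 γ.white

/-- The black edges of `γ/e` are those of `γ` other than `e`. -/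
noncomputable def contractBlack {g n : ℕ} (γ : Cell g n) (e : γ.Black) :
    {b : γ.Black // b ≠ e} ≃ (γ.contract e).Black where
  toFun b := ⟨⟨b.1.1, fun h => b.2 (Subtype.ext (h.trans (γ.edge_half e)))⟩, b.1.2⟩
  invFun f := ⟨⟨f.1.1, f.2⟩, fun h => f.1.2 ((congrArg Subtype.val h).trans (γ.edge_half e).symm)⟩
  left_inv _ := rfl
  right_inv _ := rfl

/-- The black edges of `e\γ` are those of `γ` other than `e`. -/
def whitenBlack {g n : ℕ} (γ : Cell g n) (e : γ.Black) :
    {b : γ.Black // b ≠ e} ≃ (γ.whiten e).Black where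
  toFun b := ⟨b.1.1, fun h => h.elim (fun k => b.2 (Subtype.ext k)) b.1.2⟩
  invFun f := ⟨⟨f.1, fun h => f.2 (Or.inr h)⟩, fun h => f.2 (Or.inl (congrArg Subtype.val h))⟩
  left_inv _ := rfl
  right_inv _ := rfl

end Cell

section CubeForms

/-- The cube `[0,1]^B`.  The interval `[0,∞]` carries the smooth structure of `[0,1]` by means of
`x ↦ 1/(1-x) - 1`, so `[0,∞]^B` is this cube in the coordinates `x`; length `0` is `x = 0`
and length `∞` is `x = 1`. -/
def cube (B : Type) : Set (B → ℝ) := Set.Icc 0 1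

/-- Fields of alternating `k`-forms on `ℝ^B`. -/
abbrev FormField (B : Type) [Fintype B] (k : ℕ) : Type := (B → ℝ) → (B → ℝ) [⋀^Fin k]→L[ℝ] ℝ

/-- `ω` is a smooth differential form on the cube (smooth up to the boundary).  As only the values
on the cube matter, `ω` is set to zero outside. -/
structure IsCubeForm {B : Type} [Fintype B] {k : ℕ} (ω : FormField B k) : Prop where
  smooth : ContDiffOn ℝ ((⊤ : ℕ∞) : WithTop ℕ∞) ω (cube B)
  zero_off : ∀ x, x ∉ cube B → ω x = 0

open Classical in
/-- The exterior derivative of a differential form on the cube. -/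
noncomputable def cubeD {B : Type} [Fintype B] {k : ℕ} (ω : FormField B k) : FormField B (k + 1) :=
  fun x => if x ∈ cube B then extDerivWithin ω (cube B) x else 0

/-- The pullback of `ω` along the affine map `y ↦ A y + c`. -/
noncomputable def pullback {B B' : Type} [Fintype B] [Fintype B'] {k : ℕ}
    (A : (B' → ℝ) →L[ℝ] (B → ℝ)) (c : B → ℝ) (ω : FormField B k) : FormField B' k :=
  fun y => (ω (A y + c)).compContinuousLinearMap A

/-- The identification `ℝ^{B'} → ℝ^B`, `y ↦ y ∘ φ`, given by a bijection `φ : B ≃ B'`. -/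
noncomputable def reindex {B B' : Type} (φ : B ≃ B') : (B' → ℝ) →L[ℝ] (B → ℝ) :=
  ContinuousLinearMap.pi fun b => ContinuousLinearMap.proj (φ b)

open Classical in
/-- The embedding `ℝ^{B'} → ℝ^B` with coordinate `0` at `e`, where `B'` is identified with
`B \ {e}`. -/
noncomputable def faceLin {B B' : Type} (e : B) (ε : {b // b ≠ e} ≃ B') :
    (B' → ℝ) →L[ℝ] (B → ℝ) :=
  ContinuousLinearMap.pi fun b =>
    if h : b = e then 0 else ContinuousLinearMap.proj (ε ⟨b, h⟩)

open Classical in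
/-- The unit vector in the direction `e`. -/
noncomputable def unitVec {B : Type} (e : B) : B → ℝ := Pi.single e 1

end CubeForms

section Complexes

/-- Orbi-cellular `k`-forms on `L^∞_{g,n}`: a form on the cube `[0,∞]^{Black γ}` for every `γ`,
compatible with all isomorphisms of graphs (so it depends only on the isomorphism class and is
`Aut(γ)`-invariant), whose restriction to the face `x_e = 0` is the form of `γ/e` and whose
restriction to the face `x_e = ∞` is the form of `e\γ`. -/
structure IsOrbiForm {g n k : ℕ} (ω : ∀ γ : Cell g n, FormField γ.Black k) : Prop where
  cubeForm : ∀ γ, IsCubeForm (ω γ)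
  invariant : ∀ (γ γ' : Cell g n) (φ : Cell.Iso γ γ'),
    pullback (reindex φ.onBlack) 0 (ω γ) = ω γ'
  zero_face : ∀ (γ : Cell g n) (e : γ.Black),
    pullback (faceLin e (γ.contractBlack e)) 0 (ω γ) = ω (γ.contract e)
  infty_face : ∀ (γ : Cell g n) (e : γ.Black),
    pullback (faceLin e (γ.whitenBlack e)) (unitVec e) (ω γ) = ω (γ.whiten e)

theorem pullback_zero {B B' : Type} [Fintype B] [Fintype B'] {k : ℕ}
    (A : (B' → ℝ) →L[ℝ] (B → ℝ)) (c : B → ℝ) : pullback A c (0 : FormField B k) = 0 := by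
  ext y v; simp [pullback]

theorem pullback_add {B B' : Type} [Fintype B] [Fintype B'] {k : ℕ}
    (A : (B' → ℝ) →L[ℝ] (B → ℝ)) (c : B → ℝ) (ω η : FormField B k) :
    pullback A c (ω + η) = pullback A c ω + pullback A c η := by
  ext y v; simp [pullback]

theorem pullback_smul {B B' : Type} [Fintype B] [Fintype B'] {k : ℕ}
    (A : (B' → ℝ) →L[ℝ] (B → ℝ)) (c : B → ℝ) (r : ℝ) (ω : FormField B k) :
    pullback A c (r • ω) = r • pullback A c ω := by
  ext y v; simp [pullback]

/-- The real vector space `Ω^k(L^∞_{g,n})` of orbi-cellular `k`-forms. -/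
def orbiForms (g n k : ℕ) : Submodule ℝ (∀ γ : Cell g n, FormField γ.Black k) where
  carrier := {ω | IsOrbiForm ω}
  zero_mem' :=
    { cubeForm := fun _ => ⟨contDiffOn_const, fun _ _ => rfl⟩
      invariant := fun _ _ _ => pullback_zero _ _
      zero_face := fun _ _ => pullback_zero _ _
      infty_face := fun _ _ => pullback_zero _ _ }
  add_mem' {ω η} hω hη :=
    { cubeForm := fun γ => ⟨(hω.cubeForm γ).smooth.add (hη.cubeForm γ).smooth, fun x hx => by
        rw [Pi.add_apply, Pi.add_apply, (hω.cubeForm γ).zero_off x hx,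
          (hη.cubeForm γ).zero_off x hx, add_zero]⟩
      invariant := fun γ γ' φ => (pullback_add _ _ _ _).trans
        (congrArg₂ (· + ·) (hω.invariant γ γ' φ) (hη.invariant γ γ' φ))
      zero_face := fun γ e => (pullback_add _ _ _ _).trans
        (congrArg₂ (· + ·) (hω.zero_face γ e) (hη.zero_face γ e))
      infty_face := fun γ e => (pullback_add _ _ _ _).trans
        (congrArg₂ (· + ·) (hω.infty_face γ e) (hη.infty_face γ e)) }
  smul_mem' r ω hω :=
    { cubeForm := fun γ => ⟨(hω.cubeForm γ).smooth.const_smul r, fun x hx => by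
        rw [Pi.smul_apply, Pi.smul_apply, (hω.cubeForm γ).zero_off x hx, smul_zero]⟩
      invariant := fun γ γ' φ => (pullback_smul _ _ _ _).trans
        (congrArg (r • ·) (hω.invariant γ γ' φ))
      zero_face := fun γ e => (pullback_smul _ _ _ _).trans
        (congrArg (r • ·) (hω.zero_face γ e))
      infty_face := fun γ e => (pullback_smul _ _ _ _).trans
        (congrArg (r • ·) (hω.infty_face γ e)) }

/-- The real vector space `C^k(L^∞_{g,n})` of orbi-cellular `k`-cochains, that is, of linear
functionals on the `k`-chains: a number for every graph with `k` black edges and every ordering of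
its black edges, which changes by the sign under a permutation of the ordering and depends only on
the isomorphism class. -/
def cochains (g n k : ℕ) : Submodule ℝ (∀ γ : Cell g n, (Fin k ≃ γ.Black) → ℝ) where
  carrier := {c | (∀ γ (o : Fin k ≃ γ.Black) (π : Perm (Fin k)),
      c γ (π.trans o) = ((Perm.sign π : ℤ) : ℝ) * c γ o) ∧
    ∀ (γ γ' : Cell g n) (φ : Cell.Iso γ γ') (o : Fin k ≃ γ.Black),
      c γ' (o.trans φ.onBlack) = c γ o}
  zero_mem' := ⟨fun _ _ _ => (mul_zero _).symm, fun _ _ _ _ => rfl⟩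
  add_mem' {c d} hc hd := ⟨fun γ o π => by
      simp only [Pi.add_apply, hc.1 γ o π, hd.1 γ o π]; ring, fun γ γ' φ o => by
      simp only [Pi.add_apply, hc.2 γ γ' φ o, hd.2 γ γ' φ o]⟩
  smul_mem' r c hc := ⟨fun γ o π => by
      simp only [Pi.smul_apply, smul_eq_mul, hc.1 γ o π]; ring, fun γ γ' φ o => by
      simp only [Pi.smul_apply, hc.2 γ γ' φ o]⟩

/-- The ordering `o` with its entry `o i` left out. -/
def dropEntry {B : Type} {k : ℕ} (o : Fin (k + 1) ≃ B) (i : Fin (k + 1)) : Fin k ≃ {b // b ≠ o i} :=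
  (finSuccAboveEquiv i).trans (o.subtypeEquiv fun _ => not_congr o.apply_eq_iff_eq.symm)

/-- The differential of orbi-cellular cochains, dual to `∂γ = ∑_e (γ/e + e\γ)`, where `γ/e` and
`e\γ` carry the orientation induced on the faces `x_e = 0` and `x_e = ∞` of the cube as parts of
its boundary (outward normal first): for `e = o i` and the remaining edges in the order `o`, this is
the sign `(-1)^i` for `e\γ` and `-(-1)^i` for `γ/e`. -/
noncomputable def cochainD {g n k : ℕ} (c : ∀ γ : Cell g n, (Fin k ≃ γ.Black) → ℝ)
    (γ : Cell g n) (o : Fin (k + 1) ≃ γ.Black) : ℝ :=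
  ∑ i : Fin (k + 1), (-1) ^ (i : ℕ) * (c (γ.whiten (o i)) ((dropEntry o i).trans (γ.whitenBlack (o i))) -
    c (γ.contract (o i)) ((dropEntry o i).trans (γ.contractBlack (o i))))

/-- The integral of `ω` over the orbi-cell `γ`, the cube `[0,∞]^{Black γ}` oriented by the ordering
`o` of its coordinates. -/
noncomputable def integrate {g n k : ℕ} (ω : ∀ γ : Cell g n, FormField γ.Black k)
    (γ : Cell g n) (o : Fin k ≃ γ.Black) : ℝ :=
  ∫ x in cube (Fin k), ω γ (x ∘ o.symm) fun j => unitVec (o j)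

end Complexes

section Space

/-- The gluing of the cubes `[0,∞]^{Black γ}` along isomorphisms and along the faces `x_e = 0` and
`x_e = ∞`. -/
inductive Glue (g n : ℕ) : (Σ γ : Cell g n, cube γ.Black) → (Σ γ : Cell g n, cube γ.Black) → Prop
  | iso {γ γ' : Cell g n} (φ : Cell.Iso γ γ') (x : cube γ.Black) (y : cube γ'.Black)
      (h : x.1 = reindex φ.onBlack y.1) : Glue g n ⟨γ', y⟩ ⟨γ, x⟩
  | zero {γ : Cell g n} (e : γ.Black) (x : cube γ.Black) (y : cube (γ.contract e).Black)
      (h : x.1 = faceLin e (γ.contractBlack e) y.1) : Glue g n ⟨γ.contract e, y⟩ ⟨γ, x⟩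
  | infty {γ : Cell g n} (e : γ.Black) (x : cube γ.Black) (y : cube (γ.whiten e).Black)
      (h : x.1 = faceLin e (γ.whitenBlack e) y.1 + unitVec e) : Glue g n ⟨γ.whiten e, y⟩ ⟨γ, x⟩

/-- The orbi-cell complex `L^∞_{g,n}`: the space of stable metric ribbon graphs of type `(g, n)`
with edge lengths in `[0,∞]`. -/
def LInfty (g n : ℕ) : Type 1 := Quot (Glue g n)

instance (g n : ℕ) : TopologicalSpace (LInfty g n) :=
  inferInstanceAs (TopologicalSpace (Quot (Glue g n)))

/-- The contravariant functor sending a set `S` to the vector space of functions `S → ℝ`. -/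
def functionsFunctor : (Type 1)ᵒᵖ ⥤ ModuleCat.{1} ℝ where
  obj S := ModuleCat.of ℝ (S.unop → ℝ)
  map f := ModuleCat.ofHom (LinearMap.funLeft ℝ ℝ f.unop)

/-- The singular cochain complex of a topological space with real coefficients. -/
noncomputable def singularCochains (X : TopCat.{1}) : CochainComplex (ModuleCat.{1} ℝ) ℕ :=
  (AlgebraicTopology.alternatingCofaceMapComplex (ModuleCat.{1} ℝ)).obj
    ((TopCat.toSSet.obj X).rightOp ⋙ functionsFunctor)

end Space

end OrbiCell

set_option linter.unusedSectionVars false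


namespace OrbiCell

/-! ### Differentiation under the integral sign, up to the boundary of a convex set. -/

section ParametricIntegral

open Set Filter Topology MeasureTheory
open scoped ContDiff

variable {E G : Type} [NormedAddCommGroup E] [NormedSpace ℝ E] [NormedAddCommGroup G]
  [NormedSpace ℝ G] {S : Set E}

theorem uniqueDiffOn_prod_unitInterval (hU : UniqueDiffOn ℝ S) :
    UniqueDiffOn ℝ (S ×ˢ Icc (0:ℝ) 1) := hU.prod uniqueDiffOn_Icc_zero_one

/-- The derivative in the first variable on `S × [0,1]`. -/
noncomputable def partialDeriv (S : Set E) (F : E × ℝ → G) (p : E × ℝ) : E →L[ℝ] G :=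
  (fderivWithin ℝ F (S ×ˢ Icc (0:ℝ) 1) p).comp (ContinuousLinearMap.inl ℝ E ℝ)

theorem hasFDerivWithinAt_partialDeriv {F : E × ℝ → G} {x : E} {u : ℝ} (hu : u ∈ Icc (0:ℝ) 1)
    (hF : DifferentiableWithinAt ℝ F (S ×ˢ Icc (0:ℝ) 1) (x, u)) :
    HasFDerivWithinAt (fun y => F (y, u)) (partialDeriv S F (x, u)) S x := by
  refine HasFDerivWithinAt.comp x hF.hasFDerivWithinAt (f := fun y => (y, u)) ?_
    fun y hy => ⟨hy, hu⟩
  exact (hasFDerivAt_prodMk_left x u).hasFDerivWithinAt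

theorem contDiffOn_partialDeriv (hU : UniqueDiffOn ℝ S) {F : E × ℝ → G} {n : WithTop ℕ∞}
    (hF : ContDiffOn ℝ (n + 1) F (S ×ˢ Icc (0:ℝ) 1)) :
    ContDiffOn ℝ n (partialDeriv S F) (S ×ˢ Icc (0:ℝ) 1) :=
  (hF.fderivWithin (uniqueDiffOn_prod_unitInterval hU) le_rfl).clm_comp contDiffOn_const

theorem intervalIntegrable_slice {F : E × ℝ → G}
    (hF : ContinuousOn F (S ×ˢ Icc 0 1)) {x : E} (hx : x ∈ S) :
    IntervalIntegrable (fun u => F (x, u)) volume 0 1 := by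
  apply ContinuousOn.intervalIntegrable
  rw [uIcc_of_le zero_le_one]
  exact hF.comp (by fun_prop) fun u hu => ⟨hx, hu⟩

/-- Compactness of `[0,1]` makes `F (y, ·)` uniformly close to `F (x, ·)` for `y` in `S` near `x`.
-/
theorem continuousOn_parametric_integral {F : E × ℝ → G}
    (hF : ContinuousOn F (S ×ˢ Icc 0 1)) :
    ContinuousOn (fun x => ∫ u in (0:ℝ)..1, F (x, u)) S := by
  intro x hx
  rw [ContinuousWithinAt, Metric.tendsto_nhds]
  intro ε hε
  obtain ⟨v, hv, hvb⟩ := isCompact_Icc.mem_uniformity_of_prod (f := fun x u => F (x, u)) hF hx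
    (Metric.dist_mem_uniformity (half_pos hε))
  filter_upwards [hv, self_mem_nhdsWithin] with y hy hyS
  rw [dist_eq_norm, ← intervalIntegral.integral_sub (intervalIntegrable_slice hF hyS)
    (intervalIntegrable_slice hF hx)]
  have : ‖∫ u in (0:ℝ)..1, (F (y, u) - F (x, u))‖ ≤ (ε / 2) * |1 - 0| := by
    refine intervalIntegral.norm_integral_le_of_norm_le_const fun u hu => ?_
    rw [uIoc_of_le zero_le_one] at hu
    rw [← dist_eq_norm]
    exact le_of_lt (hvb y hy u ⟨hu.1.le, hu.2⟩)
  simp only [sub_zero, abs_one, mul_one] at this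
  linarith

/-- On the convex set `S ∩ ball x r` the derivative `F' (·, u)` differs from `F' (x, u)` by less
than `ε`, uniformly in `u`. The mean value inequality then bounds the remainder of the integrand by
`ε ‖y - x‖`. -/
theorem hasFDerivWithinAt_parametric_integral [CompleteSpace G] (hS : Convex ℝ S) {F : E × ℝ → G}
    {F' : E × ℝ → E →L[ℝ] G} (hF : ContinuousOn F (S ×ˢ Icc 0 1))
    (hF' : ContinuousOn F' (S ×ˢ Icc 0 1))
    (h : ∀ x ∈ S, ∀ u ∈ Icc (0:ℝ) 1, HasFDerivWithinAt (fun y => F (y, u)) (F' (x, u)) S x)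
    {x : E} (hx : x ∈ S) :
    HasFDerivWithinAt (fun x => ∫ u in (0:ℝ)..1, F (x, u)) (∫ u in (0:ℝ)..1, F' (x, u)) S x := by
  rw [hasFDerivWithinAt_iff_isLittleO, Asymptotics.isLittleO_iff]
  intro ε hε
  obtain ⟨v, hv, hvb⟩ := isCompact_Icc.mem_uniformity_of_prod (f := fun x u => F' (x, u)) hF' hx
    (Metric.dist_mem_uniformity hε)
  obtain ⟨r, hr, hrv⟩ := Metric.mem_nhdsWithin_iff.1 hv
  filter_upwards [inter_mem_nhdsWithin S (Metric.ball_mem_nhds x hr)] with y hy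
  have hi := intervalIntegrable_slice hF hx
  have hi2 := intervalIntegrable_slice hF hy.1
  have hi' := intervalIntegrable_slice hF' hx
  rw [← intervalIntegral.integral_sub hi2 hi,
    ContinuousLinearMap.intervalIntegral_apply hi',
    ← intervalIntegral.integral_sub (hi2.sub hi)
      (intervalIntegrable_slice (hF'.clm_apply continuousOn_const) hx)]
  have : ‖∫ u in (0:ℝ)..1, (F (y, u) - F (x, u) - F' (x, u) (y - x))‖ ≤ ε * ‖y - x‖ * |1 - 0| := by
    refine intervalIntegral.norm_integral_le_of_norm_le_const fun u hu => ?_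
    rw [uIoc_of_le zero_le_one] at hu
    have hu' : u ∈ Icc (0:ℝ) 1 := ⟨hu.1.le, hu.2⟩
    refine (hS.inter (convex_ball x r)).norm_image_sub_le_of_norm_hasFDerivWithin_le'
      (f := fun y => F (y, u)) (f' := fun z => F' (z, u))
      (fun z hz => (h z hz.1 u hu').mono inter_subset_left) (fun z hz => ?_)
      ⟨hx, Metric.mem_ball_self hr⟩ hy
    rw [← dist_eq_norm]
    exact le_of_lt (hvb z (hrv ⟨hz.2, hz.1⟩) u hu')
  simpa using this

theorem hasFDerivWithinAt_integral_partialDeriv [CompleteSpace G] (hS : Convex ℝ S)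
    (hU : UniqueDiffOn ℝ S) {F : E × ℝ → G} (hF : ContDiffOn ℝ 1 F (S ×ˢ Icc (0:ℝ) 1)) {x : E}
    (hx : x ∈ S) : HasFDerivWithinAt (fun x => ∫ u in (0:ℝ)..1, F (x, u))
      (∫ u in (0:ℝ)..1, partialDeriv S F (x, u)) S x :=
  hasFDerivWithinAt_parametric_integral hS hF.continuousOn
    (contDiffOn_partialDeriv (n := 0) hU (by simpa using hF)).continuousOn
    (fun y hy u hu => hasFDerivWithinAt_partialDeriv hu
      (hF.differentiableOn one_ne_zero (y, u) ⟨hy, hu⟩)) hx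

/-- The target `G` is quantified inside the induction because the induction hypothesis is applied to
the derivative, whose values lie in `E →L[ℝ] G`. -/
theorem contDiffOn_nat_parametric_integral (hS : Convex ℝ S) (hU : UniqueDiffOn ℝ S) (n : ℕ) :
    ∀ {G : Type} [NormedAddCommGroup G] [NormedSpace ℝ G] [CompleteSpace G] {F : E × ℝ → G},
      ContDiffOn ℝ n F (S ×ˢ Icc (0:ℝ) 1) →
      ContDiffOn ℝ n (fun x => ∫ u in (0:ℝ)..1, F (x, u)) S := by
  induction n with
  | zero =>
    intro G _ _ _ F hF
    rw [Nat.cast_zero, contDiffOn_zero] at hF ⊢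
    exact continuousOn_parametric_integral hF
  | succ n ih =>
    intro G _ _ _ F hF
    rw [Nat.cast_succ] at hF ⊢
    rw [contDiffOn_succ_iff_hasFDerivWithinAt_of_uniqueDiffOn hU]
    exact ⟨fun h => absurd h (by simp), _, ih (contDiffOn_partialDeriv hU hF), fun x hx =>
      hasFDerivWithinAt_integral_partialDeriv hS hU (hF.of_le (by simp)) hx⟩

theorem contDiffOn_parametric_integral [CompleteSpace G] (hS : Convex ℝ S) (hU : UniqueDiffOn ℝ S)
    {F : E × ℝ → G} (hF : ContDiffOn ℝ ∞ F (S ×ˢ Icc (0:ℝ) 1)) :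
    ContDiffOn ℝ ∞ (fun x => ∫ u in (0:ℝ)..1, F (x, u)) S := by
  rw [contDiffOn_infty] at hF ⊢
  exact fun n => contDiffOn_nat_parametric_integral hS hU n (hF n)

end ParametricIntegral

/-! ### The cube as a convex set of unique differentiability. -/

section Cube

open Set

variable {B : Type}

theorem mem_cube {x : B → ℝ} : x ∈ cube B ↔ ∀ b, x b ∈ Icc (0:ℝ) 1 :=
  ⟨fun h b => ⟨h.1 b, h.2 b⟩, fun h => ⟨fun b => (h b).1, fun b => (h b).2⟩⟩

theorem cube_eq_pi : cube B = Set.pi univ fun _ => Icc (0:ℝ) 1 := by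
  ext x; simp only [mem_cube, Set.mem_pi, mem_univ, true_imp_iff]

theorem convex_cube : Convex ℝ (cube B) := convex_Icc _ _

theorem zero_mem_cube : (0 : B → ℝ) ∈ cube B := mem_cube.2 fun _ => by simp

theorem uniqueDiffOn_cube [Fintype B] : UniqueDiffOn ℝ (cube B) := by
  rw [cube_eq_pi]
  exact UniqueDiffOn.univ_pi fun _ => uniqueDiffOn_Icc_zero_one

/-- Second derivatives within a set are symmetric at points in the closure of its interior. This is
what `d ∘ d = 0` and the naturality of `d` require at boundary points. -/
theorem mem_closure_interior_cube [Finite B] {x : B → ℝ} (hx : x ∈ cube B) :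
    x ∈ closure (interior (cube B)) := by
  rw [cube_eq_pi, interior_pi_set Set.finite_univ, closure_pi_set]
  intro b _
  rw [interior_Icc, closure_Ioo zero_ne_one]
  exact mem_cube.1 hx b

end Cube
end OrbiCell


namespace OrbiCell

/-! ### Forms on the part of a cube that avoids a set of coordinate values, and their pullback to
faces. -/

section Box

open Set Filter Topology

theorem two_le_smoothness : minSmoothness ℝ 2 ≤ ((⊤ : ℕ∞) : WithTop ℕ∞) := by
  rw [minSmoothness_of_isRCLikeNormedField]
  exact WithTop.coe_le_coe.2 (le_top : (2 : ℕ∞) ≤ ⊤)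

/-- The points of the cube none of whose coordinates lies in `A`. -/
def box (A : Set ℝ) (B : Type) : Set (B → ℝ) := {x | x ∈ cube B ∧ ∀ b, x b ∉ A}

theorem box_empty (B : Type) : box ∅ B = cube B := by
  ext x; simp [box]

theorem box_anti {A A' : Set ℝ} (h : A ⊆ A') {B : Type} : box A' B ⊆ box A B :=
  fun _ hx => ⟨hx.1, fun b hb => hx.2 b (h hb)⟩

variable {A : Set ℝ} {B B' : Type} [Fintype B] [Fintype B'] {k : ℕ}

/-- The box is relatively open in the cube, so all derivatives on the box may be taken within the
cube. -/
theorem eventually_mem_box (hA : IsClosed A) {x : B → ℝ} (hx : x ∈ box A B) :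
    ∀ᶠ y in 𝓝[cube B] x, y ∈ box A B := by
  have : ∀ᶠ y in 𝓝 x, ∀ b, y b ∉ A :=
    eventually_all.2 fun b => (continuous_apply b).continuousAt.eventually
      (hA.isOpen_compl.mem_nhds (hx.2 b))
  filter_upwards [this.filter_mono nhdsWithin_le_nhds, self_mem_nhdsWithin] with y h1 h2
  exact ⟨h2, h1⟩

/-- A differential form on the part `box A B` of the cube, set to zero elsewhere. -/
structure IsFormOn (A : Set ℝ) (ω : FormField B k) : Prop where
  smooth : ∀ x ∈ box A B, ContDiffWithinAt ℝ ((⊤ : ℕ∞) : WithTop ℕ∞) ω (cube B) x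
  zero_off : ∀ x, x ∉ box A B → ω x = 0

theorem isCubeForm_iff {ω : FormField B k} : IsCubeForm ω ↔ IsFormOn ∅ ω :=
  ⟨fun h => ⟨fun x hx => h.1 x hx.1, fun x hx => h.2 x (by rwa [box_empty] at hx)⟩,
    fun h => ⟨fun x hx => h.1 x (by rwa [box_empty]), fun x hx => h.2 x (by rwa [box_empty])⟩⟩

theorem IsFormOn.differentiable {ω : FormField B k} (h : IsFormOn A ω) {x : B → ℝ}
    (hx : x ∈ box A B) : DifferentiableWithinAt ℝ ω (cube B) x :=
  (h.smooth x hx).differentiableWithinAt (by simp)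

theorem contDiff_alternatizeUncurryFin {E : Type} [NormedAddCommGroup E] [NormedSpace ℝ E]
    {n : WithTop ℕ∞} : ContDiff ℝ n (ContinuousAlternatingMap.alternatizeUncurryFin :
      (E →L[ℝ] E [⋀^Fin k]→L[ℝ] ℝ) → E [⋀^Fin (k + 1)]→L[ℝ] ℝ) := by
  have : ContDiff ℝ n (ContinuousAlternatingMap.alternatizeUncurryFinCLM ℝ E ℝ (n := k)) := by
    fun_prop
  exact this

theorem contDiffWithinAt_extDerivWithin {E : Type} [NormedAddCommGroup E] [NormedSpace ℝ E]
    {s : Set E} {ω : E → E [⋀^Fin k]→L[ℝ] ℝ} {x : E} (hs : UniqueDiffOn ℝ s) (hx : x ∈ s)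
    (h : ContDiffWithinAt ℝ ((⊤ : ℕ∞) : WithTop ℕ∞) ω s x) :
    ContDiffWithinAt ℝ ((⊤ : ℕ∞) : WithTop ℕ∞) (extDerivWithin ω s) s x :=
  contDiff_alternatizeUncurryFin.contDiffWithinAt.comp (t := univ) x
    (h.fderivWithin_right hs (by simp) hx) (fun _ _ => trivial)

open Classical in
/-- The exterior derivative of a differential form on `box A B`. -/
noncomputable def extD (A : Set ℝ) (ω : FormField B k) : FormField B (k + 1) :=
  fun x => if x ∈ box A B then extDerivWithin ω (cube B) x else 0

theorem cubeD_eq_extD (ω : FormField B k) : cubeD ω = extD ∅ ω := by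
  funext x
  by_cases hx : x ∈ cube B
  · rw [cubeD, extD, if_pos hx, if_pos (by rwa [box_empty])]
  · rw [cubeD, extD, if_neg hx, if_neg (by rwa [box_empty])]

theorem extD_of_mem {ω : FormField B k} {x : B → ℝ} (hx : x ∈ box A B) :
    extD A ω x = extDerivWithin ω (cube B) x := if_pos hx

theorem extD_eventuallyEq (hA : IsClosed A) (ω : FormField B k) {x : B → ℝ} (hx : x ∈ box A B) :
    extD A ω =ᶠ[𝓝[cube B] x] extDerivWithin ω (cube B) :=
  (eventually_mem_box hA hx).mono fun _ hy => extD_of_mem hy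

theorem IsFormOn.extD (hA : IsClosed A) {ω : FormField B k} (h : IsFormOn A ω) :
    IsFormOn A (extD A ω) where
  smooth x hx := by
    refine ContDiffWithinAt.congr_of_eventuallyEq ?_ (extD_eventuallyEq hA ω hx) (extD_of_mem hx)
    exact contDiffWithinAt_extDerivWithin uniqueDiffOn_cube hx.1 (h.smooth x hx)
  zero_off x hx := if_neg hx

theorem extD_extD (hA : IsClosed A) {ω : FormField B k} (h : IsFormOn A ω) :
    extD A (extD A ω) = 0 := by
  funext x
  by_cases hx : x ∈ box A B
  · rw [extD_of_mem hx, (extD_eventuallyEq hA ω hx).extDerivWithin_eq (extD_of_mem hx),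
      extDerivWithin_extDerivWithin_apply (h.smooth x hx) two_le_smoothness
        uniqueDiffOn_cube (mem_closure_interior_cube hx.1) hx.1]
    rfl
  · exact if_neg hx

theorem extD_add {ω η : FormField B k} (h : IsFormOn A ω) (h' : IsFormOn A η) :
    extD A (ω + η) = extD A ω + extD A η := by
  funext x
  by_cases hx : x ∈ box A B
  · simp only [Pi.add_apply, extD_of_mem hx]
    exact extDerivWithin_add (uniqueDiffOn_cube x hx.1) (h.differentiable hx) (h'.differentiable hx)
  · simp [extD, hx]

theorem extD_smul (r : ℝ) (ω : FormField B k) : extD A (r • ω) = r • extD A ω := by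
  funext x
  by_cases hx : x ∈ box A B
  · simp only [Pi.smul_apply, extD_of_mem hx]
    exact extDerivWithin_smul r ω (uniqueDiffOn_cube x hx.1)
  · simp [extD, hx]

/-- The affine map `y ↦ L y + c` identifies `[0,1]^{B'}` with a face of `[0,1]^B`. -/
def IsFaceMap (L : (B' → ℝ) →L[ℝ] (B → ℝ)) (c : B → ℝ) : Prop :=
  ∃ j : B' → B, Function.Injective j ∧ (∀ y b', (L y + c) (j b') = y b') ∧
    ∀ b, b ∉ range j → (∀ y, (L y + c) b = 0) ∨ ∀ y, (L y + c) b = 1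

theorem IsFaceMap.coord {L : (B' → ℝ) →L[ℝ] (B → ℝ)} {c : B → ℝ} (h : IsFaceMap L c) (b : B) :
    (∃ b', ∀ y, (L y + c) b = y b') ∨ (∀ y, (L y + c) b = 0) ∨ ∀ y, (L y + c) b = 1 := by
  obtain ⟨j, -, h1, h2⟩ := h
  by_cases hb : b ∈ range j
  · obtain ⟨b', rfl⟩ := hb
    exact Or.inl ⟨b', fun y => h1 y b'⟩
  · exact Or.inr (h2 b hb)

theorem IsFaceMap.surj {L : (B' → ℝ) →L[ℝ] (B → ℝ)} {c : B → ℝ} (h : IsFaceMap L c) (b' : B') :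
    ∃ b, ∀ y, (L y + c) b = y b' :=
  let ⟨j, _, h1, _⟩ := h
  ⟨j b', fun y => h1 y b'⟩

/-- The coordinates that are constant on the face are `0` or `1`, and neither value is removed. -/
theorem IsFaceMap.mem_box_iff {L : (B' → ℝ) →L[ℝ] (B → ℝ)} {c : B → ℝ} (h : IsFaceMap L c)
    (h0 : (0:ℝ) ∉ A) (h1 : (1:ℝ) ∉ A) (y : B' → ℝ) : L y + c ∈ box A B ↔ y ∈ box A B' := by
  simp only [box, mem_ofPred_eq, mem_cube, ← forall_and]
  constructor
  · intro hy b'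
    obtain ⟨b, hb⟩ := h.surj b'
    simpa only [hb] using hy b
  · intro hy b
    rcases h.coord b with ⟨b', hb⟩ | hb | hb
    · simpa only [hb] using hy b'
    · simpa only [hb] using ⟨by simp, h0⟩
    · simpa only [hb] using ⟨by simp, h1⟩

theorem IsFaceMap.mem_cube_iff {L : (B' → ℝ) →L[ℝ] (B → ℝ)} {c : B → ℝ} (h : IsFaceMap L c)
    (y : B' → ℝ) : L y + c ∈ cube B ↔ y ∈ cube B' := by
  simpa only [box_empty] using h.mem_box_iff (A := ∅) (by simp) (by simp) y

theorem contDiff_affine (L : (B' → ℝ) →L[ℝ] (B → ℝ)) (c : B → ℝ) {n : WithTop ℕ∞} :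
    ContDiff ℝ n fun y => L y + c := L.contDiff.add contDiff_const

theorem IsFormOn.pullback (h0 : (0:ℝ) ∉ A) (h1 : (1:ℝ) ∉ A) {L : (B' → ℝ) →L[ℝ] (B → ℝ)}
    {c : B → ℝ} (h : IsFaceMap L c) {ω : FormField B k} (hω : IsFormOn A ω) :
    IsFormOn A (pullback L c ω) where
  smooth y hy := by
    have e := (hω.smooth _ ((h.mem_box_iff h0 h1 y).2 hy)).comp y
      (contDiff_affine L c).contDiffWithinAt (fun z hz => (h.mem_cube_iff z).2 hz)
    exact (ContinuousAlternatingMap.compContinuousLinearMapCLM L).contDiff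
      |>.contDiffWithinAt.comp (t := univ) y e (fun _ _ => trivial)
  zero_off y hy := by
    unfold OrbiCell.pullback
    rw [hω.zero_off _ (fun k => hy ((h.mem_box_iff h0 h1 y).1 k))]
    ext v; rfl

theorem extD_pullback (h0 : (0:ℝ) ∉ A) (h1 : (1:ℝ) ∉ A) {L : (B' → ℝ) →L[ℝ] (B → ℝ)}
    {c : B → ℝ} (h : IsFaceMap L c) {ω : FormField B k} (hω : IsFormOn A ω) :
    extD A (pullback L c ω) = pullback L c (extD A ω) := by
  funext y
  by_cases hy : y ∈ box A B'
  · have hy' := (h.mem_box_iff h0 h1 y).2 hy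
    unfold pullback
    rw [extD_of_mem hy, extD_of_mem hy']
    -- The derivative of the affine map within the cube is its linear part, so `pullback` is the
    -- usual pullback by the derivative.
    have hf : ∀ z ∈ cube B', fderivWithin ℝ (fun y => L y + c) (cube B') z = L := fun z hz => by
      rw [fderivWithin_add_const, L.fderivWithin (uniqueDiffOn_cube z hz)]
    have key := extDerivWithin_pullback (𝕜 := ℝ) (r := ((⊤ : ℕ∞) : WithTop ℕ∞)) (s := cube B') (x := y)
      (hω.differentiable hy')
      (contDiff_affine L c).contDiffWithinAt two_le_smoothness uniqueDiffOn_cube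
      (mem_closure_interior_cube hy.1) hy.1 (fun z hz => (h.mem_cube_iff z).2 hz)
    rw [hf y hy.1] at key
    rw [← key]
    exact extDerivWithin_congr' (fun z hz => by simp only [hf z hz]) hy.1
  · have hy' : L y + c ∉ box A B := fun k => hy ((h.mem_box_iff h0 h1 y).1 k)
    ext v
    simp [extD, hy, pullback, hy']

theorem reindex_apply (φ : B ≃ B') (y : B' → ℝ) : reindex φ y = y ∘ φ := rfl

open Classical in
theorem faceLin_apply (e : B) (ε : {b // b ≠ e} ≃ B') (y : B' → ℝ) (b : B) :
    faceLin e ε y b = if h : b = e then 0 else y (ε ⟨b, h⟩) := by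
  simp only [faceLin, ContinuousLinearMap.coe_pi']
  split_ifs <;> rfl

theorem faceLin_self (e : B) (ε : {b // b ≠ e} ≃ B') (y : B' → ℝ) : faceLin e ε y e = 0 := by
  simp [faceLin_apply]

theorem faceLin_ne (e : B) (ε : {b // b ≠ e} ≃ B') (y : B' → ℝ) {b : B} (h : b ≠ e) :
    faceLin e ε y b = y (ε ⟨b, h⟩) := by
  simp [faceLin_apply, h]

theorem unitVec_self (e : B) : unitVec e e = 1 := by simp [unitVec]

theorem unitVec_ne {e b : B} (h : b ≠ e) : unitVec e b = 0 := by simp [unitVec, h]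

theorem isFaceMap_reindex (φ : B ≃ B') : IsFaceMap (reindex φ) 0 :=
  ⟨φ.symm, φ.symm.injective, fun y b' => by simp [reindex_apply],
    fun b hb => absurd ⟨φ b, φ.symm_apply_apply b⟩ hb⟩

theorem isFaceMap_face (e : B) (ε : {b // b ≠ e} ≃ B') {c : B → ℝ} (hc : ∀ b, b ≠ e → c b = 0)
    (hce : c e = 0 ∨ c e = 1) : IsFaceMap (faceLin e ε) c := by
  refine ⟨fun b' => (ε.symm b').1, fun a b h => ε.symm.injective (Subtype.ext h), fun y b' => ?_,
    fun b hb => ?_⟩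
  · simp [faceLin_ne e ε y (ε.symm b').2, hc _ (ε.symm b').2]
  · have : b = e := by
      by_contra h
      exact hb ⟨ε ⟨b, h⟩, by simp⟩
    subst this
    simpa [faceLin_self] using hce

theorem isFaceMap_zero (e : B) (ε : {b // b ≠ e} ≃ B') : IsFaceMap (faceLin e ε) 0 :=
  isFaceMap_face e ε (fun _ _ => rfl) (Or.inl rfl)

theorem isFaceMap_one (e : B) (ε : {b // b ≠ e} ≃ B') : IsFaceMap (faceLin e ε) (unitVec e) :=
  isFaceMap_face e ε (fun _ h => unitVec_ne h) (Or.inr (unitVec_self e))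

end Box

/-! ### The complex of orbi-cellular forms on the part of the complex avoiding `A`. -/

section OrbiForms

variable {g n k : ℕ} {A : Set ℝ}

/-- Orbi-cellular forms on the part of the complex where no coordinate lies in `A`. -/
structure IsOrbiFormOn (A : Set ℝ) (ω : ∀ γ : Cell g n, FormField γ.Black k) : Prop where
  form : ∀ γ, IsFormOn A (ω γ)
  invariant : ∀ (γ γ' : Cell g n) (φ : Cell.Iso γ γ'),
    pullback (reindex φ.onBlack) 0 (ω γ) = ω γ'
  zero_face : ∀ (γ : Cell g n) (e : γ.Black),
    pullback (faceLin e (γ.contractBlack e)) 0 (ω γ) = ω (γ.contract e)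
  infty_face : ∀ (γ : Cell g n) (e : γ.Black),
    pullback (faceLin e (γ.whitenBlack e)) (unitVec e) (ω γ) = ω (γ.whiten e)

theorem isOrbiForm_iff {ω : ∀ γ : Cell g n, FormField γ.Black k} :
    IsOrbiForm ω ↔ IsOrbiFormOn ∅ ω :=
  ⟨fun h => ⟨fun γ => isCubeForm_iff.1 (h.1 γ), h.2, h.3, h.4⟩,
    fun h => ⟨fun γ => isCubeForm_iff.2 (h.1 γ), h.2, h.3, h.4⟩⟩

theorem IsFormOn.zero {B : Type} [Fintype B] : IsFormOn A (0 : FormField B k) :=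
  ⟨fun _ _ => contDiffWithinAt_const, fun _ _ => rfl⟩

theorem IsFormOn.add {B : Type} [Fintype B] {ω η : FormField B k} (h : IsFormOn A ω)
    (h' : IsFormOn A η) : IsFormOn A (ω + η) :=
  ⟨fun x hx => (h.smooth x hx).add (h'.smooth x hx), fun x hx => by
    rw [Pi.add_apply, h.zero_off x hx, h'.zero_off x hx, add_zero]⟩

theorem IsFormOn.smul {B : Type} [Fintype B] (r : ℝ) {ω : FormField B k} (h : IsFormOn A ω) :
    IsFormOn A (r • ω) :=
  ⟨fun x hx => (h.smooth x hx).const_smul r, fun x hx => by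
    rw [Pi.smul_apply, h.zero_off x hx, smul_zero]⟩

/-- The real vector space of orbi-cellular `k`-forms on the part of the complex where no coordinate
lies in `A`. -/
def orbiFormsOn (A : Set ℝ) (g n k : ℕ) :
    Submodule ℝ (∀ γ : Cell g n, FormField γ.Black k) where
  carrier := {ω | IsOrbiFormOn A ω}
  zero_mem' :=
    { form := fun _ => .zero
      invariant := fun _ _ _ => pullback_zero _ _
      zero_face := fun _ _ => pullback_zero _ _
      infty_face := fun _ _ => pullback_zero _ _ }
  add_mem' hω hη :=
    { form := fun γ => (hω.form γ).add (hη.form γ)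
      invariant := fun γ γ' φ => (pullback_add _ _ _ _).trans
        (congrArg₂ (· + ·) (hω.invariant γ γ' φ) (hη.invariant γ γ' φ))
      zero_face := fun γ e => (pullback_add _ _ _ _).trans
        (congrArg₂ (· + ·) (hω.zero_face γ e) (hη.zero_face γ e))
      infty_face := fun γ e => (pullback_add _ _ _ _).trans
        (congrArg₂ (· + ·) (hω.infty_face γ e) (hη.infty_face γ e)) }
  smul_mem' r _ hω :=
    { form := fun γ => (hω.form γ).smul r
      invariant := fun γ γ' φ => (pullback_smul _ _ _ _).trans
        (congrArg (r • ·) (hω.invariant γ γ' φ))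
      zero_face := fun γ e => (pullback_smul _ _ _ _).trans
        (congrArg (r • ·) (hω.zero_face γ e))
      infty_face := fun γ e => (pullback_smul _ _ _ _).trans
        (congrArg (r • ·) (hω.infty_face γ e)) }

theorem orbiForms_eq (g n k : ℕ) : orbiForms g n k = orbiFormsOn ∅ g n k :=
  Submodule.ext fun _ => isOrbiForm_iff

theorem IsOrbiFormOn.extD (hA : IsClosed A) (h0 : (0:ℝ) ∉ A) (h1 : (1:ℝ) ∉ A)
    {ω : ∀ γ : Cell g n, FormField γ.Black k} (h : IsOrbiFormOn A ω) :
    IsOrbiFormOn A fun γ => extD A (ω γ) where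
  form γ := (h.form γ).extD hA
  invariant γ γ' φ := by
    rw [← extD_pullback h0 h1 (isFaceMap_reindex _) (h.form γ), h.invariant]
  zero_face γ e := by
    rw [← extD_pullback h0 h1 (isFaceMap_zero _ _) (h.form γ), h.zero_face]
  infty_face γ e := by
    rw [← extD_pullback h0 h1 (isFaceMap_one _ _) (h.form γ), h.infty_face]

/-- The exterior derivative of orbi-cellular forms. -/
noncomputable def orbiD (hA : IsClosed A) (h0 : (0:ℝ) ∉ A) (h1 : (1:ℝ) ∉ A) (g n k : ℕ) :
    orbiFormsOn A g n k →ₗ[ℝ] orbiFormsOn A g n (k + 1) where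
  toFun ω := ⟨fun γ => extD A (ω.1 γ), IsOrbiFormOn.extD hA h0 h1 ω.2⟩
  map_add' ω η := Subtype.ext (funext fun γ => extD_add (ω.2.form γ) (η.2.form γ))
  map_smul' r ω := Subtype.ext (funext fun γ => extD_smul r (ω.1 γ))

theorem orbiD_orbiD (hA : IsClosed A) (h0 : (0:ℝ) ∉ A) (h1 : (1:ℝ) ∉ A)
    (ω : orbiFormsOn A g n k) : orbiD hA h0 h1 g n (k + 1) (orbiD hA h0 h1 g n k ω) = 0 :=
  Subtype.ext (funext fun γ => extD_extD hA (ω.2.form γ))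

end OrbiForms
end OrbiCell

namespace OrbiCell

/-! ### Stokes' theorem: integration is a map of complexes. -/

section Stokes

open Set MeasureTheory

variable {B B' B'' : Type} [Fintype B] [Fintype B'] [Fintype B''] {k : ℕ}

theorem pullback_pullback (L : (B' → ℝ) →L[ℝ] (B → ℝ)) (c : B → ℝ)
    (L' : (B'' → ℝ) →L[ℝ] (B' → ℝ)) (c' : B' → ℝ) (ω : FormField B k) :
    pullback L' c' (pullback L c ω) = pullback (L.comp L') (L c' + c) ω := by
  ext y v
  simp [pullback, add_assoc]
  rfl

theorem reindex_unitVec (o : B' ≃ B) (j : B') :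
    reindex o.symm (unitVec j) = (unitVec (o j) : B → ℝ) := by
  funext b
  rw [reindex_apply, Function.comp_apply]
  by_cases h : b = o j
  · subst h
    rw [o.symm_apply_apply, unitVec_self, unitVec_self]
  · rw [unitVec_ne h, unitVec_ne fun e => h (by rw [← e, o.apply_symm_apply])]

/-- The integral of a top-dimensional form over the standard cube. -/
noncomputable def intTop (η : FormField (Fin k) k) : ℝ :=
  ∫ x in cube (Fin k), η x fun j => unitVec j

theorem integrate_eq_intTop {g n : ℕ} (ω : ∀ γ : Cell g n, FormField γ.Black k) (γ : Cell g n)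
    (o : Fin k ≃ γ.Black) :
    integrate ω γ o = intTop (pullback (reindex o.symm) 0 (ω γ)) := by
  unfold integrate intTop pullback
  congr 1
  funext x
  rw [add_zero]
  show ω γ (x ∘ o.symm) _ = ω γ (x ∘ o.symm) _
  congr 1
  funext j
  exact (reindex_unitVec o j).symm

/-- The front (`c = unitVec i`) and back (`c = 0`) faces of the standard cube. -/
noncomputable def stdFace (i : Fin (k + 1)) : (Fin k → ℝ) →L[ℝ] (Fin (k + 1) → ℝ) :=
  faceLin i (finSuccAboveEquiv i).symm

theorem stdFace_self (i : Fin (k + 1)) (y : Fin k → ℝ) : stdFace i y i = 0 := faceLin_self _ _ _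

theorem stdFace_succAbove (i : Fin (k + 1)) (y : Fin k → ℝ) (j : Fin k) :
    stdFace i y (i.succAbove j) = y j := by
  rw [stdFace, faceLin_ne _ _ _ (Fin.succAbove_ne i j)]
  congr 1
  rw [Equiv.symm_apply_eq]; rfl

theorem stdFace_unitVec (i : Fin (k + 1)) (j : Fin k) :
    stdFace i (unitVec j) = unitVec (i.succAbove j) := by
  funext a
  rcases Fin.eq_self_or_eq_succAbove i a with rfl | ⟨b, rfl⟩
  · rw [stdFace_self, unitVec_ne (Fin.succAbove_ne a j).symm]
  · rw [stdFace_succAbove]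
    simp [unitVec, Pi.single_apply]

theorem stdFace_eq_insertNth (i : Fin (k + 1)) (y : Fin k → ℝ) :
    stdFace i y = i.insertNth (α := fun _ => ℝ) 0 y := by
  refine (Fin.insertNth_eq_iff.2 ⟨(stdFace_self i y).symm, funext fun j => ?_⟩).symm
  exact (stdFace_succAbove i y j).symm

theorem stdFace_add_unitVec (i : Fin (k + 1)) (y : Fin k → ℝ) :
    stdFace i y + unitVec i = i.insertNth (α := fun _ => ℝ) 1 y := by
  refine (Fin.insertNth_eq_iff.2 ⟨?_, funext fun j => ?_⟩).symm
  · simp [stdFace_self, unitVec_self]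
  · simp [Fin.removeNth, stdFace_succAbove, unitVec_ne (Fin.succAbove_ne i j)]

/-- The top coefficient of `dη` is the divergence of the vector field whose `i`-th component is
`(-1)^i` times `η` on the unit vectors other than the `i`-th. The flux of this field through a pair
of opposite faces is the difference of the integrals of the restrictions of `η`. -/
theorem intTop_extD {η : FormField (Fin (k + 1)) k} (h : IsFormOn ∅ η) :
    intTop (extD ∅ η) = ∑ i : Fin (k + 1), (-1) ^ (i : ℕ) *
      (intTop (pullback (stdFace i) (unitVec i) η) - intTop (pullback (stdFace i) 0 η)) := by
  let v : Fin (k + 1) → Fin (k + 1) → ℝ := fun j => unitVec j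
  let f : Fin (k + 1) → (Fin (k + 1) → ℝ) → ℝ := fun i x => (-1) ^ (i : ℕ) * η x (i.removeNth v)
  let f' : Fin (k + 1) → (Fin (k + 1) → ℝ) → (Fin (k + 1) → ℝ) →L[ℝ] ℝ :=
    fun i x => fderivWithin ℝ (f i) (cube (Fin (k + 1))) x
  have hsm : ContDiffOn ℝ ((⊤ : ℕ∞) : WithTop ℕ∞) η (cube (Fin (k + 1))) :=
    (isCubeForm_iff.2 h).smooth
  have hf : ∀ i, ContDiffOn ℝ ((⊤ : ℕ∞) : WithTop ℕ∞) (f i) (cube (Fin (k + 1))) := fun i => by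
    refine contDiffOn_const.mul ?_
    exact (ContinuousAlternatingMap.apply ℝ (Fin (k + 1) → ℝ) ℝ (i.removeNth v)).contDiff
      |>.comp_contDiffOn hsm
  have key := integral_divergence_of_hasFDerivAt_off_countable' (E := ℝ) (a := (0 : Fin (k + 1) → ℝ))
    (b := 1) zero_le_one f f' ∅ countable_empty (fun i => (hf i).continuousOn) ?_ ?_
  · have e1 : intTop (extD ∅ η) = ∫ x in Icc (0 : Fin (k + 1) → ℝ) 1, ∑ i, f' i x (v i) := by
      refine setIntegral_congr_fun measurableSet_Icc fun x hx => ?_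
      have hx' : x ∈ cube (Fin (k + 1)) := hx
      show extD ∅ η x v = _
      rw [extD_of_mem (by rwa [box_empty]), extDerivWithin_apply
        (hsm.differentiableOn (by simp) x hx') (uniqueDiffOn_cube x hx')]
      refine Finset.sum_congr rfl fun i _ => ?_
      show _ = fderivWithin ℝ (fun x => (-1) ^ (i : ℕ) * η x (i.removeNth v)) _ x (v i)
      rw [fderivWithin_const_mul]
      · simp
      · exact uniqueDiffOn_cube x hx'
      · exact ((ContinuousAlternatingMap.apply ℝ (Fin (k + 1) → ℝ) ℝ (i.removeNth v)).contDiff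
          |>.comp_contDiffOn hsm).differentiableOn (by simp) x hx'
    have hv : ∀ i, v i = Pi.single i 1 := fun i => by
      funext j
      simp [v, unitVec, Pi.single_apply]
    rw [e1]
    simp only [hv]
    refine key.trans (Finset.sum_congr rfl fun i _ => ?_)
    rw [mul_sub]
    -- The unit vectors other than the `i`-th are the images of the unit vectors of the face, in the
    -- same order, so no further sign appears.
    have hrem : i.removeNth v = ⇑(stdFace i) ∘ fun j => unitVec j :=
      (funext fun j => stdFace_unitVec i j).symm
    congr 1
    · rw [intTop, ← integral_const_mul]
      refine setIntegral_congr_fun measurableSet_Icc fun x _ => ?_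
      simp only [f, pullback, stdFace_add_unitVec, ContinuousAlternatingMap.compContinuousLinearMap_apply]
      rw [hrem]
      rfl
    · rw [intTop, ← integral_const_mul]
      refine setIntegral_congr_fun measurableSet_Icc fun x _ => ?_
      simp only [f, pullback, add_zero, ContinuousAlternatingMap.compContinuousLinearMap_apply]
      rw [hrem, stdFace_eq_insertNth]
      rfl
  -- The divergence theorem asks for derivatives only in the interior, where the derivative within
  -- the cube is the ordinary one.
  · intro x hx i
    have hx1 : x ∈ interior (cube (Fin (k + 1))) := by
      rw [cube_eq_pi, interior_pi_set finite_univ]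
      simpa [interior_Icc] using hx.1
    have hx2 := interior_subset hx1
    exact (((hf i).differentiableOn (by simp) x hx2).hasFDerivWithinAt).hasFDerivAt
      (mem_interior_iff_mem_nhds.1 hx1)
  · refine ContinuousOn.integrableOn_compact isCompact_Icc ?_
    refine continuousOn_finsetSum _ fun i _ => ?_
    exact ((hf i).continuousOn_fderivWithin uniqueDiffOn_cube (by simp)).clm_apply
      continuousOn_const

/-- The `i`-th face of the standard cube corresponds to the face in direction `o i` with the
ordering in which `o i` is left out; this matches the signs of Stokes with those of `cochainD`. -/
theorem stdFace_reindex (o : Fin (k + 1) ≃ B) (i : Fin (k + 1)) (ε : {b // b ≠ o i} ≃ B') :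
    (reindex o.symm).comp (stdFace i) =
      (faceLin (o i) ε).comp (reindex ((dropEntry o i).trans ε).symm) := by
  ext1 y
  funext b
  by_cases hb : b = o i
  · subst hb
    simp [reindex_apply, stdFace_self, faceLin_self]
  · obtain ⟨a, rfl⟩ := o.surjective b
    have ha : a ≠ i := fun h => hb (h ▸ rfl)
    obtain ⟨j, rfl⟩ := Fin.exists_succAbove_eq ha
    have e : (⟨o (i.succAbove j), hb⟩ : {b // b ≠ o i}) = dropEntry o i j := rfl
    simp [reindex_apply, faceLin_ne _ _ _ hb, e, stdFace_succAbove]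

theorem intTop_pullback_face {B B' : Type} [Fintype B] [Fintype B'] {k : ℕ} (o : Fin (k + 1) ≃ B)
    (i : Fin (k + 1)) (ε : {b // b ≠ o i} ≃ B')
    (ω : FormField B k) :
    intTop (pullback (stdFace i) 0 (pullback (reindex o.symm) 0 ω)) =
      intTop (pullback (reindex ((dropEntry o i).trans ε).symm) 0
        (pullback (faceLin (o i) ε) 0 ω)) := by
  rw [pullback_pullback, pullback_pullback, stdFace_reindex o i ε]
  simp

theorem intTop_pullback_face_one {B B' : Type} [Fintype B] [Fintype B'] {k : ℕ}
    (o : Fin (k + 1) ≃ B) (i : Fin (k + 1))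
    (ε : {b // b ≠ o i} ≃ B') (ω : FormField B k) :
    intTop (pullback (stdFace i) (unitVec i) (pullback (reindex o.symm) 0 ω)) =
      intTop (pullback (reindex ((dropEntry o i).trans ε).symm) 0
        (pullback (faceLin (o i) ε) (unitVec (o i)) ω)) := by
  rw [pullback_pullback, pullback_pullback, stdFace_reindex o i ε]
  congr 2
  simp only [map_zero, add_zero, zero_add]
  exact reindex_unitVec o i

/-- **Stokes' theorem** for orbi-cellular forms. -/
theorem integrate_extD {g n : ℕ} {ω : ∀ γ : Cell g n, FormField γ.Black k}
    (h : IsOrbiFormOn ∅ ω) : integrate (fun γ => extD ∅ (ω γ)) = cochainD (integrate ω) := by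
  funext γ o
  rw [integrate_eq_intTop, ← extD_pullback (by simp) (by simp) (isFaceMap_reindex _) (h.form γ),
    intTop_extD ((h.form γ).pullback (by simp) (by simp) (isFaceMap_reindex _)), cochainD]
  refine Finset.sum_congr rfl fun i _ => ?_
  rw [integrate_eq_intTop, integrate_eq_intTop, ← h.infty_face, ← h.zero_face,
    intTop_pullback_face_one o i (γ.whitenBlack (o i)),
    intTop_pullback_face o i (γ.contractBlack (o i))]

/-- A permutation of the coordinates preserves Lebesgue measure and the cube, so only the sign from
the alternating form remains. -/
theorem intTop_reindex_perm (π : Perm (Fin k)) (η : FormField (Fin k) k) :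
    intTop (pullback (reindex π.symm) 0 η) = ((Perm.sign π : ℤ) : ℝ) * intTop η := by
  have hv : ∀ j, reindex π.symm (unitVec j) = unitVec (π j) := reindex_unitVec π
  unfold intTop pullback
  simp only [add_zero]
  have e : ∀ x, (η (reindex π.symm x)).compContinuousLinearMap (reindex π.symm)
      (fun j => unitVec j) = ((Perm.sign π : ℤ) : ℝ) * η (reindex π.symm x) fun j => unitVec j := by
    intro x
    have := (η (reindex π.symm x)).toAlternatingMap.map_perm (fun j => (unitVec j : Fin k → ℝ)) π
    rw [show ((Perm.sign π : ℤ) : ℝ) * η (reindex π.symm x) (fun j => unitVec j) =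
      Perm.sign π • η (reindex π.symm x) (fun j => unitVec j) by
        rw [Units.smul_def, zsmul_eq_mul]]
    refine Eq.trans ?_ this
    show η (reindex π.symm x) (fun j => reindex π.symm (unitVec j)) = _
    simp only [hv]
    rfl
  simp only [e]
  rw [integral_const_mul]
  congr 1
  have hm := volume_measurePreserving_piCongrLeft (fun _ : Fin k => ℝ) π
  have hpre : (MeasurableEquiv.piCongrLeft (fun _ : Fin k => ℝ) π) ⁻¹' (cube (Fin k)) =
      cube (Fin k) := by
    ext x
    constructor
    · intro hx
      rw [mem_cube]
      intro j
      have := mem_cube.1 hx (π j)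
      rwa [MeasurableEquiv.coe_piCongrLeft, Equiv.piCongrLeft_apply_apply] at this
    · intro hx
      rw [mem_preimage, mem_cube]
      intro j
      obtain ⟨i, rfl⟩ := π.surjective j
      rw [MeasurableEquiv.coe_piCongrLeft, Equiv.piCongrLeft_apply_apply]
      exact mem_cube.1 hx i
  have := hm.setIntegral_preimage_emb (MeasurableEquiv.measurableEmbedding _)
    (fun x => η x fun j => unitVec j) (cube (Fin k))
  rw [hpre] at this
  rw [← this]
  refine setIntegral_congr_fun measurableSet_Icc fun x _ => ?_
  show η _ _ = η _ _
  congr 1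
  congr 1
  funext j
  obtain ⟨i, rfl⟩ := π.surjective j
  rw [MeasurableEquiv.coe_piCongrLeft, Equiv.piCongrLeft_apply_apply, reindex_apply,
    Function.comp_apply, Equiv.symm_apply_apply]

theorem integrate_mem_cochains {g n : ℕ} {ω : ∀ γ : Cell g n, FormField γ.Black k}
    (h : IsOrbiFormOn ∅ ω) : integrate ω ∈ cochains g n k := by
  refine ⟨fun γ o π => ?_, fun γ γ' φ o => ?_⟩
  · rw [integrate_eq_intTop, integrate_eq_intTop, ← intTop_reindex_perm π, pullback_pullback]
    simp only [map_zero, add_zero]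
    rfl
  · rw [integrate_eq_intTop, integrate_eq_intTop, ← h.invariant γ γ' φ, pullback_pullback]
    simp only [map_zero, add_zero]
    congr 2
    ext1 y
    funext b
    simp [reindex_apply]

end Stokes
end OrbiCell

namespace OrbiCell

/-! ### Primitive, average and interpolation in one coordinate. -/

section CoordinateOperators

open Set MeasureTheory

variable {B : Type} [Fintype B] {G G' : Type} [NormedAddCommGroup G] [NormedSpace ℝ G]
  [CompleteSpace G] [NormedAddCommGroup G'] [NormedSpace ℝ G'] [CompleteSpace G']

/-- The linear map multiplying the coordinate `b` by `u`. -/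
noncomputable def scaleAt (b : B) (u : ℝ) : (B → ℝ) →L[ℝ] (B → ℝ) :=
  ContinuousLinearMap.id ℝ _ +
    (u - 1) • (ContinuousLinearMap.proj (R := ℝ) (φ := fun _ : B => ℝ) b).smulRight (unitVec b)

theorem scaleAt_self (b : B) (u : ℝ) (x : B → ℝ) : scaleAt b u x b = u * x b := by
  simp [scaleAt, unitVec_self]; ring

theorem scaleAt_ne {b c : B} (h : c ≠ b) (u : ℝ) (x : B → ℝ) : scaleAt b u x c = x c := by
  simp [scaleAt, unitVec_ne h]

theorem scaleAt_one (b : B) (x : B → ℝ) : scaleAt b 1 x = x := by simp [scaleAt]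

theorem scaleAt_eq (b : B) (u : ℝ) (x : B → ℝ) : scaleAt b u x = scaleAt b 0 x + (u * x b) • unitVec b := by
  funext c
  by_cases h : c = b
  · subst h; simp [scaleAt_self, unitVec_self]
  · simp [scaleAt_ne h, unitVec_ne h]

/-- The point `x` with its coordinate `b` replaced by `s`. -/
noncomputable def setAt (b : B) (s : ℝ) (x : B → ℝ) : B → ℝ := scaleAt b 0 x + s • unitVec b

theorem setAt_self (b : B) (s : ℝ) (x : B → ℝ) : setAt b s x b = s := by
  simp [setAt, scaleAt_self, unitVec_self]

theorem setAt_ne {b c : B} (h : c ≠ b) (s : ℝ) (x : B → ℝ) : setAt b s x c = x c := by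
  simp [setAt, scaleAt_ne h, unitVec_ne h]

theorem setAt_setAt (b : B) (s t : ℝ) (x : B → ℝ) : setAt b s (setAt b t x) = setAt b s x := by
  funext c
  by_cases h : c = b
  · subst h; rw [setAt_self, setAt_self]
  · rw [setAt_ne h, setAt_ne h, setAt_ne h]

theorem setAt_comm {b c : B} (h : b ≠ c) (s t : ℝ) (x : B → ℝ) :
    setAt b s (setAt c t x) = setAt c t (setAt b s x) := by
  funext a
  by_cases h1 : a = b
  · subst h1; rw [setAt_self, setAt_ne h, setAt_self]
  · by_cases h2 : a = c
    · subst h2; rw [setAt_ne h1, setAt_self, setAt_self]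
    · rw [setAt_ne h1, setAt_ne h2, setAt_ne h2, setAt_ne h1]

theorem scaleAt_eq_setAt (b : B) (u : ℝ) (x : B → ℝ) : scaleAt b u x = setAt b (u * x b) x :=
  scaleAt_eq b u x

theorem setAt_mem_cube (b : B) {s : ℝ} (hs : s ∈ Icc (0:ℝ) 1) {x : B → ℝ} (hx : x ∈ cube B) :
    setAt b s x ∈ cube B := by
  rw [mem_cube] at hx ⊢
  intro c
  by_cases h : c = b
  · subst h; rwa [setAt_self]
  · rw [setAt_ne h]; exact hx c

theorem scaleAt_mem_cube (b : B) {u : ℝ} (hu : u ∈ Icc (0:ℝ) 1) {x : B → ℝ} (hx : x ∈ cube B) :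
    scaleAt b u x ∈ cube B := by
  rw [scaleAt_eq_setAt]
  have := mem_cube.1 hx b
  exact setAt_mem_cube b ⟨mul_nonneg hu.1 this.1, mul_le_one₀ hu.2 this.1 this.2⟩ hx

theorem contDiff_scaleAt (b : B) {n : WithTop ℕ∞} :
    ContDiff ℝ n fun p : (B → ℝ) × ℝ => scaleAt b p.2 p.1 := by
  unfold scaleAt
  simp only [add_apply, smul_apply,
    ContinuousLinearMap.smulRight_apply, ContinuousLinearMap.proj_apply, ContinuousLinearMap.id_apply]
  fun_prop

theorem contDiff_setAt (b : B) {n : WithTop ℕ∞} :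
    ContDiff ℝ n fun p : (B → ℝ) × ℝ => setAt b p.2 p.1 := by
  unfold setAt
  fun_prop

/-- `x_b` times the average of `f` over the segment from `x_b = 0` to `x`: the primitive of `f` in
the direction `b`. -/
noncomputable def prim (b : B) (f : (B → ℝ) → G) (x : B → ℝ) : G :=
  x b • ∫ u in (0:ℝ)..1, f (scaleAt b u x)

/-- The average of `f` in the direction `b`. -/
noncomputable def avg (b : B) (f : (B → ℝ) → G) (x : B → ℝ) : G :=
  ∫ u in (0:ℝ)..1, f (setAt b u x)

/-- The interpolation of `f` between `x_b = 0` and `x_b = 1`. -/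
noncomputable def interp (b : B) (f : (B → ℝ) → G) (x : B → ℝ) : G :=
  (1 - x b) • f (setAt b 0 x) + x b • f (setAt b 1 x)

/-- The primitive of `f - avg f` in the direction `b`. -/
noncomputable def relPrim (b : B) (f : (B → ℝ) → G) (x : B → ℝ) : G :=
  prim b f x - x b • avg b f x

variable {f : (B → ℝ) → G} {x : B → ℝ}

theorem contDiffOn_comp_scaleAt (b : B) {n : WithTop ℕ∞} (hf : ContDiffOn ℝ n f (cube B)) :
    ContDiffOn ℝ n (fun p : (B → ℝ) × ℝ => f (scaleAt b p.2 p.1)) (cube B ×ˢ Icc (0:ℝ) 1) :=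
  hf.comp (contDiff_scaleAt b).contDiffOn fun _ hp => scaleAt_mem_cube b hp.2 hp.1

theorem contDiffOn_comp_setAt (b : B) {n : WithTop ℕ∞} (hf : ContDiffOn ℝ n f (cube B)) :
    ContDiffOn ℝ n (fun p : (B → ℝ) × ℝ => f (setAt b p.2 p.1)) (cube B ×ˢ Icc (0:ℝ) 1) :=
  hf.comp (contDiff_setAt b).contDiffOn fun _ hp => setAt_mem_cube b hp.2 hp.1

theorem intervalIntegrable_scaleAt (b : B) (hf : ContinuousOn f (cube B)) (hx : x ∈ cube B) :
    IntervalIntegrable (fun u => f (scaleAt b u x)) volume 0 1 :=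
  intervalIntegrable_slice (contDiffOn_zero.1 (contDiffOn_comp_scaleAt b (contDiffOn_zero.2 hf))) hx

theorem intervalIntegrable_setAt (b : B) (hf : ContinuousOn f (cube B)) (hx : x ∈ cube B) :
    IntervalIntegrable (fun u => f (setAt b u x)) volume 0 1 :=
  intervalIntegrable_slice (contDiffOn_zero.1 (contDiffOn_comp_setAt b (contDiffOn_zero.2 hf))) hx

theorem contDiffOn_prim (b : B) (hf : ContDiffOn ℝ ((⊤ : ℕ∞) : WithTop ℕ∞) f (cube B)) :
    ContDiffOn ℝ ((⊤ : ℕ∞) : WithTop ℕ∞) (prim b f) (cube B) :=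
  (contDiff_apply ℝ ℝ b).contDiffOn.smul
    (contDiffOn_parametric_integral convex_cube uniqueDiffOn_cube (contDiffOn_comp_scaleAt b hf))

theorem contDiffOn_avg (b : B) (hf : ContDiffOn ℝ ((⊤ : ℕ∞) : WithTop ℕ∞) f (cube B)) :
    ContDiffOn ℝ ((⊤ : ℕ∞) : WithTop ℕ∞) (avg b f) (cube B) :=
  contDiffOn_parametric_integral convex_cube uniqueDiffOn_cube (contDiffOn_comp_setAt b hf)

theorem contDiffOn_relPrim (b : B) (hf : ContDiffOn ℝ ((⊤ : ℕ∞) : WithTop ℕ∞) f (cube B)) :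
    ContDiffOn ℝ ((⊤ : ℕ∞) : WithTop ℕ∞) (relPrim b f) (cube B) :=
  (contDiffOn_prim b hf).sub ((contDiff_apply ℝ ℝ b).contDiffOn.smul (contDiffOn_avg b hf))

theorem prim_clm (b : B) (T : G →L[ℝ] G') (hf : ContinuousOn f (cube B)) (hx : x ∈ cube B) :
    prim b (fun y => T (f y)) x = T (prim b f x) := by
  unfold prim
  rw [T.intervalIntegral_comp_comm (intervalIntegrable_scaleAt b hf hx), map_smul]

theorem avg_clm (b : B) (T : G →L[ℝ] G') (hf : ContinuousOn f (cube B)) (hx : x ∈ cube B) :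
    avg b (fun y => T (f y)) x = T (avg b f x) :=
  T.intervalIntegral_comp_comm (intervalIntegrable_setAt b hf hx)

theorem interp_clm (b : B) (T : G →L[ℝ] G') (f : (B → ℝ) → G) (x : B → ℝ) :
    interp b (fun y => T (f y)) x = T (interp b f x) := by
  simp [interp]

theorem relPrim_clm (b : B) (T : G →L[ℝ] G') (hf : ContinuousOn f (cube B)) (hx : x ∈ cube B) :
    relPrim b (fun y => T (f y)) x = T (relPrim b f x) := by
  simp only [relPrim, map_sub, map_smul, prim_clm b T hf hx, avg_clm b T hf hx]

/-- The derivative of `f` on the cube, in the directions other than `b`. -/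
noncomputable def derivOff (b : B) (f : (B → ℝ) → G) (y : B → ℝ) : (B → ℝ) →L[ℝ] G :=
  (fderivWithin ℝ f (cube B) y).comp (scaleAt b 0)

theorem continuousOn_fderiv_cube (hf : ContDiffOn ℝ ((⊤ : ℕ∞) : WithTop ℕ∞) f (cube B)) :
    ContinuousOn (fderivWithin ℝ f (cube B)) (cube B) :=
  hf.continuousOn_fderivWithin uniqueDiffOn_cube (by simp)

theorem continuousOn_derivOff (b : B) (hf : ContDiffOn ℝ ((⊤ : ℕ∞) : WithTop ℕ∞) f (cube B)) :
    ContinuousOn (derivOff b f) (cube B) :=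
  (continuousOn_fderiv_cube hf).clm_comp continuousOn_const

theorem hasFDerivWithinAt_cube (hf : ContDiffOn ℝ ((⊤ : ℕ∞) : WithTop ℕ∞) f (cube B))
    (hx : x ∈ cube B) : HasFDerivWithinAt f (fderivWithin ℝ f (cube B) x) (cube B) x :=
  (hf.differentiableOn (by simp) x hx).hasFDerivWithinAt

theorem hasDerivWithinAt_scaleAt (b : B) (hf : ContDiffOn ℝ ((⊤ : ℕ∞) : WithTop ℕ∞) f (cube B))
    (hx : x ∈ cube B) {u : ℝ} (hu : u ∈ Icc (0:ℝ) 1) :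
    HasDerivWithinAt (fun u => f (scaleAt b u x))
      (x b • fderivWithin ℝ f (cube B) (scaleAt b u x) (unitVec b)) (Icc 0 1) u := by
  have h1 : HasDerivWithinAt (fun u => scaleAt b u x) (x b • unitVec b) (Icc 0 1) u := by
    have e : (fun u => scaleAt b u x) = fun u => scaleAt b 0 x + (u * x b) • unitVec b :=
      funext fun u => scaleAt_eq b u x
    rw [e]
    have := ((hasDerivAt_id u).mul_const (x b)).smul_const (unitVec b : B → ℝ)
    simpa using (this.const_add (scaleAt b 0 x)).hasDerivWithinAt
  have := (hasFDerivWithinAt_cube hf (scaleAt_mem_cube b hu hx)).comp_hasDerivWithinAt u h1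
    (fun u hu => scaleAt_mem_cube b hu hx)
  rw [map_smul] at this
  exact this

theorem hasDerivWithinAt_setAt (b : B) (hf : ContDiffOn ℝ ((⊤ : ℕ∞) : WithTop ℕ∞) f (cube B))
    (hx : x ∈ cube B) {u : ℝ} (hu : u ∈ Icc (0:ℝ) 1) :
    HasDerivWithinAt (fun u => f (setAt b u x))
      (fderivWithin ℝ f (cube B) (setAt b u x) (unitVec b)) (Icc 0 1) u := by
  have h1 : HasDerivWithinAt (fun u => setAt b u x) (unitVec b) (Icc 0 1) u := by
    unfold setAt
    have := (hasDerivAt_id u).smul_const (unitVec b : B → ℝ)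
    simpa using (this.const_add (scaleAt b 0 x)).hasDerivWithinAt
  exact (hasFDerivWithinAt_cube hf (setAt_mem_cube b hu hx)).comp_hasDerivWithinAt u h1
    (fun u hu => setAt_mem_cube b hu hx)

theorem continuousOn_dir (b : B) (hf : ContDiffOn ℝ ((⊤ : ℕ∞) : WithTop ℕ∞) f (cube B)) :
    ContinuousOn (fun y => fderivWithin ℝ f (cube B) y (unitVec b)) (cube B) :=
  (continuousOn_fderiv_cube hf).clm_apply continuousOn_const

theorem integral_eq_sub_of_hasDerivWithinAt_unitInterval {h h' : ℝ → G}
    (hd : ∀ u ∈ Icc (0:ℝ) 1, HasDerivWithinAt h (h' u) (Icc 0 1) u)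
    (hi : IntervalIntegrable h' volume 0 1) : ∫ u in (0:ℝ)..1, h' u = h 1 - h 0 := by
  refine intervalIntegral.integral_eq_sub_of_hasDerivAt_of_le zero_le_one
    (fun u hu => (hd u hu).continuousWithinAt) (fun u hu => ?_) hi
  exact (hd u ⟨hu.1.le, hu.2.le⟩).hasDerivAt (Icc_mem_nhds hu.1 hu.2)

/-- By the fundamental theorem of calculus the primitive of `∂_b f` is `f` minus its value at `x_b =
0`, and the average is the difference of the two end values. Subtracting `x_b` times the latter
replaces the end value by the interpolation. -/
theorem relPrim_deriv (b : B) (hf : ContDiffOn ℝ ((⊤ : ℕ∞) : WithTop ℕ∞) f (cube B))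
    (hx : x ∈ cube B) :
    relPrim b (fun y => fderivWithin ℝ f (cube B) y (unitVec b)) x = f x - interp b f x := by
  have h1 : prim b (fun y => fderivWithin ℝ f (cube B) y (unitVec b)) x =
      f x - f (setAt b 0 x) := by
    unfold prim
    rw [← intervalIntegral.integral_smul, integral_eq_sub_of_hasDerivWithinAt_unitInterval
      (fun u hu => hasDerivWithinAt_scaleAt b hf hx hu)
      ((intervalIntegrable_scaleAt b (continuousOn_dir b hf) hx).smul _)]
    rw [scaleAt_one, scaleAt_eq_setAt, zero_mul]
  have h2 : avg b (fun y => fderivWithin ℝ f (cube B) y (unitVec b)) x =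
      f (setAt b 1 x) - f (setAt b 0 x) :=
    integral_eq_sub_of_hasDerivWithinAt_unitInterval
      (fun u hu => hasDerivWithinAt_setAt b hf hx hu)
      (intervalIntegrable_setAt b (continuousOn_dir b hf) hx)
  rw [relPrim, h1, h2, interp]
  module

theorem hasFDerivWithinAt_avg (b : B) (hf : ContDiffOn ℝ ((⊤ : ℕ∞) : WithTop ℕ∞) f (cube B))
    (hx : x ∈ cube B) :
    HasFDerivWithinAt (avg b f) (avg b (derivOff b f) x) (cube B) x := by
  refine hasFDerivWithinAt_parametric_integral (F := fun p => f (setAt b p.2 p.1))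
    (F' := fun p => derivOff b f (setAt b p.2 p.1)) convex_cube
    (contDiffOn_zero.1 (contDiffOn_comp_setAt b (contDiffOn_zero.2 hf.continuousOn)))
    (contDiffOn_zero.1 (contDiffOn_comp_setAt b (contDiffOn_zero.2 (continuousOn_derivOff b hf))))
    (fun x hx u hu => ?_) hx
  refine (hasFDerivWithinAt_cube hf (setAt_mem_cube b hu hx)).comp x ?_
    (fun y hy => setAt_mem_cube b hu hy)
  exact ((scaleAt b 0).hasFDerivAt.add_const _).hasFDerivWithinAt

/-- The direction `b` returns `f`; the other directions are differentiated under the integral. Since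
the primitive is written over the fixed interval `[0,1]`, the direction `b` also moves the
integrand, and `key` below collects these contributions. -/
theorem hasFDerivWithinAt_prim (b : B) (hf : ContDiffOn ℝ ((⊤ : ℕ∞) : WithTop ℕ∞) f (cube B))
    (hx : x ∈ cube B) :
    HasFDerivWithinAt (prim b f)
      ((ContinuousLinearMap.proj (R := ℝ) (φ := fun _ : B => ℝ) b).smulRight (f x) +
        prim b (derivOff b f) x) (cube B) x := by
  set pb := ContinuousLinearMap.proj (R := ℝ) (φ := fun _ : B => ℝ) b with hpb
  let F' : (B → ℝ) × ℝ → (B → ℝ) →L[ℝ] G := fun p =>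
    (fderivWithin ℝ f (cube B) (scaleAt b p.2 p.1)).comp (scaleAt b p.2)
  have hF' : ContinuousOn F' (cube B ×ˢ Icc (0:ℝ) 1) := by
    refine (contDiffOn_zero.1 (contDiffOn_comp_scaleAt b
      (contDiffOn_zero.2 (continuousOn_fderiv_cube hf)))).clm_comp ?_
    unfold scaleAt
    fun_prop
  have h1 : HasFDerivWithinAt (fun x => ∫ u in (0:ℝ)..1, f (scaleAt b u x))
      (∫ u in (0:ℝ)..1, F' (x, u)) (cube B) x := by
    refine hasFDerivWithinAt_parametric_integral (F := fun p => f (scaleAt b p.2 p.1))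
      convex_cube
      (contDiffOn_zero.1 (contDiffOn_comp_scaleAt b (contDiffOn_zero.2 hf.continuousOn)))
      hF' (fun x hx u hu => ?_) hx
    exact (hasFDerivWithinAt_cube hf (scaleAt_mem_cube b hu hx)).comp x
      (scaleAt b u).hasFDerivAt.hasFDerivWithinAt (fun y hy => scaleAt_mem_cube b hu hy)
  have h2 := (pb.hasFDerivAt (x := x)).hasFDerivWithinAt (s := cube B).smul h1
  refine h2.congr_fderiv ?_
  have iF := intervalIntegrable_slice hF' hx
  have i1 := intervalIntegrable_scaleAt b hf.continuousOn hx
  have i2 := intervalIntegrable_scaleAt b (continuousOn_derivOff b hf) hx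
  ext v
  have e1 : (∫ u in (0:ℝ)..1, F' (x, u)) v = ∫ u in (0:ℝ)..1, F' (x, u) v :=
    ContinuousLinearMap.intervalIntegral_apply iF v
  have e2 : (∫ u in (0:ℝ)..1, derivOff b f (scaleAt b u x)) v =
      ∫ u in (0:ℝ)..1, derivOff b f (scaleAt b u x) v :=
    ContinuousLinearMap.intervalIntegral_apply i2 v
  -- The integrand is the derivative of `u • f (scaleAt b u x)`, which is `0` at `u = 0` and `f x`
  -- at `u = 1`.
  have key : ∫ u in (0:ℝ)..1, (f (scaleAt b u x) + u • x b •
      fderivWithin ℝ f (cube B) (scaleAt b u x) (unitVec b)) = f x := by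
    rw [integral_eq_sub_of_hasDerivWithinAt_unitInterval (h := fun u => u • f (scaleAt b u x))]
    · simp [scaleAt_one]
    · intro u hu
      have := (hasDerivWithinAt_id u (Icc (0:ℝ) 1)).smul (hasDerivWithinAt_scaleAt b hf hx hu)
      refine this.congr_deriv ?_
      simp [add_comm]
    · refine i1.add ?_
      refine IntervalIntegrable.continuousOn_smul ?_ continuousOn_id
      exact (intervalIntegrable_scaleAt b (continuousOn_dir b hf) hx).smul _
  have e3 : ∀ u, F' (x, u) v = derivOff b f (scaleAt b u x) v +
      (u * v b) • fderivWithin ℝ f (cube B) (scaleAt b u x) (unitVec b) := fun u => by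
    simp only [F', derivOff, ContinuousLinearMap.comp_apply]
    rw [scaleAt_eq b u v, map_add, map_smul]
  have i3 : IntervalIntegrable (fun u => derivOff b f (scaleAt b u x) v) volume 0 1 :=
    intervalIntegrable_scaleAt (f := fun y => derivOff b f y v) b
      ((continuousOn_derivOff b hf).clm_apply continuousOn_const) hx
  have i4 : IntervalIntegrable (fun u => u • x b •
      fderivWithin ℝ f (cube B) (scaleAt b u x) (unitVec b)) volume 0 1 :=
    IntervalIntegrable.continuousOn_smul
      ((intervalIntegrable_scaleAt b (continuousOn_dir b hf) hx).smul _) continuousOn_id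
  have i5 : IntervalIntegrable (fun u => (u * v b) •
      fderivWithin ℝ f (cube B) (scaleAt b u x) (unitVec b)) volume 0 1 :=
    IntervalIntegrable.continuousOn_smul
      (intervalIntegrable_scaleAt b (continuousOn_dir b hf) hx) (by fun_prop)
  rw [intervalIntegral.integral_add i1 i4] at key
  simp only [add_apply, smul_apply,
    ContinuousLinearMap.smulRight_apply, prim, e1, e2, e3]
  rw [intervalIntegral.integral_add i3 i5, ← key]
  have e4 : x b • ∫ u in (0:ℝ)..1, (u * v b) •
      fderivWithin ℝ f (cube B) (scaleAt b u x) (unitVec b) =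
      v b • ∫ u in (0:ℝ)..1, u • x b •
        fderivWithin ℝ f (cube B) (scaleAt b u x) (unitVec b) := by
    rw [← intervalIntegral.integral_smul, ← intervalIntegral.integral_smul]
    congr 1
    funext u
    simp only [smul_smul]
    congr 1
    ring
  have p1 : ∀ y, pb y = y b := fun _ => rfl
  rw [p1, p1, smul_add, smul_add, e4]
  abel

theorem hasFDerivWithinAt_relPrim (b : B) (hf : ContDiffOn ℝ ((⊤ : ℕ∞) : WithTop ℕ∞) f (cube B))
    (hx : x ∈ cube B) :
    HasFDerivWithinAt (relPrim b f)
      ((ContinuousLinearMap.proj (R := ℝ) (φ := fun _ : B => ℝ) b).smulRight (f x - avg b f x) +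
        relPrim b (derivOff b f) x) (cube B) x := by
  have h1 := ((ContinuousLinearMap.proj (R := ℝ) (φ := fun _ : B => ℝ) b).hasFDerivAt
    (x := x)).hasFDerivWithinAt (s := cube B).smul (hasFDerivWithinAt_avg b hf hx)
  refine ((hasFDerivWithinAt_prim b hf hx).sub h1).congr_fderiv ?_
  ext v
  simp only [relPrim, add_apply, sub_apply,
    smul_apply, ContinuousLinearMap.smulRight_apply, smul_sub,
    ContinuousLinearMap.proj_apply]
  abel

/-- At `x_b = 1` the primitive is the average. This vanishing on both faces makes the homotopy
operators compatible with restriction to faces. -/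
theorem relPrim_of_boundary (b : B) (f : (B → ℝ) → G) (hx : x b = 0 ∨ x b = 1) :
    relPrim b f x = 0 := by
  rcases hx with h | h
  · simp [relPrim, prim, h]
  · simp only [relPrim, prim, avg, h, one_smul, scaleAt_eq_setAt, mul_one, sub_self]

end CoordinateOperators
end OrbiCell

namespace OrbiCell

/-! ### Interior products and the part of an alternating form free of a given direction. -/

section AlternatingAlgebra

variable {B B' : Type} [Fintype B] [Fintype B'] {k : ℕ}

/-- The interior product of an alternating form with the unit vector in the direction `b`. -/
noncomputable def iota (b : B) :
    ((B → ℝ) [⋀^Fin (k + 1)]→L[ℝ] ℝ) →L[ℝ] ((B → ℝ) [⋀^Fin k]→L[ℝ] ℝ) :=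
  (ContinuousLinearMap.apply ℝ _ (unitVec b)).comp
    (ContinuousAlternatingMap.curryLeftLI (𝕜 := ℝ) (E := B → ℝ) (F := ℝ) (n := k)).toContinuousLinearMap

theorem iota_apply (b : B) (α : (B → ℝ) [⋀^Fin (k + 1)]→L[ℝ] ℝ) (v : Fin k → B → ℝ) :
    iota b α v = α (Matrix.vecCons (unitVec b) v) := rfl

/-- The part of an alternating form that does not involve the direction `b`. -/
noncomputable def freePart (b : B) :
    ((B → ℝ) [⋀^Fin k]→L[ℝ] ℝ) →L[ℝ] ((B → ℝ) [⋀^Fin k]→L[ℝ] ℝ) :=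
  ContinuousAlternatingMap.compContinuousLinearMapCLM (scaleAt b 0)

theorem freePart_apply (b : B) (α : (B → ℝ) [⋀^Fin k]→L[ℝ] ℝ) (v : Fin k → B → ℝ) :
    freePart b α v = α fun i => scaleAt b 0 (v i) := rfl

theorem scaleAt_zero_unitVec_self (b : B) : scaleAt b 0 (unitVec b) = 0 := by
  funext c
  by_cases h : c = b
  · subst h; simp [scaleAt_self]
  · simp [scaleAt_ne h, unitVec_ne h]

theorem scaleAt_zero_unitVec_ne {b c : B} (h : c ≠ b) : scaleAt b 0 (unitVec c) = unitVec c := by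
  funext a
  by_cases ha : a = b
  · subst ha; simp [scaleAt_self, unitVec_ne h.symm]
  · simp [scaleAt_ne ha]

/-- Alternating forms agree if they agree on tuples of distinct unit vectors. -/
theorem ext_unitVec {α β : (B → ℝ) [⋀^Fin k]→L[ℝ] ℝ}
    (h : ∀ s : Fin k → B, Function.Injective s → α (fun i => unitVec (s i)) = β fun i => unitVec (s i)) :
    α = β := by
  classical
  refine ContinuousAlternatingMap.toAlternatingMap_injective
    (Module.Basis.ext_alternating (Pi.basisFun ℝ B) fun s hs => ?_)
  have e : (fun i => (Pi.basisFun ℝ B) (s i)) = fun i => (unitVec (s i) : B → ℝ) := by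
    funext i
    rw [Pi.basisFun_apply, unitVec]
  rw [e]
  exact h s hs

theorem vecCons_removeNth (α : (B → ℝ) [⋀^Fin (k + 1)]→L[ℝ] ℝ) (v : Fin (k + 1) → B → ℝ)
    (i : Fin (k + 1)) : (-1 : ℝ) ^ (i : ℕ) * α (Matrix.vecCons (v i) (i.removeNth v)) = α v := by
  have := AlternatingMap.map_insertNth α.toAlternatingMap i (v i) (i.removeNth v)
  rw [Fin.insertNth_self_removeNth] at this
  simpa [zsmul_eq_mul] using this.symm

/-- The projection to the coordinate `b`. -/
noncomputable abbrev coordProj (b : B) : (B → ℝ) →L[ℝ] ℝ :=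
  ContinuousLinearMap.proj (R := ℝ) (φ := fun _ : B => ℝ) b

/-- The left side is `dx_b ∧ ι_b α`, the part of `α` involving `dx_b`. On distinct unit vectors at
most one summand survives: the one at the position of `b`. -/
theorem alternatize_coordProj_iota (b : B) (α : (B → ℝ) [⋀^Fin (k + 1)]→L[ℝ] ℝ) :
    ContinuousAlternatingMap.alternatizeUncurryFin ((coordProj b).smulRight (iota b α)) =
      α - freePart b α := by
  refine ext_unitVec fun s hs => ?_
  rw [ContinuousAlternatingMap.alternatizeUncurryFin_apply, ContinuousAlternatingMap.sub_apply]
  simp only [ContinuousLinearMap.smulRight_apply, ContinuousLinearMap.proj_apply,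
    ContinuousAlternatingMap.smul_apply, iota_apply, freePart_apply, zsmul_eq_mul, smul_eq_mul]
  by_cases hb : ∃ i, s i = b
  · obtain ⟨i, rfl⟩ := hb
    rw [Finset.sum_eq_single i]
    · rw [unitVec_self, one_mul]
      have := vecCons_removeNth α (fun i => unitVec (s i)) i
      rw [α.map_coord_zero (m := fun j => scaleAt (s i) 0 (unitVec (s j))) i
        (scaleAt_zero_unitVec_self _), sub_zero, ← this]
      push_cast
      ring
    · intro j _ hj
      rw [unitVec_ne (fun e => hj (hs e.symm))]
      ring
    · simp
  · push Not at hb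
    simp only [fun j => scaleAt_zero_unitVec_ne (hb j)]
    rw [sub_self]
    refine Finset.sum_eq_zero fun j _ => ?_
    rw [unitVec_ne (hb j).symm]
    ring

/-- With `T` the derivative of a form this is Cartan's formula `ι_b d = ∂_b - d ι_b`. The first
summand of the alternatization puts `e_b` into `T`; the others leave `e_b` in the form and have
their signs shifted by one. -/
theorem iota_alternatize (b : B) (T : (B → ℝ) →L[ℝ] (B → ℝ) [⋀^Fin (k + 1)]→L[ℝ] ℝ) :
    iota b (ContinuousAlternatingMap.alternatizeUncurryFin T) =
      T (unitVec b) - ContinuousAlternatingMap.alternatizeUncurryFin ((iota b).comp T) := by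
  ext v
  rw [iota_apply, ContinuousAlternatingMap.alternatizeUncurryFin_apply, Fin.sum_univ_succ,
    ContinuousAlternatingMap.sub_apply, ContinuousAlternatingMap.alternatizeUncurryFin_apply]
  simp only [Fin.val_zero, pow_zero, one_smul, Matrix.cons_val_zero, Fin.removeNth_zero,
    Fin.val_succ, Matrix.cons_val_succ, sub_eq_add_neg, ← Finset.sum_neg_distrib]
  congr 1
  refine Finset.sum_congr rfl fun i _ => ?_
  rw [pow_succ, mul_neg_one, neg_smul]
  congr 2
  rw [ContinuousLinearMap.comp_apply, iota_apply]
  congr 1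
  funext j
  refine Fin.cases ?_ (fun j => ?_) j
  · simp [Fin.removeNth]
  · simp [Fin.removeNth]

theorem iota_alternatize_zero (b : B) (T : (B → ℝ) →L[ℝ] (B → ℝ) [⋀^Fin 0]→L[ℝ] ℝ) :
    iota b (ContinuousAlternatingMap.alternatizeUncurryFin T) = T (unitVec b) := by
  refine ContinuousAlternatingMap.ext fun v => (iota_apply _ _ _).trans
    ((ContinuousAlternatingMap.alternatizeUncurryFin_apply _ _).trans
      ((Fin.sum_univ_one _).trans ?_))
  simp only [Fin.val_zero, pow_zero, one_smul, Matrix.cons_val_zero]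
  congr 1

theorem freePart_zero_form (b : B) (α : (B → ℝ) [⋀^Fin 0]→L[ℝ] ℝ) : freePart b α = α := by
  ext v
  rw [freePart_apply]
  congr 1
  exact Subsingleton.elim _ _

theorem scaleAt_zero_zero (b : B) (x : B → ℝ) : scaleAt b 0 (scaleAt b 0 x) = scaleAt b 0 x := by
  simp only [scaleAt_eq_setAt, zero_mul, setAt_setAt]

theorem freePart_freePart (b : B) (α : (B → ℝ) [⋀^Fin k]→L[ℝ] ℝ) :
    freePart b (freePart b α) = freePart b α := by
  ext v
  simp only [freePart_apply, scaleAt_zero_zero]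

theorem freePart_comm (b c : B) (α : (B → ℝ) [⋀^Fin k]→L[ℝ] ℝ) :
    freePart b (freePart c α) = freePart c (freePart b α) := by
  ext v
  simp only [freePart_apply]
  congr 1
  funext i
  by_cases h : b = c
  · rw [h]
  · simp only [scaleAt_eq_setAt, zero_mul]
    exact setAt_comm (Ne.symm h) _ _ _

theorem iota_compContinuousLinearMap {L : (B' → ℝ) →L[ℝ] (B → ℝ)} {b : B} {b' : B'}
    (h : L (unitVec b') = unitVec b) (α : (B → ℝ) [⋀^Fin (k + 1)]→L[ℝ] ℝ) :
    iota b' (α.compContinuousLinearMap L) = (iota b α).compContinuousLinearMap L := by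
  ext v
  rw [iota_apply, ContinuousAlternatingMap.compContinuousLinearMap_apply,
    ContinuousAlternatingMap.compContinuousLinearMap_apply, iota_apply]
  congr 1
  funext j
  refine Fin.cases ?_ (fun j => ?_) j
  · simp [h]
  · simp

end AlternatingAlgebra

end OrbiCell

namespace OrbiCell

theorem one_sub_mul_one_sub_comm {R : Type} [Ring R] {x y : R} (h : Commute x y) :
    (1 - x) * (1 - y) = (1 - y) * (1 - x) :=
  ((Commute.one_left _).sub_left ((Commute.one_right _).sub_right h)).eq

/-! ### The commuting projections `P_b` on the forms of a cube. -/

section CubeOperators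

open Set MeasureTheory

variable {B B' : Type} [Fintype B] [Fintype B'] {k : ℕ} {G G' : Type} [NormedAddCommGroup G]
  [NormedSpace ℝ G] [CompleteSpace G] [NormedAddCommGroup G'] [NormedSpace ℝ G'] [CompleteSpace G']

open Classical in
/-- Cut a function off outside the cube. -/
noncomputable def onCube (f : (B → ℝ) → G) (x : B → ℝ) : G := if x ∈ cube B then f x else 0

theorem onCube_of_mem (f : (B → ℝ) → G) {x : B → ℝ} (hx : x ∈ cube B) : onCube f x = f x :=
  if_pos hx

theorem onCube_of_notMem (f : (B → ℝ) → G) {x : B → ℝ} (hx : x ∉ cube B) : onCube f x = 0 :=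
  if_neg hx

theorem IsFormOn.contDiffOn {ω : FormField B k} (h : IsFormOn ∅ ω) :
    ContDiffOn ℝ ((⊤ : ℕ∞) : WithTop ℕ∞) ω (cube B) :=
  fun x hx => h.smooth x (by rwa [box_empty])

theorem isFormOn_onCube {ω : FormField B k}
    (h : ContDiffOn ℝ ((⊤ : ℕ∞) : WithTop ℕ∞) ω (cube B)) : IsFormOn ∅ (onCube ω) where
  smooth x hx := by
    rw [box_empty] at hx
    exact (h.congr fun y hy => onCube_of_mem ω hy) x hx
  zero_off x hx := onCube_of_notMem _ (by rwa [box_empty] at hx)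

theorem avg_congr (b : B) {f f' : (B → ℝ) → G} (h : ∀ y ∈ cube B, f y = f' y) {x : B → ℝ}
    (hx : x ∈ cube B) : avg b f x = avg b f' x :=
  intervalIntegral.integral_congr fun u hu => h _ (setAt_mem_cube b
    (by rwa [uIcc_of_le zero_le_one] at hu) hx)

theorem prim_congr (b : B) {f f' : (B → ℝ) → G} (h : ∀ y ∈ cube B, f y = f' y) {x : B → ℝ}
    (hx : x ∈ cube B) : prim b f x = prim b f' x := by
  unfold prim
  congr 1
  exact intervalIntegral.integral_congr fun u hu => h _ (scaleAt_mem_cube b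
    (by rwa [uIcc_of_le zero_le_one] at hu) hx)

theorem interp_congr (b : B) {f f' : (B → ℝ) → G} (h : ∀ y ∈ cube B, f y = f' y) {x : B → ℝ}
    (hx : x ∈ cube B) : interp b f x = interp b f' x := by
  rw [interp, interp, h _ (setAt_mem_cube b (by simp) hx), h _ (setAt_mem_cube b (by simp) hx)]

theorem relPrim_congr (b : B) {f f' : (B → ℝ) → G} (h : ∀ y ∈ cube B, f y = f' y) {x : B → ℝ}
    (hx : x ∈ cube B) : relPrim b f x = relPrim b f' x := by
  rw [relPrim, relPrim, prim_congr b h hx, avg_congr b h hx]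

theorem avg_add (b : B) {f f' : (B → ℝ) → G} (h : ContinuousOn f (cube B))
    (h' : ContinuousOn f' (cube B)) {x : B → ℝ} (hx : x ∈ cube B) :
    avg b (f + f') x = avg b f x + avg b f' x :=
  intervalIntegral.integral_add (intervalIntegrable_setAt b h hx) (intervalIntegrable_setAt b h' hx)

theorem avg_smul (b : B) (r : ℝ) (f : (B → ℝ) → G) (x : B → ℝ) :
    avg b (r • f) x = r • avg b f x :=
  intervalIntegral.integral_smul _ _

theorem prim_add (b : B) {f f' : (B → ℝ) → G} (h : ContinuousOn f (cube B))
    (h' : ContinuousOn f' (cube B)) {x : B → ℝ} (hx : x ∈ cube B) :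
    prim b (f + f') x = prim b f x + prim b f' x := by
  unfold prim
  rw [← smul_add, ← intervalIntegral.integral_add (intervalIntegrable_scaleAt b h hx)
    (intervalIntegrable_scaleAt b h' hx)]
  rfl

theorem prim_smul (b : B) (r : ℝ) (f : (B → ℝ) → G) (x : B → ℝ) :
    prim b (r • f) x = r • prim b f x := by
  simp only [prim, Pi.smul_apply]
  rw [intervalIntegral.integral_smul, smul_comm]

theorem relPrim_add (b : B) {f f' : (B → ℝ) → G} (h : ContinuousOn f (cube B))
    (h' : ContinuousOn f' (cube B)) {x : B → ℝ} (hx : x ∈ cube B) :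
    relPrim b (f + f') x = relPrim b f x + relPrim b f' x := by
  rw [relPrim, prim_add b h h' hx, avg_add b h h' hx, relPrim, relPrim]
  module

theorem relPrim_smul (b : B) (r : ℝ) (f : (B → ℝ) → G) (x : B → ℝ) :
    relPrim b (r • f) x = r • relPrim b f x := by
  rw [relPrim, prim_smul, avg_smul, relPrim]
  module

theorem avg_setAt (b : B) (s : ℝ) (f : (B → ℝ) → G) (x : B → ℝ) :
    avg b f (setAt b s x) = avg b f x := by
  simp only [avg, setAt_setAt]

theorem avg_avg_self (b : B) (f : (B → ℝ) → G) (x : B → ℝ) :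
    avg b (avg b f) x = avg b f x := by
  rw [avg]
  simp only [avg_setAt]
  simp

theorem interp_setAt (b : B) (s : ℝ) (f : (B → ℝ) → G) (x : B → ℝ) :
    interp b f (setAt b s x) = (1 - s) • f (setAt b 0 x) + s • f (setAt b 1 x) := by
  simp only [interp, setAt_setAt, setAt_self]

theorem interp_interp_self (b : B) (f : (B → ℝ) → G) (x : B → ℝ) :
    interp b (interp b f) x = interp b f x := by
  rw [interp, interp_setAt, interp_setAt]
  simp [interp]

theorem interp_comm {b c : B} (h : b ≠ c) (f : (B → ℝ) → G) (x : B → ℝ) :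
    interp b (interp c f) x = interp c (interp b f) x := by
  simp only [interp, setAt_ne h, setAt_ne h.symm, setAt_comm h]
  module

theorem avg_interp_comm {b c : B} (h : b ≠ c) {f : (B → ℝ) → G} (hf : ContinuousOn f (cube B))
    {x : B → ℝ} (hx : x ∈ cube B) : avg b (interp c f) x = interp c (avg b f) x := by
  have i : ∀ s ∈ Icc (0:ℝ) 1, IntervalIntegrable (fun u => f (setAt b u (setAt c s x))) volume 0 1 :=
    fun s hs => intervalIntegrable_setAt b hf (setAt_mem_cube c hs hx)
  simp only [avg, interp, setAt_ne h.symm]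
  simp only [fun u s => setAt_comm h.symm s u x]
  have i0 : IntervalIntegrable (fun u => (1 - x c) • f (setAt b u (setAt c 0 x))) volume 0 1 :=
    (i 0 (by simp)).smul _
  have i1 : IntervalIntegrable (fun u => x c • f (setAt b u (setAt c 1 x))) volume 0 1 :=
    (i 1 (by simp)).smul _
  rw [intervalIntegral.integral_add i0 i1,
    intervalIntegral.integral_smul, intervalIntegral.integral_smul]

/-- Fubini on the unit square; continuity on the cube gives integrability. -/
theorem avg_comm {b c : B} (h : b ≠ c) {f : (B → ℝ) → G} (hf : ContinuousOn f (cube B))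
    {x : B → ℝ} (hx : x ∈ cube B) : avg b (avg c f) x = avg c (avg b f) x := by
  simp only [avg]
  rw [intervalIntegral.integral_of_le zero_le_one, intervalIntegral.integral_of_le zero_le_one]
  simp only [intervalIntegral.integral_of_le zero_le_one]
  rw [integral_integral_swap]
  · simp only [fun u s => setAt_comm h.symm s u x]
  · rw [Measure.prod_restrict]
    have hc : ContinuousOn (fun p : ℝ × ℝ => f (setAt c p.2 (setAt b p.1 x)))
        (Icc (0:ℝ) 1 ×ˢ Icc (0:ℝ) 1) := by
      refine hf.comp (Continuous.continuousOn ?_) fun p hp =>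
        setAt_mem_cube c hp.2 (setAt_mem_cube b hp.1 hx)
      exact (contDiff_setAt c (n := 0)).continuous.comp
        (((contDiff_setAt b (n := 0)).continuous.comp (by fun_prop :
          Continuous fun p : ℝ × ℝ => (x, p.1))).prodMk continuous_snd)
    exact (hc.integrableOn_compact (isCompact_Icc.prod isCompact_Icc)).mono_set
      (prod_mono Ioc_subset_Icc_self Ioc_subset_Icc_self)

theorem interp_add (b : B) (f f' : (B → ℝ) → G) (x : B → ℝ) :
    interp b (f + f') x = interp b f x + interp b f' x := by
  simp only [interp, Pi.add_apply]
  module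

theorem interp_smul (b : B) (r : ℝ) (f : (B → ℝ) → G) (x : B → ℝ) :
    interp b (r • f) x = r • interp b f x := by
  simp only [interp, Pi.smul_apply]
  module

theorem contDiffOn_interp (b : B) {f : (B → ℝ) → G}
    (hf : ContDiffOn ℝ ((⊤ : ℕ∞) : WithTop ℕ∞) f (cube B)) :
    ContDiffOn ℝ ((⊤ : ℕ∞) : WithTop ℕ∞) (interp b f) (cube B) := by
  have h : ∀ s ∈ Icc (0:ℝ) 1, ContDiffOn ℝ ((⊤ : ℕ∞) : WithTop ℕ∞) (fun x => f (setAt b s x)) (cube B) :=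
    fun s hs => hf.comp ((contDiff_setAt b).comp (by fun_prop : ContDiff ℝ _ fun x : B → ℝ => (x, s))
      |>.contDiffOn) fun x hx => setAt_mem_cube b hs hx
  exact ((by fun_prop : ContDiff ℝ _ fun x : B → ℝ => 1 - x b).contDiffOn.smul (h 0 (by simp))).add
    ((contDiff_apply ℝ ℝ b).contDiffOn.smul (h 1 (by simp)))

/-- Smooth `k`-forms on the cube. -/
def cubeForms (B : Type) [Fintype B] (k : ℕ) : Submodule ℝ (FormField B k) where
  carrier := {ω | IsFormOn ∅ ω}
  zero_mem' := .zero
  add_mem' h h' := h.add h'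
  smul_mem' r _ h := h.smul r

local instance (S : Submodule ℝ (FormField B k)) : AddCommGroup S := Submodule.addCommGroup S

theorem cubeForms_ext {ω η : cubeForms B k} (h : ∀ x ∈ cube B, ω.1 x = η.1 x) : ω = η := by
  refine Subtype.ext (funext fun x => ?_)
  by_cases hx : x ∈ cube B
  · exact h x hx
  · rw [ω.2.zero_off x (by rwa [box_empty]), η.2.zero_off x (by rwa [box_empty])]

/-- Averaging forms in the direction `b`. -/
noncomputable def avgOp (b : B) : Module.End ℝ (cubeForms B k) where
  toFun ω := ⟨onCube (avg b ω.1), isFormOn_onCube (contDiffOn_avg b ω.2.contDiffOn)⟩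
  map_add' ω η := cubeForms_ext fun x hx => by
    simpa only [Submodule.coe_add, onCube_of_mem _ hx, Pi.add_apply] using
      avg_add b ω.2.contDiffOn.continuousOn η.2.contDiffOn.continuousOn hx
  map_smul' r ω := cubeForms_ext fun x hx => by
    simpa only [Submodule.coe_smul, onCube_of_mem _ hx, Pi.smul_apply, RingHom.id_apply] using
      avg_smul b r ω.1 x

/-- Interpolating forms in the direction `b`. -/
noncomputable def interpOp (b : B) : Module.End ℝ (cubeForms B k) where
  toFun ω := ⟨onCube (interp b ω.1), isFormOn_onCube (contDiffOn_interp b ω.2.contDiffOn)⟩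
  map_add' ω η := cubeForms_ext fun x hx => by
    simpa only [Submodule.coe_add, onCube_of_mem _ hx, Pi.add_apply] using interp_add b ω.1 η.1 x
  map_smul' r ω := cubeForms_ext fun x hx => by
    simpa only [Submodule.coe_smul, onCube_of_mem _ hx, Pi.smul_apply, RingHom.id_apply] using
      interp_smul b r ω.1 x

theorem IsFormOn.clm_comp {A : Set ℝ} {l : ℕ} {ω : FormField B k} (h : IsFormOn A ω)
    (T : ((B → ℝ) [⋀^Fin k]→L[ℝ] ℝ) →L[ℝ] ((B → ℝ) [⋀^Fin l]→L[ℝ] ℝ)) :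
    IsFormOn A fun x => T (ω x) :=
  ⟨fun x hx => T.contDiff.contDiffAt.comp_contDiffWithinAt x (h.smooth x hx),
    fun x hx => by rw [h.zero_off x hx, map_zero]⟩

/-- The part of a form that does not involve `dx_b`. -/
noncomputable def freeOp (b : B) : Module.End ℝ (cubeForms B k) where
  toFun ω := ⟨fun x => freePart b (ω.1 x), ω.2.clm_comp _⟩
  map_add' ω η := Subtype.ext (funext fun x => map_add _ _ _)
  map_smul' r ω := Subtype.ext (funext fun x => map_smul (freePart b) r (ω.1 x))

theorem avgOp_apply (b : B) (ω : cubeForms B k) {x : B → ℝ} (hx : x ∈ cube B) :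
    (avgOp b ω).1 x = avg b ω.1 x := onCube_of_mem _ hx

theorem interpOp_apply (b : B) (ω : cubeForms B k) {x : B → ℝ} (hx : x ∈ cube B) :
    (interpOp b ω).1 x = interp b ω.1 x := onCube_of_mem _ hx

theorem freeOp_apply (b : B) (ω : cubeForms B k) (x : B → ℝ) :
    (freeOp b ω).1 x = freePart b (ω.1 x) := rfl

theorem continuousOn_cubeForm (ω : cubeForms B k) : ContinuousOn ω.1 (cube B) :=
  ω.2.contDiffOn.continuousOn

theorem avgOp_freeOp (b c : B) : Commute (avgOp b (k := k)) (freeOp c) :=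
  LinearMap.ext fun ω => cubeForms_ext fun x hx => by
    rw [Module.End.mul_apply, Module.End.mul_apply, avgOp_apply b _ hx, freeOp_apply,
      avgOp_apply b _ hx]
    exact avg_clm b (freePart c) (continuousOn_cubeForm ω) hx

theorem interpOp_freeOp (b c : B) : Commute (interpOp b (k := k)) (freeOp c) :=
  LinearMap.ext fun ω => cubeForms_ext fun x hx => by
    rw [Module.End.mul_apply, Module.End.mul_apply, interpOp_apply b _ hx, freeOp_apply,
      interpOp_apply b _ hx]
    exact interp_clm b (freePart c) ω.1 x

theorem freeOp_freeOp (b c : B) : Commute (freeOp b (k := k)) (freeOp c) :=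
  LinearMap.ext fun ω => cubeForms_ext fun x _ => freePart_comm b c (ω.1 x)

theorem freeOp_idem (b : B) : freeOp b (k := k) * freeOp b = freeOp b :=
  LinearMap.ext fun ω => cubeForms_ext fun x _ => freePart_freePart b (ω.1 x)

theorem avgOp_avgOp {b c : B} (h : b ≠ c) : Commute (avgOp b (k := k)) (avgOp c) :=
  LinearMap.ext fun ω => cubeForms_ext fun x hx => by
    rw [Module.End.mul_apply, Module.End.mul_apply, avgOp_apply b _ hx, avgOp_apply c _ hx,
      avg_congr b (fun y hy => avgOp_apply c ω hy) hx, avg_congr c (fun y hy => avgOp_apply b ω hy) hx]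
    exact avg_comm h (continuousOn_cubeForm ω) hx

theorem interpOp_interpOp {b c : B} (h : b ≠ c) : Commute (interpOp b (k := k)) (interpOp c) :=
  LinearMap.ext fun ω => cubeForms_ext fun x hx => by
    rw [Module.End.mul_apply, Module.End.mul_apply, interpOp_apply b _ hx, interpOp_apply c _ hx,
      interp_congr b (fun y hy => interpOp_apply c ω hy) hx,
      interp_congr c (fun y hy => interpOp_apply b ω hy) hx]
    exact interp_comm h ω.1 x

theorem avgOp_interpOp {b c : B} (h : b ≠ c) : Commute (avgOp b (k := k)) (interpOp c) :=
  LinearMap.ext fun ω => cubeForms_ext fun x hx => by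
    rw [Module.End.mul_apply, Module.End.mul_apply, avgOp_apply b _ hx, interpOp_apply c _ hx,
      avg_congr b (fun y hy => interpOp_apply c ω hy) hx,
      interp_congr c (fun y hy => avgOp_apply b ω hy) hx]
    exact avg_interp_comm h (continuousOn_cubeForm ω) hx

theorem avgOp_idem (b : B) : avgOp b (k := k) * avgOp b = avgOp b :=
  LinearMap.ext fun ω => cubeForms_ext fun x hx => by
    rw [Module.End.mul_apply, avgOp_apply b _ hx, avgOp_apply b _ hx,
      avg_congr b (fun y hy => avgOp_apply b ω hy) hx, avg_avg_self]

theorem interpOp_idem (b : B) : interpOp b (k := k) * interpOp b = interpOp b :=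
  LinearMap.ext fun ω => cubeForms_ext fun x hx => by
    rw [Module.End.mul_apply, interpOp_apply b _ hx, interpOp_apply b _ hx,
      interp_congr b (fun y hy => interpOp_apply b ω hy) hx, interp_interp_self]

/-- The projection of forms in the direction `b` to the forms that are affine in `x_b` with
coefficients without `dx_b`, or constant in `x_b` with coefficients with `dx_b`. -/
noncomputable def projOp (b : B) : Module.End ℝ (cubeForms B k) :=
  freeOp b * interpOp b + ((1 : Module.End ℝ (cubeForms B k)) - freeOp b) * avgOp b

/-- Averages and interpolations in different directions commute, and taking free parts commutes with
all of them, so the four products of summands commute separately. -/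
theorem projOp_comm {b c : B} (h : b ≠ c) : Commute (projOp b (k := k)) (projOp c) := by
  have key : ∀ X Y : Module.End ℝ (cubeForms B k), Commute X Y → (∀ a, Commute X (freeOp a)) →
      (∀ a, Commute Y (freeOp a)) → ∀ F F' : Module.End ℝ (cubeForms B k), Commute F F' →
      Commute X F' → Commute Y F → Commute (F * X) (F' * Y) := fun X Y hXY _ _ F F' hF h1 h2 =>
    ((hF.mul_right h2.symm).mul_left (h1.mul_right hXY))
  have o : ∀ {X Y : Module.End ℝ (cubeForms B k)}, Commute X Y →
      Commute X ((1 : Module.End ℝ (cubeForms B k)) - Y) := fun h =>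
    (Commute.one_right _).sub_right h
  have fi : ∀ a a' : B, Commute (interpOp a (k := k)) (freeOp a') := interpOp_freeOp
  have fa : ∀ a a' : B, Commute (avgOp a (k := k)) (freeOp a') := avgOp_freeOp
  have ff := freeOp_freeOp b c (k := k)
  have ff' := o ff
  have ff'' := (o ff.symm).symm
  have ff''' := o ff''
  unfold projOp
  refine Commute.add_left (Commute.add_right ?_ ?_) (Commute.add_right ?_ ?_)
  · exact key _ _ (interpOp_interpOp h) (fi b) (fi c) _ _ ff (fi _ _) (fi _ _)
  · exact key _ _ (avgOp_interpOp h.symm).symm (fi b) (fa c) _ _ ff' (o (fi _ _)) (fa _ _)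
  · exact key _ _ (avgOp_interpOp h) (fa b) (fi c) _ _ ff'' (fa _ _) (o (fi _ _))
  · exact key _ _ (avgOp_avgOp h) (fa b) (fa c) _ _ ff''' (o (fa _ _)) (o (fa _ _))

/-- The interpolation and the average in one direction need not commute, but their cross terms
contain `F (1 - F) = 0` for the free part `F`, which commutes with both. -/
theorem projOp_idem (b : B) : projOp b (k := k) * projOp b = projOp b := by
  have h1 := (interpOp_freeOp b b (k := k)).eq
  have h2 := (avgOp_freeOp b b (k := k)).eq
  have h3 := freeOp_idem b (k := k)
  have h4 := avgOp_idem b (k := k)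
  have h5 := interpOp_idem b (k := k)
  unfold projOp
  generalize freeOp b (k := k) = F at *
  generalize avgOp b (k := k) = X at *
  generalize interpOp b (k := k) = Y at *
  have e1 : F * Y * (F * Y) = F * Y := by
    rw [mul_assoc, ← mul_assoc Y F Y, h1, mul_assoc, h5, ← mul_assoc, h3]
  have e2 : F * X * (F * X) = F * X := by
    rw [mul_assoc, ← mul_assoc X F X, h2, mul_assoc, h4, ← mul_assoc, h3]
  have e3 : F * Y * (F * X) = F * Y * X := by
    rw [mul_assoc, ← mul_assoc Y F X, h1, mul_assoc, ← mul_assoc F F, h3]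
  have e4 : F * X * (F * Y) = F * X * Y := by
    rw [mul_assoc, ← mul_assoc X F Y, h2, mul_assoc, ← mul_assoc F F, h3]
  have e5 : X * (F * Y) = F * X * Y := by rw [← mul_assoc, h2]
  have e6 : X * (F * X) = F * X := by rw [← mul_assoc, h2, mul_assoc, h4]
  have e7 : F * X * X = F * X := by rw [mul_assoc, h4]
  simp only [sub_mul, one_mul, add_mul, mul_add, mul_sub, e1, e2, e3, e4, e5, e6, e7, h4]
  abel

/-- The projection complementary to `projOp`. -/
noncomputable def complOp (b : B) : Module.End ℝ (cubeForms B k) :=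
  (1 : Module.End ℝ (cubeForms B k)) - projOp b

theorem complOp_apply (b : B) (ω : cubeForms B k) : complOp b ω = ω - projOp b ω := rfl

theorem complOp_idem (b : B) : complOp b (k := k) * complOp b = complOp b :=
  IsIdempotentElem.one_sub (projOp_idem b)

theorem complOp_comm (b c : B) : complOp b (k := k) * complOp c = complOp c * complOp b := by
  by_cases h : b = c
  · rw [h]
  · exact one_sub_mul_one_sub_comm (projOp_comm h)

end CubeOperators

/-! ### Polynomials annihilating sums of commuting idempotents. -/

section IdempotentAlgebra

/-- A sum of `r` commuting idempotents has spectrum in `{0, …, r}`. In the induction the product is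
split by `1 = e b + (1 - e b)`; on the two parts the new idempotent becomes `1` and `0`, and both
resulting products contain the one for `s`. -/
theorem prod_sum_idempotents_sub {R ι : Type} [CommRing R] [DecidableEq ι] (e : ι → R)
    (he : ∀ i, e i * e i = e i) (s : Finset ι) :
    ∏ i ∈ Finset.range (s.card + 1), (∑ b ∈ s, e b - (i : R)) = 0 := by
  induction s using Finset.induction_on with
  | empty => simp
  | insert b s hb ih =>
    have key : ∀ (x y : R) (m : ℕ), e b * ∏ i ∈ Finset.range m, (e b + x - (i:R)) =
        e b * ∏ i ∈ Finset.range m, (1 + x - (i : R)) := fun x y m => by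
      induction m with
      | zero => simp
      | succ m ihm =>
        rw [Finset.prod_range_succ, Finset.prod_range_succ, ← mul_assoc, ihm]
        linear_combination (∏ i ∈ Finset.range m, (1 + x - (i : R))) * he b
    have key' : ∀ (x : R) (m : ℕ), (1 - e b) * ∏ i ∈ Finset.range m, (e b + x - (i:R)) =
        (1 - e b) * ∏ i ∈ Finset.range m, (x - (i : R)) := fun x m => by
      induction m with
      | zero => simp
      | succ m ihm =>
        rw [Finset.prod_range_succ, Finset.prod_range_succ, ← mul_assoc, ihm]
        linear_combination -(∏ i ∈ Finset.range m, (x - (i : R))) * he b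
    rw [Finset.sum_insert hb, Finset.card_insert_of_notMem hb]
    set x := ∑ b ∈ s, e b
    have h1 : ∏ i ∈ Finset.range (s.card + 1 + 1), (1 + x - (i : R)) = 0 := by
      rw [Finset.prod_range_succ']
      have : ∀ i : ℕ, (1 + x - ((i + 1 : ℕ) : R)) = x - i := fun i => by push_cast; ring
      simp only [this, ih, zero_mul]
    have h2 : ∏ i ∈ Finset.range (s.card + 1 + 1), (x - (i : R)) = 0 := by
      rw [Finset.prod_range_succ, ih, zero_mul]
    linear_combination key x 0 (s.card + 1 + 1) + key' x (s.card + 1 + 1) + e b * h1 + (1 - e b) * h2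

/-- On the image of `e b` the sum is one plus the sum of the others, so the value `0` does not occur
and the roots `1, …, card ι` suffice. Further factors up to `D` do no harm and allow one polynomial
for all cells. -/
theorem idempotent_mul_prod_comm {R ι : Type} [CommRing R] [Fintype ι] [DecidableEq ι] (e : ι → R)
    (he : ∀ i, e i * e i = e i) {D : ℕ} (hD : Fintype.card ι ≤ D) (b : ι) :
    e b * ∏ i ∈ Finset.range D, (∑ b, e b - ((i + 1 : ℕ) : R)) = 0 := by
  have h := prod_sum_idempotents_sub e he (Finset.univ.erase b)
  rw [Finset.card_erase_of_mem (Finset.mem_univ b), Finset.card_univ,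
    Nat.sub_add_cancel (Fintype.card_pos_iff.2 ⟨b⟩)] at h
  rw [← Finset.add_sum_erase _ _ (Finset.mem_univ b)]
  set x := ∑ b ∈ Finset.univ.erase b, e b
  have key : ∀ m : ℕ, e b * ∏ i ∈ Finset.range m, (e b + x - ((i + 1 : ℕ) : R)) =
      e b * ∏ i ∈ Finset.range m, (x - (i : R)) := fun m => by
    induction m with
    | zero => simp
    | succ m ihm =>
      rw [Finset.prod_range_succ, Finset.prod_range_succ, ← mul_assoc, ihm]
      push_cast
      linear_combination (∏ i ∈ Finset.range m, (x - (i : R))) * he b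
  rw [key, ← Finset.prod_range_mul_prod_Ico _ hD, h, zero_mul, mul_zero]

open Polynomial in
/-- The polynomial with simple roots `1, …, D`. -/
noncomputable def rootsPoly (D : ℕ) : ℝ[X] := ∏ i ∈ Finset.range D, (X - C (((i + 1 : ℕ) : ℝ)))

-- The commutative case applies in the subalgebra generated by the commuting elements `e i`.
open Polynomial in
theorem idempotent_mul_aeval {R ι : Type} [Ring R] [Algebra ℝ R] [Fintype ι] (e : ι → R)
    (he : ∀ i, e i * e i = e i) (hc : ∀ i j, e i * e j = e j * e i) {D : ℕ}
    (hD : Fintype.card ι ≤ D) (b : ι) : e b * aeval (∑ b, e b) (rootsPoly D) = 0 := by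
  classical
  letI := Algebra.adjoinCommRingOfComm ℝ (s := Set.range e) (by
    rintro _ ⟨i, rfl⟩ _ ⟨j, rfl⟩; exact hc i j)
  let e' : ι → Algebra.adjoin ℝ (Set.range e) := fun i => ⟨e i, Algebra.subset_adjoin ⟨i, rfl⟩⟩
  have h := idempotent_mul_prod_comm e' (fun i => Subtype.ext (he i)) hD b
  have h2 := congrArg (Algebra.adjoin ℝ (Set.range e)).val h
  have e3 : aeval (∑ b, e b) (rootsPoly D) =
      (Algebra.adjoin ℝ (Set.range e)).val
        (∏ i ∈ Finset.range D, (∑ b, e' b - ((i + 1 : ℕ) : Algebra.adjoin ℝ (Set.range e)))) := by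
    have e4 : ∑ b, e b = (Algebra.adjoin ℝ (Set.range e)).val (∑ b, e' b) := by
      rw [map_sum]; rfl
    rw [e4, aeval_algHom_apply]
    congr 1
    rw [rootsPoly, map_prod]
    refine Finset.prod_congr rfl fun i _ => ?_
    rw [map_sub, aeval_X, aeval_C, map_natCast]
  rw [e3]
  rw [map_mul, map_zero] at h2
  exact h2

end IdempotentAlgebra

end OrbiCell

namespace OrbiCell

/-! ### The homotopy operators `K_b` and their naturality. -/

section Contraction

open Set MeasureTheory

variable {B B' : Type} [Fintype B] [Fintype B'] {k : ℕ}

local instance (S : Submodule ℝ (FormField B k)) : AddCommGroup S := Submodule.addCommGroup S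

/-- The homotopy operator in the direction `b`: a primitive in the direction `b`, vanishing on both
faces, of the coefficients of `dx_b` minus their averages. -/
noncomputable def contrOp (b : B) (ω : FormField B (k + 1)) : FormField B k :=
  onCube (relPrim b fun y => iota b (ω y))

theorem contDiffOn_iota (b : B) {ω : FormField B (k + 1)} (h : IsFormOn ∅ ω) :
    ContDiffOn ℝ ((⊤ : ℕ∞) : WithTop ℕ∞) (fun y => iota b (ω y)) (cube B) :=
  (iota b).contDiff.comp_contDiffOn h.contDiffOn

theorem IsFormOn.contrOp (b : B) {ω : FormField B (k + 1)} (h : IsFormOn ∅ ω) :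
    IsFormOn ∅ (contrOp b ω) :=
  isFormOn_onCube (contDiffOn_relPrim b (contDiffOn_iota b h))

theorem contrOp_add (b : B) {ω η : FormField B (k + 1)} (h : IsFormOn ∅ ω) (h' : IsFormOn ∅ η) :
    contrOp b (ω + η) = contrOp b ω + contrOp b η := by
  funext x
  by_cases hx : x ∈ cube B
  · simp only [contrOp, Pi.add_apply, onCube_of_mem _ hx, map_add]
    exact relPrim_add b (contDiffOn_iota b h).continuousOn (contDiffOn_iota b h').continuousOn hx
  · simp only [contrOp, Pi.add_apply, onCube_of_notMem _ hx, add_zero]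

theorem contrOp_smul (b : B) (r : ℝ) (ω : FormField B (k + 1)) :
    contrOp b (r • ω) = r • contrOp b ω := by
  funext x
  by_cases hx : x ∈ cube B
  · simp only [contrOp, Pi.smul_apply, onCube_of_mem _ hx, map_smul]
    exact relPrim_smul b r _ x
  · simp only [contrOp, Pi.smul_apply, onCube_of_notMem _ hx, smul_zero]

theorem projOp_apply (b : B) (ω : cubeForms B k) {x : B → ℝ} (hx : x ∈ cube B) :
    (projOp b ω).1 x = freePart b (interp b ω.1 x) + (avg b ω.1 x - freePart b (avg b ω.1 x)) := by
  rw [projOp, sub_mul, one_mul]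
  simp only [LinearMap.add_apply, LinearMap.sub_apply, Module.End.mul_apply, Submodule.coe_add,
    AddSubgroupClass.coe_sub, Pi.add_apply, Pi.sub_apply, freeOp_apply, interpOp_apply b _ hx,
    avgOp_apply b _ hx]

theorem continuousOn_fderiv_form {ω : FormField B k} (h : IsFormOn ∅ ω) :
    ContinuousOn (fderivWithin ℝ ω (cube B)) (cube B) := continuousOn_fderiv_cube h.contDiffOn

theorem extD_empty_of_mem (ω : FormField B k) {x : B → ℝ} (hx : x ∈ cube B) :
    extD ∅ ω x = ContinuousAlternatingMap.alternatizeUncurryFin (fderivWithin ℝ ω (cube B) x) :=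
  extD_of_mem (by rwa [box_empty])

/-- Differentiating `K_b ω` gives `dx_b ∧ ι_b (ω - avg ω)`, which is `ω - avg ω` minus its free
part, and a term with the derivatives in the other directions. The latter combines with `K_b dω`, by
Cartan's formula, to the free part of `relPrim ∂_b ω = ω - interp ω`. The sum is `ω - P_b ω`. -/
theorem contrOp_homotopy (b : B) (ω : cubeForms B (k + 1)) :
    extD ∅ (contrOp b ω.1) + contrOp b (extD ∅ ω.1) =
      (complOp b ω).1 := by
  have hω : IsFormOn ∅ ω.1 := ω.2
  have hg := contDiffOn_iota b hω
  let A := ContinuousAlternatingMap.alternatizeUncurryFinCLM ℝ (B → ℝ) ℝ (n := k)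
  set T := fderivWithin ℝ ω.1 (cube B) with hT
  have hTc : ContinuousOn T (cube B) := continuousOn_fderiv_form hω
  funext x
  by_cases hx : x ∈ cube B
  swap
  · have e := ((complOp b ω).2).zero_off x
      (by rwa [box_empty])
    rw [e, Pi.add_apply, (((hω.contrOp b).extD isClosed_empty).zero_off x (by rwa [box_empty])),
      contrOp, onCube_of_notMem _ hx, add_zero]
  have hd : fderivWithin ℝ (contrOp b ω.1) (cube B) x =
      (coordProj b).smulRight (iota b (ω.1 x) - avg b (fun y => iota b (ω.1 y)) x) +
        relPrim b (derivOff b fun y => iota b (ω.1 y)) x :=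
    ((hasFDerivWithinAt_relPrim b hg hx).congr (fun y hy => onCube_of_mem _ hy)
      (onCube_of_mem _ hx)).fderivWithin (uniqueDiffOn_cube x hx)
  have hoff : ∀ y ∈ cube B, derivOff b (fun y => iota b (ω.1 y)) y =
      ((iota b).comp (T y)).comp (scaleAt b 0) := fun y hy => by
    rw [derivOff]
    congr 1
    exact ((iota b).hasFDerivAt.comp_hasFDerivWithinAt y
      (hasFDerivWithinAt_cube hω.contDiffOn hy)).fderivWithin (uniqueDiffOn_cube y hy)
  have hAoff : ContinuousOn (fun y => A (derivOff b (fun y => iota b (ω.1 y)) y)) (cube B) :=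
    A.continuous.comp_continuousOn (continuousOn_derivOff b hg)
  have e1 : A (relPrim b (derivOff b fun y => iota b (ω.1 y)) x) =
      relPrim b (fun y => A (derivOff b (fun y => iota b (ω.1 y)) y)) x :=
    (relPrim_clm b A (continuousOn_derivOff b hg) hx).symm
  have hι : ContinuousOn (fun y => iota b (extD ∅ ω.1 y)) (cube B) :=
    (contDiffOn_iota b (hω.extD isClosed_empty)).continuousOn
  -- Under `relPrim` the terms `d ι_b ω` cancel and only the free part of `∂_b ω` is left.
  have e2 : relPrim b (fun y => A (derivOff b (fun y => iota b (ω.1 y)) y)) x +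
      relPrim b (fun y => iota b (extD ∅ ω.1 y)) x =
      freePart b (relPrim b (fun y => T y (unitVec b)) x) := by
    rw [← relPrim_add b hAoff hι hx, ← relPrim_clm b (freePart b)
      (hTc.clm_apply continuousOn_const) hx]
    refine relPrim_congr b (fun y hy => ?_) hx
    rw [Pi.add_apply, hoff y hy, extD_empty_of_mem _ hy, iota_alternatize]
    -- Dropping the derivative in direction `b` from `d ι_b ω` subtracts `dx_b ∧ ι_b ∂_b ω`.
    have e3 : (A (((iota b).comp (T y)).comp (scaleAt b 0)) : (B → ℝ) [⋀^Fin (k + 1)]→L[ℝ] ℝ) =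
        A ((iota b).comp (T y)) - (T y (unitVec b) - freePart b (T y (unitVec b))) := by
      rw [← alternatize_coordProj_iota, ← ContinuousAlternatingMap.alternatizeUncurryFinCLM_apply]
      rw [← map_sub]
      congr 1
      ext1 v
      have := scaleAt_eq b 1 v
      rw [scaleAt_one, one_mul] at this
      simp only [ContinuousLinearMap.comp_apply, sub_apply, ContinuousLinearMap.smulRight_apply,
        ContinuousLinearMap.proj_apply]
      conv_rhs => rw [this]
      rw [map_add, map_add, map_smul, map_smul]
      simp [scaleAt_self, unitVec_self]
    rw [e3]
    change A ((iota b).comp (T y)) - (T y (unitVec b) - freePart b (T y (unitVec b))) +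
      (T y (unitVec b) - A ((iota b).comp (T y))) = _
    abel
  have e4 : avg b (fun y => iota b (ω.1 y)) x = iota b (avg b ω.1 x) :=
    avg_clm b (iota b) hω.contDiffOn.continuousOn hx
  rw [Pi.add_apply, extD_empty_of_mem _ hx, hd, e4, ← map_sub,
    ← ContinuousAlternatingMap.alternatizeUncurryFinCLM_apply, map_add,
    ContinuousAlternatingMap.alternatizeUncurryFinCLM_apply, alternatize_coordProj_iota]
  change _ + A _ + _ = _
  rw [e1, contrOp, onCube_of_mem _ hx, add_assoc, e2, hT, relPrim_deriv b hω.contDiffOn hx,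
    complOp_apply, AddSubgroupClass.coe_sub, Pi.sub_apply, projOp_apply b _ hx, map_sub, map_sub]
  abel

/-- A form of degree zero is its own free part, so the average drops out of `P_b` and the formula
reduces to `relPrim_deriv`. -/
theorem contrOp_homotopy_zero (b : B) (ω : cubeForms B 0) :
    contrOp b (extD ∅ ω.1) = (complOp b ω).1 := by
  have hω : IsFormOn ∅ ω.1 := ω.2
  funext x
  by_cases hx : x ∈ cube B
  swap
  · have e := ((complOp b ω).2).zero_off x
      (by rwa [box_empty])
    rw [e, contrOp, onCube_of_notMem _ hx]
  rw [contrOp, onCube_of_mem _ hx, relPrim_congr b (f' := fun y =>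
    fderivWithin ℝ ω.1 (cube B) y (unitVec b)) (fun y hy => by
      rw [extD_empty_of_mem _ hy, iota_alternatize_zero]) hx, relPrim_deriv b hω.contDiffOn hx,
    complOp_apply, AddSubgroupClass.coe_sub, Pi.sub_apply, projOp_apply b _ hx,
    freePart_zero_form, freePart_zero_form]
  abel

theorem IsFaceMap.linear_apply {L : (B' → ℝ) →L[ℝ] (B → ℝ)} {c : B → ℝ} {j : B' → B}
    (h1 : ∀ y b', (L y + c) (j b') = y b')
    (h2 : ∀ b, b ∉ range j → (∀ y, (L y + c) b = 0) ∨ ∀ y, (L y + c) b = 1) :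
    (∀ y b', L y (j b') = y b') ∧ ∀ b, b ∉ range j → ∀ y, L y b = 0 := by
  have e : ∀ y b, L y b = (L y + c) b - (L 0 + c) b := fun y b => by simp
  refine ⟨fun y b' => by rw [e, h1, h1]; simp, fun b hb y => ?_⟩
  rcases h2 b hb with h | h <;> rw [e, h, h, sub_self]

/-- The operator in direction `j b'` moves only that coordinate, and `L` sends `e_{b'}` to `e_{j
b'}`. So it integrates along the same segments in the face and in the cube. -/
theorem pullback_contrOp {L : (B' → ℝ) →L[ℝ] (B → ℝ)} {c : B → ℝ} {j : B' → B}
    (hj : Function.Injective j) (h1 : ∀ y b', (L y + c) (j b') = y b')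
    (h2 : ∀ b, b ∉ range j → (∀ y, (L y + c) b = 0) ∨ ∀ y, (L y + c) b = 1)
    {ω : FormField B (k + 1)} (hω : IsFormOn ∅ ω) (b' : B') :
    pullback L c (contrOp (j b') ω) = contrOp b' (pullback L c ω) := by
  have hF : IsFaceMap L c := ⟨j, hj, h1, h2⟩
  obtain ⟨l1, l2⟩ := IsFaceMap.linear_apply h1 h2
  have hu : L (unitVec b') = unitVec (j b') := by
    funext b
    by_cases hb : b ∈ range j
    · obtain ⟨a, rfl⟩ := hb
      rw [l1]
      by_cases ha : a = b'
      · rw [ha, unitVec_self, unitVec_self]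
      · rw [unitVec_ne ha, unitVec_ne (hj.ne ha)]
    · rw [l2 b hb, unitVec_ne (fun e => hb ⟨b', e.symm⟩)]
  have hset : ∀ s y, setAt (j b') s (L y + c) = L (setAt b' s y) + c := fun s y => by
    funext b
    by_cases hb : b ∈ range j
    · obtain ⟨a, rfl⟩ := hb
      rw [h1]
      by_cases ha : a = b'
      · rw [ha, setAt_self, setAt_self]
      · rw [setAt_ne ha, setAt_ne (hj.ne ha), h1]
    · rw [setAt_ne (fun e => hb ⟨b', e.symm⟩)]
      rcases h2 b hb with h | h <;> rw [h, h]
  funext y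
  by_cases hy : y ∈ cube B'
  swap
  · rw [contrOp, contrOp, onCube_of_notMem _ hy, pullback,
      onCube_of_notMem _ (fun h => hy ((hF.mem_cube_iff y).1 h))]
    rfl
  rw [pullback, contrOp, contrOp, onCube_of_mem _ hy,
    onCube_of_mem _ ((hF.mem_cube_iff y).2 hy)]
  have e := relPrim_clm b' (f := fun y => iota (j b') (ω (L y + c)))
    (ContinuousAlternatingMap.compContinuousLinearMapCLM L)
    ((contDiffOn_iota (j b') hω).continuousOn.comp
      ((contDiff_affine L c (n := 0)).continuous.continuousOn) fun z hz =>
        (hF.mem_cube_iff z).2 hz) hy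
  refine Eq.trans ?_ (e.symm.trans (relPrim_congr b' (fun z _ => ?_) hy))
  · change ContinuousAlternatingMap.compContinuousLinearMapCLM L _ = _
    congr 1
    simp only [relPrim, prim, avg, scaleAt_eq_setAt, hset, h1]
  · rw [pullback, iota_compContinuousLinearMap hu]
    rfl

theorem pullback_contrOp_eq_zero {L : (B' → ℝ) →L[ℝ] (B → ℝ)} {c : B → ℝ} {b : B}
    (h : (∀ y, (L y + c) b = 0) ∨ ∀ y, (L y + c) b = 1) (ω : FormField B (k + 1)) :
    pullback L c (contrOp b ω) = 0 := by
  funext y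
  have : contrOp b ω (L y + c) = 0 := by
    by_cases hx : L y + c ∈ cube B
    · rw [contrOp, onCube_of_mem _ hx]
      exact relPrim_of_boundary b _ (h.imp (· y) (· y))
    · exact onCube_of_notMem _ hx
  rw [pullback, this]
  rfl

theorem pullback_sum {L : (B' → ℝ) →L[ℝ] (B → ℝ)} {c : B → ℝ} {ι : Type} (s : Finset ι)
    (f : ι → FormField B k) : pullback L c (∑ i ∈ s, f i) = ∑ i ∈ s, pullback L c (f i) := by
  classical
  induction s using Finset.induction_on with
  | empty => simp [pullback_zero]
  | insert a s ha ih => rw [Finset.sum_insert ha, Finset.sum_insert ha, pullback_add, ih]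

/-- Directions along the face match, and directions transverse to it contribute zero. This is why
the sum over all directions is used: it needs no choice of direction or ordering of the edges. -/
theorem pullback_sum_contrOp {L : (B' → ℝ) →L[ℝ] (B → ℝ)} {c : B → ℝ} (h : IsFaceMap L c)
    {ω : FormField B (k + 1)} (hω : IsFormOn ∅ ω) :
    pullback L c (∑ b, contrOp b ω) = ∑ b', contrOp b' (pullback L c ω) := by
  obtain ⟨j, hj, h1, h2⟩ := h
  rw [pullback_sum]
  exact (Fintype.sum_of_injective j hj _ _ (fun b hb => pullback_contrOp_eq_zero (h2 b hb) ω)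
    (fun b' => (pullback_contrOp hj h1 h2 hω b').symm)).symm

theorem isFormOn_sum {A : Set ℝ} {ι : Type} (s : Finset ι) (f : ι → FormField B k)
    (h : ∀ i, IsFormOn A (f i)) : IsFormOn A (∑ i ∈ s, f i) := by
  classical
  induction s using Finset.induction_on with
  | empty => simpa using IsFormOn.zero
  | insert a s ha ih => rw [Finset.sum_insert ha]; exact (h a).add ih

/-- The form already has `e_b` inserted, and it is alternating. -/
theorem contrOp_apply_unitVec {ω : FormField B (k + 1)} (hω : IsFormOn ∅ ω) (b : B)
    (s : Fin k → B) (hs : b ∈ range s) (x : B → ℝ) :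
    contrOp b ω x (fun i => unitVec (s i)) = 0 := by
  by_cases hx : x ∈ cube B
  swap
  · rw [contrOp, onCube_of_notMem _ hx]; rfl
  rw [contrOp, onCube_of_mem _ hx]
  have e := relPrim_clm b (f := fun y => iota b (ω y)) (ContinuousAlternatingMap.apply ℝ (B → ℝ) ℝ
    (fun i => unitVec (s i))) (contDiffOn_iota b hω).continuousOn hx
  refine e.symm.trans ?_
  have e2 : ∀ y, ContinuousAlternatingMap.apply ℝ (B → ℝ) ℝ (fun i => unitVec (s i))
      (iota b (ω y)) = 0 := fun y => by
    obtain ⟨i, rfl⟩ := hs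
    exact (ω y).map_eq_zero_of_eq _ (i := 0) (j := i.succ) (by simp) (Fin.succ_ne_zero i).symm
  simp only [e2, relPrim, prim, avg]
  simp

end Contraction

/-! ### Acyclicity of the kernel of integration. -/

section Acyclic

open Set MeasureTheory Polynomial

variable {g n k : ℕ}

local instance (S : Submodule ℝ (∀ γ : Cell g n, FormField γ.Black k)) : AddCommGroup S :=
  Submodule.addCommGroup S

local instance {B : Type} [Fintype B] (S : Submodule ℝ (FormField B k)) : AddCommGroup S :=
  Submodule.addCommGroup S

/-- The exterior derivative of orbi-cellular forms. -/
noncomputable abbrev formD (g n k : ℕ) :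
    orbiFormsOn ∅ g n k →ₗ[ℝ] orbiFormsOn ∅ g n (k + 1) :=
  orbiD isClosed_empty (by simp) (by simp) g n k

/-- The sum of the homotopy operators in all directions, on orbi-cellular forms. -/
noncomputable def formContr (g n k : ℕ) :
    orbiFormsOn ∅ g n (k + 1) →ₗ[ℝ] orbiFormsOn ∅ g n k where
  toFun ω := ⟨fun γ => ∑ b, contrOp b (ω.1 γ),
    { form := fun γ => isFormOn_sum _ _ fun b => (ω.2.form γ).contrOp b
      invariant := fun γ γ' φ => by
        rw [pullback_sum_contrOp (isFaceMap_reindex _) (ω.2.form γ), ω.2.invariant]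
      zero_face := fun γ e => by
        rw [pullback_sum_contrOp (isFaceMap_zero _ _) (ω.2.form γ), ω.2.zero_face]
      infty_face := fun γ e => by
        rw [pullback_sum_contrOp (isFaceMap_one _ _) (ω.2.form γ), ω.2.infty_face] }⟩
  map_add' ω η := Subtype.ext (funext fun γ => by
    have : ∀ b, contrOp b ((ω.1 + η.1) γ) = contrOp b (ω.1 γ) + contrOp b (η.1 γ) := fun b =>
      contrOp_add b (ω.2.form γ) (η.2.form γ)
    simp only [Submodule.coe_add, this, Finset.sum_add_distrib]
    rfl)
  map_smul' r ω := Subtype.ext (funext fun γ => by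
    have : ∀ b, contrOp b ((r • ω.1) γ) = r • contrOp b (ω.1 γ) := fun b => contrOp_smul b r _
    simp only [Submodule.coe_smul, this, ← Finset.smul_sum, RingHom.id_apply]
    rfl)

/-- The Laplacian-like operator `dK + Kd` of the homotopy operator. -/
noncomputable def formN (g n : ℕ) : ∀ k, Module.End ℝ (orbiFormsOn ∅ g n k)
  | 0 => formContr g n 0 ∘ₗ formD g n 0
  | k + 1 => formD g n k ∘ₗ formContr g n k + formContr g n (k + 1) ∘ₗ formD g n (k + 1)

theorem formD_formN (ω : orbiFormsOn ∅ g n k) :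
    formD g n k (formN g n k ω) = formN g n (k + 1) (formD g n k ω) := by
  cases k with
  | zero =>
    simp only [formN, LinearMap.comp_apply, LinearMap.add_apply, orbiD_orbiD, map_zero, add_zero]
  | succ k =>
    simp only [formN, LinearMap.comp_apply, LinearMap.add_apply, orbiD_orbiD, map_zero, add_zero,
      map_add, zero_add]

theorem aeval_intertwine {V W : Type*} [AddCommGroup V] [Module ℝ V] [AddCommGroup W] [Module ℝ W]
    (f : V →ₗ[ℝ] W) (S : Module.End ℝ V) (T : Module.End ℝ W) (h : ∀ v, f (S v) = T (f v))
    (p : ℝ[X]) (v : V) : f (aeval S p v) = aeval T p (f v) := by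
  induction p using Polynomial.induction_on generalizing v with
  | C a => simp [aeval_C, Module.algebraMap_end_apply]
  | add p q hp hq => simp only [map_add, LinearMap.add_apply, hp, hq]
  | monomial m a ih =>
    rw [pow_succ, ← mul_assoc, map_mul (aeval S), map_mul (aeval T), aeval_X, aeval_X,
      Module.End.mul_apply, Module.End.mul_apply, ih, h]

theorem aeval_apply_eq {V : Type*} [AddCommGroup V] [Module ℝ V] (T : Module.End ℝ V) (p : ℝ[X])
    (v : V) : aeval T p v = T (aeval T p.divX v) + p.coeff 0 • v := by
  conv_lhs => rw [← X_mul_divX_add p]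
  rw [map_add, map_mul, aeval_X, aeval_C, LinearMap.add_apply, Module.End.mul_apply,
    Module.algebraMap_end_apply]

/-- The form on the cube of `γ`. -/
def formAt (γ : Cell g n) : orbiFormsOn ∅ g n k →ₗ[ℝ] cubeForms γ.Black k where
  toFun ω := ⟨ω.1 γ, ω.2.form γ⟩
  map_add' _ _ := rfl
  map_smul' _ _ := rfl

theorem extD_sum {B : Type} [Fintype B] {A : Set ℝ} {ι : Type} (s : Finset ι)
    (f : ι → FormField B k) (h : ∀ i, IsFormOn A (f i)) :
    extD A (∑ i ∈ s, f i) = ∑ i ∈ s, extD A (f i) := by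
  classical
  induction s using Finset.induction_on with
  | empty => simpa using extD_smul (A := A) 0 (0 : FormField B k)
  | insert a s ha ih =>
    rw [Finset.sum_insert ha, Finset.sum_insert ha, extD_add (h a) (isFormOn_sum _ _ h), ih]

/-- The homotopy formulas of all directions, added up: on a single cube `N` is a sum of commuting
idempotents. -/
theorem formAt_formN (γ : Cell g n) (ω : orbiFormsOn ∅ g n k) :
    formAt γ (formN g n k ω) =
      (∑ b, complOp b : Module.End ℝ (cubeForms γ.Black k)) (formAt γ ω) := by
  refine Subtype.ext ?_
  rw [LinearMap.sum_apply, AddSubmonoidClass.coe_finsetSum]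
  cases k with
  | zero =>
    change ∑ b, contrOp b (extD ∅ (ω.1 γ)) = _
    exact Finset.sum_congr rfl fun b _ => contrOp_homotopy_zero b (formAt γ ω)
  | succ k =>
    change extD ∅ (∑ b, contrOp b (ω.1 γ)) + ∑ b, contrOp b (extD ∅ (ω.1 γ)) = _
    rw [extD_sum _ _ fun b => (ω.2.form γ).contrOp b, ← Finset.sum_add_distrib]
    exact Finset.sum_congr rfl fun b _ => contrOp_homotopy b (formAt γ ω)

/-- Integration over a cell evaluates the form on all unit vectors, among them `e_b`, on which the
summand of direction `b` vanishes. -/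
theorem integrate_formContr (ω : orbiFormsOn ∅ g n (k + 1)) :
    integrate (formContr g n k ω).1 = 0 := by
  funext γ o
  have : ∀ x, (formContr g n k ω).1 γ x (fun j => unitVec (o j)) = 0 := fun x => by
    change (∑ b, contrOp b (ω.1 γ)) x _ = 0
    rw [Finset.sum_apply, ContinuousAlternatingMap.sum_apply]
    exact Finset.sum_eq_zero fun b _ => contrOp_apply_unitVec (ω.2.form γ) b o
      ⟨o.symm b, o.apply_symm_apply b⟩ x
  simp only [integrate, this, integral_zero]
  rfl

theorem integrate_formD (ω : orbiFormsOn ∅ g n k) :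
    integrate (formD g n k ω).1 = cochainD (integrate ω.1) := integrate_extD ω.2

theorem cochainD_zero : cochainD (0 : ∀ γ : Cell g n, (Fin k ≃ γ.Black) → ℝ) = 0 := by
  funext γ o
  simp [cochainD]

/-- The free part sees only vectors tangent to the face, so on the face it is determined by the
restriction. -/
theorem freePart_of_pullback_zero {B B' : Type} [Fintype B] [Fintype B'] {ω : FormField B k} {b : B}
    (ε : {c // c ≠ b} ≃ B') {c : B → ℝ} (h : pullback (faceLin b ε) c ω = 0) (y : B → ℝ)
    (x : B → ℝ) (hx : x = scaleAt b 0 y + c) : freePart b (ω x) = 0 := by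
  have r : ∀ v : B → ℝ, faceLin b ε (fun b' => v (ε.symm b').1) = scaleAt b 0 v := fun v => by
    funext a
    by_cases ha : a = b
    · subst ha; rw [faceLin_self, scaleAt_self, zero_mul]
    · rw [faceLin_ne _ _ _ ha, scaleAt_ne ha, ε.symm_apply_apply]
  have := congrFun h (fun b' => y (ε.symm b').1)
  ext v
  rw [freePart_apply]
  have := DFunLike.congr_fun this fun i b' => v i (ε.symm b').1
  rw [pullback, r, ← hx] at this
  simp only [← r]
  exact this

theorem volume_cube : (volume (cube (Fin k))).toReal = 1 := by
  rw [cube, Real.volume_Icc_pi_toReal (a := (0 : Fin k → ℝ)) (b := 1) zero_le_one]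
  simp

/-- Induction on the number of black edges. The restrictions to all faces vanish by induction, so
the part of the form affine in `x_b` without `dx_b` vanishes for every `b`. What is left involves
every `dx_b` and is constant in every `x_b`. It is thus a constant form of top degree, and its
integral is zero. -/
theorem eq_zero_of_projOp (η : orbiFormsOn ∅ g n k)
    (h : ∀ γ b, projOp b (formAt γ η) = formAt γ η) (hI : integrate η.1 = 0) : η = 0 := by
  classical
  refine Subtype.ext (funext fun γ => ?_)
  change η.1 γ = 0
  induction hm : Fintype.card γ.Black using Nat.strong_induction_on generalizing γ with
  | _ m ih =>
  subst hm
  set ω := formAt γ η with hω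
  have hc : ContinuousOn ω.1 (cube γ.Black) := continuousOn_cubeForm ω
  have hcard : ∀ (b : γ.Black), Fintype.card {c // c ≠ b} < Fintype.card γ.Black := fun b =>
    Fintype.card_subtype_lt (x := b) (by simp)
  -- The restriction to `x_b = 0` is the form of `γ/b`, which has fewer black edges.
  have hz : ∀ b x, freePart b (ω.1 (setAt b 0 x)) = 0 := fun b x => by
    refine freePart_of_pullback_zero (γ.contractBlack b) (c := 0) ?_ x _ ?_
    · refine (η.2.zero_face γ b).trans (ih _ ?_ (γ.contract b) rfl)
      rw [← Fintype.card_congr (γ.contractBlack b)]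
      exact hcard b
    · rw [scaleAt_eq_setAt, zero_mul, add_zero]
  have ho : ∀ b x, freePart b (ω.1 (setAt b 1 x)) = 0 := fun b x => by
    refine freePart_of_pullback_zero (γ.whitenBlack b) (c := unitVec b) ?_ x _ ?_
    · refine (η.2.infty_face γ b).trans (ih _ ?_ (γ.whiten b) rfl)
      rw [← Fintype.card_congr (γ.whitenBlack b)]
      exact hcard b
    · rw [setAt, one_smul]
  -- In `P_b ω = ω` the interpolation term is gone, as the free parts on both faces vanish.
  have hp : ∀ b, ∀ x ∈ cube γ.Black, ω.1 x = avg b ω.1 x - freePart b (avg b ω.1 x) :=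
    fun b x hx => by
      have e := congrArg (fun ξ : cubeForms γ.Black k => ξ.1 x) (h γ b)
      change (projOp b ω).1 x = ω.1 x at e
      rw [projOp_apply b _ hx, interp, map_add, map_smul, map_smul, hz, ho] at e
      simpa using e.symm
  have hf : ∀ b, ∀ x ∈ cube γ.Black, freePart b (ω.1 x) = 0 := fun b x hx => by
    rw [hp b x hx, map_sub, freePart_freePart, sub_self]
  have ha : ∀ b, ∀ x ∈ cube γ.Black, ω.1 x = avg b ω.1 x := fun b x hx => by
    have e : freePart b (avg b ω.1 x) = 0 := by
      rw [← avg_clm b (freePart b) hc hx, avg_congr b (f' := fun _ => 0) (hf b) hx]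
      simp [avg]
    rw [hp b x hx, e, sub_zero]
  have hset : ∀ b, ∀ x ∈ cube γ.Black, ω.1 (setAt b 0 x) = ω.1 x := fun b x hx => by
    rw [ha b x hx, ha b _ (setAt_mem_cube b (by simp) hx), avg_setAt]
  -- The coordinates of `x` are set to zero one after another.
  have hconst : ∀ x ∈ cube γ.Black, ω.1 x = ω.1 0 := fun x hx => by
    classical
    have key : ∀ s : Finset γ.Black, (fun c => if c ∈ s then 0 else x c) ∈ cube γ.Black ∧
        ω.1 (fun c => if c ∈ s then 0 else x c) = ω.1 x := fun s => by
      induction s using Finset.induction_on with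
      | empty => simpa using hx
      | insert b s hb ihs =>
        have e : (fun c => if c ∈ insert b s then 0 else x c) =
            setAt b 0 (fun c => if c ∈ s then 0 else x c) := by
          funext c
          by_cases hc : c = b
          · subst hc; simp [setAt_self]
          · simp [setAt_ne hc, hc]
        rw [e]
        exact ⟨setAt_mem_cube b (by simp) ihs.1, (hset b _ ihs.1).trans ihs.2⟩
    have := (key Finset.univ).2
    simp only [Finset.mem_univ, if_true] at this
    exact this.symm
  -- A tuple of unit vectors that omits a direction `b` only sees the free part for `b`; a tuple
  -- with all directions gives the integral, as the cube has volume one.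
  have h0 : ω.1 0 = 0 := by
    refine ext_unitVec fun s hs => ?_
    by_cases hsur : Function.Surjective s
    · let o : Fin k ≃ γ.Black := Equiv.ofBijective s ⟨hs, hsur⟩
      have e := congrFun (congrFun hI γ) o
      have e2 : integrate η.1 γ o = ω.1 0 fun i => unitVec (s i) := by
        rw [integrate, setIntegral_congr_fun (s := cube (Fin k)) (g := fun _ => ω.1 0 fun i => unitVec (s i))
          (measurableSet_Icc : MeasurableSet (cube (Fin k))) (fun x hx => ?_)]
        · rw [setIntegral_const, Measure.real, volume_cube, one_smul]
        · simp only
          rw [← hconst (x ∘ o.symm) (mem_cube.2 fun b => mem_cube.1 hx _)]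
          rfl
      rw [← e2, e]
      rfl
    · rw [Function.Surjective] at hsur
      push Not at hsur
      obtain ⟨b, hb⟩ := hsur
      have e := DFunLike.congr_fun (hf b 0 zero_mem_cube) fun i => unitVec (s i)
      rw [freePart_apply] at e
      simpa only [fun i => scaleAt_zero_unitVec_ne (hb i)] using e
  funext x
  by_cases hx : x ∈ cube γ.Black
  · exact (hconst x hx).trans h0
  · exact ω.2.zero_off x (by rwa [box_empty])

/-- Integration of orbi-cellular forms as a linear map. -/
noncomputable def integrateLM (g n k : ℕ) : orbiFormsOn ∅ g n k →ₗ[ℝ] cochains g n k where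
  toFun ω := ⟨integrate ω.1, integrate_mem_cochains ω.2⟩
  map_add' ω η := Subtype.ext <| by
    funext γ o
    have i : ∀ ξ : orbiFormsOn ∅ g n k, IntegrableOn
        (fun x => ξ.1 γ (x ∘ o.symm) fun j => unitVec (o j)) (cube (Fin k)) := fun ξ => by
      refine ContinuousOn.integrableOn_compact (K := cube (Fin k)) isCompact_Icc ?_
      refine (ContinuousAlternatingMap.apply ℝ (γ.Black → ℝ) ℝ
        (fun j => unitVec (o j))).continuous.comp_continuousOn
        ((ξ.2.form γ).contDiffOn.continuousOn.comp (Continuous.continuousOn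
          (continuous_pi fun _ => continuous_apply _))
          fun x hx => mem_cube.2 fun b => mem_cube.1 hx _)
    exact integral_add (i ω) (i η)
  map_smul' r ω := Subtype.ext <| by
    funext γ o
    exact integral_const_mul r _

theorem rootsPoly_coeff_zero (D : ℕ) : (rootsPoly D).coeff 0 ≠ 0 := by
  rw [coeff_zero_eq_eval_zero, rootsPoly, eval_prod, Finset.prod_ne_zero_iff]
  intro i _
  simp only [eval_sub, eval_X, eval_C, zero_sub, ne_eq, neg_eq_zero]
  positivity

/-- On every cube `1 - P_b` annihilates the polynomial in the sum of all `1 - P_b`, so the form is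
fixed by every `P_b` and `eq_zero_of_projOp` applies. -/
theorem aeval_rootsPoly_eq_zero {D : ℕ} (hD : ∀ γ : Cell g n, Fintype.card γ.Black ≤ D)
    {ω : orbiFormsOn ∅ g n k} (hI : integrateLM g n k (aeval (formN g n k) (rootsPoly D) ω) = 0) :
    aeval (formN g n k) (rootsPoly D) ω = 0 := by
  refine eq_zero_of_projOp _ (fun γ b => ?_) (congrArg Subtype.val hI)
  rw [aeval_intertwine (formAt γ) _ _ (formAt_formN γ)]
  have e := idempotent_mul_aeval (R := Module.End ℝ (cubeForms γ.Black k))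
    (fun b => complOp b) complOp_idem complOp_comm (hD γ) b
  have := LinearMap.congr_fun e (formAt γ ω)
  rw [Module.End.mul_apply, complOp_apply, LinearMap.zero_apply, sub_eq_zero] at this
  exact this.symm

theorem aeval_rootsPoly_apply (D : ℕ) (ω : orbiFormsOn ∅ g n k) :
    aeval (formN g n k) (rootsPoly D) ω = formN g n k (aeval (formN g n k) (rootsPoly D).divX ω) +
      (rootsPoly D).coeff 0 • ω :=
   aeval_apply_eq _ _ _

/-- A closed form of positive degree whose integrals vanish is the derivative of a form whose
integrals vanish. -/
theorem exists_formD_eq {D : ℕ} (hD : ∀ γ : Cell g n, Fintype.card γ.Black ≤ D)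
    (ω : orbiFormsOn ∅ g n (k + 1)) (hd : formD g n (k + 1) ω = 0)
    (hI : integrateLM g n (k + 1) ω = 0) :
    ∃ η, integrateLM g n k η = 0 ∧ formD g n k η = ω := by
  -- With `p = X q + p(0)` one has `p(N)ω = N ω' + p(0) ω` for `ω' = q(N)ω`. As `N` commutes with
  -- `d`, also `ω'` is closed, and `N ω' = d K ω'`.
  set ω' := aeval (formN g n (k + 1)) (rootsPoly D).divX ω with hω'
  have hd' : formD g n (k + 1) ω' = 0 := by
    rw [hω', aeval_intertwine (formD g n (k + 1)) _ _ formD_formN, hd, map_zero]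
  have hN : formN g n (k + 1) ω' = formD g n k (formContr g n k ω') := by
    simp [formN, hd']
  have hIK : integrateLM g n k (formContr g n k ω') = 0 := Subtype.ext (integrate_formContr ω')
  have hIN : integrateLM g n (k + 1) (formD g n k (formContr g n k ω')) = 0 := Subtype.ext <|
    (integrate_formD _).trans (by rw [integrate_formContr, cochainD_zero]; rfl)
  have h0 := rootsPoly_coeff_zero D
  have e := aeval_rootsPoly_apply D ω
  rw [aeval_rootsPoly_eq_zero hD (by rw [e, ← hω', hN, map_add, hIN, map_smul, hI, smul_zero,
    add_zero]), ← hω', hN] at e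
  refine ⟨-((rootsPoly D).coeff 0)⁻¹ • formContr g n k ω', by rw [map_smul, hIK, smul_zero], ?_⟩
  rw [map_smul, eq_neg_of_add_eq_zero_left e.symm, smul_neg, neg_smul, neg_neg, smul_smul,
    inv_mul_cancel₀ h0, one_smul]

/-- In degree zero `N = K d` vanishes on closed forms, so `p(N)ω = 0` reads `p(0) ω = 0`. -/
theorem eq_zero_of_formD_eq_zero {D : ℕ} (hD : ∀ γ : Cell g n, Fintype.card γ.Black ≤ D)
    (ω : orbiFormsOn ∅ g n 0) (hd : formD g n 0 ω = 0) (hI : integrateLM g n 0 ω = 0) : ω = 0 := by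
  set ω' := aeval (formN g n 0) (rootsPoly D).divX ω with hω'
  have hd' : formD g n 0 ω' = 0 := by
    rw [hω', aeval_intertwine (formD g n 0) _ _ formD_formN, hd, map_zero]
  have hN : formN g n 0 ω' = 0 := by
    simp [formN, hd']
  have e := aeval_rootsPoly_apply D ω
  rw [aeval_rootsPoly_eq_zero hD (by rw [e, ← hω', hN, map_add, map_zero, map_smul, hI, smul_zero,
    add_zero]), ← hω', hN, zero_add] at e
  exact (smul_eq_zero.1 e.symm).resolve_left (rootsPoly_coeff_zero D)

end Acyclic

end OrbiCell

namespace OrbiCell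

/-! ### Transport of cycle counts along bijections, and quotients of vertex sets. -/

section Unlink

theorem unlink_comm {α : Type} (a b : α) (π : Perm α) :
    unlink a (unlink b π) = unlink b (unlink a π) := by
  classical
  refine Equiv.ext fun x => ?_
  have hinj := π.injective
  simp only [unlink_apply]
  grind [Function.Injective]

theorem swap_conj {α β : Type} [DecidableEq α] [DecidableEq β] (f : α ≃ β) (a b x : α) :
    swap (f a) (f b) (f x) = f (swap a b x) := by
  simp only [swap_apply_def, f.apply_eq_iff_eq]
  split_ifs <;> rfl

theorem swap_subtype_val {α : Type} {p : α → Prop} {_ : DecidableEq α} {_ : DecidableEq {x // p x}}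
    (a b x : {x // p x}) : (swap a b x).1 = swap a.1 b.1 x.1 := by
  by_cases h1 : x = a
  · rw [h1, swap_apply_left, swap_apply_left]
  · by_cases h2 : x = b
    · rw [h2, swap_apply_right, swap_apply_right]
    · rw [swap_apply_of_ne_of_ne h1 h2, swap_apply_of_ne_of_ne (fun e => h1 (Subtype.ext e))
        (fun e => h2 (Subtype.ext e))]

theorem unlink_subtype_val {α : Type} {p : α → Prop} {π' : Perm {x // p x}} {π : Perm α}
    (h : ∀ y, (π' y).1 = π y.1) (a y : {x // p x}) : (unlink a π' y).1 = unlink a.1 π y.1 := by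
  rw [unlink_apply, unlink_apply, ← h]
  by_cases h1 : y = a
  · rw [if_pos h1, if_pos (congrArg Subtype.val h1)]
  · rw [if_neg h1, if_neg (fun e => h1 (Subtype.ext e))]
    by_cases h2 : π' y = a
    · rw [if_pos h2, if_pos (congrArg Subtype.val h2), h]
    · rw [if_neg h2, if_neg (fun e => h2 (Subtype.ext e))]

theorem unlink_mul {α : Type} (a : α) (π τ : Perm α) (h : τ a = a) :
    unlink a (π * τ) = unlink a π * τ := by
  simp [unlink, h, mul_assoc]

theorem unlink_conj {α β : Type} (f : α ≃ β) {π : Perm α} {π' : Perm β}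
    (h : ∀ x, π' (f x) = f (π x)) (a x : α) : unlink (f a) π' (f x) = f (unlink a π x) := by
  classical
  simp only [unlink_apply, h, f.apply_eq_iff_eq]
  split_ifs <;> rfl

theorem sameCycle_conj {α β : Type} [Finite α] [Finite β] (f : α ≃ β) {π : Perm α} {π' : Perm β}
    (h : ∀ x, π' (f x) = f (π x)) (x y : α) : π'.SameCycle (f x) (f y) ↔ π.SameCycle x y := by
  constructor
  · intro k
    have := sameCycle_closed π' {z | π.SameCycle x (f.symm z)} (fun z hz => ?_) k
      (by simpa using Perm.SameCycle.refl π x)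
    · simpa using this
    · have e : f.symm (π' z) = π (f.symm z) := by
        rw [Equiv.symm_apply_eq, ← h, f.apply_symm_apply]
      simp only [Set.mem_ofPred_eq, e]
      exact Perm.SameCycle.trans hz (sameCycle_step π _)
  · intro k
    exact sameCycle_closed π {z | π'.SameCycle (f x) (f z)} (fun z hz => by
      have := sameCycle_step π' (f z)
      rw [h] at this
      exact Perm.SameCycle.trans hz this) k (Perm.SameCycle.refl _ _)

theorem numCycles_conj {α β : Type} [Finite α] [Finite β] (f : α ≃ β) {π : Perm α} {π' : Perm β}
    (h : ∀ x, π' (f x) = f (π x)) (P : Set α) (P' : Set β) (hP : ∀ x, f x ∈ P' ↔ x ∈ P) :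
    numCycles π' P' = numCycles π P := by
  have : P' = f '' P := by
    ext y
    obtain ⟨x, rfl⟩ := f.surjective y
    rw [hP]
    simp
  rw [this]
  exact ncard_image_congr (cyc π') (cyc π) f P fun x _ y _ => by
    rw [cyc_eq_iff, cyc_eq_iff, sameCycle_conj f h]

end Unlink

/-- Two quotients of a set by the same relation are in bijection. -/
noncomputable def quotEquiv {V W W' : Type} (q : V → W) (q' : V → W') (hq : Function.Surjective q)
    (hq' : Function.Surjective q') (h : ∀ a b, q a = q b ↔ q' a = q' b) : W ≃ W' :=
  Equiv.ofBijective (fun w => q' (hq w).choose) ⟨fun w w' e => by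
    have := (h _ _).2 e
    rwa [(hq w).choose_spec, (hq w').choose_spec] at this, fun w' => by
    obtain ⟨v, rfl⟩ := hq' w'
    exact ⟨q v, (h _ _).1 (hq (q v)).choose_spec⟩⟩

theorem quotEquiv_apply {V W W' : Type} (q : V → W) (q' : V → W') (hq : Function.Surjective q)
    (hq' : Function.Surjective q') (h : ∀ a b, q a = q b ↔ q' a = q' b) (v : V) :
    quotEquiv q q' hq hq' h (q v) = q' v := (h _ _).1 (hq (q v)).choose_spec

/-! ### Contractions of surface graphs: invariance, commutation, and a bound for the number of
edges. -/

namespace SurfaceGraph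

open Classical in
/-- The number of circles without half-edges on the surfaces of the vertices in `Q`. -/
noncomputable def freeSum (γ : SurfaceGraph) (Q : Set γ.V) : ℕ :=
  ∑ᶠ v, if v ∈ Q then γ.freeBdry v else 0

open Classical in
/-- The Euler characteristic of the surfaces of the vertices in `Q`. -/
noncomputable def chiSum (γ : SurfaceGraph) (Q : Set γ.V) : ℤ :=
  ∑ᶠ v, if v ∈ Q then (2 - 2 * (γ.genus v : ℤ) - (γ.numBdry v : ℤ)) else 0

theorem freeSum_singleton (γ : SurfaceGraph) (v : γ.V) : γ.freeSum {v} = γ.freeBdry v := by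
  exact (finsum_eq_single _ v (fun w hw => if_neg hw)).trans (if_pos rfl)

theorem chiSum_singleton (γ : SurfaceGraph) (v : γ.V) :
    γ.chiSum {v} = 2 - 2 * (γ.genus v : ℤ) - (γ.numBdry v : ℤ) := by
  exact (finsum_eq_single _ v (fun w hw => if_neg hw)).trans (if_pos rfl)

open Classical in
/-- The vertex of the contracted graph that a vertex becomes. -/
noncomputable def quot (γ : SurfaceGraph) (h : γ.H) (v : γ.V) : (γ.contractAt h).V :=
  if hv : v = γ.vert (γ.opp h) then ⟨γ.vert h, Or.inl rfl⟩ else ⟨v, Or.inr hv⟩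

theorem quot_vert (γ : SurfaceGraph) (h : γ.H) (x : (γ.contractAt h).H) :
    (γ.contractAt h).vert x = γ.quot h (γ.vert x.1) := rfl

theorem quot_of_eq (γ : SurfaceGraph) (h : γ.H) {v : γ.V} (hv : v = γ.vert (γ.opp h)) :
    γ.quot h v = ⟨γ.vert h, Or.inl rfl⟩ := dif_pos hv

theorem quot_of_ne (γ : SurfaceGraph) (h : γ.H) {v : γ.V} (hv : v ≠ γ.vert (γ.opp h)) :
    γ.quot h v = ⟨v, Or.inr hv⟩ := dif_neg hv

theorem quot_val (γ : SurfaceGraph) (h : γ.H) (u : (γ.contractAt h).V) : γ.quot h u.1 = u := by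
  by_cases c : u.1 = γ.vert (γ.opp h)
  · rw [quot_of_eq _ _ c]
    exact Subtype.ext (u.2.resolve_right (not_not.2 c)).symm
  · exact quot_of_ne _ _ c

theorem quot_surjective (γ : SurfaceGraph) (h : γ.H) : Function.Surjective (γ.quot h) :=
  fun u => ⟨u.1, γ.quot_val h u⟩

theorem quot_opp (γ : SurfaceGraph) (h : γ.H) :
    γ.quot h (γ.vert (γ.opp h)) = γ.quot h (γ.vert h) := by
  rw [quot_of_eq _ _ rfl]
  exact (γ.quot_val h ⟨γ.vert h, Or.inl rfl⟩).symm

theorem quot_eq_iff (γ : SurfaceGraph) (h : γ.H) (v w : γ.V) : γ.quot h v = γ.quot h w ↔ v = w ∨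
    ((v = γ.vert h ∨ v = γ.vert (γ.opp h)) ∧ (w = γ.vert h ∨ w = γ.vert (γ.opp h))) := by
  have e : ∀ v, v = γ.vert h ∨ v = γ.vert (γ.opp h) → γ.quot h v = γ.quot h (γ.vert h) := by
    rintro v (rfl | rfl)
    · rfl
    · exact γ.quot_opp h
  constructor
  · intro k
    by_cases c1 : v = γ.vert (γ.opp h) <;> by_cases c2 : w = γ.vert (γ.opp h)
    · exact Or.inl (c1.trans c2.symm)
    · rw [quot_of_eq _ _ c1, quot_of_ne _ _ c2] at k
      exact Or.inr ⟨Or.inr c1, Or.inl (congrArg Subtype.val k).symm⟩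
    · rw [quot_of_ne _ _ c1, quot_of_eq _ _ c2] at k
      exact Or.inr ⟨Or.inl (congrArg Subtype.val k), Or.inr c2⟩
    · rw [quot_of_ne _ _ c1, quot_of_ne _ _ c2] at k
      exact Or.inl (congrArg Subtype.val k)
  · rintro (rfl | ⟨h1, h2⟩)
    · rfl
    · rw [e v h1, e w h2]

open Classical in
theorem finsum_quot (γ : SurfaceGraph) (h : γ.H) {M : Type} [AddCommMonoid M]
    (Q : Set (γ.contractAt h).V) (f : γ.V → M) (f' : (γ.contractAt h).V → M) (c : M)
    (hf : ∀ u, u.1 ≠ γ.vert h → f' u = f u.1)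
    (hv : f' ⟨γ.vert h, Or.inl rfl⟩ =
      f (γ.vert h) + (if γ.vert h = γ.vert (γ.opp h) then 0 else f (γ.vert (γ.opp h))) + c) :
    (∑ᶠ u, if u ∈ Q then f' u else 0) = (∑ᶠ v, if γ.quot h v ∈ Q then f v else 0) +
      if γ.quot h (γ.vert h) ∈ Q then c else 0 := by
  refine finsum_collapse (γ.vert h) (γ.vert (γ.opp h)) (fun v => if γ.quot h v ∈ Q then f v else 0)
    (fun u => if u ∈ Q then f' u else 0) _ (fun u hu => ?_) ?_
  · have e := γ.quot_val h u
    change _ = if γ.quot h u.1 ∈ Q then f u.1 else 0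
    rw [e, hf u hu]
    rfl
  · have e : (⟨γ.vert h, Or.inl rfl⟩ : (γ.contractAt h).V) = γ.quot h (γ.vert h) :=
      (γ.quot_val h ⟨γ.vert h, Or.inl rfl⟩).symm
    simp only [γ.quot_opp h]
    by_cases hQ : γ.quot h (γ.vert h) ∈ Q
    · simp only [if_pos hQ]
      rw [← hv]
      exact if_pos (e ▸ hQ)
    · simp only [if_neg hQ]
      rw [ite_self, add_zero, add_zero]
      exact if_neg (e ▸ hQ)

open Classical in
theorem freeSum_contractAt (γ : SurfaceGraph) (h : γ.H) (Q : Set (γ.contractAt h).V) :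
    (γ.contractAt h).freeSum Q = γ.freeSum (γ.quot h ⁻¹' Q) +
      if γ.quot h (γ.vert h) ∈ Q then γ.newFree h else 0 :=
  γ.finsum_quot h Q γ.freeBdry _ _ (fun _ hu => if_neg hu) (if_pos rfl)

open Classical in
theorem chiSum_contractAt (γ : SurfaceGraph) (h : γ.H) (Q : Set (γ.contractAt h).V) :
    (γ.contractAt h).chiSum Q = γ.chiSum (γ.quot h ⁻¹' Q) +
      if γ.quot h (γ.vert h) ∈ Q then -1 else 0 := by
  refine γ.finsum_quot h Q (fun v => 2 - 2 * (γ.genus v : ℤ) - (γ.numBdry v : ℤ)) _ _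
    (fun u hu => ?_) ?_
  · rw [γ.numBdry_contractAt_old h u hu, show (γ.contractAt h).genus u = γ.genus u.1 from if_neg hu]
  · have hb := γ.numBdry_contractAt_new h ⟨γ.vert h, Or.inl rfl⟩ rfl
    have hg := γ.genus_contractAt_new h ⟨γ.vert h, Or.inl rfl⟩ rfl
    have hs : γ.rot.SameCycle h (γ.opp h) → γ.vert h = γ.vert (γ.opp h) :=
      fun k => (γ.vert_eq_of_sameCycle k).symm
    by_cases c1 : γ.vert h = γ.vert (γ.opp h) <;>
    by_cases c2 : γ.rot.SameCycle h (γ.opp h) <;>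
    simp only [if_pos, if_neg, c1, c2, not_false_iff] at hb hg ⊢ <;>
    first
      | omega
      | exact absurd (hs c2) c1

theorem numBdry_eq_freeSum (γ : SurfaceGraph) (v : γ.V) :
    γ.numBdry v = numCycles γ.rot {x | γ.vert x ∈ ({v} : Set γ.V)} + γ.freeSum {v} := by
  rw [freeSum_singleton]; rfl

/-- Boundary circles of the surface glued from some vertex surfaces and some strips, counted before
and after the contraction of an edge. -/
theorem numCycles_add_freeSum_contractAt (γ : SurfaceGraph) (h : γ.H) (Q : Set (γ.contractAt h).V)
    (τ : Perm γ.H) (τ' : Perm (γ.contractAt h).H) (hτ : ∀ x, (τ' x).1 = τ x.1) (h0 : τ h = h)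
    (h1 : τ (γ.opp h) = γ.opp h) [DecidableEq γ.H] :
    numCycles ((γ.contractAt h).rot * τ') {x | (γ.contractAt h).vert x ∈ Q} +
        (γ.contractAt h).freeSum Q =
      numCycles (γ.rot * swap h (γ.opp h) * τ) {x | γ.vert x ∈ γ.quot h ⁻¹' Q} +
        γ.freeSum (γ.quot h ⁻¹' Q) := by
  classical
  set P : Set γ.H := {x | γ.vert x ∈ γ.quot h ⁻¹' Q} with hP
  set π := γ.rot * swap h (γ.opp h) * τ with hπ
  set σ := unlink (γ.opp h) (unlink h π) with hσ
  -- Since `τ` fixes both ends of the contracted edge, taking them out of their cycles can be done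
  -- before or after composing with `τ`.
  have eσ : σ = γ.rotAfter h * τ := by
    rw [hσ, hπ, unlink_mul _ _ _ h0, unlink_mul _ _ _ h1, rotAfter]
    congr!
  have hmem : ∀ x, γ.edge (σ x) ≠ γ.edge h ↔ γ.edge x ≠ γ.edge h := fun x => by
    have f1 : σ h = h := by rw [eσ, Perm.mul_apply, h0, (γ.rotAfter_fix h).1]
    have f2 : σ (γ.opp h) = γ.opp h := by rw [eσ, Perm.mul_apply, h1, (γ.rotAfter_fix h).2]
    rw [edge_ne_iff, edge_ne_iff]
    refine and_congr (not_congr ⟨fun e => ?_, fun e => ?_⟩) (not_congr ⟨fun e => ?_, fun e => ?_⟩)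
    · exact σ.injective (e.trans f1.symm)
    · rw [e, f1]
    · exact σ.injective (e.trans f2.symm)
    · rw [e, f2]
  have e1 : numCycles ((γ.contractAt h).rot * τ') {x | (γ.contractAt h).vert x ∈ Q} =
      numCycles σ (P ∩ {x | γ.edge x ≠ γ.edge h}) := by
    have : (γ.contractAt h).rot * τ' = σ.subtypePerm hmem := by
      refine Equiv.ext fun x => Subtype.ext ?_
      change γ.rotAfter h (τ' x).1 = σ x.1
      rw [eσ, hτ]
      rfl
    rw [this]
    refine (numCycles_subtypePerm σ hmem _).trans ?_
    congr 1
    ext x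
    exact ⟨fun ⟨y, hy, e⟩ => e ▸ ⟨hy, y.2⟩, fun hx => ⟨⟨x, hx.2⟩, hx.1, rfl⟩⟩
  rw [e1, freeSum_contractAt]
  have q1 : ∀ x, γ.vert (γ.rot x) = γ.vert x := γ.vert_rot
  -- If the merged vertex lies in `Q`, the cycles lost by removing the two ends are exactly the new
  -- free circles. Otherwise the two ends are not among the counted half-edges and nothing changes.
  by_cases hQ : γ.quot h (γ.vert h) ∈ Q
  · rw [if_pos hQ, γ.numCycles_unlink_unlink h π (by simp [hπ, h0]) (by simp [hπ, h1]) P hQ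
      (by rw [hP, Set.mem_ofPred_eq, Set.mem_preimage, quot_opp]; exact hQ)
      (by rw [hP, Set.mem_ofPred_eq, Set.mem_preimage, q1]; exact hQ)
      (by rw [hP, Set.mem_ofPred_eq, Set.mem_preimage, q1, quot_opp]; exact hQ)]
    ring
  · have hn : ∀ x ∈ P, x ≠ h ∧ x ≠ γ.opp h := fun x hx => by
      constructor
      · rintro rfl; exact hQ hx
      · rintro rfl
        rw [hP, Set.mem_ofPred_eq, Set.mem_preimage, quot_opp] at hx
        exact hQ hx
    have e2 : P ∩ {x | γ.edge x ≠ γ.edge h} = P := by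
      refine Set.inter_eq_left.2 fun x hx => (γ.edge_ne_iff h x).2 (hn x hx)
    rw [if_neg hQ, e2, add_zero]
    congr 1
    refine numCycles_congr _ _ _ fun x hx y hy => ?_
    rw [hσ, sameCycle_unlink _ _ (hn x hx).2 (hn y hy).2, sameCycle_unlink _ _ (hn x hx).1 (hn y hy).1]

/-- The circles are counted on the original half-edges, without distinguishing whether the strip
joins two vertices, two circles or one circle with itself. Isomorphisms and further contractions can
therefore be treated uniformly. -/
theorem numBdry_contractAt (γ : SurfaceGraph) (h : γ.H) (v : (γ.contractAt h).V)
    [DecidableEq γ.H] :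
    (γ.contractAt h).numBdry v =
      numCycles (γ.rot * swap h (γ.opp h)) {x | γ.vert x ∈ γ.quot h ⁻¹' {v}} +
        γ.freeSum (γ.quot h ⁻¹' {v}) := by
  have := γ.numCycles_add_freeSum_contractAt h {v} 1 1 (fun _ => rfl) rfl rfl
  rw [mul_one, mul_one] at this
  rw [numBdry_eq_freeSum, this]

namespace Iso

/-- The identity isomorphism. -/
def refl (γ : SurfaceGraph) : Iso γ γ :=
  ⟨Equiv.refl _, Equiv.refl _, Equiv.refl _, fun _ => rfl, fun _ => rfl, fun _ => rfl,
    fun _ => rfl, fun _ => rfl⟩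

/-- Composition of isomorphisms. -/
def trans {γ γ' γ'' : SurfaceGraph} (φ : Iso γ γ') (ψ : Iso γ' γ'') : Iso γ γ'' where
  onH := φ.onH.trans ψ.onH
  onV := φ.onV.trans ψ.onV
  onE := φ.onE.trans ψ.onE
  vert_onH x := by simp [ψ.vert_onH, φ.vert_onH]
  edge_onH x := by simp [ψ.edge_onH, φ.edge_onH]
  rot_onH x := by simp [ψ.rot_onH, φ.rot_onH]
  genus_onV v := by simp [ψ.genus_onV, φ.genus_onV]
  freeBdry_onV v := by simp [ψ.freeBdry_onV, φ.freeBdry_onV]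

theorem numCycles_onV {γ γ' : SurfaceGraph} (onH : γ.H ≃ γ'.H) (onV : γ.V ≃ γ'.V)
    (vert_onH : ∀ x, γ'.vert (onH x) = onV (γ.vert x))
    (rot_onH : ∀ x, γ'.rot (onH x) = onH (γ.rot x)) (v : γ.V) :
    numCycles γ'.rot {x | γ'.vert x = onV v} = numCycles γ.rot {x | γ.vert x = v} :=
  numCycles_conj onH rot_onH _ _ fun x => by simp [vert_onH]

theorem numBdry_onV {γ γ' : SurfaceGraph} (φ : Iso γ γ') (v : γ.V) :
    γ'.numBdry (φ.onV v) = γ.numBdry v := by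
  rw [numBdry, numBdry, numCycles_onV φ.onH φ.onV φ.vert_onH φ.rot_onH, φ.freeBdry_onV]

/-- To give an isomorphism it suffices to match the numbers of boundary circles and the Euler
characteristics. -/
def ofChi {γ γ' : SurfaceGraph} (onH : γ.H ≃ γ'.H) (onV : γ.V ≃ γ'.V) (onE : γ.E ≃ γ'.E)
    (vert_onH : ∀ x, γ'.vert (onH x) = onV (γ.vert x))
    (edge_onH : ∀ x, γ'.edge (onH x) = onE (γ.edge x))
    (rot_onH : ∀ x, γ'.rot (onH x) = onH (γ.rot x))
    (bdry : ∀ v, γ'.numBdry (onV v) = γ.numBdry v)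
    (chi : ∀ v, γ'.chiSum {onV v} = γ.chiSum {v}) : Iso γ γ' where
  onH := onH
  onV := onV
  onE := onE
  vert_onH := vert_onH
  edge_onH := edge_onH
  rot_onH := rot_onH
  genus_onV v := by
    have := chi v
    rw [chiSum_singleton, chiSum_singleton, bdry] at this
    omega
  freeBdry_onV v := by
    have := bdry v
    rw [numBdry, numBdry, numCycles_onV onH onV vert_onH rot_onH] at this
    omega

theorem opp_onH {γ γ' : SurfaceGraph} (φ : Iso γ γ') (x : γ.H) :
    γ'.opp (φ.onH x) = φ.onH (γ.opp x) := by
  have e : γ'.edge (φ.onH x) = γ'.edge (φ.onH (γ.opp x)) := by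
    rw [φ.edge_onH, φ.edge_onH, γ.edge_opp]
  rcases (γ'.edge_eq_iff _ _).1 e with h | h
  · exact absurd (φ.onH.injective h) (γ.opp_ne x)
  · exact h.symm

theorem freeSum_onV {γ γ' : SurfaceGraph} (φ : Iso γ γ') (Q : Set γ.V) (Q' : Set γ'.V)
    (h : ∀ v, φ.onV v ∈ Q' ↔ v ∈ Q) : γ'.freeSum Q' = γ.freeSum Q := by
  rw [freeSum, freeSum, ← finsum_comp_equiv φ.onV]
  refine finsum_congr fun v => ?_
  by_cases hv : v ∈ Q
  · rw [if_pos hv, if_pos ((h v).2 hv), φ.freeBdry_onV]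
  · rw [if_neg hv, if_neg (fun k => hv ((h v).1 k))]

theorem chiSum_onV {γ γ' : SurfaceGraph} (φ : Iso γ γ') (Q : Set γ.V) (Q' : Set γ'.V)
    (h : ∀ v, φ.onV v ∈ Q' ↔ v ∈ Q) : γ'.chiSum Q' = γ.chiSum Q := by
  rw [chiSum, chiSum, ← finsum_comp_equiv φ.onV]
  refine finsum_congr fun v => ?_
  by_cases hv : v ∈ Q
  · rw [if_pos hv, if_pos ((h v).2 hv), φ.genus_onV, φ.numBdry_onV]
  · rw [if_neg hv, if_neg (fun k => hv ((h v).1 k))]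

end Iso

-- Either half of an edge may be used to contract it: the transposition is symmetric and the two
-- removals commute.
open Classical in
theorem rotAfter_opp (γ : SurfaceGraph) (h : γ.H) : γ.rotAfter (γ.opp h) = γ.rotAfter h := by
  rw [rotAfter, rotAfter, γ.opp_opp, unlink_comm, swap_comm]

/-- An isomorphism induces isomorphisms of the contractions of corresponding edges. -/
theorem exists_iso_contractAt {γ γ' : SurfaceGraph} (φ : Iso γ γ') (h : γ.H) (h' : γ'.H)
    (hh : γ'.edge h' = φ.onE (γ.edge h)) :
    ∃ ψ : Iso (γ.contractAt h) (γ'.contractAt h'), ∀ e, (ψ.onE e).1 = φ.onE e.1 := by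
  classical
  -- The hypothesis fixes only the edge of `h'`, not which half of it.
  have hor : h' = φ.onH h ∨ h' = φ.onH (γ.opp h) := by
    rw [← φ.edge_onH] at hh
    rcases (γ'.edge_eq_iff _ _).1 hh.symm with k | k
    · exact Or.inl k
    · exact Or.inr (k.trans (φ.opp_onH h))
  let onH : (γ.contractAt h).H ≃ (γ'.contractAt h').H := φ.onH.subtypeEquiv fun x => by
    rw [hh, φ.edge_onH]
    exact not_congr φ.onE.apply_eq_iff_eq.symm
  let onE : (γ.contractAt h).E ≃ (γ'.contractAt h').E := φ.onE.subtypeEquiv fun e => by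
    rw [hh]
    exact not_congr φ.onE.apply_eq_iff_eq.symm
  have hends : ∀ v, (φ.onV v = γ'.vert h' ∨ φ.onV v = γ'.vert (γ'.opp h')) ↔
      (v = γ.vert h ∨ v = γ.vert (γ.opp h)) := fun v => by
    rcases hor with rfl | rfl
    · rw [φ.opp_onH, φ.vert_onH, φ.vert_onH, φ.onV.apply_eq_iff_eq, φ.onV.apply_eq_iff_eq]
    · rw [φ.opp_onH, φ.vert_onH, φ.vert_onH, φ.onV.apply_eq_iff_eq, φ.onV.apply_eq_iff_eq, γ.opp_opp,
        or_comm]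
  have hq : ∀ a b, γ.quot h a = γ.quot h b ↔ γ'.quot h' (φ.onV a) = γ'.quot h' (φ.onV b) :=
    fun a b => by
      rw [quot_eq_iff, quot_eq_iff, hends, hends, φ.onV.apply_eq_iff_eq]
  let onV := quotEquiv (γ.quot h) (γ'.quot h' ∘ φ.onV) (γ.quot_surjective h)
    ((γ'.quot_surjective h').comp φ.onV.surjective) hq
  have honV : ∀ v, onV (γ.quot h v) = γ'.quot h' (φ.onV v) := quotEquiv_apply _ _ _ _ _
  have hQ : ∀ w v, φ.onV v ∈ γ'.quot h' ⁻¹' {onV w} ↔ v ∈ γ.quot h ⁻¹' {w} := fun w v => by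
    rw [Set.mem_preimage, Set.mem_preimage, Set.mem_singleton_iff, Set.mem_singleton_iff, ← honV,
      onV.apply_eq_iff_eq]
  have hswap : ∀ x, swap h' (γ'.opp h') (φ.onH x) = φ.onH (swap h (γ.opp h) x) := fun x => by
    rcases hor with rfl | rfl
    · rw [φ.opp_onH, swap_conj]
    · rw [φ.opp_onH, γ.opp_opp, swap_comm, swap_conj]
  have hrot : ∀ x, γ'.rotAfter h' (φ.onH x) = φ.onH (γ.rotAfter h x) := fun x => by
    have key : ∀ x, γ'.rotAfter (φ.onH h) (φ.onH x) = φ.onH (γ.rotAfter h x) := fun x => by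
      unfold rotAfter
      rw [φ.opp_onH]
      refine unlink_conj φ.onH (fun y => unlink_conj φ.onH (fun z => ?_) _ _) _ _
      rw [Perm.mul_apply, Perm.mul_apply, swap_conj, φ.rot_onH]
    rcases hor with rfl | rfl
    · exact key x
    · rw [← φ.opp_onH, rotAfter_opp]
      exact key x
  -- Genus and free circles of a contraction are defined by cases. The numbers of boundary circles
  -- and the Euler characteristics determine them and obey uniform formulas.
  refine ⟨Iso.ofChi onH onV onE (fun x => ?_) (fun x => Subtype.ext (φ.edge_onH x.1))
    (fun x => Subtype.ext (hrot x.1)) (fun w => ?_) (fun w => ?_), fun e => rfl⟩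
  · rw [quot_vert, quot_vert, honV, ← φ.vert_onH]
    rfl
  · rw [numBdry_contractAt, numBdry_contractAt, φ.freeSum_onV _ _ (hQ w)]
    congr 1
    refine numCycles_conj φ.onH (fun x => ?_) _ _ fun x => ?_
    · rw [Perm.mul_apply, Perm.mul_apply, hswap, φ.rot_onH]
    · simp only [Set.mem_ofPred_eq, φ.vert_onH, hQ]
  · rw [chiSum_contractAt, chiSum_contractAt, φ.chiSum_onV _ _ (hQ w)]
    congr 1
    have : γ'.quot h' (γ'.vert h') = onV (γ.quot h (γ.vert h)) := by
      rw [honV]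
      refine (γ'.quot_eq_iff h' _ _).2 (Or.inr ⟨Or.inl rfl, (hends _).2 (Or.inl rfl)⟩)
    rw [this]
    simp only [Set.mem_singleton_iff, onV.apply_eq_iff_eq]

/-- The right side is symmetric in the two edges, so the vertices of the two double contractions are
quotients by the same relation. -/
theorem quot_quot_eq_iff (γ : SurfaceGraph) (h : γ.H) (k : (γ.contractAt h).H) (a b : γ.V) :
    (γ.contractAt h).quot k (γ.quot h a) = (γ.contractAt h).quot k (γ.quot h b) ↔
      Relation.EqvGen (fun v w => (v = γ.vert h ∧ w = γ.vert (γ.opp h)) ∨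
        (v = γ.vert k.1 ∧ w = γ.vert (γ.opp k.1))) a b := by
  set R : γ.V → γ.V → Prop := fun v w => (v = γ.vert h ∧ w = γ.vert (γ.opp h)) ∨
    (v = γ.vert k.1 ∧ w = γ.vert (γ.opp k.1)) with hR
  have r1 : Relation.EqvGen R (γ.vert h) (γ.vert (γ.opp h)) := .rel _ _ (Or.inl ⟨rfl, rfl⟩)
  have r2 : Relation.EqvGen R (γ.vert k.1) (γ.vert (γ.opp k.1)) := .rel _ _ (Or.inr ⟨rfl, rfl⟩)
  have h1 : ∀ a b, γ.quot h a = γ.quot h b → Relation.EqvGen R a b := fun a b e => by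
    rcases (γ.quot_eq_iff h a b).1 e with rfl | ⟨rfl | rfl, rfl | rfl⟩
    · exact .refl _
    · exact .refl _
    · exact r1
    · exact r1.symm
    · exact .refl _
  constructor
  · intro e
    rcases ((γ.contractAt h).quot_eq_iff k _ _).1 e with e | ⟨e1, e2⟩
    · exact h1 _ _ e
    · have key : ∀ a, γ.quot h a = (γ.contractAt h).vert k ∨
          γ.quot h a = (γ.contractAt h).vert ((γ.contractAt h).opp k) →
          Relation.EqvGen R a (γ.vert k.1) := by
        rintro a (e | e)
        · exact h1 _ _ e
        · exact (h1 a (γ.vert (γ.opp k.1)) e).trans _ _ _ r2.symm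
      exact (key a e1).trans _ _ _ (key b e2).symm
  · intro e
    induction e with
    | rel a b hab =>
      rcases hab with ⟨rfl, rfl⟩ | ⟨rfl, rfl⟩
      · rw [quot_opp]
      · exact ((γ.contractAt h).quot_opp k).symm
    | refl => rfl
    | symm _ _ _ ih => exact ih.symm
    | trans _ _ _ _ _ ih1 ih2 => exact ih1.trans ih2

/-- The strip of the second edge is carried along as the permutation `τ` while the first contraction
is undone; its transposition fixes both halves of the first edge. -/
theorem numBdry_contractAt_contractAt (γ : SurfaceGraph) (h : γ.H) (k : (γ.contractAt h).H)
    (w : ((γ.contractAt h).contractAt k).V) [DecidableEq γ.H] :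
    ((γ.contractAt h).contractAt k).numBdry w =
      numCycles (γ.rot * swap h (γ.opp h) * swap k.1 (γ.opp k.1))
        {x | γ.vert x ∈ γ.quot h ⁻¹' ((γ.contractAt h).quot k ⁻¹' {w})} +
      γ.freeSum (γ.quot h ⁻¹' ((γ.contractAt h).quot k ⁻¹' {w})) := by
  classical
  have hk := (γ.edge_ne_iff h k.1).1 k.2
  have hok : γ.opp k.1 ≠ h ∧ γ.opp k.1 ≠ γ.opp h :=
    (γ.edge_ne_iff h _).1 (by rw [edge_opp]; exact k.2)
  rw [numBdry_contractAt]
  refine γ.numCycles_add_freeSum_contractAt h ((γ.contractAt h).quot k ⁻¹' {w})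
    (swap k.1 (γ.opp k.1)) _ (fun x => ?_) (swap_apply_of_ne_of_ne hk.1.symm hok.1.symm)
    (swap_apply_of_ne_of_ne hk.2.symm hok.2.symm)
  exact swap_subtype_val _ _ _

open Classical in
theorem chiSum_contractAt_contractAt (γ : SurfaceGraph) (h : γ.H) (k : (γ.contractAt h).H)
    (w : ((γ.contractAt h).contractAt k).V) :
    ((γ.contractAt h).contractAt k).chiSum {w} =
      γ.chiSum (γ.quot h ⁻¹' ((γ.contractAt h).quot k ⁻¹' {w})) +
      (if γ.vert h ∈ γ.quot h ⁻¹' ((γ.contractAt h).quot k ⁻¹' {w}) then -1 else 0) +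
      (if γ.vert k.1 ∈ γ.quot h ⁻¹' ((γ.contractAt h).quot k ⁻¹' {w}) then -1 else 0) := by
  rw [chiSum_contractAt, chiSum_contractAt]
  rfl

/-- Both transpositions are performed before all four removals. In this form the order of the edges
is irrelevant, since disjoint transpositions commute and so do removals. -/
theorem rotAfter_contractAt (γ : SurfaceGraph) (h : γ.H) (k x : (γ.contractAt h).H)
    [DecidableEq γ.H] :
    ((γ.contractAt h).rotAfter k x).1 = unlink (γ.opp k.1) (unlink k.1
      (unlink (γ.opp h) (unlink h (γ.rot * swap h (γ.opp h) * swap k.1 (γ.opp k.1))))) x.1 := by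
  classical
  have hk := (γ.edge_ne_iff h k.1).1 k.2
  have hok : γ.opp k.1 ≠ h ∧ γ.opp k.1 ≠ γ.opp h :=
    (γ.edge_ne_iff h _).1 (by rw [edge_opp]; exact k.2)
  rw [unlink_mul _ _ _ (swap_apply_of_ne_of_ne hk.1.symm hok.1.symm),
    unlink_mul _ _ _ (swap_apply_of_ne_of_ne hk.2.symm hok.2.symm)]
  refine unlink_subtype_val (unlink_subtype_val (fun y => ?_) _) _ _
  rw [Perm.mul_apply]
  have e : (swap k ((γ.contractAt h).opp k) y).1 = swap k.1 (γ.opp k.1) y.1 := by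
    exact swap_subtype_val _ _ _
  rw [← e]
  change γ.rotAfter h _ = _
  rw [rotAfter]
  congr!

/-- Contractions of different edges commute. -/
theorem exists_iso_contractAt_comm (γ : SurfaceGraph) (h k : γ.H) (hk : γ.edge k ≠ γ.edge h) :
    ∃ φ : Iso ((γ.contractAt h).contractAt ⟨k, hk⟩) ((γ.contractAt k).contractAt ⟨h, hk.symm⟩),
      ∀ e, (φ.onE e).1.1 = e.1.1 := by
  classical
  let k' : (γ.contractAt h).H := ⟨k, hk⟩
  let h' : (γ.contractAt k).H := ⟨h, hk.symm⟩
  let onH : ((γ.contractAt h).contractAt k').H ≃ ((γ.contractAt k).contractAt h').H :=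
    { toFun := fun x => ⟨⟨x.1.1, fun e => x.2 (Subtype.ext e)⟩, fun e => x.1.2 (congrArg Subtype.val e)⟩
      invFun := fun x => ⟨⟨x.1.1, fun e => x.2 (Subtype.ext e)⟩, fun e => x.1.2 (congrArg Subtype.val e)⟩
      left_inv := fun _ => rfl
      right_inv := fun _ => rfl }
  let onE : ((γ.contractAt h).contractAt k').E ≃ ((γ.contractAt k).contractAt h').E :=
    { toFun := fun x => ⟨⟨x.1.1, fun e => x.2 (Subtype.ext e)⟩, fun e => x.1.2 (congrArg Subtype.val e)⟩
      invFun := fun x => ⟨⟨x.1.1, fun e => x.2 (Subtype.ext e)⟩, fun e => x.1.2 (congrArg Subtype.val e)⟩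
      left_inv := fun _ => rfl
      right_inv := fun _ => rfl }
  let q := (γ.contractAt h).quot k' ∘ γ.quot h
  let q' := (γ.contractAt k).quot h' ∘ γ.quot k
  let onV := quotEquiv q q' (((γ.contractAt h).quot_surjective k').comp (γ.quot_surjective h))
    (((γ.contractAt k).quot_surjective h').comp (γ.quot_surjective k)) fun a b => by
      refine (γ.quot_quot_eq_iff h k' a b).trans (Iff.trans ?_ (γ.quot_quot_eq_iff k h' a b).symm)
      simp only [k', h', or_comm]
  have honV : ∀ v, onV (q v) = q' v := quotEquiv_apply _ _ _ _ _
  have hQ : ∀ w, γ.quot k ⁻¹' ((γ.contractAt k).quot h' ⁻¹' {onV w}) =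
      γ.quot h ⁻¹' ((γ.contractAt h).quot k' ⁻¹' {w}) := fun w => by
    ext v
    change q' v = onV w ↔ q v = w
    rw [← honV, onV.apply_eq_iff_eq]
  -- Different edges have disjoint pairs of halves.
  have hcomm : γ.rot * swap k (γ.opp k) * swap h (γ.opp h) =
      γ.rot * swap h (γ.opp h) * swap k (γ.opp k) := by
    have hk' := (γ.edge_ne_iff h k).1 hk
    have hok : γ.opp k ≠ h ∧ γ.opp k ≠ γ.opp h :=
      (γ.edge_ne_iff h _).1 (by rw [edge_opp]; exact hk)
    rw [mul_assoc, mul_assoc]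
    congr 1
    refine (Perm.Disjoint.commute ?_).eq
    intro x
    by_cases c1 : x = k
    · right; rw [c1]; exact swap_apply_of_ne_of_ne hk'.1 hk'.2
    · by_cases c2 : x = γ.opp k
      · right; rw [c2]; exact swap_apply_of_ne_of_ne hok.1 hok.2
      · left; exact swap_apply_of_ne_of_ne c1 c2
  refine ⟨Iso.ofChi onH onV onE (fun x => ?_) (fun x => rfl) (fun x => ?_) (fun w => ?_)
    (fun w => ?_), fun e => rfl⟩
  · exact (honV (γ.vert x.1.1)).symm
  · refine Subtype.ext (Subtype.ext ?_)
    refine (γ.rotAfter_contractAt k h' (onH x).1).trans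
      (Eq.trans ?_ (γ.rotAfter_contractAt h k' x.1).symm)
    change unlink (γ.opp h) (unlink h (unlink (γ.opp k) (unlink k
      (γ.rot * swap k (γ.opp k) * swap h (γ.opp h))))) x.1.1 = unlink (γ.opp k) (unlink k
      (unlink (γ.opp h) (unlink h (γ.rot * swap h (γ.opp h) * swap k (γ.opp k))))) x.1.1
    rw [hcomm, unlink_comm h (γ.opp k), unlink_comm h k, unlink_comm (γ.opp h) (γ.opp k),
      unlink_comm (γ.opp h) k]
  · refine (γ.numBdry_contractAt_contractAt k h' (onV w)).trans
      (Eq.trans ?_ (γ.numBdry_contractAt_contractAt h k' w).symm)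
    rw [hQ, hcomm]
  · refine (γ.chiSum_contractAt_contractAt k h' (onV w)).trans
      (Eq.trans ?_ (γ.chiSum_contractAt_contractAt h k' w).symm)
    rw [hQ, add_right_comm]

/-- A stable graph has at most `-3 χ` edges. -/
theorem card_edges_le (γ : SurfaceGraph) (hγ : γ.IsStable) :
    (Nat.card γ.E : ℤ) ≤ -3 * γ.eulerChar := by
  classical
  have := Fintype.ofFinite γ.V
  have := Fintype.ofFinite γ.E
  have := Fintype.ofFinite γ.H
  have hv : ∑ v, (γ.valency v : ℤ) = 2 * (Nat.card γ.E : ℤ) := by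
    have e1 : Nat.card γ.H = ∑ v, γ.valency v := by
      rw [Nat.card_congr (Equiv.sigmaFiberEquiv γ.vert).symm, Nat.card_sigma]
      exact Finset.sum_congr rfl fun v _ => Nat.card_coe_set_eq {x | γ.vert x = v}
    have e2 : Nat.card γ.H = ∑ e : γ.E, 2 := by
      rw [Nat.card_congr (Equiv.sigmaFiberEquiv γ.edge).symm, Nat.card_sigma]
      refine Finset.sum_congr rfl fun e _ => ?_
      refine (Nat.card_coe_set_eq {x | γ.edge x = e}).trans ?_
      obtain ⟨x, rfl⟩ := γ.edge_surj e
      rw [← Set.ncard_pair (γ.opp_ne x).symm]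
      congr 1
      ext y
      rw [Set.mem_ofPred_eq, eq_comm, γ.edge_eq_iff]
      rfl
    rw [Finset.sum_const, smul_eq_mul, Finset.card_univ, ← Nat.card_eq_fintype_card] at e2
    rw [← Nat.cast_sum, ← e1, e2]
    push_cast
    ring
  -- Write `b` for the number of boundary circles and `v` for the valency. Stability gives `4g + 2b
  -- + v ≥ 5` and nonempty boundary gives `2g + b ≥ 1`; the sum is `6g + 3b + v ≥ 6`.
  have h3 : 3 * ∑ v, (2 - 2 * (γ.genus v : ℤ) - (γ.numBdry v : ℤ)) ≤ ∑ v, (γ.valency v : ℤ) := by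
    rw [Finset.mul_sum]
    refine Finset.sum_le_sum fun v _ => ?_
    have h1 := hγ.bdry_pos v
    have h2 := hγ.stable v
    omega
  rw [eulerChar, finsum_eq_sum_of_fintype]
  omega

end SurfaceGraph

end OrbiCell

namespace OrbiCell

/-! ### Faces of cells: bounded dimension, isomorphisms, and faces of faces. -/

namespace Cell

variable {g n : ℕ}

/-- The dimension of the cells is bounded. -/
theorem card_black_le (γ : Cell g n) : Fintype.card γ.Black ≤ 6 * g + 3 * n := by
  have h1 := γ.graph.card_edges_le γ.isStableRibbon.toIsStable
  rw [γ.isStableRibbon.euler] at h1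
  have h2 : Nat.card γ.Black ≤ Nat.card γ.graph.E :=
    Nat.card_le_card_of_injective (fun b : γ.Black => b.1) Subtype.val_injective
  rw [← Nat.card_eq_fintype_card]
  omega

/-- The faces `γ/b` and `b\γ` of the cell `γ`. -/
noncomputable def face (γ : Cell g n) (b : γ.Black) : Bool → Cell g n
  | false => γ.contract b
  | true => γ.whiten b

/-- The black edges of a face of `γ` are those of `γ` with one exception. -/
noncomputable def faceBlack (γ : Cell g n) (b : γ.Black) :
    ∀ ε, {c : γ.Black // c ≠ b} ≃ (γ.face b ε).Black
  | false => γ.contractBlack b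
  | true => γ.whitenBlack b

theorem faceBlack_ne (γ : Cell g n) (b : γ.Black) (ε : Bool) {c d : γ.Black} (hc : c ≠ b)
    (hd : d ≠ b) (h : c ≠ d) : γ.faceBlack b ε ⟨c, hc⟩ ≠ γ.faceBlack b ε ⟨d, hd⟩ :=
  fun e => h (congrArg Subtype.val ((γ.faceBlack b ε).injective e))

/-- An isomorphism of cells induces isomorphisms of their faces. -/
theorem exists_iso_face {γ γ' : Cell g n} (φ : Iso γ γ') (b : γ.Black) (ε : Bool) :
    ∃ ψ : Iso (γ.face b ε) (γ'.face (φ.onBlack b) ε), ∀ (c : γ.Black) (h : c ≠ b),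
      ψ.onBlack (γ.faceBlack b ε ⟨c, h⟩) =
        γ'.faceBlack (φ.onBlack b) ε ⟨φ.onBlack c, fun e => h (φ.onBlack.injective e)⟩ := by
  cases ε with
  | false =>
    obtain ⟨ψ, hψ⟩ := SurfaceGraph.exists_iso_contractAt φ.toIso (γ.half b) (γ'.half (φ.onBlack b))
      (by rw [edge_half, edge_half]; rfl)
    refine ⟨⟨ψ, fun e => ?_⟩, fun c h => Subtype.ext (Subtype.ext (hψ _))⟩
    exact (congrArg (· ∈ γ'.white) (hψ e)).to_iff.trans (φ.white_onE e.1)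
  | true =>
    refine ⟨⟨φ.toIso, fun e => ?_⟩, fun c h => rfl⟩
    exact or_congr φ.onE.apply_eq_iff_eq (φ.white_onE e)

/-- Passing to faces in different directions commutes. -/
theorem exists_iso_face_face (γ : Cell g n) {b e : γ.Black} (h : e ≠ b) (ε ε' : Bool) :
    ∃ φ : Iso ((γ.face b ε).face (γ.faceBlack b ε ⟨e, h⟩) ε')
        ((γ.face e ε').face (γ.faceBlack e ε' ⟨b, h.symm⟩) ε),
      ∀ (c : γ.Black) (hb : c ≠ b) (he : c ≠ e),
        φ.onBlack ((γ.face b ε).faceBlack _ ε'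
            ⟨γ.faceBlack b ε ⟨c, hb⟩, γ.faceBlack_ne b ε hb h he⟩) =
          (γ.face e ε').faceBlack _ ε
            ⟨γ.faceBlack e ε' ⟨c, he⟩, γ.faceBlack_ne e ε' he h.symm hb⟩ := by
  cases ε <;> cases ε'
  · let e' := γ.contractBlack b ⟨e, h⟩
    let b' := γ.contractBlack e ⟨b, h.symm⟩
    let k := (γ.contract b).half e'
    have hk : γ.graph.edge k.1 = e.1 := congrArg Subtype.val ((γ.contract b).edge_half e')
    -- The half-edge chosen for an edge may change after contracting another edge. `φ1` exchanges
    -- the contractions for one choice, and `ψ0` and `ψ` pass to the other choice.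
    obtain ⟨φ1, h1⟩ := γ.graph.exists_iso_contractAt_comm (γ.half b) k.1 k.2
    obtain ⟨ψ0, h0⟩ := SurfaceGraph.exists_iso_contractAt (SurfaceGraph.Iso.refl γ.graph) k.1
      (γ.half e) (by rw [edge_half, hk]; rfl)
    obtain ⟨ψ, h2⟩ := SurfaceGraph.exists_iso_contractAt ψ0 ⟨γ.half b, k.2.symm⟩
      ((γ.contract e).half b') (((γ.contract e).edge_half b').trans
        (Subtype.ext ((γ.edge_half b).symm.trans
        (h0 ((γ.graph.contractAt k.1).edge ⟨γ.half b, k.2.symm⟩)).symm)))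
    have key : ∀ f, ((φ1.trans ψ).onE f).1.1 = f.1.1 := fun f =>
      (congrArg Subtype.val (h2 (φ1.onE f))).trans ((h0 _).trans (h1 f))
    refine ⟨⟨φ1.trans ψ, fun f => ?_⟩, fun c hb he =>
      Subtype.ext (Subtype.ext (Subtype.ext (key _)))⟩
    exact (congrArg (· ∈ γ.white) (key f)).to_iff
  · refine ⟨⟨SurfaceGraph.Iso.refl _, fun (f : (γ.contract b).graph.E) => ?_⟩, fun c hb he => rfl⟩
    exact or_congr (Subtype.ext_iff (a1 := f) (a2 := (γ.contractBlack b ⟨e, h⟩).1)).symm Iff.rfl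
  · refine ⟨⟨SurfaceGraph.Iso.refl _, fun (f : (γ.contract e).graph.E) => ?_⟩, fun c hb he => rfl⟩
    exact or_congr (Subtype.ext_iff (a1 := f) (a2 := (γ.contractBlack e ⟨b, h.symm⟩).1)) Iff.rfl
  · refine ⟨⟨SurfaceGraph.Iso.refl _, fun f => ?_⟩, fun c hb he => rfl⟩
    exact or_left_comm

end Cell

/-! ### Extending forms from the faces of a cube to the cube. -/

section Extension

open Set MeasureTheory

/-- The point `0` or `∞` of `[0,∞]` in the direction `b`. -/
noncomputable def faceShift {B : Type} (b : B) : Bool → B → ℝ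
  | false => 0
  | true => unitVec b

theorem isFaceMap_faceShift {B B' : Type} [Fintype B] [Fintype B'] (b : B)
    (φ : {c // c ≠ b} ≃ B') (ε : Bool) : IsFaceMap (faceLin b φ) (faceShift b ε) := by
  cases ε
  · exact isFaceMap_zero b φ
  · exact isFaceMap_one b φ

variable {g n k : ℕ} {A : Set ℝ}

theorem isOrbiFormOn_of_face {ω : ∀ γ : Cell g n, FormField γ.Black k}
    (h1 : ∀ γ, IsFormOn A (ω γ))
    (h2 : ∀ (γ γ' : Cell g n) (φ : Cell.Iso γ γ'), pullback (reindex φ.onBlack) 0 (ω γ) = ω γ')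
    (h3 : ∀ (γ : Cell g n) (b : γ.Black) (ε : Bool),
      pullback (faceLin b (γ.faceBlack b ε)) (faceShift b ε) (ω γ) = ω (γ.face b ε)) :
    IsOrbiFormOn A ω :=
  ⟨h1, h2, fun γ b => h3 γ b false, fun γ b => h3 γ b true⟩

/-- The linear map forgetting the coordinate `b`. -/
noncomputable def forgetCoord {B B' : Type} (b : B) (φ : {c // c ≠ b} ≃ B') :
    (B → ℝ) →L[ℝ] (B' → ℝ) :=
  ContinuousLinearMap.pi fun b' => ContinuousLinearMap.proj (φ.symm b').1

theorem forgetCoord_apply {B B' : Type} (b : B) (φ : {c // c ≠ b} ≃ B') (x : B → ℝ) (b' : B') :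
    forgetCoord b φ x b' = x (φ.symm b').1 := rfl

theorem forgetCoord_apply_coe {B B' : Type} (b : B) (φ : {c // c ≠ b} ≃ B') (x : B → ℝ) (c : B)
    (hc : c ≠ b) : forgetCoord b φ x (φ ⟨c, hc⟩) = x c := by
  rw [forgetCoord_apply, φ.symm_apply_apply]

theorem faceLin_apply_coe {B B' : Type} [Fintype B] [Fintype B'] (b : B) (φ : {c // c ≠ b} ≃ B')
    (y : B' → ℝ) (c : B) (hc : c ≠ b) : faceLin b φ y c = y (φ ⟨c, hc⟩) := faceLin_ne b φ y hc

/-- The weight of the face `ε` in the direction `b`. -/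
noncomputable def weight {B : Type} (b : B) (x : B → ℝ) : Bool → ℝ
  | false => 1 - x b
  | true => x b

/-- The extension of forms from the faces to the cube, by interpolation in all directions. -/
noncomputable def extendFaces (γ : Cell g n) (ω : ∀ δ : Cell g n, FormField δ.Black k) :
    FormField γ.Black k :=
  onCube fun x => ∑ b, ∑ ε : Bool,
    weight b x ε • pullback (forgetCoord b (γ.faceBlack b ε)) 0 (ω (γ.face b ε)) x

theorem forgetCoord_mem_cube {B B' : Type} (b : B) (φ : {c // c ≠ b} ≃ B') {x : B → ℝ}
    (hx : x ∈ cube B) : forgetCoord b φ x + 0 ∈ cube B' := by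
  rw [add_zero, mem_cube] at *
  exact fun b' => hx _

theorem contDiff_weight {B : Type} [Fintype B] (b : B) (ε : Bool) :
    ContDiff ℝ ((⊤ : ℕ∞) : WithTop ℕ∞) fun x : B → ℝ => weight b x ε := by
  cases ε
  · exact contDiff_const.sub (contDiff_apply ℝ ℝ b)
  · exact contDiff_apply ℝ ℝ b

theorem isFormOn_extendFaces (γ : Cell g n) {ω : ∀ δ : Cell g n, FormField δ.Black k}
    (h : ∀ δ, IsFormOn ∅ (ω δ)) : IsFormOn ∅ (extendFaces γ ω) := by
  refine isFormOn_onCube (ContDiffOn.sum fun b _ => ContDiffOn.sum fun ε _ =>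
    (contDiff_weight b ε).contDiffOn.smul ?_)
  have e := (h (γ.face b ε)).contDiffOn.comp
    (contDiff_affine (forgetCoord b (γ.faceBlack b ε)) 0).contDiffOn
    (fun x hx => forgetCoord_mem_cube b (γ.faceBlack b ε) hx)
  exact (ContinuousAlternatingMap.compContinuousLinearMapCLM
    (forgetCoord b (γ.faceBlack b ε))).contDiff.comp_contDiffOn e

theorem weight_reindex {B B' : Type} (φ : B ≃ B') (b : B) (y : B' → ℝ) (ε : Bool) :
    weight b (reindex φ y + 0) ε = weight (φ b) y ε := by
  cases ε <;> simp [weight, reindex_apply]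

theorem weight_face {B B' : Type} [Fintype B] [Fintype B'] (e : B) (φ : {c // c ≠ e} ≃ B')
    (ε' : Bool) {b : B} (hb : b ≠ e) (y : B' → ℝ) (ε : Bool) :
    weight b (faceLin e φ y + faceShift e ε') ε = weight (φ ⟨b, hb⟩) y ε := by
  cases ε' <;> cases ε <;> simp [weight, faceShift, faceLin_ne e φ y hb, unitVec_ne hb]

theorem sum_weight_face {B B' : Type} [Fintype B] [Fintype B'] {M : Type} [AddCommMonoid M]
    [Module ℝ M] (e : B) (φ : {c // c ≠ e} ≃ B') (ε' : Bool) (y : B' → ℝ) (f : Bool → M) :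
    ∑ ε, weight e (faceLin e φ y + faceShift e ε') ε • f ε = f ε' := by
  cases ε' <;> simp [weight, faceShift, faceLin_self, unitVec_self]

theorem comp_sum_smul {B B' : Type} [Fintype B] [Fintype B'] {ι : Type} [Fintype ι]
    (L : (B' → ℝ) →L[ℝ] (B → ℝ)) (w : ι → Bool → ℝ)
    (f : ι → Bool → (B → ℝ) [⋀^Fin k]→L[ℝ] ℝ) :
    (∑ b, ∑ ε, w b ε • f b ε).compContinuousLinearMap L =
      ∑ b, ∑ ε, w b ε • (f b ε).compContinuousLinearMap L := by
  ext v
  simp only [ContinuousAlternatingMap.compContinuousLinearMap_apply,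
    ContinuousAlternatingMap.sum_apply, ContinuousAlternatingMap.smul_apply]

theorem pullback_congr {B B' : Type} [Fintype B] [Fintype B'] {L L' : (B' → ℝ) →L[ℝ] (B → ℝ)}
    {c c' : B → ℝ} (h : L = L') (h' : c = c') (ω : FormField B k) (y : B' → ℝ) :
    pullback L c ω y = pullback L' c' ω y := by rw [h, h']

theorem extendFaces_invariant {ω : ∀ δ : Cell g n, FormField δ.Black k}
    (hω : ∀ (γ γ' : Cell g n) (φ : Cell.Iso γ γ'), pullback (reindex φ.onBlack) 0 (ω γ) = ω γ')
    {γ γ' : Cell g n} (φ : Cell.Iso γ γ') :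
    pullback (reindex φ.onBlack) 0 (extendFaces γ ω) = extendFaces γ' ω := by
  funext y
  by_cases hy : y ∈ cube γ'.Black
  · have hy' := ((isFaceMap_reindex φ.onBlack).mem_cube_iff y).2 hy
    unfold pullback extendFaces
    rw [onCube_of_mem _ hy, onCube_of_mem _ hy', comp_sum_smul, ← φ.onBlack.sum_comp]
    refine Finset.sum_congr rfl fun b _ => Finset.sum_congr rfl fun ε _ => ?_
    rw [weight_reindex]
    congr 1
    obtain ⟨ψ, hψ⟩ := Cell.exists_iso_face φ b ε
    rw [← hω _ _ ψ]
    change pullback (reindex φ.onBlack) 0 (pullback (forgetCoord b (γ.faceBlack b ε)) 0 _) y =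
      pullback (forgetCoord (φ.onBlack b) _) 0 (pullback _ 0 _) y
    rw [pullback_pullback, pullback_pullback, map_zero, map_zero]
    refine pullback_congr (ContinuousLinearMap.ext fun y => funext fun c' => ?_) rfl _ _
    obtain ⟨⟨c, hc⟩, rfl⟩ := (γ.faceBlack b ε).surjective c'
    rw [ContinuousLinearMap.comp_apply, ContinuousLinearMap.comp_apply, forgetCoord_apply_coe,
      reindex_apply, reindex_apply, Function.comp_apply, Function.comp_apply, hψ, forgetCoord_apply_coe]
  · have hy' := fun h => hy (((isFaceMap_reindex φ.onBlack).mem_cube_iff y).1 h)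
    unfold pullback extendFaces
    rw [onCube_of_notMem _ hy, onCube_of_notMem _ hy']
    rfl

/-- On a face in direction `e` the weights of that direction select the form given there. In another
direction `b` the summand restricts to the face of a face; as faces commute up to isomorphism, these
summands form the extension on the face of the next lower forms `η`. -/
theorem extendFaces_face {ω η : ∀ δ : Cell g n, FormField δ.Black k}
    (hη : ∀ (γ γ' : Cell g n) (φ : Cell.Iso γ γ'), pullback (reindex φ.onBlack) 0 (η γ) = η γ')
    (hz : ∀ γ, ∀ x : γ.Black → ℝ, x ∉ cube γ.Black → ω γ x = 0)
    (γ : Cell g n) (e : γ.Black) (ε' : Bool)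
    (hω : ∀ (b : γ.Black) (ε : Bool) (h : e ≠ b),
      pullback (faceLin (γ.faceBlack b ε ⟨e, h⟩)
        ((γ.face b ε).faceBlack (γ.faceBlack b ε ⟨e, h⟩) ε')) (faceShift (γ.faceBlack b ε ⟨e, h⟩) ε')
        (ω (γ.face b ε)) = η ((γ.face b ε).face (γ.faceBlack b ε ⟨e, h⟩) ε')) :
    pullback (faceLin e (γ.faceBlack e ε')) (faceShift e ε') (extendFaces γ ω) =
      ω (γ.face e ε') + extendFaces (γ.face e ε') η := by
  classical
  funext y
  have hF := isFaceMap_faceShift e (γ.faceBlack e ε') ε'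
  rw [Pi.add_apply]
  by_cases hy : y ∈ cube (γ.face e ε').Black
  · have hy' := (hF.mem_cube_iff y).2 hy
    conv_lhs => unfold pullback
    unfold extendFaces
    rw [onCube_of_mem _ hy, onCube_of_mem _ hy', comp_sum_smul,
      Fintype.sum_eq_add_sum_subtype_ne _ e, ← (γ.faceBlack e ε').sum_comp]
    congr 1
    -- Forgetting the coordinate `e` is a left inverse of the inclusion of the face.
    · refine (sum_weight_face e (γ.faceBlack e ε') ε' y _).trans ?_
      change pullback (faceLin e (γ.faceBlack e ε')) (faceShift e ε')
        (pullback (forgetCoord e (γ.faceBlack e ε')) 0 _) y = _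
      rw [pullback_pullback]
      have e1 : (forgetCoord e (γ.faceBlack e ε')).comp (faceLin e (γ.faceBlack e ε')) =
          ContinuousLinearMap.id ℝ _ := by
        ext z c'
        obtain ⟨⟨c, hc⟩, rfl⟩ := (γ.faceBlack e ε').surjective c'
        rw [ContinuousLinearMap.comp_apply, forgetCoord_apply_coe, faceLin_apply_coe _ _ _ _ hc]
        rfl
      have e2 : forgetCoord e (γ.faceBlack e ε') (faceShift e ε') + 0 = 0 := by
        funext c'
        obtain ⟨⟨c, hc⟩, rfl⟩ := (γ.faceBlack e ε').surjective c'
        rw [add_zero, forgetCoord_apply_coe]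
        cases ε'
        · rfl
        · exact unitVec_ne hc
      rw [e1, e2]
      ext v
      simp [pullback]
    · refine Finset.sum_congr rfl fun ⟨b, hb⟩ _ => Finset.sum_congr rfl fun ε _ => ?_
      rw [weight_face e _ ε' hb]
      congr 1
      obtain ⟨φ, hφ⟩ := γ.exists_iso_face_face hb.symm ε ε'
      rw [← hη _ _ φ, ← hω b ε hb.symm]
      change pullback (faceLin e (γ.faceBlack e ε')) (faceShift e ε')
        (pullback (forgetCoord b (γ.faceBlack b ε)) 0 _) y =
          pullback (forgetCoord _ _) 0 (pullback (reindex _) 0 _) y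
      rw [pullback_pullback, pullback_pullback, pullback_pullback]
      refine pullback_congr (ContinuousLinearMap.ext fun z => funext fun c' => ?_) ?_ _ _
      · obtain ⟨⟨c, hc⟩, rfl⟩ := (γ.faceBlack b ε).surjective c'
        rw [ContinuousLinearMap.comp_apply, ContinuousLinearMap.comp_apply,
          ContinuousLinearMap.comp_apply, forgetCoord_apply_coe]
        by_cases hce : c = e
        · subst hce
          rw [faceLin_self, faceLin_self]
        · rw [faceLin_apply_coe _ _ _ _ hce,
            faceLin_apply_coe _ _ _ _ (γ.faceBlack_ne b ε hc hb.symm hce), reindex_apply,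
            Function.comp_apply, hφ c hc hce, forgetCoord_apply_coe]
      · rw [map_zero, add_zero, zero_add, map_zero, zero_add]
        funext c'
        obtain ⟨⟨c, hc⟩, rfl⟩ := (γ.faceBlack b ε).surjective c'
        rw [forgetCoord_apply_coe]
        cases ε'
        · rfl
        · by_cases hce : c = e
          · subst hce
            exact (unitVec_self _).trans (unitVec_self _).symm
          · exact (unitVec_ne hce).trans
              (unitVec_ne (γ.faceBlack_ne b ε hc hb.symm hce)).symm
  · have hy' := fun h => hy ((hF.mem_cube_iff y).1 h)
    unfold pullback extendFaces
    rw [onCube_of_notMem _ hy, onCube_of_notMem _ hy', hz _ _ hy, add_zero]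
    rfl

end Extension

end OrbiCell

namespace OrbiCell

/-! ### Whitney forms: a right inverse of integration. -/

section Whitney

open Set MeasureTheory

variable {B B' : Type} [Fintype B] [Fintype B'] {g n k : ℕ}

/-- The determinant as a form on `ℝ^k`. -/
noncomputable def detForm (k : ℕ) : (Fin k → ℝ) [⋀^Fin k]→L[ℝ] ℝ :=
  { (Pi.basisFun ℝ (Fin k)).det with
    cont := by
      change Continuous fun v : Fin k → Fin k → ℝ => (Pi.basisFun ℝ (Fin k)).det v
      simp only [Module.Basis.det_apply]
      refine Continuous.matrix_det (continuous_matrix fun i j => ?_)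
      simp only [Module.Basis.toMatrix_apply, Pi.basisFun_repr]
      fun_prop }

theorem detForm_unitVec (k : ℕ) : detForm k (fun i => unitVec i) = 1 := by
  classical
  have : (fun i : Fin k => (unitVec i : Fin k → ℝ)) = Pi.basisFun ℝ (Fin k) := by
    funext i j
    simp [unitVec, Pi.single_apply]
  rw [this]
  exact Module.Basis.det_self _

/-- The volume form on `ℝ^B` for an ordering of `B`. -/
noncomputable def volForm (o : Fin k ≃ B) : (B → ℝ) [⋀^Fin k]→L[ℝ] ℝ :=
  (detForm k).compContinuousLinearMap (reindex o)

theorem volForm_unitVec (o o' : Fin k ≃ B) :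
    volForm o (fun j => unitVec (o' j)) = ((Perm.sign (o'.trans o.symm) : ℤ) : ℝ) := by
  have h : (fun j => reindex o (unitVec (o' j)) : Fin k → Fin k → ℝ) =
      (fun i => unitVec i) ∘ (o'.trans o.symm) := by
    funext j
    have := reindex_unitVec o.symm (o' j)
    rwa [Equiv.symm_symm] at this
  change detForm k (fun j => reindex o (unitVec (o' j))) = _
  rw [h]
  refine ((detForm k).toAlternatingMap.map_perm _ _).trans ?_
  change _ • detForm k _ = _
  rw [detForm_unitVec, Units.smul_def, zsmul_eq_mul, mul_one]

open Classical in
/-- The constant form of top degree with given value. -/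
noncomputable def topForm (c : ∀ γ : Cell g n, (Fin k ≃ γ.Black) → ℝ) (γ : Cell g n) :
    FormField γ.Black k :=
  onCube fun _ => if h : Nonempty (Fin k ≃ γ.Black) then c γ h.some • volForm h.some else 0

theorem isFormOn_topForm (c : ∀ γ : Cell g n, (Fin k ≃ γ.Black) → ℝ) (γ : Cell g n) :
    IsFormOn ∅ (topForm c γ) := isFormOn_onCube contDiffOn_const

/-- The ordering used to define the form is arbitrary; the sign by which the volume form changes
with it is the sign by which the cochain changes. -/
theorem topForm_unitVec {c : ∀ γ : Cell g n, (Fin k ≃ γ.Black) → ℝ} (hc : c ∈ cochains g n k)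
    (γ : Cell g n) (o : Fin k ≃ γ.Black) {x : γ.Black → ℝ} (hx : x ∈ cube γ.Black) :
    topForm c γ x (fun j => unitVec (o j)) = c γ o := by
  have h : Nonempty (Fin k ≃ γ.Black) := ⟨o⟩
  rw [topForm, onCube_of_mem _ hx, dif_pos h, ContinuousAlternatingMap.smul_apply,
    volForm_unitVec, smul_eq_mul, mul_comm, ← hc.1]
  congr 1
  ext j
  simp

/-- The forms of degree greater than the dimension vanish. -/
theorem eq_zero_of_card_lt (h : Fintype.card B < k) (α : (B → ℝ) [⋀^Fin k]→L[ℝ] ℝ) : α = 0 :=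
  ext_unitVec fun s hs => absurd (Fintype.card_le_of_injective s hs) (by simpa using h)

/-- The forms of top degree are determined by one value for every ordering. -/
theorem ext_top {α β : (B → ℝ) [⋀^Fin k]→L[ℝ] ℝ} (hk : Fintype.card B ≤ k)
    (h : ∀ o : Fin k ≃ B, α (fun j => unitVec (o j)) = β fun j => unitVec (o j)) : α = β := by
  refine ext_unitVec fun s hs => ?_
  have e : Function.Bijective s := (Fintype.bijective_iff_injective_and_card s).2
    ⟨hs, le_antisymm (Fintype.card_le_of_injective s hs) (by simpa using hk)⟩
  exact h (Equiv.ofBijective s e)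

theorem topForm_invariant {c : ∀ γ : Cell g n, (Fin k ≃ γ.Black) → ℝ} (hc : c ∈ cochains g n k)
    {γ γ' : Cell g n} (φ : Cell.Iso γ γ') :
    pullback (reindex φ.onBlack) 0 (topForm c γ) = topForm c γ' := by
  funext y
  have hF := (isFaceMap_reindex φ.onBlack).mem_cube_iff y
  by_cases hy : y ∈ cube γ'.Black
  · by_cases hne : Nonempty (Fin k ≃ γ'.Black)
    · obtain ⟨o⟩ := hne
      refine ext_top (by simpa using (Fintype.card_congr o).ge) fun o => ?_
      rw [topForm_unitVec hc γ' o hy]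
      change topForm c γ (reindex φ.onBlack y + 0)
        (fun j => reindex φ.onBlack (unitVec (o j))) = _
      have e : (fun j => reindex φ.onBlack (unitVec (o j))) =
          fun j => unitVec ((o.trans φ.onBlack.symm) j) := funext fun j => by
        have := reindex_unitVec φ.onBlack.symm (o j)
        rwa [Equiv.symm_symm] at this
      rw [e, topForm_unitVec hc γ _ (hF.2 hy), ← hc.2 γ γ' φ]
      congr 1
      ext j
      simp
    · have hne' : ¬ Nonempty (Fin k ≃ γ.Black) := fun ⟨o⟩ => hne ⟨o.trans φ.onBlack⟩
      unfold pullback topForm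
      rw [onCube_of_mem _ hy, onCube_of_mem _ (hF.2 hy), dif_neg hne, dif_neg hne']
      rfl
  · unfold pullback topForm
    rw [onCube_of_notMem _ hy, onCube_of_notMem _ (fun h => hy (hF.1 h))]
    rfl

/-- The forms obtained from the top degree forms by extending them repeatedly from the faces; the
first index is the codimension plus one. -/
noncomputable def whitneyAux (c : ∀ γ : Cell g n, (Fin k ≃ γ.Black) → ℝ) :
    ℕ → ∀ γ : Cell g n, FormField γ.Black k
  | 0, _ => 0
  | 1, γ => topForm c γ
  | m + 2, γ => ((m : ℝ) + 1)⁻¹ • extendFaces γ (whitneyAux c (m + 1))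

theorem isFormOn_whitneyAux (c : ∀ γ : Cell g n, (Fin k ≃ γ.Black) → ℝ) :
    ∀ (m : ℕ) (γ : Cell g n), IsFormOn ∅ (whitneyAux c m γ)
  | 0, _ => .zero
  | 1, γ => isFormOn_topForm c γ
  | m + 2, γ => .smul _ (isFormOn_extendFaces γ (isFormOn_whitneyAux c (m + 1)))

theorem whitneyAux_invariant {c : ∀ γ : Cell g n, (Fin k ≃ γ.Black) → ℝ}
    (hc : c ∈ cochains g n k) : ∀ (m : ℕ) (γ γ' : Cell g n) (φ : Cell.Iso γ γ'),
      pullback (reindex φ.onBlack) 0 (whitneyAux c m γ) = whitneyAux c m γ'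
  | 0, _, _, _ => pullback_zero _ _
  | 1, _, _, φ => topForm_invariant hc φ
  | m + 2, γ, γ', φ => (pullback_smul _ _ _ _).trans
      (congrArg _ (extendFaces_invariant (whitneyAux_invariant hc (m + 1)) φ))

theorem card_face (γ : Cell g n) (b : γ.Black) (ε : Bool) :
    Fintype.card (γ.face b ε).Black + 1 = Fintype.card γ.Black := by
  classical
  rw [← Fintype.card_congr (γ.faceBlack b ε), Fintype.card_subtype_compl,
    Fintype.card_subtype_eq]
  have : 0 < Fintype.card γ.Black := Fintype.card_pos_iff.2 ⟨b⟩
  omega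

theorem extendFaces_zero (γ : Cell g n) :
    extendFaces γ (fun δ => (0 : FormField δ.Black k)) = 0 := by
  funext x
  by_cases hx : x ∈ cube γ.Black
  · rw [extendFaces, onCube_of_mem _ hx]
    simp [pullback_zero]
  · rw [extendFaces, onCube_of_notMem _ hx]
    rfl

theorem extendFaces_whitneyAux (c : ∀ γ : Cell g n, (Fin k ≃ γ.Black) → ℝ) (γ : Cell g n) :
    ∀ m : ℕ, extendFaces γ (whitneyAux c m) = (m : ℝ) • whitneyAux c (m + 1) γ
  | 0 => by
    rw [Nat.cast_zero, zero_smul]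
    exact extendFaces_zero γ
  | m + 1 => by
    rw [whitneyAux, smul_smul, Nat.cast_add_one, mul_inv_cancel₀ (by positivity), one_smul]

/-- By `extendFaces_face` the extension of the forms of level `m + 1` restricts to such a form plus
the extension of level `m`, which by construction is `m` times the same form. The factor `(m + 1)⁻¹`
removes this multiplicity. At the bottom, a form of degree `k` restricts to zero on a cube of
dimension `k - 1`. -/
theorem whitneyAux_face {c : ∀ γ : Cell g n, (Fin k ≃ γ.Black) → ℝ} (hc : c ∈ cochains g n k) :
    ∀ (m : ℕ) (γ : Cell g n) (e : γ.Black) (ε : Bool), Fintype.card γ.Black = k + m →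
      pullback (faceLin e (γ.faceBlack e ε)) (faceShift e ε) (whitneyAux c (m + 1) γ) =
        whitneyAux c m (γ.face e ε)
  | 0, γ, e, ε, h => by
    funext y
    have := card_face γ e ε
    rw [eq_zero_of_card_lt (by omega) (pullback _ _ _ y)]
    rfl
  | m + 1, γ, e, ε, h => by
    rw [whitneyAux, pullback_smul, extendFaces_face (η := whitneyAux c m)
      (whitneyAux_invariant hc m) (fun δ x hx => (isFormOn_whitneyAux c (m + 1) δ).zero_off x
        (by rwa [box_empty])) γ e ε
      (fun b ε' hb => whitneyAux_face hc m _ _ ε (by have := card_face γ b ε'; omega)),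
      extendFaces_whitneyAux]
    rw [show whitneyAux c (m + 1) (γ.face e ε) + (m : ℝ) • whitneyAux c (m + 1) (γ.face e ε) =
      ((m : ℝ) + 1) • whitneyAux c (m + 1) (γ.face e ε) by rw [add_smul, one_smul, add_comm],
      smul_smul, inv_mul_cancel₀ (by positivity), one_smul]

/-- The Whitney form of an orbi-cellular cochain. -/
noncomputable def whitney (c : ∀ γ : Cell g n, (Fin k ≃ γ.Black) → ℝ) (γ : Cell g n) :
    FormField γ.Black k := whitneyAux c (Fintype.card γ.Black + 1 - k) γ

theorem isOrbiFormOn_whitney {c : ∀ γ : Cell g n, (Fin k ≃ γ.Black) → ℝ}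
    (hc : c ∈ cochains g n k) : IsOrbiFormOn ∅ (whitney c) := by
  refine isOrbiFormOn_of_face (fun γ => isFormOn_whitneyAux c _ γ) (fun γ γ' φ => ?_)
    fun γ b ε => ?_
  · rw [whitney, whitney, ← Fintype.card_congr φ.onBlack]
    exact whitneyAux_invariant hc _ _ _ φ
  · have h := card_face γ b ε
    rw [whitney, whitney, h]
    by_cases hk : k ≤ Fintype.card γ.Black
    · obtain ⟨m, hm⟩ := Nat.exists_eq_add_of_le hk
      rw [show Fintype.card γ.Black + 1 - k = m + 1 by omega,
        show Fintype.card γ.Black - k = m by omega]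
      exact whitneyAux_face hc m γ b ε hm
    -- In dimension below `k` the truncated difference is zero, so the forms of the cell and of its
    -- face are both zero.
    · rw [show Fintype.card γ.Black + 1 - k = 0 by omega,
        show Fintype.card γ.Black - k = 0 by omega]
      exact pullback_zero _ _

theorem integrate_whitney {c : ∀ γ : Cell g n, (Fin k ≃ γ.Black) → ℝ}
    (hc : c ∈ cochains g n k) : integrate (whitney c) = c := by
  funext γ o
  have h : Fintype.card γ.Black = k := by simpa using (Fintype.card_congr o).symm
  have : ∀ x ∈ cube (Fin k), whitney c γ (x ∘ o.symm) (fun j => unitVec (o j)) = c γ o := by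
    intro x hx
    rw [whitney, show Fintype.card γ.Black + 1 - k = 1 by omega]
    exact topForm_unitVec hc γ o (mem_cube.2 fun b => mem_cube.1 hx _)
  rw [integrate, setIntegral_congr_fun (s := cube (Fin k)) measurableSet_Icc this, setIntegral_const,
    measureReal_def, volume_cube, one_smul]

theorem integrateLM_surjective (g n k : ℕ) : Function.Surjective (integrateLM g n k) :=
  fun c => ⟨⟨whitney c.1, isOrbiFormOn_whitney c.2⟩, Subtype.ext (integrate_whitney c.2)⟩

/-- Every cochain is the integral of its Whitney form. By Stokes its coboundary is again an
integral, so this property, and below `δ ∘ δ = 0`, are inherited from forms without computing with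
double faces. -/
theorem cochainD_mem {c : ∀ γ : Cell g n, (Fin k ≃ γ.Black) → ℝ} (hc : c ∈ cochains g n k) :
    cochainD c ∈ cochains g n (k + 1) := by
  rw [← integrate_whitney hc, ← integrate_extD (isOrbiFormOn_whitney hc)]
  exact integrate_mem_cochains (formD g n k ⟨_, isOrbiFormOn_whitney hc⟩).2

theorem cochainD_cochainD {c : ∀ γ : Cell g n, (Fin k ≃ γ.Black) → ℝ} (hc : c ∈ cochains g n k) :
    cochainD (cochainD c) = 0 := by
  let ω : orbiFormsOn ∅ g n k := ⟨_, isOrbiFormOn_whitney hc⟩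
  have h : cochainD c = integrate (formD g n k ω).1 := by
    rw [integrate_formD, integrate_whitney hc]
  rw [h, ← integrate_formD]
  have : formD g n (k + 1) (formD g n k ω) = 0 := orbiD_orbiD _ _ _ ω
  rw [this]
  exact congrArg Subtype.val (map_zero (integrateLM g n (k + 1 + 1)))

/-- The differential of orbi-cellular cochains. -/
noncomputable def cochainDLM (g n k : ℕ) : cochains g n k →ₗ[ℝ] cochains g n (k + 1) where
  toFun c := ⟨cochainD c.1, cochainD_mem c.2⟩
  map_add' c d := Subtype.ext <| funext fun γ => funext fun o => by
    change cochainD (c.1 + d.1) γ o = cochainD c.1 γ o + cochainD d.1 γ o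
    simp only [cochainD, Pi.add_apply, ← Finset.sum_add_distrib]
    exact Finset.sum_congr rfl fun i _ => by ring
  map_smul' r c := Subtype.ext <| funext fun γ => funext fun o => by
    change cochainD (r • c.1) γ o = r * cochainD c.1 γ o
    simp only [cochainD, Pi.smul_apply, smul_eq_mul, Finset.mul_sum]
    exact Finset.sum_congr rfl fun i _ => by ring

end Whitney

end OrbiCell

namespace OrbiCell

/-! ### Quasi-isomorphisms in terms of elements. -/

section QuasiIsoCriterion

/-- A morphism of short complexes of modules inducing a bijection on homology, in terms of
elements. -/
theorem quasiIso_of_elements {R : Type*} [Ring R] {S T : ShortComplex (ModuleCat.{1} R)} (φ : S ⟶ T)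
    (h1 : ∀ y : T.X₂, T.g y = 0 → ∃ x : S.X₂, S.g x = 0 ∧ ∃ z : T.X₁, T.f z = y - φ.τ₂ x)
    (h2 : ∀ x : S.X₂, S.g x = 0 → (∃ z : T.X₁, T.f z = φ.τ₂ x) → ∃ z : S.X₁, S.f z = x) :
    ShortComplex.QuasiIso φ := by
  have surj : ∀ U : ShortComplex (ModuleCat.{1} R), Function.Surjective U.homologyπ := fun U =>
    (ModuleCat.epi_iff_surjective _).1 inferInstance
  have inj : ∀ U : ShortComplex (ModuleCat.{1} R), Function.Injective U.iCycles := fun U =>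
    (ModuleCat.mono_iff_injective _).1 inferInstance
  have ex : ∀ (U : ShortComplex (ModuleCat.{1} R)) (c : U.cycles), U.homologyπ c = 0 →
      ∃ z : U.X₁, U.f z = U.iCycles c := fun U c hc => by
    have e : (ShortComplex.mk U.toCycles U.homologyπ (by simp)).Exact :=
      ShortComplex.exact_of_g_is_cokernel _ U.homologyIsCokernel
    obtain ⟨z, hz⟩ := (ShortComplex.moduleCat_exact_iff _).1 e c hc
    refine ⟨z, ?_⟩
    have : U.iCycles (U.toCycles z) = U.f z := congr($(U.toCycles_i) z)
    rw [← this]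
    exact congrArg U.iCycles hz
  have zer : ∀ (U : ShortComplex (ModuleCat.{1} R)) (c : U.cycles) (z : U.X₁),
      U.f z = U.iCycles c → U.homologyπ c = 0 := fun U c z hz => by
    have e : U.toCycles z = c := inj U ((congr($(U.toCycles_i) z) : _).trans hz)
    rw [← e]
    exact congr($(U.toCycles_comp_homologyπ) z)
  have lift : ∀ (U : ShortComplex (ModuleCat.{1} R)) (x : U.X₂), U.g x = 0 →
      ∃ c : U.cycles, U.iCycles c = x := fun U x hx => by
    refine ⟨U.moduleCatCyclesIso.inv ⟨x, hx⟩, ?_⟩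
    exact congr($(U.moduleCatCyclesIso_inv_iCycles) ⟨x, hx⟩)
  have gi : ∀ (U : ShortComplex (ModuleCat.{1} R)) (c : U.cycles), U.g (U.iCycles c) = 0 :=
    fun U c => congr($(U.iCycles_g) c)
  have nat1 : ∀ c : S.cycles, T.iCycles (ShortComplex.cyclesMap φ c) = φ.τ₂ (S.iCycles c) :=
    fun c => congr($(ShortComplex.cyclesMap_i φ) c)
  have nat2 : ∀ c : S.cycles, ShortComplex.homologyMap φ (S.homologyπ c) =
      T.homologyπ (ShortComplex.cyclesMap φ c) :=
    fun c => congr($(ShortComplex.homologyπ_naturality φ) c)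
  rw [ShortComplex.quasiIso_iff]
  have hb : Function.Bijective (ShortComplex.homologyMap φ) := by
    constructor
    · rw [injective_iff_map_eq_zero]
      intro a ha
      obtain ⟨c, rfl⟩ := surj S a
      rw [nat2] at ha
      obtain ⟨z, hz⟩ := ex T _ ha
      rw [nat1] at hz
      obtain ⟨w, hw⟩ := h2 _ (gi S c) ⟨z, hz⟩
      exact zer S c w hw
    · intro b
      obtain ⟨c, rfl⟩ := surj T b
      obtain ⟨x, hx, z, hz⟩ := h1 _ (gi T c)
      obtain ⟨c', rfl⟩ := lift S x hx
      refine ⟨S.homologyπ c', ?_⟩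
      rw [nat2, ← sub_eq_zero, ← map_sub, ← neg_eq_zero, ← map_neg]
      refine zer T _ z ?_
      rw [hz, map_neg, map_sub, nat1, neg_sub]
  have : IsIso ((forget (ModuleCat.{1} R)).map (ShortComplex.homologyMap φ)) :=
    (isIso_iff_bijective _).2 hb
  exact isIso_of_reflects_iso _ (forget (ModuleCat.{1} R))

/-- `x` is a coboundary. -/
def IsBdry {M : ℕ → Type 1} [∀ n, AddCommGroup (M n)] [∀ n, Module ℝ (M n)]
    (d : ∀ n, M n →ₗ[ℝ] M (n + 1)) : ∀ n, M n → Prop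
  | 0, x => x = 0
  | n + 1, x => ∃ z, d n z = x

variable {M N : ℕ → Type 1} [∀ n, AddCommGroup (M n)] [∀ n, Module ℝ (M n)]
  [∀ n, AddCommGroup (N n)] [∀ n, Module ℝ (N n)]
  {d : ∀ n, M n →ₗ[ℝ] M (n + 1)} {e : ∀ n, N n →ₗ[ℝ] N (n + 1)}

theorem IsBdry.zero (n : ℕ) : IsBdry d n 0 := by
  cases n
  · rfl
  · exact ⟨0, map_zero _⟩

theorem IsBdry.add {n : ℕ} {x y : M n} (hx : IsBdry d n x) (hy : IsBdry d n y) :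
    IsBdry d n (x + y) := by
  cases n
  · exact (congrArg₂ _ hx hy).trans (add_zero _)
  · obtain ⟨a, rfl⟩ := hx
    obtain ⟨b, rfl⟩ := hy
    exact ⟨a + b, map_add _ _ _⟩

/-- The cochain complex given by a sequence of vector spaces and linear maps. -/
noncomputable abbrev cpx (d : ∀ n, M n →ₗ[ℝ] M (n + 1)) (hd : ∀ n x, d (n + 1) (d n x) = 0) :
    CochainComplex (ModuleCat.{1} ℝ) ℕ :=
  CochainComplex.of (fun n => ModuleCat.of ℝ (M n)) (fun n => ModuleCat.ofHom (d n))
    fun n => ModuleCat.hom_ext (LinearMap.ext (hd n))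

theorem cpx_d (hd : ∀ n x, d (n + 1) (d n x) = 0) (n : ℕ) :
    (cpx d hd).d n (n + 1) = ModuleCat.ofHom (d n) :=
  CochainComplex.of_d (fun n => ModuleCat.of ℝ (M n)) (fun n => ModuleCat.ofHom (d n)) n

/-- The map of complexes given by a sequence of linear maps. -/
noncomputable abbrev cpxMap {hd : ∀ n x, d (n + 1) (d n x) = 0}
    {he : ∀ n x, e (n + 1) (e n x) = 0} (f : ∀ n, M n →ₗ[ℝ] N n)
    (comm : ∀ n x, f (n + 1) (d n x) = e n (f n x)) : cpx d hd ⟶ cpx e he :=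
  CochainComplex.ofHom (X := cpx d hd) (Y := cpx e he) (fun n => ModuleCat.ofHom (f n)) fun n => by
    rw [cpx_d, cpx_d]
    exact ModuleCat.hom_ext (LinearMap.ext fun x => (comm n x).symm)

theorem cpx_bdry_iff (hd : ∀ n x, d (n + 1) (d n x) = 0) (n : ℕ) (x : M n) :
    (∃ z : (cpx d hd).X ((ComplexShape.up ℕ).prev n),
      (cpx d hd).d ((ComplexShape.up ℕ).prev n) n z = x) ↔ IsBdry d n x := by
  cases n with
  | zero =>
    -- Degree zero has no predecessor, so the incoming differential is zero and the only coboundary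
    -- is zero.
    have h : (cpx d hd).d ((ComplexShape.up ℕ).prev 0) 0 = 0 :=
      (cpx d hd).shape _ _ (by simp)
    rw [h]
    exact ⟨fun ⟨_, hz⟩ => hz.symm, fun hx => ⟨0, Eq.symm hx⟩⟩
  | succ n =>
    have hp : (ComplexShape.up ℕ).prev (n + 1) = n := CochainComplex.prev_nat_succ n
    rw [hp, cpx_d]
    rfl

/-- A map of complexes is a quasi-isomorphism if it induces bijections on cohomology, in terms of
elements. -/
theorem quasiIso_cpxMap {hd : ∀ n x, d (n + 1) (d n x) = 0}
    {he : ∀ n x, e (n + 1) (e n x) = 0} (f : ∀ n, M n →ₗ[ℝ] N n)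
    (comm : ∀ n x, f (n + 1) (d n x) = e n (f n x))
    (h1 : ∀ n y, e n y = 0 → ∃ x, d n x = 0 ∧ IsBdry e n (y - f n x))
    (h2 : ∀ n x, d n x = 0 → IsBdry e n (f n x) → IsBdry d n x) :
    QuasiIso (cpxMap (hd := hd) (he := he) f comm) := by
  refine ⟨fun n => ?_⟩
  rw [quasiIsoAt_iff' _ _ n (n + 1) rfl (CochainComplex.next ℕ n)]
  have hdd : ∀ x : M n, (cpx d hd).d n (n + 1) x = d n x := fun x => by
    rw [cpx_d]; rfl
  have hee : ∀ x : N n, (cpx e he).d n (n + 1) x = e n x := fun x => by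
    rw [cpx_d]; rfl
  refine quasiIso_of_elements _ (fun y hy => ?_) fun x hx hz => ?_
  · obtain ⟨x, hx, hb⟩ := h1 n y ((hee y).symm.trans hy)
    exact ⟨x, (hdd x).trans hx, (cpx_bdry_iff he n _).2 hb⟩
  · exact (cpx_bdry_iff hd n _).2 (h2 n x ((hdd x).symm.trans hx) ((cpx_bdry_iff he n _).1 hz))

theorem quasiIso_cpxMap_of_bijective {hd : ∀ n x, d (n + 1) (d n x) = 0}
    {he : ∀ n x, e (n + 1) (e n x) = 0} (f : ∀ n, M n →ₗ[ℝ] N n)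
    (comm : ∀ n x, f (n + 1) (d n x) = e n (f n x)) (hf : ∀ n, Function.Bijective (f n)) :
    QuasiIso (cpxMap (hd := hd) (he := he) f comm) := by
  refine quasiIso_cpxMap f comm (fun n y hy => ?_) fun n x _ hb => ?_
  · obtain ⟨x, rfl⟩ := (hf n).2 y
    refine ⟨x, (hf _).1 ?_, ?_⟩
    · rw [comm, hy, map_zero]
    · rw [sub_self]
      exact .zero n
  · cases n
    · exact (hf 0).1 (hb.trans (map_zero _).symm)
    · obtain ⟨z, hz⟩ := hb
      obtain ⟨w, rfl⟩ := (hf _).2 z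
      exact ⟨w, (hf _).1 ((comm _ _).trans hz)⟩

/-- A surjective map of complexes with acyclic kernel is a quasi-isomorphism. -/
theorem quasiIso_cpxMap_of_surjective {hd : ∀ n x, d (n + 1) (d n x) = 0}
    {he : ∀ n x, e (n + 1) (e n x) = 0} (f : ∀ n, M n →ₗ[ℝ] N n)
    (comm : ∀ n x, f (n + 1) (d n x) = e n (f n x)) (hf : ∀ n, Function.Surjective (f n))
    (h0 : ∀ x, d 0 x = 0 → f 0 x = 0 → x = 0)
    (h1 : ∀ n x, d (n + 1) x = 0 → f (n + 1) x = 0 → ∃ z, f n z = 0 ∧ d n z = x) :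
    QuasiIso (cpxMap (hd := hd) (he := he) f comm) := by
  refine quasiIso_cpxMap f comm (fun n y hy => ?_) fun n x hx hb => ?_
  · obtain ⟨x, rfl⟩ := hf n y
    -- The preimage `x` need not be closed, but `d x` is a cocycle of the kernel, hence `d z` with
    -- `z` in the kernel. Then `x - z` is a closed preimage.
    obtain ⟨z, hz, hzx⟩ := h1 n (d n x) (hd n x) (by rw [comm, hy])
    refine ⟨x - z, by rw [map_sub, hzx, sub_self], ?_⟩
    rw [map_sub, hz, sub_zero, sub_self]
    exact .zero n
  · cases n
    · exact h0 x hx hb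
    · obtain ⟨z, hz⟩ := hb
      obtain ⟨w, rfl⟩ := hf _ z
      obtain ⟨v, hv, hvx⟩ := h1 _ (x - d _ w) (by rw [map_sub, hx, hd, sub_zero])
        (by rw [map_sub, comm, hz, sub_self])
      exact ⟨v + w, by rw [map_add, hvx, sub_add_cancel]⟩

end QuasiIsoCriterion

/-! ### Double complexes with exact rows and columns. -/

section DoubleComplex

variable {D : ℕ → ℕ → Type 1} [∀ p q, AddCommGroup (D p q)] [∀ p q, Module ℝ (D p q)]

/-- Elements of `Tot D n` are families indexed by `p`, `q` and a proof of `p + q = n`, so that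
components need not be transported along equalities of degrees. -/
instance (P : Prop) (X : Type 1) [AddCommGroup X] : AddCommGroup (P → X) where
  add f g h := f h + g h
  zero _ := 0
  neg f h := -f h
  sub f g h := f h - g h
  sub_eq_add_neg _ _ := funext fun _ => sub_eq_add_neg _ _
  nsmul n f h := n • f h
  zsmul n f h := n • f h
  add_assoc _ _ _ := funext fun _ => add_assoc _ _ _
  zero_add _ := funext fun _ => zero_add _
  add_zero _ := funext fun _ => add_zero _
  add_comm _ _ := funext fun _ => add_comm _ _
  neg_add_cancel _ := funext fun _ => neg_add_cancel _
  nsmul_zero _ := funext fun _ => zero_smul ℕ _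
  nsmul_succ n f := funext fun h => succ_nsmul (f h) n
  zsmul_zero' _ := funext fun _ => zero_smul ℤ _
  zsmul_succ' n f := funext fun h => SubNegMonoid.zsmul_succ' n (f h)
  zsmul_neg' n f := funext fun h => SubNegMonoid.zsmul_neg' n (f h)

instance (P : Prop) (X : Type 1) [AddCommGroup X] [Module ℝ X] : Module ℝ (P → X) where
  smul r f h := r • f h
  one_smul _ := funext fun _ => one_smul _ _
  mul_smul _ _ _ := funext fun _ => mul_smul _ _ _
  smul_zero _ := funext fun _ => smul_zero _
  smul_add _ _ _ := funext fun _ => smul_add _ _ _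
  add_smul _ _ _ := funext fun _ => add_smul _ _ _
  zero_smul _ := funext fun _ => zero_smul _ _

/-- The terms of total degree `n` of a double complex. -/
abbrev Tot (D : ℕ → ℕ → Type 1) (n : ℕ) : Type 1 := ∀ p q, p + q = n → D p q

variable (dh : ∀ p q, D p q →ₗ[ℝ] D (p + 1) q) (dv : ∀ p q, D p q →ₗ[ℝ] D p (q + 1))

/-- The horizontal part of the total differential. -/
def totH (n : ℕ) : Tot D n →ₗ[ℝ] Tot D (n + 1) where
  toFun x
    | 0, _, _ => 0
    | p + 1, q, h => dh p q (x p q (by omega))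
  map_add' x y := by
    funext p q h
    cases p
    · exact (add_zero _).symm
    · exact map_add _ _ _
  map_smul' r x := by
    funext p q h
    cases p
    · exact (smul_zero _).symm
    · exact map_smul _ _ _

/-- The vertical part of the total differential. -/
def totV (n : ℕ) : Tot D n →ₗ[ℝ] Tot D (n + 1) where
  toFun x
    | _, 0, _ => 0
    | p, q + 1, h => dv p q (x p q (by omega))
  map_add' x y := by
    funext p q h
    cases q
    · exact (add_zero _).symm
    · exact map_add _ _ _
  map_smul' r x := by
    funext p q h
    cases q
    · exact (smul_zero _).symm
    · exact map_smul _ _ _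

/-- The total differential. -/
def totD (n : ℕ) : Tot D n →ₗ[ℝ] Tot D (n + 1) := totH dh n + totV dv n

theorem totD_apply (n : ℕ) (x : Tot D n) (p q : ℕ) (h : p + q = n + 1) :
    totD dh dv n x p q h = totH dh n x p q h + totV dv n x p q h := rfl

variable {dh dv}

theorem totD_totD (hh : ∀ p q x, dh (p + 1) q (dh p q x) = 0)
    (vv : ∀ p q x, dv p (q + 1) (dv p q x) = 0)
    (hv : ∀ p q x, dh p (q + 1) (dv p q x) + dv (p + 1) q (dh p q x) = 0) (n : ℕ) (x : Tot D n) :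
    totD dh dv (n + 1) (totD dh dv n x) = 0 := by
  have e1 : totH dh (n + 1) (totH dh n x) = 0 := by
    funext p q h
    rcases p with _ | _ | p
    · rfl
    · exact map_zero (dh 0 q)
    · exact hh p q _
  have e2 : totV dv (n + 1) (totV dv n x) = 0 := by
    funext p q h
    rcases q with _ | _ | q
    · rfl
    · exact map_zero (dv p 0)
    · exact vv p q _
  have e3 : totH dh (n + 1) (totV dv n x) + totV dv (n + 1) (totH dh n x) = 0 := by
    funext p q h
    rcases p with _ | p <;> rcases q with _ | q
    · exact add_zero _
    · exact (zero_add _).trans (map_zero (dv 0 q))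
    · exact (add_zero _).trans (map_zero (dh p 0))
    · exact hv p q _
  change totH dh (n + 1) (totH dh n x + totV dv n x) + totV dv (n + 1) (totH dh n x + totV dv n x) = 0
  rw [map_add, map_add, e1, e2, zero_add, add_zero, e3]

open Classical in
/-- The element of the total complex with one component. -/
noncomputable def totSingle {p q : ℕ} (z : D p q) : Tot D (p + q) := fun p' q' h =>
  if hp : p = p' then cast (congrArg₂ D hp (by omega)) z else 0

theorem totSingle_self {p q : ℕ} (z : D p q) (h : p + q = p + q) : totSingle z p q h = z := by
  simp [totSingle]

theorem totSingle_ne {p q p' q' : ℕ} (z : D p q) (h : p' + q' = p + q) (hp : p ≠ p') :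
    totSingle z p' q' h = 0 := dif_neg hp

/-- If the rows are exact, an element of the total complex whose differential is concentrated in the
first column can be changed by a coboundary so that it is itself concentrated there. -/
theorem exists_concentrated (hrow : ∀ p q y, dh (p + 1) q y = 0 → ∃ z, dh p q z = y) {n : ℕ}
    (P : ℕ) : ∀ x : Tot D n, (∀ p q h, P < p → x p q h = 0) →
      (∀ p q h, 0 < p → totD dh dv n x p q h = 0) →
      (∀ m (z : Tot D m), totD dh dv (m + 1) (totD dh dv m z) = 0) →
      ∃ x', IsBdry (totD dh dv) n (x - x') ∧ ∀ p q h, 0 < p → x' p q h = 0 := by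
  induction P with
  | zero => exact fun x hP _ _ => ⟨x, by rw [sub_self]; exact .zero n, hP⟩
  | succ P ih =>
    intro x hP hx hdd
    by_cases hn : n < P + 1
    · exact ih x (fun p q h hp => hP p q h (by omega)) hx hdd
    · obtain ⟨q, rfl⟩ : ∃ q, n = (P + q) + 1 := ⟨n - (P + 1), by omega⟩
      have hq : P + 1 + q = P + q + 1 := by omega
      -- Column `P + 1` is the last one in which `x` may be nonzero. So the next column of the
      -- differential says that this component is closed for the horizontal differential.
      -- Subtracting the coboundary of a horizontal primitive clears the column.
      obtain ⟨z, hz⟩ := hrow P q (x (P + 1) q hq) (by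
        have e := hx (P + 2) q (by omega) (by omega)
        rw [totD_apply] at e
        have e' : totV dv _ x (P + 2) q (by omega) = 0 := by
          cases q with
          | zero => rfl
          | succ q => exact (congrArg (dv (P + 2) q) (hP _ _ _ (by omega))).trans (map_zero _)
        rw [e', add_zero] at e
        exact e)
      have main : ∀ p q' h, P < p → (x - totD dh dv (P + q) (totSingle z)) p q' h = 0 := by
        intro p q' h hp
        change x p q' h - totD dh dv (P + q) (totSingle z) p q' h = 0
        rw [totD_apply]
        have e' : totV dv (P + q) (totSingle z) p q' h = 0 := by
          cases q' with
          | zero => rfl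
          | succ q' => exact (congrArg (dv p q') (totSingle_ne z _ (by omega))).trans (map_zero _)
        rw [e', add_zero]
        obtain ⟨p, rfl⟩ : ∃ p', p = p' + 1 := ⟨p - 1, by omega⟩
        change x (p + 1) q' h - dh p q' (totSingle z p q' (by omega)) = 0
        by_cases hpP : p = P
        · subst hpP
          obtain rfl : q' = q := by omega
          rw [totSingle_self, hz, sub_self]
        · rw [totSingle_ne z _ (by omega), map_zero, sub_zero]
          exact hP _ _ _ (by omega)
      obtain ⟨x', h1, h2⟩ := ih (x - totD dh dv (P + q) (totSingle z)) main
        (fun p q' h hp => by rw [map_sub, hdd, sub_zero]; exact hx p q' h hp) hdd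
      refine ⟨x', ?_, h2⟩
      have := h1.add (y := totD dh dv (P + q) (totSingle z)) ⟨_, rfl⟩
      rwa [sub_right_comm, sub_add_cancel] at this

variable {A : ℕ → Type 1} [∀ n, AddCommGroup (A n)] [∀ n, Module ℝ (A n)]
  {dA : ∀ n, A n →ₗ[ℝ] A (n + 1)}

/-- The transport along an equality of degrees. -/
def degCast {m n : ℕ} (h : m = n) : A m →ₗ[ℝ] A n := h ▸ LinearMap.id

/-- The augmentation as a map to the total complex. -/
def toTot (ε : ∀ q, A q →ₗ[ℝ] D 0 q) (n : ℕ) : A n →ₗ[ℝ] Tot D n where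
  toFun a
    | 0, q, h => ε q (degCast (by omega) a)
    | _ + 1, _, _ => 0
  map_add' x y := by
    funext p q h
    cases p
    · exact (congrArg (ε q) (map_add (degCast _) x y)).trans (map_add (ε q) _ _)
    · exact (add_zero _).symm
  map_smul' r x := by
    funext p q h
    cases p
    · exact (congrArg (ε q) (map_smul (degCast _) r x)).trans (map_smul (ε q) _ _)
    · exact (smul_zero _).symm

theorem toTot_comm (ε : ∀ q, A q →ₗ[ℝ] D 0 q) (hε : ∀ q a, dv 0 q (ε q a) = ε (q + 1) (dA q a))
    (hε' : ∀ q a, dh 0 q (ε q a) = 0) (n : ℕ) (a : A n) :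
    toTot ε (n + 1) (dA n a) = totD dh dv n (toTot ε n a) := by
  funext p q h
  rw [totD_apply]
  rcases p with _ | _ | p
  · obtain rfl : q = n + 1 := by omega
    exact (hε n a).symm.trans (zero_add _).symm
  · obtain rfl : q = n := by omega
    refine Eq.symm ?_
    have e : totV dv q (toTot ε q a) 1 q h = 0 := by
      cases q with
      | zero => rfl
      | succ q => exact map_zero (dv 1 q)
    rw [e, add_zero]
    exact hε' q a
  · refine Eq.symm ?_
    have e : totV dv n (toTot ε n a) (p + 2) q h = 0 := by
      cases q with
      | zero => rfl
      | succ q => exact map_zero (dv (p + 2) q)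
    rw [e, add_zero]
    exact map_zero (dh (p + 1) q)

/-- If the rows of a double complex are exact, its total complex has the cohomology of the kernels
of the rows. -/
theorem quasiIso_toTot (hd : ∀ n x, dA (n + 1) (dA n x) = 0)
    (hdd : ∀ m (z : Tot D m), totD dh dv (m + 1) (totD dh dv m z) = 0)
    (hrow : ∀ p q y, dh (p + 1) q y = 0 → ∃ z, dh p q z = y)
    (ε : ∀ q, A q →ₗ[ℝ] D 0 q) (hε : ∀ q a, dv 0 q (ε q a) = ε (q + 1) (dA q a))
    (hε' : ∀ q a, dh 0 q (ε q a) = 0) (hinj : ∀ q, Function.Injective (ε q))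
    (hex : ∀ q y, dh 0 q y = 0 → ∃ a, ε q a = y) :
    QuasiIso (cpxMap (hd := hd) (he := hdd) (toTot ε) (toTot_comm ε hε hε')) := by
  -- The first column of the differential of such an `x` is the horizontal differential of its
  -- single component, which therefore comes from the augmentation.
  have key : ∀ n (x : Tot D n), (∀ p q h, 0 < p → x p q h = 0) →
      (∀ p q h, 0 < p → totD dh dv n x p q h = 0) → ∃ a, toTot ε n a = x := by
    intro n x hx hdx
    obtain ⟨a, ha⟩ := hex n (x 0 n (zero_add n)) (by
      have e := hdx 1 n (by omega) one_pos
      rw [totD_apply] at e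
      have e' : totV dv n x 1 n (by omega) = 0 := by
        cases n with
        | zero => rfl
        | succ n => exact (congrArg (dv 1 n) (hx _ _ _ one_pos)).trans (map_zero _)
      rw [e', add_zero] at e
      exact e)
    refine ⟨a, funext fun p => funext fun q => funext fun h => ?_⟩
    cases p with
    | zero =>
      obtain rfl : q = n := by omega
      exact ha
    | succ p => exact (hx _ _ _ (by omega)).symm
  have hinj' : ∀ n, Function.Injective (toTot ε n) := fun n a b hab =>
    hinj n (congrFun (congrFun (congrFun hab 0) n) (zero_add n))
  have bound : ∀ n (x : Tot D n) p q (h : p + q = n), n < p → x p q h = 0 := fun n x p q h hp => by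
    omega
  refine quasiIso_cpxMap _ _ (fun n y hy => ?_) fun n x hx hb => ?_
  · obtain ⟨y', h1, h2⟩ := exists_concentrated (dv := dv) hrow n y (bound n y)
      (fun p q h _ => by rw [hy]; rfl) hdd
    have h3 : totD dh dv n y' = 0 := by
      cases n with
      | zero => rw [← sub_eq_zero.1 h1, hy]
      | succ n =>
        obtain ⟨z, hz⟩ := h1
        have := hdd n z
        rw [hz, map_sub, hy, zero_sub, neg_eq_zero] at this
        exact this
    obtain ⟨a, ha⟩ := key n y' h2 (fun p q h _ => by rw [h3]; rfl)
    refine ⟨a, hinj' _ ?_, by rw [ha]; exact h1⟩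
    rw [toTot_comm ε hε hε', ha, h3, map_zero]
  · cases n with
    | zero => exact hinj' 0 (hb.trans (map_zero _).symm)
    | succ n =>
      obtain ⟨y, hy⟩ := hb
      have hc : ∀ p q h, 0 < p → toTot ε (n + 1) x p q h = 0 := fun p q h hp => by
        obtain ⟨p, rfl⟩ : ∃ p', p = p' + 1 := ⟨p - 1, by omega⟩
        rfl
      obtain ⟨y', h1, h2⟩ := exists_concentrated (dv := dv) hrow n y (bound n y)
        (fun p q h hp => by rw [hy]; exact hc p q h hp) hdd
      have h3 : totD dh dv n y' = toTot ε (n + 1) x := by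
        rw [← hy]
        cases n with
        | zero => rw [← sub_eq_zero.1 h1]
        | succ n =>
          obtain ⟨z, hz⟩ := h1
          have := hdd n z
          rw [hz, map_sub, sub_eq_zero] at this
          exact this.symm
      obtain ⟨a, ha⟩ := key n y' h2 (fun p q h hp => by rw [h3]; exact hc p q h hp)
      exact ⟨a, hinj' _ ((toTot_comm ε hε hε' n a).trans ((congrArg _ ha).trans h3))⟩

variable {B : ℕ → Type 1} [∀ n, AddCommGroup (B n)] [∀ n, Module ℝ (B n)]
  {dB : ∀ n, B n →ₗ[ℝ] B (n + 1)}

/-- Reflection of a total complex at the diagonal. -/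
def totFlip (n : ℕ) : Tot D n →ₗ[ℝ] Tot (fun p q => D q p) n where
  toFun x p q h := x q p (by omega)
  map_add' _ _ := rfl
  map_smul' _ _ := rfl

/-- The kernels of the rows and the kernels of the columns of a double complex with exact rows and
columns have the same cohomology. -/
theorem nonempty_homology_iso_of_double (hdA : ∀ n x, dA (n + 1) (dA n x) = 0)
    (hdB : ∀ n x, dB (n + 1) (dB n x) = 0)
    (hh : ∀ p q x, dh (p + 1) q (dh p q x) = 0) (vv : ∀ p q x, dv p (q + 1) (dv p q x) = 0)
    (hv : ∀ p q x, dh p (q + 1) (dv p q x) + dv (p + 1) q (dh p q x) = 0)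
    (hrow : ∀ p q y, dh (p + 1) q y = 0 → ∃ z, dh p q z = y)
    (hcol : ∀ p q y, dv p (q + 1) y = 0 → ∃ z, dv p q z = y)
    (ε : ∀ q, A q →ₗ[ℝ] D 0 q) (hε : ∀ q a, dv 0 q (ε q a) = ε (q + 1) (dA q a))
    (hε' : ∀ q a, dh 0 q (ε q a) = 0) (hinj : ∀ q, Function.Injective (ε q))
    (hex : ∀ q y, dh 0 q y = 0 → ∃ a, ε q a = y)
    (η : ∀ p, B p →ₗ[ℝ] D p 0) (hη : ∀ p a, dh p 0 (η p a) = η (p + 1) (dB p a))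
    (hη' : ∀ p a, dv p 0 (η p a) = 0) (hηinj : ∀ p, Function.Injective (η p))
    (hηex : ∀ p y, dv p 0 y = 0 → ∃ a, η p a = y) (n : ℕ) :
    Nonempty ((cpx dA hdA).homology n ≅ (cpx dB hdB).homology n) := by
  have q1 := quasiIso_toTot hdA (totD_totD hh vv hv) hrow ε hε hε' hinj hex
  -- Exchanging the two differentials turns columns into rows. As they anticommute, the reflection
  -- is a map of complexes without signs.
  have hdd' := totD_totD (D := fun p q => D q p) (dh := fun p q => dv q p)
    (dv := fun p q => dh q p) (fun p q => vv q p) (fun p q => hh q p)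
    (fun p q x => (add_comm _ _).trans (hv q p x))
  have q2 := quasiIso_toTot hdB hdd' (fun p q => hcol q p) η hη hη' hηinj hηex
  have comm : ∀ n (x : Tot D n), totFlip (n + 1) (totD dh dv n x) =
      totD (D := fun p q => D q p) (fun p q => dv q p) (fun p q => dh q p) n (totFlip n x) := by
    intro n x
    funext p q h
    change totH dh n x q p _ + totV dv n x q p _ = _
    rw [totD_apply, add_comm]
    congr 1
    · cases p <;> rfl
    · cases q <;> rfl
  have q3 := quasiIso_cpxMap_of_bijective (hd := totD_totD hh vv hv) (he := hdd') totFlip comm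
    fun n => ⟨fun x y hxy => funext fun p => funext fun q => funext fun h =>
      congrFun (congrFun (congrFun hxy q) p) (by omega), fun y => ⟨fun p q h => y q p (by omega), rfl⟩⟩
  exact ⟨@asIso _ _ _ _ _ (q1.quasiIsoAt n).1.1 ≪≫ @asIso _ _ _ _ _ (q3.quasiIsoAt n).1.1 ≪≫
    (@asIso _ _ _ _ _ (q2.quasiIsoAt n).1.1).symm⟩

end DoubleComplex

end OrbiCell

namespace OrbiCell

/-! ### Cancellation in double alternating sums over faces. -/

section AlternatingSum

/-- The cancellation in a double alternating sum over faces. -/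
theorem alternating_double_sum {M : Type*} [AddCommGroup M] [Module ℝ M] {m : ℕ}
    (f : Fin (m + 2) → Fin (m + 1) → M)
    (h : ∀ i k : Fin (m + 1), i ≤ k → f i.castSucc k = f k.succ i) :
    ∑ i : Fin (m + 2), (-1 : ℝ) ^ (i : ℕ) • ∑ k : Fin (m + 1), (-1 : ℝ) ^ (k : ℕ) • f i k = 0 := by
  simp only [Finset.smul_sum]
  rw [← Finset.sum_product']
  let P : Finset (Fin (m + 2) × Fin (m + 1)) :=
    Finset.univ.filter fun x => (x.1 : ℕ) ≤ (x.2 : ℕ)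
  rw [Finset.univ_product_univ, ← Finset.sum_add_sum_compl P, ← eq_neg_iff_add_eq_zero,
    ← Finset.sum_neg_distrib]
  -- The pairs with `i ≤ k` are matched with the remaining ones by `(i, k) ↦ (k + 1, i)`; the total
  -- exponent changes by one, so matched terms cancel.
  let φ : ∀ x : Fin (m + 2) × Fin (m + 1), x ∈ P → Fin (m + 2) × Fin (m + 1) := fun x hx =>
    (x.2.succ, x.1.castLT ((Finset.mem_filter.1 hx).2.trans_lt x.2.2))
  refine Finset.sum_bij φ (fun x hx => ?_) (fun x hx y hy e => ?_) (fun x hx => ?_) fun x hx => ?_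
  · have := (Finset.mem_filter.1 hx).2
    simp only [φ, P, Finset.compl_filter, Finset.mem_filter, Finset.mem_univ, true_and,
      Fin.val_succ, Fin.val_castLT]
    omega
  · simp only [φ, Prod.mk.injEq, Fin.ext_iff, Fin.val_castLT] at e
    exact Prod.ext (Fin.ext e.2) (Fin.succ_injective _ (Fin.ext e.1))
  · simp only [P, Finset.compl_filter, Finset.mem_filter, Finset.mem_univ, true_and, not_le] at hx
    have h1 : x.1 ≠ 0 := fun e => by rw [e] at hx; exact absurd hx (Nat.not_lt_zero _)
    refine ⟨(x.2.castSucc, x.1.pred h1), ?_, ?_⟩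
    · simp only [P, Finset.mem_filter, Finset.mem_univ, true_and, Fin.val_castSucc, Fin.val_pred]
      omega
    · simp [φ, Prod.ext_iff, Fin.ext_iff]
  · have hle := (Finset.mem_filter.1 hx).2
    have e := h (x.1.castLT (hle.trans_lt x.2.2)) x.2 hle
    rw [Fin.castSucc_castLT] at e
    simp only [φ, Fin.val_succ, Fin.val_castLT]
    rw [← e, smul_smul, smul_smul, ← neg_smul]
    congr 1
    ring

theorem succAbove_succAbove {m : ℕ} (i k : Fin (m + 1)) (h : i ≤ k) :
    (i.castSucc.succAbove ∘ k.succAbove : Fin m → Fin (m + 2)) = k.succ.succAbove ∘ i.succAbove := by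
  funext l
  have hk := h
  simp only [Function.comp_apply, Fin.succAbove, Fin.ext_iff, Fin.lt_def, Fin.le_def] at *
  split_ifs <;> simp at * <;> omega

end AlternatingSum

/-! ### The augmented Čech complex of a presheaf on a cover. -/

section Cech

open Set

variable {ι : Type} [Fintype ι] {F G : Set ι → Type 1} [∀ s, AddCommGroup (F s)]
  [∀ s, Module ℝ (F s)] [∀ s, AddCommGroup (G s)] [∀ s, Module ℝ (G s)]

/-- The terms of the augmented Čech complex of a presheaf. -/
abbrev Cech (F : Set ι → Type 1) (m : ℕ) : Type 1 := ∀ J : Fin m → ι, F (range J)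

variable (res : ∀ s t : Set ι, s ⊆ t → F s →ₗ[ℝ] F t) (res' : ∀ s t : Set ι, s ⊆ t → G s →ₗ[ℝ] G t)

/-- The Čech differential. -/
noncomputable def cechD (m : ℕ) : Cech F m →ₗ[ℝ] Cech F (m + 1) where
  toFun ω J := ∑ i : Fin (m + 1), (-1 : ℝ) ^ (i : ℕ) •
    res _ _ (range_comp_subset_range i.succAbove J) (ω (J ∘ i.succAbove))
  map_add' ω η := by
    funext J
    simp only [Pi.add_apply, map_add, smul_add, Finset.sum_add_distrib]
  map_smul' r ω := by
    funext J
    simp only [Pi.smul_apply, map_smul, Finset.smul_sum, RingHom.id_apply]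
    exact Finset.sum_congr rfl fun i _ => smul_comm _ _ _

theorem cechD_apply (m : ℕ) (ω : Cech F m) (J : Fin (m + 1) → ι) :
    cechD res m ω J = ∑ i : Fin (m + 1), (-1 : ℝ) ^ (i : ℕ) •
      res _ _ (range_comp_subset_range i.succAbove J) (ω (J ∘ i.succAbove)) := rfl

variable {res res'}

theorem cechD_cechD
    (hres : ∀ s t u (h : s ⊆ t) (h' : t ⊆ u) x, res t u h' (res s t h x) = res s u (h.trans h') x)
    (m : ℕ) (ω : Cech F m) : cechD res (m + 1) (cechD res m ω) = 0 := by
  funext J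
  rw [cechD_apply]
  simp only [cechD_apply, map_sum, map_smul, hres]
  refine alternating_double_sum (fun i k => res _ _ _ (ω ((J ∘ i.succAbove) ∘ k.succAbove)))
    fun i k h => ?_
  have e : (J ∘ i.castSucc.succAbove) ∘ k.succAbove = (J ∘ k.succ.succAbove) ∘ i.succAbove := by
    rw [Function.comp_assoc, Function.comp_assoc, succAbove_succAbove i k h]
  have aux : ∀ (K K' : Fin m → ι) (hK : range K ⊆ range J) (hK' : range K' ⊆ range J), K = K' →
      res _ _ hK (ω K) = res _ _ hK' (ω K') := by
    rintro K _ _ _ rfl; rfl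
  exact aux _ _ _ _ e

/-- A natural family of linear maps induces maps of Čech complexes. -/
def cechMap (f : ∀ s, F s →ₗ[ℝ] G s) (m : ℕ) : Cech F m →ₗ[ℝ] Cech G m where
  toFun ω J := f _ (ω J)
  map_add' _ _ := funext fun _ => map_add _ _ _
  map_smul' _ _ := funext fun _ => map_smul _ _ _

theorem cechMap_comm (f : ∀ s, F s →ₗ[ℝ] G s)
    (hf : ∀ s t h x, f t (res s t h x) = res' s t h (f s x)) (m : ℕ) (ω : Cech F m) :
    cechMap f (m + 1) (cechD res m ω) = cechD res' m (cechMap f m ω) := by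
  funext J
  change f _ (cechD res m ω J) = cechD res' m (cechMap f m ω) J
  rw [cechD_apply, cechD_apply, map_sum]
  exact Finset.sum_congr rfl fun i _ => by rw [map_smul, hf]; rfl

theorem range_cons_subset {m : ℕ} (j : ι) (J : Fin m → ι) :
    range (Fin.cons j J : Fin (m + 1) → ι) ⊆ insert j (range J) := (Fin.range_cons j J).subset

/-- The Čech complex is exact if there is a partition of unity. -/
theorem exists_cechD_eq
    (hres : ∀ s t u (h : s ⊆ t) (h' : t ⊆ u) x, res t u h' (res s t h x) = res s u (h.trans h') x)
    (e : ∀ (j : ι) (s : Set ι), F (insert j s) →ₗ[ℝ] F s)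
    (he : ∀ j s t (h : s ⊆ t) x,
      res s t h (e j s x) = e j t (res _ _ (insert_subset_insert h) x))
    (he' : ∀ s x, ∑ j, e j s (res _ _ (subset_insert j s) x) = x)
    (m : ℕ) (ω : Cech F (m + 1)) (hω : cechD res (m + 1) ω = 0) :
    ∃ η, cechD res m η = ω := by
  have aux : ∀ {m : ℕ} (ω : Cech F m) (K K' : Fin m → ι) (s : Set ι) (hK : range K ⊆ s)
      (hK' : range K' ⊆ s), K = K' → res _ _ hK (ω K) = res _ _ hK' (ω K') := by
    rintro m ω K _ s _ _ rfl; rfl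
  -- The usual contracting homotopy: prepend an index `j`, extend over the intersection without `j`
  -- by means of the partition of unity, and sum over `j`.
  refine ⟨fun J => ∑ j, e j _ (res _ _ (range_cons_subset j J) (ω (Fin.cons j J))),
    funext fun J => ?_⟩
  -- The cocycle condition at the tuple `(j, J)`, weighted and summed. Deleting `j` returns `ω J`,
  -- and the other deletions give minus the differential of the primitive.
  have h1 : ∑ j, e j _ (res _ _ (range_cons_subset j J)
      (cechD res (m + 1) ω (Fin.cons j J))) = 0 := by
    rw [hω]
    exact Finset.sum_eq_zero fun j _ => by rw [Pi.zero_apply, map_zero, map_zero]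
  simp only [cechD_apply, Fin.sum_univ_succ (n := m + 1), map_add, map_sum, map_smul, hres,
    Finset.sum_add_distrib] at h1
  have h2 : ∑ j, e j (range J) ((-1 : ℝ) ^ ((0 : Fin (m + 2)) : ℕ) •
      res _ _ ((range_comp_subset_range (Fin.succAbove 0) (Fin.cons j J)).trans
        (range_cons_subset j J)) (ω ((Fin.cons j J : Fin (m + 2) → ι) ∘ Fin.succAbove 0))) = ω J := by
    conv_rhs => rw [← he' _ (ω J)]
    refine Finset.sum_congr rfl fun j _ => congrArg _ ?_
    rw [Fin.val_zero, pow_zero, one_smul]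
    refine aux ω _ _ _ _ _ (funext fun k => ?_)
    simp
  simp only [map_smul] at h2
  rw [h2, add_eq_zero_iff_eq_neg] at h1
  rw [h1, cechD_apply, Finset.sum_comm, ← Finset.sum_neg_distrib]
  refine Finset.sum_congr rfl fun i _ => ?_
  rw [map_sum, Finset.smul_sum, ← Finset.sum_neg_distrib]
  refine Finset.sum_congr rfl fun j _ => ?_
  rw [he, hres, ← neg_smul, Fin.val_succ, pow_succ, mul_neg_one, neg_neg]
  congr 2
  refine aux ω _ _ _ _ _ (funext fun k => ?_)
  refine Fin.cases ?_ (fun k => ?_) k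
  · simp
  · simp

end Cech

/-! ### From a resolution with partitions of unity to Čech cohomology. -/

section CechDouble

open Set

variable {ι : Type} [Fintype ι] {F : ℕ → Set ι → Type 1} [∀ q s, AddCommGroup (F q s)]
  [∀ q s, Module ℝ (F q s)] {G : Set ι → Type 1} [∀ s, AddCommGroup (G s)] [∀ s, Module ℝ (G s)]
  {res : ∀ q (s t : Set ι), s ⊆ t → F q s →ₗ[ℝ] F q t} {res' : ∀ s t : Set ι, s ⊆ t → G s →ₗ[ℝ] G t}
  {d : ∀ q s, F q s →ₗ[ℝ] F (q + 1) s}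

/-- If a complex of presheaves has partitions of unity and resolves `G` on the nonempty
intersections, then its global sections compute the Čech cohomology of `G`. -/
theorem nonempty_homology_iso_cech
    (hres : ∀ q s t u (h : s ⊆ t) (h' : t ⊆ u) x,
      res q t u h' (res q s t h x) = res q s u (h.trans h') x)
    (hres1 : ∀ q x, res q ∅ ∅ subset_rfl x = x)
    (hd : ∀ q s x, d (q + 1) s (d q s x) = 0)
    (hdres : ∀ q s t h x, d q t (res q s t h x) = res (q + 1) s t h (d q s x))
    (e : ∀ q (j : ι) (s : Set ι), F q (insert j s) →ₗ[ℝ] F q s)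
    (he : ∀ q j s t (h : s ⊆ t) x,
      res q s t h (e q j s x) = e q j t (res q _ _ (insert_subset_insert h) x))
    (he' : ∀ q s x, ∑ j, e q j s (res q _ _ (subset_insert j s) x) = x)
    (hres' : ∀ s t u (h : s ⊆ t) (h' : t ⊆ u) x, res' t u h' (res' s t h x) = res' s u (h.trans h') x)
    (η : ∀ s, G s →ₗ[ℝ] F 0 s)
    (hη : ∀ s t h x, η t (res' s t h x) = res 0 s t h (η s x))
    (hηd : ∀ s x, s.Nonempty → d 0 s (η s x) = 0)
    (hηinj : ∀ s, s.Nonempty → Function.Injective (η s))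
    (hηex : ∀ s y, s.Nonempty → d 0 s y = 0 → ∃ x, η s x = y)
    (hex : ∀ q s y, s.Nonempty → d (q + 1) s y = 0 → ∃ x, d q s x = y) (n : ℕ) :
    Nonempty ((cpx (fun q => d q ∅) (fun q => hd q ∅)).homology n ≅
      (cpx (M := fun p => Cech G (p + 1)) (fun p => cechD res' (p + 1))
        (fun p => cechD_cechD hres' (p + 1))).homology n) := by
  have hne : ∀ {p : ℕ} (J : Fin (p + 1) → ι), (range J).Nonempty := fun J => ⟨J 0, 0, rfl⟩
  have hzero : ∀ J : Fin 0 → ι, range J ⊆ ∅ := fun J => by rintro _ ⟨i, -⟩; exact i.elim0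
  let D : ℕ → ℕ → Type 1 := fun p q => Cech (F q) (p + 1)
  let dh : ∀ p q, D p q →ₗ[ℝ] D (p + 1) q := fun p q => cechD (res q) (p + 1)
  -- The sign makes the two differentials anticommute.
  let dv : ∀ p q, D p q →ₗ[ℝ] D p (q + 1) := fun p q => (-1 : ℝ) ^ p • cechMap (d q) (p + 1)
  -- The only tuple of length zero has empty range, so the augmentation term consists of global
  -- sections. The double complex itself starts with tuples of length one, where the range is
  -- nonempty.
  let aug : ∀ q, F q ∅ →ₗ[ℝ] Cech (F q) 0 := fun q =>
    LinearMap.pi fun J => res q _ _ (empty_subset _)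
  have haug : ∀ q x J, aug q x J = res q _ _ (empty_subset _) x := fun q x J => rfl
  have comm : ∀ q m (x : Cech (F q) m),
      cechMap (d q) (m + 1) (cechD (res q) m x) = cechD (res (q + 1)) m (cechMap (d q) m x) :=
    fun q m x => cechMap_comm (d q) (hdres q) m x
  have sgn : ∀ p : ℕ, (-1 : ℝ) ^ p * (-1) ^ p = 1 := fun p => by
    rw [← mul_pow]; norm_num
  refine nonempty_homology_iso_of_double (D := D) (dh := dh) (dv := dv) _ _
    (fun p q x => cechD_cechD (hres q) _ x) (fun p q x => ?_) (fun p q x => ?_)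
    (fun p q y hy => exists_cechD_eq (hres q) (e q) (he q) (he' q) _ y hy) (fun p q y hy => ?_)
    (fun q => cechD (res q) 0 ∘ₗ aug q) (fun q a => ?_) (fun q a => cechD_cechD (hres q) _ _)
    (fun q => (injective_iff_map_eq_zero _).2 fun a ha => ?_) (fun q y hy => ?_)
    (fun p => cechMap η (p + 1)) (fun p a => (cechMap_comm η hη _ a).symm) (fun p a => ?_)
    (fun p a b hab => funext fun J => hηinj _ (hne J) (congrFun hab J)) (fun p y hy => ?_) n
  · funext J
    change (-1 : ℝ) ^ p • d (q + 1) _ ((-1 : ℝ) ^ p • d q _ (x J)) = 0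
    rw [map_smul, hd, smul_zero, smul_zero]
  · change cechD (res (q + 1)) (p + 1) ((-1 : ℝ) ^ p • cechMap (d q) (p + 1) x) +
      (-1 : ℝ) ^ (p + 1) • cechMap (d q) (p + 1 + 1) (cechD (res q) (p + 1) x) = 0
    rw [map_smul, comm, ← add_smul, pow_succ, mul_neg_one, add_neg_cancel, zero_smul]
  · have h : ∀ J, d (q + 1) _ (y J) = 0 := fun J => by
      have := congrFun hy J
      change (-1 : ℝ) ^ p • d (q + 1) _ (y J) = 0 at this
      exact (smul_eq_zero.1 this).resolve_left (by simp)
    choose z hz using fun J => hex q _ (y J) (hne J) (h J)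
    refine ⟨(-1 : ℝ) ^ p • z, funext fun J => ?_⟩
    change (-1 : ℝ) ^ p • d q _ ((-1 : ℝ) ^ p • z J) = y J
    rw [map_smul, hz, smul_smul, sgn, one_smul]
  · change (-1 : ℝ) ^ 0 • cechMap (d q) 1 (cechD (res q) 0 (aug q a)) =
      cechD (res (q + 1)) 0 (aug (q + 1) (d q ∅ a))
    rw [pow_zero, one_smul, comm]
    refine congrArg _ (funext fun J => ?_)
    exact hdres q _ _ _ a
  · have h : ∀ j : ι, res q ∅ _ (subset_insert j ∅) a = 0 := fun j => by
      have hJ := congrFun ha (fun _ => j)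
      rw [LinearMap.comp_apply, cechD_apply, Fin.sum_univ_one] at hJ
      simp only [Fin.val_zero, pow_zero, one_smul, haug, hres] at hJ
      have := congrArg (res q _ (insert j ∅) (by rintro _ ⟨_, rfl⟩; exact mem_insert _ _)) hJ
      exact (hres q _ _ _ _ _ a).symm.trans (this.trans (map_zero _))
    rw [← he' q ∅ a]
    exact Finset.sum_eq_zero fun j _ => by rw [h, map_zero]
  · obtain ⟨z, rfl⟩ := exists_cechD_eq (hres q) (e q) (he q) (he' q) _ y hy
    refine ⟨res q _ ∅ (hzero default) (z default), ?_⟩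
    refine congrArg (cechD (res q) 0) (funext fun J => ?_)
    obtain rfl : J = default := Subsingleton.elim _ _
    rw [haug, hres]
    have aux : ∀ (s : Set ι) (hs : s = ∅) (x : F q s), res q s s subset_rfl x = x := by
      rintro s rfl x; exact hres1 q x
    exact aux _ (subset_empty_iff.1 (hzero _)) _
  · funext J
    change (-1 : ℝ) ^ p • d 0 _ (η _ (a J)) = 0
    rw [hηd _ _ (hne J), smul_zero]
  · have h : ∀ J, d 0 _ (y J) = 0 := fun J => by
      have := congrFun hy J
      change (-1 : ℝ) ^ p • d 0 _ (y J) = 0 at this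
      exact (smul_eq_zero.1 this).resolve_left (by simp)
    choose z hz using fun J => hηex _ (y J) (hne J) (h J)
    exact ⟨z, funext hz⟩

end CechDouble

end OrbiCell

namespace OrbiCell

open Set Filter Topology MeasureTheory intervalIntegral

/-! ### Components of a box and their base points. -/

section Components

variable {A : Set ℝ}

/-- `s` and `t` are not separated by a point of `A`. -/
def Unsep (A : Set ℝ) (s t : ℝ) : Prop := Disjoint (uIcc s t) A

theorem Unsep.symm {s t : ℝ} (h : Unsep A s t) : Unsep A t s := by
  rwa [Unsep, uIcc_comm]

theorem Unsep.trans {s t u : ℝ} (h : Unsep A s t) (h' : Unsep A t u) : Unsep A s u :=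
  (disjoint_union_left.2 ⟨h, h'⟩).mono_left uIcc_subset_uIcc_union_uIcc

theorem unsep_self {t : ℝ} (h : t ∉ A) : Unsep A t t := by
  rw [Unsep, uIcc_self]
  exact disjoint_singleton_left.2 h

open Classical in
/-- A base point in the component of `t` in `[0,1] \ A`. -/
noncomputable def basePt (A : Set ℝ) (t : ℝ) : ℝ :=
  if Unsep A t 0 then 0 else if Unsep A t 1 then 1
  else Classical.epsilon fun s => s ∈ Icc (0:ℝ) 1 ∧ Unsep A t s

theorem basePt_eq {s t : ℝ} (h : Unsep A s t) : basePt A s = basePt A t := by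
  have e : ∀ u, Unsep A s u = Unsep A t u := fun u =>
    propext ⟨fun k => h.symm.trans k, fun k => h.trans k⟩
  unfold basePt
  rw [funext e]

theorem basePt_spec {t : ℝ} (ht : t ∈ Icc (0:ℝ) 1) (hA : t ∉ A) :
    basePt A t ∈ Icc (0:ℝ) 1 ∧ Unsep A t (basePt A t) := by
  unfold basePt
  split_ifs with h1 h2
  · exact ⟨by simp, h1⟩
  · exact ⟨by simp, h2⟩
  · exact Classical.epsilon_spec (p := fun s => s ∈ Icc (0:ℝ) 1 ∧ Unsep A t s)
      ⟨t, ht, unsep_self hA⟩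

theorem basePt_zero (h0 : (0:ℝ) ∉ A) : basePt A 0 = 0 := if_pos (unsep_self h0)

/-- As `0` takes precedence, a point of `A` has to separate it from `1`. This is why the contraction
is compatible with faces only on nonempty intersections of the cover. -/
theorem basePt_one (h1 : (1:ℝ) ∉ A) (hA : A ⊆ Icc 0 1) (hne : A.Nonempty) : basePt A 1 = 1 := by
  have h : ¬ Unsep A 1 0 := fun h => by
    obtain ⟨a, ha⟩ := hne
    exact disjoint_left.1 h (by rw [uIcc_comm, uIcc_of_le zero_le_one]; exact hA ha) ha
  rw [basePt, if_neg h, if_pos (unsep_self h1)]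

theorem isOpen_unsep (hA : IsClosed A) (c : ℝ) : IsOpen {t | Unsep A t c} := by
  rw [Metric.isOpen_iff]
  intro t ht
  have htA : t ∉ A := disjoint_left.1 ht left_mem_uIcc
  obtain ⟨ε, hε, hb⟩ := Metric.isOpen_iff.1 hA.isOpen_compl t htA
  refine ⟨ε, hε, fun u hu => Unsep.trans ?_ ht⟩
  refine disjoint_left.2 fun v hv hvA => hb ?_ hvA
  exact (convex_ball t ε).ordConnected.uIcc_subset hu (Metric.mem_ball_self hε) hv

theorem convex_unsep (c : ℝ) : Convex ℝ {t | Unsep A t c} := by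
  refine OrdConnected.convex ⟨fun s hs t ht u hu => ?_⟩
  refine (disjoint_union_left.2 ⟨hs, ht⟩).mono_left fun v hv => ?_
  simp only [mem_union, mem_uIcc, mem_Icc] at *
  grind

variable {B : Type} [Fintype B]

/-- The base point of the component of `x` in the box. -/
noncomputable def baseVec (A : Set ℝ) (x : B → ℝ) : B → ℝ := fun b => basePt A (x b)

/-- The component of `c` in the box. -/
def boxComp (A : Set ℝ) (c : B → ℝ) : Set (B → ℝ) := {x ∈ cube B | ∀ b, Unsep A (x b) (c b)}

theorem baseVec_eq {c x : B → ℝ} (hx : x ∈ boxComp A c) : baseVec A x = baseVec A c :=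
  funext fun b => basePt_eq (hx.2 b)

theorem mem_boxComp {x : B → ℝ} (hx : x ∈ box A B) : x ∈ boxComp A x :=
  ⟨hx.1, fun b => unsep_self (hx.2 b)⟩

theorem convex_boxComp (c : B → ℝ) : Convex ℝ (boxComp A c) := by
  refine convex_cube.inter fun x hx y hy a b ha hb hab i => ?_
  exact convex_unsep (c i) (hx i) (hy i) ha hb hab

theorem isOpen_boxComp_aux (hA : IsClosed A) (c : B → ℝ) :
    IsOpen {x : B → ℝ | ∀ b, Unsep A (x b) (c b)} := by
  have : {x : B → ℝ | ∀ b, Unsep A (x b) (c b)} =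
      ⋂ b, (fun x : B → ℝ => x b) ⁻¹' {t | Unsep A t (c b)} := by
    ext x
    simp
  rw [this]
  exact isOpen_iInter_of_finite fun b => (isOpen_unsep hA (c b)).preimage (continuous_apply b)

theorem uniqueDiffOn_boxComp (hA : IsClosed A) (c : B → ℝ) : UniqueDiffOn ℝ (boxComp A c) :=
  uniqueDiffOn_cube.inter (isOpen_boxComp_aux hA c)

theorem boxComp_mem_nhdsWithin (hA : IsClosed A) {x : B → ℝ} (hx : x ∈ box A B) :
    boxComp A x ∈ 𝓝[cube B] x :=
  inter_mem_nhdsWithin _ ((isOpen_boxComp_aux hA x).mem_nhds (mem_boxComp hx).2)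

theorem boxComp_subset_box (c : B → ℝ) : boxComp A c ⊆ box A B := fun _ hx =>
  ⟨hx.1, fun b => disjoint_left.1 (hx.2 b) left_mem_uIcc⟩

/-- The contraction of a component of the box to its base point. -/
theorem segment_mem_box {c x : B → ℝ} (hc : c ∈ box A B) (hx : x ∈ boxComp A c) {s : ℝ}
    (hs : s ∈ Icc (0:ℝ) 1) : baseVec A c + s • (x - baseVec A c) ∈ boxComp A c := by
  have h : baseVec A c ∈ boxComp A c :=
    ⟨mem_cube.2 fun b => (basePt_spec (mem_cube.1 hc.1 b) (hc.2 b)).1,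
      fun b => (basePt_spec (mem_cube.1 hc.1 b) (hc.2 b)).2.symm⟩
  exact (convex_boxComp c).add_smul_sub_mem h hx hs

end Components

/-! ### The Poincaré lemma on boxes, by radial contraction. -/

section Poincare

variable {A : Set ℝ} {B B' : Type} [Fintype B] [Fintype B'] {k : ℕ}

theorem sum_smul_unitVec (w : B → ℝ) : ∑ b, w b • (unitVec b : B → ℝ) = w := by
  classical
  funext c
  simp [unitVec, Pi.single_apply]

theorem sum_smul_iota_apply (w : B → ℝ) (α : (B → ℝ) [⋀^Fin (k + 1)]→L[ℝ] ℝ) (v : Fin k → B → ℝ) :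
    (∑ b, w b • iota b α) v = α (Matrix.vecCons w v) := by
  rw [ContinuousAlternatingMap.sum_apply]
  let g : (B → ℝ) →ₗ[ℝ] ℝ :=
    { toFun := fun w => α (Matrix.vecCons w v)
      map_add' := fun x y => α.toMultilinearMap.cons_add v x y
      map_smul' := fun r x => α.toMultilinearMap.cons_smul v r x }
  have h : g w = g (∑ b, w b • unitVec b) := by rw [sum_smul_unitVec]
  refine Eq.trans ?_ h.symm
  rw [map_sum]
  exact Finset.sum_congr rfl fun b _ => (map_smul g _ _).symm

theorem freePart_unitVec (b : B) (α : (B → ℝ) [⋀^Fin k]→L[ℝ] ℝ) (s : Fin k → B) [Decidable (∃ i, s i = b)] :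
    freePart b α (fun i => unitVec (s i)) =
      if ∃ i, s i = b then 0 else α fun i => unitVec (s i) := by
  rw [freePart_apply]
  split_ifs with h
  · obtain ⟨i, rfl⟩ := h
    exact α.map_coord_zero (m := fun j => scaleAt (s i) 0 (unitVec (s j))) i
      (scaleAt_zero_unitVec_self _)
  · push Not at h
    simp only [fun j => scaleAt_zero_unitVec_ne (h j)]

/-- On `k` distinct unit vectors exactly the `k` directions that occur contribute; this is the
identity `∑ dx_b ∧ ι_b = k` in degree `k`. -/
theorem sum_sub_freePart (α : (B → ℝ) [⋀^Fin k]→L[ℝ] ℝ) :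
    ∑ b, (α - freePart b α) = (k : ℝ) • α := by
  classical
  refine ext_unitVec fun s hs => ?_
  rw [ContinuousAlternatingMap.sum_apply, ContinuousAlternatingMap.smul_apply]
  simp only [ContinuousAlternatingMap.sub_apply, freePart_unitVec]
  have : ∀ b, ((α fun i => unitVec (s i)) - if ∃ i, s i = b then 0 else α fun i => unitVec (s i)) =
      if b ∈ Finset.univ.image s then α fun i => unitVec (s i) else 0 := fun b => by
    by_cases h : ∃ i, s i = b <;> simp [h]
  simp only [this]
  rw [Finset.sum_ite_mem, Finset.univ_inter, Finset.sum_const,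
    Finset.card_image_of_injective _ hs, Finset.card_fin, nsmul_eq_mul, smul_eq_mul]

/-- The integrand of the radial contraction. -/
noncomputable def radial (z : B → ℝ) (ω : FormField B (k + 1)) (p : (B → ℝ) × ℝ) :
    (B → ℝ) [⋀^Fin k]→L[ℝ] ℝ :=
  p.2 ^ k • ∑ b, (p.1 b - z b) • iota b (ω (z + p.2 • (p.1 - z)))

/-- Its derivative in the direction of the cube. -/
noncomputable def radialDeriv (z : B → ℝ) (ω : FormField B (k + 1)) (p : (B → ℝ) × ℝ) :
    (B → ℝ) →L[ℝ] (B → ℝ) [⋀^Fin k]→L[ℝ] ℝ :=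
  p.2 ^ k • ∑ b, ((coordProj b).smulRight (iota b (ω (z + p.2 • (p.1 - z)))) +
    (p.2 * (p.1 b - z b)) •
      (iota b).comp (fderivWithin ℝ ω (cube B) (z + p.2 • (p.1 - z))))

open Classical in
/-- The radial contraction of a form on the box. -/
noncomputable def contractBox (A : Set ℝ) (ω : FormField B (k + 1)) : FormField B k := fun x =>
  if x ∈ box A B then ∫ s in (0:ℝ)..1, radial (baseVec A x) ω (x, s) else 0

theorem contractBox_of_mem {ω : FormField B (k + 1)} {x : B → ℝ} (hx : x ∈ box A B) :
    contractBox A ω x = ∫ s in (0:ℝ)..1, radial (baseVec A x) ω (x, s) := if_pos hx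

variable {ω : FormField B (k + 1)} {c : B → ℝ}

theorem contDiffOn_segment (z : B → ℝ) {n : WithTop ℕ∞} {S : Set ((B → ℝ) × ℝ)} :
    ContDiffOn ℝ n (fun p : (B → ℝ) × ℝ => z + p.2 • (p.1 - z)) S := by
  fun_prop

theorem IsFormOn.contDiffOn_boxComp {l : ℕ} {ω : FormField B l} (hω : IsFormOn A ω) :
    ContDiffOn ℝ ((⊤ : ℕ∞) : WithTop ℕ∞) ω (boxComp A c) := fun x hx =>
  (hω.smooth x (boxComp_subset_box c hx)).mono fun _ h => h.1

theorem contDiffOn_radial (hω : IsFormOn A ω) (hc : c ∈ box A B) :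
    ContDiffOn ℝ ((⊤ : ℕ∞) : WithTop ℕ∞) (radial (baseVec A c) ω) (boxComp A c ×ˢ Icc 0 1) := by
  have h1 := (hω.contDiffOn_boxComp (c := c)).comp (contDiffOn_segment (baseVec A c))
    (fun p (hp : p ∈ boxComp A c ×ˢ Icc 0 1) => segment_mem_box hc hp.1 hp.2)
  have h4 : ContDiffOn ℝ ((⊤ : ℕ∞) : WithTop ℕ∞) (fun p : (B → ℝ) × ℝ => p.2 ^ k)
    (boxComp A c ×ˢ Icc 0 1) := by fun_prop
  have h5 : ∀ b, ContDiffOn ℝ ((⊤ : ℕ∞) : WithTop ℕ∞)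
      (fun p : (B → ℝ) × ℝ => p.1 b - baseVec A c b) (boxComp A c ×ˢ Icc 0 1) := fun b => by
    fun_prop
  exact h4.smul (ContDiffOn.sum fun b _ => (h5 b).smul ((iota b).contDiff.comp_contDiffOn h1))

theorem continuousOn_fderiv_segment (hA : IsClosed A) {l : ℕ} {ω : FormField B l}
    (hω : IsFormOn A ω) (hc : c ∈ box A B) :
    ContinuousOn (fun p : (B → ℝ) × ℝ =>
      fderivWithin ℝ ω (cube B) (baseVec A c + p.2 • (p.1 - baseVec A c)))
      (boxComp A c ×ˢ Icc 0 1) := by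
  have h : ContinuousOn (fderivWithin ℝ ω (cube B)) (boxComp A c) := fun x hx =>
    (((hω.smooth x (boxComp_subset_box c hx)).fderivWithin_right (m := 0) uniqueDiffOn_cube
      (by simp) hx.1).continuousWithinAt).mono fun _ h => h.1
  exact h.comp (contDiffOn_segment (n := 0) _).continuousOn
    fun p hp => segment_mem_box hc hp.1 hp.2

theorem continuousOn_form_segment {l : ℕ} {ω : FormField B l}
    (hω : IsFormOn A ω) (hc : c ∈ box A B) :
    ContinuousOn (fun p : (B → ℝ) × ℝ => ω (baseVec A c + p.2 • (p.1 - baseVec A c)))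
      (boxComp A c ×ˢ Icc 0 1) :=
  (hω.contDiffOn_boxComp (c := c)).continuousOn.comp (contDiffOn_segment (n := 0) _).continuousOn
    fun p hp => segment_mem_box hc hp.1 hp.2

theorem intervalIntegrable_clm_slice {E M N : Type} [NormedAddCommGroup E] [NormedSpace ℝ E]
    [NormedAddCommGroup M] [NormedSpace ℝ M] [NormedAddCommGroup N] [NormedSpace ℝ N] {S : Set E}
    (Φ : M →L[ℝ] N) {f : E × ℝ → M} (hf : ContinuousOn f (S ×ˢ Icc 0 1)) {x : E} (hx : x ∈ S) :
    IntervalIntegrable (fun s => Φ (f (x, s))) volume 0 1 :=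
  intervalIntegrable_slice (F := fun p => Φ (f p)) (Φ.continuous.comp_continuousOn hf) hx

theorem integral_add_integral_eq_sub {M : Type} [NormedAddCommGroup M] [NormedSpace ℝ M]
    [CompleteSpace M] {P Q f f' : ℝ → M} (hP : IntervalIntegrable P volume 0 1)
    (hQ : IntervalIntegrable Q volume 0 1)
    (hf : ∀ s ∈ Icc (0:ℝ) 1, HasDerivWithinAt f (f' s) (Icc 0 1) s)
    (h : ∀ s ∈ Icc (0:ℝ) 1, P s + Q s = f' s) :
    (∫ s in (0:ℝ)..1, P s) + ∫ s in (0:ℝ)..1, Q s = f 1 - f 0 := by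
  rw [← integral_add hP hQ, integral_congr (g := f')
    (fun s hs => h s (by rwa [uIcc_of_le zero_le_one] at hs))]
  refine integral_eq_sub_of_hasDerivAt_of_le zero_le_one (fun s hs => (hf s hs).continuousWithinAt)
      (fun s hs => (hf s (Ioo_subset_Icc_self hs)).hasDerivAt (Icc_mem_nhds hs.1 hs.2)) ?_
  refine (hP.add hQ).congr fun s hs => ?_
  exact h s (Ioc_subset_Icc_self (by rwa [uIoc_of_le zero_le_one] at hs))

theorem clm_fderivWithin_parametric {E M N : Type} [NormedAddCommGroup E] [NormedSpace ℝ E]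
    [FiniteDimensional ℝ E] [NormedAddCommGroup M] [NormedSpace ℝ M] [CompleteSpace M]
    [NormedAddCommGroup N] [NormedSpace ℝ N] [CompleteSpace N] {S C : Set E}
    (Φ : (E →L[ℝ] M) →L[ℝ] N) (hS : Convex ℝ S) {F : E × ℝ → M} {F' : E × ℝ → E →L[ℝ] M}
    {f : E → M} (hF : ContinuousOn F (S ×ˢ Icc 0 1)) (hF' : ContinuousOn F' (S ×ˢ Icc 0 1))
    (h : ∀ x ∈ S, ∀ u ∈ Icc (0:ℝ) 1, HasFDerivWithinAt (fun y => F (y, u)) (F' (x, u)) S x)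
    {x : E} (hx : x ∈ S) (hC : UniqueDiffWithinAt ℝ C x) (hSC : S ∈ 𝓝[C] x)
    (hf : ∀ y ∈ S, f y = ∫ s in (0:ℝ)..1, F (y, s)) :
    Φ (fderivWithin ℝ f C x) = ∫ s in (0:ℝ)..1, Φ (F' (x, s)) := by
  have h1 := (hasFDerivWithinAt_parametric_integral hS hF hF' h hx).congr hf (hf x hx)
  rw [(h1.mono_of_mem_nhdsWithin hSC).fderivWithin hC]
  exact (Φ.intervalIntegral_comp_comm (intervalIntegrable_slice hF' hx)).symm

theorem continuousOn_radialDeriv_aux {X E Λ N ι : Type} [TopologicalSpace X] [Fintype ι]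
    [NormedAddCommGroup E] [NormedSpace ℝ E] [NormedAddCommGroup Λ] [NormedSpace ℝ Λ]
    [NormedAddCommGroup N] [NormedSpace ℝ N] {S : Set X} (P : ι → E →L[ℝ] ℝ) (I : ι → Λ →L[ℝ] N)
    {f : X → Λ} {f' : X → E →L[ℝ] Λ} {w : ι → X → ℝ} {a : X → ℝ} (k : ℕ) (hf : ContinuousOn f S)
    (hf' : ContinuousOn f' S) (hw : ∀ i, ContinuousOn (w i) S) (ha : ContinuousOn a S) :
    ContinuousOn (fun x => a x ^ k • ∑ i, ((P i).smulRight (I i (f x)) +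
      w i x • (I i).comp (f' x))) S := by
  refine (ha.pow k).smul (continuousOn_finsetSum _ fun i _ => ContinuousOn.add ?_ ?_)
  · exact (ContinuousLinearMap.smulRightL ℝ E N (P i)).continuous.comp_continuousOn
      ((I i).continuous.comp_continuousOn hf)
  · exact (hw i).smul (continuousOn_const.clm_comp hf')

theorem continuousOn_radialDeriv (hA : IsClosed A) (hω : IsFormOn A ω) (hc : c ∈ box A B) :
    ContinuousOn (radialDeriv (baseVec A c) ω) (boxComp A c ×ˢ Icc 0 1) :=
  continuousOn_radialDeriv_aux (fun b => coordProj b) (fun b => iota b) k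
    (continuousOn_form_segment hω hc) (continuousOn_fderiv_segment hA hω hc)
    (w := fun b p => p.2 * (p.1 b - baseVec A c b)) (a := fun p => p.2)
    (fun b => (Continuous.continuousOn (by fun_prop))) continuous_snd.continuousOn

theorem hasFDerivWithinAt_radial (hω : IsFormOn A ω) (hc : c ∈ box A B) {x : B → ℝ}
    (hx : x ∈ boxComp A c) {s : ℝ} (hs : s ∈ Icc (0:ℝ) 1) :
    HasFDerivWithinAt (fun y => radial (baseVec A c) ω (y, s)) (radialDeriv (baseVec A c) ω (x, s))
      (boxComp A c) x := by
  set z := baseVec A c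
  have hp := segment_mem_box hc hx hs
  have h1 : HasFDerivWithinAt (fun y : B → ℝ => z + s • (y - z)) (s • ContinuousLinearMap.id ℝ _)
      (boxComp A c) x := (((hasFDerivWithinAt_id x _).sub_const z).const_smul s).const_add z
  have h2 := (hω.differentiable (boxComp_subset_box c hp)).hasFDerivWithinAt.comp x h1
    (fun y hy => (segment_mem_box hc hy hs).1)
  have h3 : ∀ b, HasFDerivWithinAt (fun y : B → ℝ => (y b - z b) • iota b (ω (z + s • (y - z))))
      ((x b - z b) • (iota b).comp ((fderivWithin ℝ ω (cube B) (z + s • (x - z))).comp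
        (s • ContinuousLinearMap.id ℝ _)) + (coordProj b).smulRight (iota b (ω (z + s • (x - z)))))
      (boxComp A c) x := fun b =>
    (((coordProj b).hasFDerivAt (x := x)).hasFDerivWithinAt.sub_const (z b)).smul
      ((iota b).hasFDerivAt.comp_hasFDerivWithinAt x h2)
  refine ((HasFDerivWithinAt.fun_sum fun b _ => h3 b).const_smul (s ^ k)).congr_fderiv ?_
  refine congrArg (s ^ k • ·) (Finset.sum_congr rfl fun b _ => ?_)
  ext v u
  simp [z]
  ring

theorem contractBox_eq_on {x : B → ℝ} (hx : x ∈ boxComp A c) :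
    contractBox A ω x = ∫ s in (0:ℝ)..1, radial (baseVec A c) ω (x, s) := by
  rw [contractBox_of_mem (boxComp_subset_box c hx), baseVec_eq hx]

theorem IsFormOn.contractBox (hA : IsClosed A) (hω : IsFormOn A ω) :
    IsFormOn A (contractBox A ω) where
  smooth x hx := by
    have h := contDiffOn_parametric_integral (convex_boxComp x) (uniqueDiffOn_boxComp hA x)
      (contDiffOn_radial hω hx)
    have h' : ContDiffWithinAt ℝ ((⊤ : ℕ∞) : WithTop ℕ∞) (OrbiCell.contractBox A ω)
        (boxComp A x) x :=
      (h x (mem_boxComp hx)).congr (fun y hy => contractBox_eq_on hy)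
        (contractBox_eq_on (mem_boxComp hx))
    exact h'.mono_of_mem_nhdsWithin (boxComp_mem_nhdsWithin hA hx)
  zero_off x hx := if_neg hx

/-- The pointwise form of Cartan's formula for the radial field. The terms `dx_b ∧ ι_b α` add up to
`k + 1` times `α`, and the terms with `ι_b T` cancel against those of the interior product with
`dω`. -/
theorem alternatize_radial (α : (B → ℝ) [⋀^Fin (k + 1)]→L[ℝ] ℝ)
    (T : (B → ℝ) →L[ℝ] (B → ℝ) [⋀^Fin (k + 1)]→L[ℝ] ℝ) (s : ℝ) (w : B → ℝ) :
    ContinuousAlternatingMap.alternatizeUncurryFin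
      (s ^ k • ∑ b, ((coordProj b).smulRight (iota b α) + (s * w b) • (iota b).comp T)) +
      s ^ (k + 1) • ∑ b, w b • iota b (ContinuousAlternatingMap.alternatizeUncurryFin T) =
    ((k + 1 : ℝ) * s ^ k) • α + s ^ (k + 1) • T w := by
  let Φ := (ContinuousAlternatingMap.alternatizeUncurryFinCLM ℝ (B → ℝ) ℝ (n := k)).toLinearMap
  have h1 : ∀ b, iota b (ContinuousAlternatingMap.alternatizeUncurryFin T) = T (unitVec b) -
      Φ ((iota b).comp T) := fun b => iota_alternatize b T
  have h2 : ∀ b, Φ ((coordProj b).smulRight (iota b α)) = α - freePart b α :=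
    fun b => alternatize_coordProj_iota b _
  have h3 : T w = ∑ b, w b • T (unitVec b) := by
    conv_lhs => rw [← sum_smul_unitVec w]
    rw [map_sum]
    exact Finset.sum_congr rfl fun b _ => map_smul _ _ _
  have h4 : Φ (s ^ k • ∑ b, ((coordProj b).smulRight (iota b α) + (s * w b) • (iota b).comp T)) =
      s ^ k • ((((k + 1 : ℕ) : ℝ) • α) + ∑ b, (s * w b) • Φ ((iota b).comp T)) := by
    rw [map_smul, map_sum, ← sum_sub_freePart α, ← Finset.sum_add_distrib]
    refine congrArg _ (Finset.sum_congr rfl fun b _ => ?_)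
    rw [map_add, map_smul, h2]
  refine (congrArg₂ (· + ·) h4 rfl).trans ?_
  rw [h3]
  simp only [h1, smul_sub, Finset.sum_sub_distrib, mul_smul, ← Finset.smul_sum]
  push_cast
  module

theorem hasDerivWithinAt_radial_path (hω : IsFormOn A ω) (hc : c ∈ box A B) {s : ℝ}
    (hs : s ∈ Icc (0:ℝ) 1) : HasDerivWithinAt
      (fun s : ℝ => s ^ (k + 1) • ω (baseVec A c + s • (c - baseVec A c)))
      (((k + 1 : ℝ) * s ^ k) • ω (baseVec A c + s • (c - baseVec A c)) +
        s ^ (k + 1) • fderivWithin ℝ ω (cube B) (baseVec A c + s • (c - baseVec A c))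
          (c - baseVec A c)) (Icc 0 1) s := by
  have hcc := mem_boxComp hc
  have hp := segment_mem_box hc hcc hs
  have h1 : HasDerivWithinAt (fun s : ℝ => baseVec A c + s • (c - baseVec A c))
      (c - baseVec A c) (Icc 0 1) s := by
    simpa using ((hasDerivWithinAt_id s (Icc 0 1)).smul_const (c - baseVec A c)).const_add
      (baseVec A c)
  have h2 := (hω.differentiable (boxComp_subset_box c hp)).hasFDerivWithinAt.comp_hasDerivWithinAt
    s h1 (fun u hu => (segment_mem_box hc hcc hu).1)
  have h3 := (hasDerivWithinAt_pow (s := Icc (0:ℝ) 1) (k + 1) s).smul h2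
  refine h3.congr_deriv ?_
  simp only [Nat.cast_add, Nat.cast_one, Nat.add_sub_cancel]
  exact add_comm _ _

theorem alternatize_radialDeriv_add (hc : c ∈ box A B) {s : ℝ}
    (hs : s ∈ Icc (0:ℝ) 1) :
    ContinuousAlternatingMap.alternatizeUncurryFinCLM ℝ (B → ℝ) ℝ
        (radialDeriv (baseVec A c) ω (c, s)) + radial (baseVec A c) (extD A ω) (c, s) =
      ((k + 1 : ℝ) * s ^ k) • ω (baseVec A c + s • (c - baseVec A c)) +
        s ^ (k + 1) • fderivWithin ℝ ω (cube B) (baseVec A c + s • (c - baseVec A c))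
          (c - baseVec A c) := by
  rw [radial, extD_of_mem (boxComp_subset_box c (segment_mem_box hc (mem_boxComp hc) hs))]
  exact alternatize_radial _ _ s _

theorem clm_fderivWithin_parametric_add {E M N : Type} [NormedAddCommGroup E] [NormedSpace ℝ E]
    [FiniteDimensional ℝ E] [NormedAddCommGroup M] [NormedSpace ℝ M] [CompleteSpace M]
    [NormedAddCommGroup N] [NormedSpace ℝ N] [CompleteSpace N] {S C : Set E}
    (Φ : (E →L[ℝ] M) →L[ℝ] N) (hS : Convex ℝ S) {F : E × ℝ → M} {F' : E × ℝ → E →L[ℝ] M}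
    {f : E → M} (hF : ContinuousOn F (S ×ˢ Icc 0 1)) (hF' : ContinuousOn F' (S ×ˢ Icc 0 1))
    (h : ∀ x ∈ S, ∀ u ∈ Icc (0:ℝ) 1, HasFDerivWithinAt (fun y => F (y, u)) (F' (x, u)) S x)
    {x : E} (hx : x ∈ S) (hC : UniqueDiffWithinAt ℝ C x) (hSC : S ∈ 𝓝[C] x)
    (hf : ∀ y ∈ S, f y = ∫ s in (0:ℝ)..1, F (y, s)) {Q : E × ℝ → N} {q q' : ℝ → N}
    (hQ : ContinuousOn Q (S ×ˢ Icc 0 1))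
    (hq : ∀ s ∈ Icc (0:ℝ) 1, HasDerivWithinAt q (q' s) (Icc 0 1) s)
    (hPQ : ∀ s ∈ Icc (0:ℝ) 1, Φ (F' (x, s)) + Q (x, s) = q' s) :
    Φ (fderivWithin ℝ f C x) + (∫ s in (0:ℝ)..1, Q (x, s)) = q 1 - q 0 := by
  rw [clm_fderivWithin_parametric Φ hS hF hF' h hx hC hSC hf]
  exact integral_add_integral_eq_sub (intervalIntegrable_clm_slice Φ hF' hx)
    (intervalIntegrable_slice hQ hx) hq hPQ

/-- The base point `z` is constant near `c`, so it is not differentiated. The combined integrand is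
the derivative of `s^(k+1) ω (z + s (c - z))`, whose end values are `0` and `ω c`. -/
theorem extD_contractBox_add (hA : IsClosed A) (hω : IsFormOn A ω) (hc : c ∈ box A B) :
    extD A (contractBox A ω) c + contractBox A (extD A ω) c = ω c := by
  refine (congrArg₂ (· + ·) (extD_of_mem hc) (contractBox_eq_on (mem_boxComp hc))).trans ?_
  refine (clm_fderivWithin_parametric_add
    (ContinuousAlternatingMap.alternatizeUncurryFinCLM ℝ _ ℝ) (convex_boxComp c)
    (contDiffOn_radial hω hc).continuousOn (continuousOn_radialDeriv hA hω hc)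
    (fun x hx u hu => hasFDerivWithinAt_radial hω hc hx hu) (mem_boxComp hc)
    (uniqueDiffOn_cube c hc.1) (boxComp_mem_nhdsWithin hA hc) (fun y hy => contractBox_eq_on hy)
    (contDiffOn_radial (hω.extD hA) hc).continuousOn
    (fun s hs => hasDerivWithinAt_radial_path hω hc hs)
    (fun s hs => alternatize_radialDeriv_add hc hs)).trans ?_
  simp

/-- The Poincaré lemma on the components of the box. -/
theorem contractBox_homotopy (hA : IsClosed A) (hω : IsFormOn A ω) :
    extD A (contractBox A ω) + contractBox A (extD A ω) = ω := by
  funext c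
  by_cases hc : c ∈ box A B
  · exact extD_contractBox_add hA hω hc
  · rw [Pi.add_apply, (hω.contractBox hA).extD hA |>.zero_off c hc,
      (hω.extD hA).contractBox hA |>.zero_off c hc, hω.zero_off c hc, add_zero]

/-- The coordinates constant on a face are `0` or `1`, and these points are the base points of their
own components. -/
theorem baseVec_faceMap (h0 : (0:ℝ) ∉ A) (h1 : (1:ℝ) ∉ A) (hA : A ⊆ Icc 0 1)
    (hne : A.Nonempty) {L : (B' → ℝ) →L[ℝ] (B → ℝ)} {c : B → ℝ} (h : IsFaceMap L c) (y : B' → ℝ) :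
    baseVec A (L y + c) = L (baseVec A y) + c := by
  funext b
  change basePt A ((L y + c) b) = _
  rcases h.coord b with ⟨b', hb⟩ | hb | hb
  · rw [hb, hb]; rfl
  · rw [hb, hb, basePt_zero h0]
  · rw [hb, hb, basePt_one h1 hA hne]

/-- The radial contraction is natural for face maps. -/
theorem pullback_contractBox (h0 : (0:ℝ) ∉ A) (h1 : (1:ℝ) ∉ A) (hA : A ⊆ Icc 0 1)
    (hne : A.Nonempty) {L : (B' → ℝ) →L[ℝ] (B → ℝ)} {c : B → ℝ} (h : IsFaceMap L c)
    {ω : FormField B (k + 1)} (hω : IsFormOn A ω) :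
    pullback L c (contractBox A ω) = contractBox A (pullback L c ω) := by
  have hbase := fun y => baseVec_faceMap h0 h1 hA hne h y
  funext y
  have hm := h.mem_box_iff h0 h1 y
  by_cases hy : y ∈ box A B'
  · change (contractBox A ω (L y + c)).compContinuousLinearMap L = _
    rw [contractBox_of_mem hy, contractBox_of_mem (hm.2 hy), hbase]
    have hL : L y + c - (L (baseVec A y) + c) = L (y - baseVec A y) := by
      rw [map_sub]; abel
    change ContinuousAlternatingMap.compContinuousLinearMapCLM L _ = _
    have e : ∀ s : ℝ, radial (baseVec A y) (pullback L c ω) (y, s) =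
        ContinuousAlternatingMap.compContinuousLinearMapCLM L
          (radial (L (baseVec A y) + c) ω (L y + c, s)) := fun s => by
      ext v
      change s ^ k * (∑ b, (y b - baseVec A y b) • iota b _) v = s ^ k *
        (∑ b, ((L y + c) b - (L (baseVec A y) + c) b) • iota b _) fun i => L (v i)
      rw [show (∑ b, (y b - baseVec A y b) • iota b (pullback L c ω
        (baseVec A y + s • (y - baseVec A y)))) v = _ from sum_smul_iota_apply (y - baseVec A y) _ v,
        show (∑ b, ((L y + c) b - (L (baseVec A y) + c) b) • iota b _) (fun i => L (v i)) = _ from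
          sum_smul_iota_apply (L y + c - (L (baseVec A y) + c)) _ _]
      change s ^ k * ω (L (baseVec A y + s • (y - baseVec A y)) + c)
        (fun i => L (Matrix.vecCons (y - baseVec A y) v i)) = s ^ k *
        ω (L (baseVec A y) + c + s • (L y + c - (L (baseVec A y) + c)))
        (Matrix.vecCons (L y + c - (L (baseVec A y) + c)) fun i => L (v i))
      rw [hL, map_add, map_smul, add_right_comm]
      congr 2
      funext i
      refine Fin.cases rfl (fun i => rfl) i
    simp only [e]
    refine (ContinuousLinearMap.intervalIntegral_comp_comm _ ?_).symm
    rw [← hbase]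
    exact intervalIntegrable_slice (contDiffOn_radial hω (hm.2 hy)).continuousOn
      (mem_boxComp (hm.2 hy))
  · change (contractBox A ω (L y + c)).compContinuousLinearMap L = _
    rw [contractBox, contractBox, if_neg hy, if_neg (fun k => hy (hm.1 k))]
    rfl

end Poincare

end OrbiCell

namespace OrbiCell

open Set Filter Topology

/-! ### Cut points in the interval and the partition of unity they define. -/

section Cutoffs

/-- Points `a j` of `(0,1)` and smooth functions `φ j` on the line that vanish near `a j` and are
equal to `1` outside of disjoint subsets of `(0,1)`. -/
structure Cutoffs (ι : Type) where
  a : ι → ℝ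
  φ : ι → ℝ → ℝ
  mem : ∀ j, a j ∈ Ioo (0:ℝ) 1
  smooth : ∀ j, ContDiff ℝ ((⊤ : ℕ∞) : WithTop ℕ∞) (φ j)
  nonneg : ∀ j t, 0 ≤ φ j t
  vanish : ∀ j, φ j =ᶠ[𝓝 (a j)] 0
  zero : ∀ j, φ j 0 = 1
  one : ∀ j, φ j 1 = 1
  disj : ∀ i j t, i ≠ j → φ i t = 1 ∨ φ j t = 1

theorem nonempty_cutoffs (N : ℕ) : Nonempty (Cutoffs (Fin N)) := by
  let r : ℝ := 1 / (N + 1)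
  have hr : 0 < r := by positivity
  have hN : (N + 1 : ℝ) * r = 1 := by simp only [r]; field_simp
  let a : Fin N → ℝ := fun j => (j + 1) * r
  -- The points are multiples of `r` at distance at least `r` from `0` and `1`. Bumps of outer
  -- radius `r / 3` are disjoint and do not reach the end points.
  let f : ∀ j, ContDiffBump (a j) := fun j =>
    { rIn := r / 4, rOut := r / 3, rIn_pos := by positivity, rIn_lt_rOut := by linarith }
  have ha : ∀ j, r ≤ a j ∧ a j ≤ 1 - r := fun j => by
    have h1 : (j : ℝ) + 1 ≤ N := by exact_mod_cast j.2
    have h0 : (0:ℝ) ≤ j := Nat.cast_nonneg _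
    constructor
    · change r ≤ (j + 1) * r
      nlinarith
    · change (j + 1) * r ≤ 1 - r
      nlinarith
  have far : ∀ j t, r / 3 ≤ |t - a j| → f j t = 0 := fun j t h => (f j).zero_of_le_dist h
  refine ⟨⟨a, fun j t => 1 - f j t, fun j => ?_, fun j => ?_, fun j t => ?_, fun j => ?_,
    fun j => ?_, fun j => ?_, fun i j t hij => ?_⟩⟩
  · have := ha j
    exact ⟨by linarith, by linarith⟩
  · exact contDiff_const.sub (f j).contDiff
  · exact sub_nonneg.2 (f j).le_one
  · filter_upwards [(f j).eventuallyEq_one] with t ht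
    rw [ht]
    simp
  · rw [far, sub_zero]
    have := ha j
    rw [zero_sub, abs_neg, abs_of_nonneg (by linarith)]
    linarith
  · rw [far, sub_zero]
    have := ha j
    rw [abs_of_nonneg (by linarith)]
    linarith
  · by_contra! h
    have hi : |t - a i| < r / 3 := by
      by_contra! hc
      exact h.1 (by rw [far i t hc, sub_zero])
    have hj : |t - a j| < r / 3 := by
      by_contra! hc
      exact h.2 (by rw [far j t hc, sub_zero])
    have h1 : |a i - a j| < r := by
      have := abs_sub_le (a i) t (a j)
      rw [abs_sub_comm (a i) t] at this
      linarith
    have h2 : (1:ℝ) ≤ |(i : ℝ) - j| := by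
      have : (i : ℤ) - j ≠ 0 := fun e => hij (Fin.ext (by omega))
      exact_mod_cast Int.one_le_abs this
    have h3 : a i - a j = ((i : ℝ) - j) * r := by simp only [a]; ring
    rw [h3, abs_mul, abs_of_pos hr] at h1
    nlinarith

variable {ι : Type} [Fintype ι] (K : Cutoffs ι) {B B' : Type} [Fintype B] [Fintype B']

namespace Cutoffs

/-- The set of the points `a j` with `j ∈ s`. -/
def cut (s : Set ι) : Set ℝ := K.a '' s

theorem isClosed_cut (s : Set ι) : IsClosed (K.cut s) := (s.toFinite.image _).isClosed

theorem cut_subset (s : Set ι) : K.cut s ⊆ Icc 0 1 := by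
  rintro _ ⟨j, -, rfl⟩
  exact Ioo_subset_Icc_self (K.mem j)

theorem zero_notMem (s : Set ι) : (0:ℝ) ∉ K.cut s := by
  rintro ⟨j, -, h⟩
  exact (K.mem j).1.ne' h

theorem one_notMem (s : Set ι) : (1:ℝ) ∉ K.cut s := by
  rintro ⟨j, -, h⟩
  exact (K.mem j).2.ne h

theorem cut_mono {s t : Set ι} (h : s ⊆ t) : K.cut s ⊆ K.cut t := image_mono h

/-- The product of the cutoff functions over the coordinates. -/
noncomputable def bump (j : ι) (x : B → ℝ) : ℝ := ∏ b, K.φ j (x b)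

theorem bump_nonneg (j : ι) (x : B → ℝ) : 0 ≤ K.bump j x :=
  Finset.prod_nonneg fun _ _ => K.nonneg _ _

theorem contDiff_bump (j : ι) :
    ContDiff ℝ ((⊤ : ℕ∞) : WithTop ℕ∞) (K.bump j : (B → ℝ) → ℝ) :=
  contDiff_prod fun b _ => (K.smooth j).comp (contDiff_apply ℝ ℝ b)

theorem eventually_bump (j : ι) {x : B → ℝ} {b : B} (h : x b = K.a j) :
    ∀ᶠ y in 𝓝 x, K.bump j y = 0 := by
  have h1 : ∀ᶠ y : B → ℝ in 𝓝 x, K.φ j (y b) = 0 :=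
    (continuous_apply b).continuousAt.eventually (h ▸ K.vanish j)
  exact h1.mono fun y hy => Finset.prod_eq_zero (Finset.mem_univ b) hy

/-- Otherwise every `j` has a coordinate of `x` at which `φ j ≠ 1`. By the pigeonhole principle two
indices share such a coordinate, contrary to disjointness. -/
theorem exists_bump_eq_one (h : Fintype.card B < Fintype.card ι) (x : B → ℝ) :
    ∃ j, K.bump j x = 1 := by
  classical
  by_contra! hc
  have h1 : ∀ j, ∃ b, K.φ j (x b) ≠ 1 := fun j => by
    by_contra! hj
    exact hc j (Finset.prod_eq_one fun b _ => hj b)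
  choose b hb using h1
  obtain ⟨i, j, hij, e⟩ := Fintype.exists_ne_map_eq_of_card_lt b h
  rcases K.disj i j (x (b i)) hij with h2 | h2
  · exact hb i h2
  · exact hb j (e ▸ h2)

theorem sum_bump_pos (h : Fintype.card B < Fintype.card ι) (x : B → ℝ) :
    0 < ∑ j, K.bump j x := by
  obtain ⟨j, hj⟩ := K.exists_bump_eq_one h x
  exact Finset.sum_pos' (fun i _ => K.bump_nonneg i x) ⟨j, Finset.mem_univ _, by rw [hj]; norm_num⟩

/-- Coordinates constant on the face contribute the factor `φ j 0` or `φ j 1`, which is one. So the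
functions on the cubes are compatible with the gluing. -/
theorem bump_faceMap {L : (B' → ℝ) →L[ℝ] (B → ℝ)} {c : B → ℝ} (h : IsFaceMap L c) (j : ι)
    (y : B' → ℝ) : K.bump j (L y + c) = K.bump j y := by
  obtain ⟨f, hf, h1, h2⟩ := h
  refine (Fintype.prod_of_injective f hf _ _ (fun b hb => ?_) fun b' => ?_).symm
  · rcases h2 b hb with h3 | h3
    · rw [h3, K.zero]
    · rw [h3, K.one]
  · rw [h1]

/-- The partition of unity subordinate to the sets on which no coordinate is `a j`. -/
noncomputable def part (j : ι) (x : B → ℝ) : ℝ := K.bump j x / ∑ i, K.bump i x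

theorem contDiff_part (h : Fintype.card B < Fintype.card ι) (j : ι) :
    ContDiff ℝ ((⊤ : ℕ∞) : WithTop ℕ∞) (K.part j : (B → ℝ) → ℝ) :=
  (K.contDiff_bump j).div (ContDiff.sum fun i _ => K.contDiff_bump i)
    fun x => (K.sum_bump_pos h x).ne'

theorem sum_part (h : Fintype.card B < Fintype.card ι) (x : B → ℝ) : ∑ j, K.part j x = 1 := by
  simp only [part]
  rw [← Finset.sum_div, div_self (K.sum_bump_pos h x).ne']

theorem eventually_part (j : ι) {x : B → ℝ} {b : B} (h : x b = K.a j) :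
    ∀ᶠ y in 𝓝 x, K.part j y = 0 :=
  (K.eventually_bump j h).mono fun y hy => by rw [part, hy, zero_div]

theorem part_faceMap {L : (B' → ℝ) →L[ℝ] (B → ℝ)} {c : B → ℝ} (h : IsFaceMap L c) (j : ι)
    (y : B' → ℝ) : K.part j (L y + c) = K.part j y := by
  simp only [part, K.bump_faceMap h]

theorem exists_eq_of_not_mem_box {s : Set ι} {j : ι} {x : B → ℝ} (hx : x ∈ box (K.cut s) B)
    (h : x ∉ box (K.cut (insert j s)) B) : ∃ b, x b = K.a j := by
  by_contra! hc
  refine h ⟨hx.1, fun b => ?_⟩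
  rintro ⟨i, rfl | hi, e⟩
  · exact hc b e.symm
  · exact hx.2 b ⟨i, hi, e⟩

end Cutoffs

end Cutoffs

/-! ### Restriction of forms, and extension by zero with the partition of unity. -/

section CutForms

variable {A A' : Set ℝ} {B B' : Type} [Fintype B] [Fintype B'] {k : ℕ} {g n : ℕ}

open Classical in
/-- The restriction of a form to `box A B`. -/
noncomputable def restrictForm (A : Set ℝ) (ω : FormField B k) : FormField B k :=
  fun x => if x ∈ box A B then ω x else 0

theorem restrictForm_of_mem {ω : FormField B k} {x : B → ℝ} (hx : x ∈ box A B) :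
    restrictForm A ω x = ω x := if_pos hx

theorem restrictForm_eventuallyEq (hA : IsClosed A) (ω : FormField B k) {x : B → ℝ}
    (hx : x ∈ box A B) : restrictForm A ω =ᶠ[𝓝[cube B] x] ω :=
  (eventually_mem_box hA hx).mono fun _ hy => restrictForm_of_mem hy

theorem IsFormOn.restrictForm (hA : IsClosed A) (hAA : A' ⊆ A) {ω : FormField B k}
    (h : IsFormOn A' ω) : IsFormOn A (restrictForm A ω) where
  smooth x hx := (h.smooth x (box_anti hAA hx)).congr_of_eventuallyEq
    (restrictForm_eventuallyEq hA ω hx) (restrictForm_of_mem hx)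
  zero_off x hx := if_neg hx

theorem pullback_restrictForm (h0 : (0:ℝ) ∉ A) (h1 : (1:ℝ) ∉ A) {L : (B' → ℝ) →L[ℝ] (B → ℝ)}
    {c : B → ℝ} (h : IsFaceMap L c) (ω : FormField B k) :
    pullback L c (restrictForm A ω) = restrictForm A (pullback L c ω) := by
  funext y
  have hm := h.mem_box_iff h0 h1 y
  by_cases hy : y ∈ box A B'
  · rw [restrictForm_of_mem hy, pullback, restrictForm_of_mem (hm.2 hy), pullback]
  · rw [restrictForm, if_neg hy, pullback, restrictForm, if_neg fun k => hy (hm.1 k)]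
    rfl

theorem extD_restrictForm (hA : IsClosed A) (hAA : A' ⊆ A) (ω : FormField B k) :
    extD A (restrictForm A ω) = restrictForm A (extD A' ω) := by
  funext x
  by_cases hx : x ∈ box A B
  · rw [extD_of_mem hx, restrictForm_of_mem hx, extD_of_mem (box_anti hAA hx),
      (restrictForm_eventuallyEq hA ω hx).extDerivWithin_eq (restrictForm_of_mem hx)]
  · rw [extD, if_neg hx, restrictForm, if_neg hx]

theorem restrictForm_restrictForm (hAA : A' ⊆ A) (ω : FormField B k) :
    restrictForm A (restrictForm A' ω) = restrictForm A ω := by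
  funext x
  by_cases hx : x ∈ box A B
  · rw [restrictForm_of_mem hx, restrictForm_of_mem hx, restrictForm_of_mem (box_anti hAA hx)]
  · rw [restrictForm, if_neg hx, restrictForm, if_neg hx]

/-- A natural operation on forms maps orbi-cellular forms to orbi-cellular forms. -/
theorem IsOrbiFormOn.map {l : ℕ} {ω : ∀ γ : Cell g n, FormField γ.Black k}
    (hω : IsOrbiFormOn A ω) (T : ∀ (B : Type) [Fintype B], FormField B k → FormField B l)
    (h1 : ∀ γ : Cell g n, ∀ ω : FormField γ.Black k, IsFormOn A ω → IsFormOn A' (T _ ω))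
    (h2 : ∀ (B B' : Type) [Fintype B] [Fintype B'] (L : (B' → ℝ) →L[ℝ] (B → ℝ)) (c : B → ℝ)
      (ω : FormField B k), IsFaceMap L c → IsFormOn A ω →
      pullback L c (T _ ω) = T _ (pullback L c ω)) :
    IsOrbiFormOn A' fun γ => T _ (ω γ) where
  form γ := h1 γ _ (hω.form γ)
  invariant γ γ' φ := by rw [h2 _ _ _ _ _ (isFaceMap_reindex _) (hω.form γ), hω.invariant]
  zero_face γ e := by rw [h2 _ _ _ _ _ (isFaceMap_zero _ _) (hω.form γ), hω.zero_face]
  infty_face γ e := by rw [h2 _ _ _ _ _ (isFaceMap_one _ _) (hω.form γ), hω.infty_face]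

variable {ι : Type} [Fintype ι] (K : Cutoffs ι)

/-- The restriction of orbi-cellular forms. -/
noncomputable def orbiRes (g n k : ℕ) (s t : Set ι) (h : s ⊆ t) :
    orbiFormsOn (K.cut s) g n k →ₗ[ℝ] orbiFormsOn (K.cut t) g n k where
  toFun ω := ⟨fun γ => restrictForm (K.cut t) (ω.1 γ), ω.2.map (fun _ _ => restrictForm (K.cut t))
    (fun _ _ hω => hω.restrictForm (K.isClosed_cut t) (K.cut_mono h))
    (fun _ _ _ _ _ _ _ hL _ => pullback_restrictForm (K.zero_notMem t) (K.one_notMem t) hL _)⟩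
  map_add' ω η := Subtype.ext (funext fun γ => funext fun x => by
    by_cases hx : x ∈ box (K.cut t) γ.Black
    · simp [restrictForm, hx]
    · simp [restrictForm, hx])
  map_smul' r ω := Subtype.ext (funext fun γ => funext fun x => by
    by_cases hx : x ∈ box (K.cut t) γ.Black
    · simp [restrictForm, hx]
    · simp [restrictForm, hx])

/-- Multiplication by a function of the partition of unity. -/
noncomputable def partMul (j : ι) (ω : FormField B k) : FormField B k :=
  fun x => K.part j x • ω x

/-- Where a coordinate equals `a j` the function of the partition vanishes on a neighbourhood, so
the product extends smoothly by zero. -/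
theorem IsFormOn.partMul (hB : Fintype.card B < Fintype.card ι) {j : ι} {s : Set ι}
    {ω : FormField B k} (h : IsFormOn (K.cut (insert j s)) ω) :
    IsFormOn (K.cut s) (partMul K j ω) where
  smooth x hx := by
    by_cases hx' : x ∈ box (K.cut (insert j s)) B
    · exact (K.contDiff_part hB j).contDiffAt.contDiffWithinAt.smul (h.smooth x hx')
    · obtain ⟨b, hb⟩ := K.exists_eq_of_not_mem_box hx hx'
      have h0 := K.eventually_part j hb
      refine (contDiffWithinAt_const (c := (0 : (B → ℝ) [⋀^Fin k]→L[ℝ] ℝ))).congr_of_eventuallyEq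
        (nhdsWithin_le_nhds (h0.mono fun y hy => ?_)) ?_
      · rw [OrbiCell.partMul, hy, zero_smul]
      · rw [OrbiCell.partMul, h0.self_of_nhds, zero_smul]
  zero_off x hx := by
    rw [OrbiCell.partMul,
      h.zero_off x fun k => hx (box_anti (K.cut_mono (subset_insert j s)) k), smul_zero]

theorem pullback_partMul {L : (B' → ℝ) →L[ℝ] (B → ℝ)} {c : B → ℝ} (h : IsFaceMap L c) (j : ι)
    (ω : FormField B k) : pullback L c (partMul K j ω) = partMul K j (pullback L c ω) := by
  funext y
  rw [pullback, partMul, K.part_faceMap h]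
  rfl

theorem partMul_restrictForm (j : ι) (t : Set ι) (ω : FormField B k) :
    restrictForm (K.cut t) (partMul K j ω) =
      partMul K j (restrictForm (K.cut (insert j t)) ω) := by
  funext x
  by_cases hx : x ∈ box (K.cut t) B
  · rw [restrictForm_of_mem hx]
    by_cases hx' : x ∈ box (K.cut (insert j t)) B
    · rw [partMul, partMul, restrictForm_of_mem hx']
    · obtain ⟨b, hb⟩ := K.exists_eq_of_not_mem_box hx hx'
      rw [partMul, partMul, (K.eventually_part j hb).self_of_nhds, zero_smul, zero_smul]
  · rw [restrictForm, if_neg hx, partMul, restrictForm,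
      if_neg fun k => hx (box_anti (K.cut_mono (subset_insert j t)) k), smul_zero]

theorem sum_partMul (hB : Fintype.card B < Fintype.card ι) {s : Set ι} {ω : FormField B k}
    (hω : IsFormOn (K.cut s) ω) :
    ∑ j, partMul K j (restrictForm (K.cut (insert j s)) ω) = ω := by
  have h : ∀ j, partMul K j (restrictForm (K.cut (insert j s)) ω) = partMul K j ω := fun j => by
    rw [← partMul_restrictForm]
    funext x
    by_cases hx : x ∈ box (K.cut s) B
    · exact restrictForm_of_mem hx
    · rw [restrictForm, if_neg hx, partMul, hω.zero_off x hx, smul_zero]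
  simp only [h]
  funext x
  rw [Finset.sum_apply]
  simp only [partMul]
  rw [← Finset.sum_smul, K.sum_part hB, one_smul]

variable (hK : 6 * g + 3 * n < Fintype.card ι)

/-- Extension by zero by means of the partition of unity. -/
noncomputable def orbiExt (k : ℕ) (j : ι) (s : Set ι) :
    orbiFormsOn (K.cut (insert j s)) g n k →ₗ[ℝ] orbiFormsOn (K.cut s) g n k where
  toFun ω := ⟨fun γ => partMul K j (ω.1 γ), ω.2.map (fun _ _ => partMul K j)
    (fun γ _ hω => hω.partMul K (γ.card_black_le.trans_lt hK))
    (fun _ _ _ _ _ _ _ hL _ => pullback_partMul K hL j _)⟩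
  map_add' ω η := Subtype.ext (funext fun γ => funext fun x => smul_add _ _ _)
  map_smul' r ω := Subtype.ext (funext fun γ => funext fun x =>
    smul_comm (K.part j x) r (ω.1 γ x))

end CutForms

end OrbiCell

namespace OrbiCell

open Set Filter Topology

/-! ### The open sets of the cover and their locally constant functions. -/

section Avoid

variable {g n : ℕ} {A : Set ℝ}

/-- The point of `L^∞_{g,n}` with coordinates `x` in the cell `γ`. -/
def toLInfty (γ : Cell g n) (x : cube γ.Black) : LInfty g n := Quot.mk _ ⟨γ, x⟩

theorem continuous_toLInfty (γ : Cell g n) : Continuous (toLInfty γ) :=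
  continuous_quot_mk.comp continuous_sigmaMk

/-- All three kinds of gluing are along face maps, so descent to the quotient is checked once for
face maps. -/
theorem Glue.exists_isFaceMap {p q : Σ γ : Cell g n, cube γ.Black} (h : Glue g n p q) :
    ∃ (L : (p.1.Black → ℝ) →L[ℝ] (q.1.Black → ℝ)) (c : q.1.Black → ℝ), IsFaceMap L c ∧
      q.2.1 = L p.2.1 + c ∧ ∀ y z, z.1 = L y.1 + c → Glue g n ⟨p.1, y⟩ ⟨q.1, z⟩ := by
  cases h with
  | iso φ x y h =>
    exact ⟨_, 0, isFaceMap_reindex _, h.trans (add_zero _).symm,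
      fun y z hz => .iso φ z y (hz.trans (add_zero _))⟩
  | zero e x y h =>
    exact ⟨_, 0, isFaceMap_zero _ _, h.trans (add_zero _).symm,
      fun y z hz => .zero e z y (hz.trans (add_zero _))⟩
  | infty e x y h => exact ⟨_, _, isFaceMap_one _ _, h, fun y z hz => .infty e z y hz⟩

theorem Glue.mem_box_iff (h0 : (0:ℝ) ∉ A) (h1 : (1:ℝ) ∉ A) {p q : Σ γ : Cell g n, cube γ.Black}
    (h : Glue g n p q) : p.2.1 ∈ box A p.1.Black ↔ q.2.1 ∈ box A q.1.Black := by
  obtain ⟨L, c, hL, e, -⟩ := h.exists_isFaceMap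
  rw [e]
  exact (hL.mem_box_iff h0 h1 _).symm

/-- The points of `L^∞_{g,n}` none of whose coordinates lies in `A`. -/
def avoid (A : Set ℝ) (g n : ℕ) : Set (LInfty g n) :=
  {p | ∃ γ x, x.1 ∈ box A γ.Black ∧ toLInfty γ x = p}

/-- Whether a coordinate lies in `A` is unchanged by gluing, so it does not depend on the
representative of the point. -/
theorem toLInfty_mem_avoid (h0 : (0:ℝ) ∉ A) (h1 : (1:ℝ) ∉ A) {γ : Cell g n} {x : cube γ.Black} :
    toLInfty γ x ∈ avoid A g n ↔ x.1 ∈ box A γ.Black := by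
  refine ⟨fun ⟨γ', x', hx', e⟩ => ?_, fun h => ⟨γ, x, h, rfl⟩⟩
  let P : LInfty g n → Prop := Quot.lift (fun p => p.2.1 ∈ box A p.1.Black)
    fun p q h => propext (h.mem_box_iff h0 h1)
  exact (congrArg P e).mp hx'

theorem exists_toLInfty (p : LInfty g n) : ∃ γ x, toLInfty γ x = p := by
  obtain ⟨⟨γ, x⟩, rfl⟩ := Quot.exists_rep p
  exact ⟨γ, x, rfl⟩

/-- In the quotient topology openness is tested on every cube, and there the component of a point in
the box is a neighbourhood of it. -/
theorem isOpen_avoid_inter (hA : IsClosed A) {S : Set (LInfty g n)} (hS : S ⊆ avoid A g n)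
    (h0 : (0:ℝ) ∉ A) (h1 : (1:ℝ) ∉ A)
    (h : ∀ (γ : Cell g n) (x y : cube γ.Black), toLInfty γ x ∈ S → y.1 ∈ boxComp A x.1 →
      toLInfty γ y ∈ S) : IsOpen S := by
  refine isOpen_coinduced.2 (isOpen_sigma_iff.2 fun γ => isOpen_iff_mem_nhds.2 fun x hx => ?_)
  have hx' : x.1 ∈ box A γ.Black := (toLInfty_mem_avoid h0 h1).1 (hS hx)
  have h2 := boxComp_mem_nhdsWithin hA hx'
  rw [nhdsWithin_eq_map_subtype_coe hx'.1] at h2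
  exact mem_of_superset (mem_map.1 h2) fun y hy => h γ x y hx hy

theorem isOpen_avoid (hA : IsClosed A) (h0 : (0:ℝ) ∉ A) (h1 : (1:ℝ) ∉ A) :
    IsOpen (avoid A g n) :=
  isOpen_avoid_inter hA subset_rfl h0 h1 fun _ x _ _ hy =>
    (toLInfty_mem_avoid h0 h1).2 (boxComp_subset_box x.1 hy)

/-- A function constant on the components of the boxes is locally constant. -/
theorem eventually_eq_of_boxComp {M : Type*} (hA : IsClosed A) (h0 : (0:ℝ) ∉ A) (h1 : (1:ℝ) ∉ A)
    {f : LInfty g n → M} (h : ∀ (γ : Cell g n) (x y : cube γ.Black), x.1 ∈ box A γ.Black →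
      y.1 ∈ boxComp A x.1 → f (toLInfty γ y) = f (toLInfty γ x))
    {p : LInfty g n} (hp : p ∈ avoid A g n) : ∀ᶠ q in 𝓝 p, f q = f p := by
  have ho : IsOpen {q | q ∈ avoid A g n ∧ f q = f p} :=
    isOpen_avoid_inter hA (fun q hq => hq.1) h0 h1 fun γ x y hx hy =>
      ⟨(toLInfty_mem_avoid h0 h1).2 (boxComp_subset_box x.1 hy),
        (h γ x y ((toLInfty_mem_avoid h0 h1).1 hx.1) hy).trans hx.2⟩
  have h2 : {q | q ∈ avoid A g n ∧ f q = f p} ∈ 𝓝 p := ho.mem_nhds ⟨hp, rfl⟩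
  filter_upwards [h2] with q hq using hq.2

theorem avoid_anti {A' : Set ℝ} (h : A ⊆ A') : avoid A' g n ⊆ avoid A g n := by
  rintro _ ⟨γ, x, hx, rfl⟩
  exact ⟨γ, x, box_anti h hx, rfl⟩

/-- The functions on `L^∞_{g,n}` that are locally constant on `avoid A` and zero elsewhere. -/
def locConst (A : Set ℝ) (g n : ℕ) : Submodule ℝ (LInfty g n → ℝ) where
  carrier := {f | (∀ p, p ∉ avoid A g n → f p = 0) ∧ ∀ p ∈ avoid A g n, ∀ᶠ q in 𝓝 p, f q = f p}
  zero_mem' := ⟨fun _ _ => rfl, fun _ _ => Eventually.of_forall fun _ => rfl⟩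
  add_mem' {f f'} h h' := ⟨fun p hp => by rw [Pi.add_apply, h.1 p hp, h'.1 p hp, add_zero],
    fun p hp => by
      filter_upwards [h.2 p hp, h'.2 p hp] with q e e'
      rw [Pi.add_apply, e, e', Pi.add_apply]⟩
  smul_mem' r f h := ⟨fun p hp => by rw [Pi.smul_apply, h.1 p hp, smul_zero], fun p hp => by
    filter_upwards [h.2 p hp] with q e
    rw [Pi.smul_apply, e, Pi.smul_apply]⟩

open Classical in
/-- The restriction of locally constant functions. -/
noncomputable def locConstRes {A A' : Set ℝ} (h : IsOpen (avoid A' g n)) (hAA : A ⊆ A') :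
    locConst A g n →ₗ[ℝ] locConst A' g n where
  toFun f := ⟨fun p => if p ∈ avoid A' g n then f.1 p else 0, fun p hp => if_neg hp, fun p hp => by
    filter_upwards [f.2.2 p (avoid_anti hAA hp), h.mem_nhds hp] with q e hq
    rw [if_pos hq, if_pos hp, e]⟩
  map_add' f f' := Subtype.ext (funext fun p => by
    by_cases hp : p ∈ avoid A' g n <;> simp [hp])
  map_smul' r f := Subtype.ext (funext fun p => by
    by_cases hp : p ∈ avoid A' g n <;> simp [hp])

theorem locConstRes_of_mem {A A' : Set ℝ} (h : IsOpen (avoid A' g n)) (hAA : A ⊆ A')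
    (f : locConst A g n) {p : LInfty g n} (hp : p ∈ avoid A' g n) :
    (locConstRes h hAA f).1 p = f.1 p := if_pos hp

theorem locConst_ext {f f' : locConst A g n} (h : ∀ p ∈ avoid A g n, f.1 p = f'.1 p) : f = f' :=
  Subtype.ext (funext fun p => by
    by_cases hp : p ∈ avoid A g n
    · exact h p hp
    · rw [f.2.1 p hp, f'.2.1 p hp])

end Avoid

/-! ### Forms resolve the locally constant functions on the intersections of the cover. -/

section LocConstForms

variable {g n : ℕ} {A : Set ℝ}

/-- The real numbers as alternating forms of degree `0`. -/
noncomputable def constForm (E : Type) [NormedAddCommGroup E] [NormedSpace ℝ E] (r : ℝ) :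
    E [⋀^Fin 0]→L[ℝ] ℝ := ContinuousAlternatingMap.constOfIsEmpty ℝ E (Fin 0) r

theorem constForm_apply {E : Type} [NormedAddCommGroup E] [NormedSpace ℝ E] (r : ℝ)
    (v : Fin 0 → E) : constForm E r v = r := rfl

open Classical in
/-- The field of `0`-forms on the cell `γ` given by a function. -/
noncomputable def zeroForm (f : LInfty g n → ℝ) (γ : Cell g n) : FormField γ.Black 0 := fun x =>
  if h : x ∈ cube γ.Black then constForm _ (f (toLInfty γ ⟨x, h⟩)) else 0

theorem zeroForm_of_mem (f : LInfty g n → ℝ) {γ : Cell g n} {x : γ.Black → ℝ}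
    (h : x ∈ cube γ.Black) : zeroForm f γ x = constForm _ (f (toLInfty γ ⟨x, h⟩)) := dif_pos h

theorem zeroForm_eventually (h0 : (0:ℝ) ∉ A) (h1 : (1:ℝ) ∉ A) (f : locConst A g n)
    {γ : Cell g n} {x : γ.Black → ℝ} (hx : x ∈ box A γ.Black) :
    zeroForm f.1 γ =ᶠ[𝓝[cube γ.Black] x] fun _ => zeroForm f.1 γ x := by
  have h2 : ∀ᶠ y in 𝓝 (⟨x, hx.1⟩ : cube γ.Black), f.1 (toLInfty γ y) = f.1 (toLInfty γ ⟨x, hx.1⟩) :=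
    (continuous_toLInfty γ).continuousAt.eventually
      (f.2.2 _ ((toLInfty_mem_avoid h0 h1).2 hx))
  change ∀ᶠ y in 𝓝[cube γ.Black] x, zeroForm f.1 γ y = zeroForm f.1 γ x
  rw [nhdsWithin_eq_map_subtype_coe hx.1, eventually_map]
  filter_upwards [h2] with y hy
  rw [zeroForm_of_mem _ y.2, zeroForm_of_mem _ hx.1, hy]

theorem isFormOn_zeroForm (h0 : (0:ℝ) ∉ A) (h1 : (1:ℝ) ∉ A) (f : locConst A g n) (γ : Cell g n) :
    IsFormOn A (zeroForm f.1 γ) where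
  smooth x hx := (contDiffWithinAt_const (c := zeroForm f.1 γ x)).congr_of_eventuallyEq
    (zeroForm_eventually h0 h1 f hx) rfl
  zero_off x hx := by
    by_cases h : x ∈ cube γ.Black
    · rw [zeroForm_of_mem _ h, f.2.1 _ fun k => hx ((toLInfty_mem_avoid h0 h1).1 k)]
      ext v
      rfl
    · exact dif_neg h

theorem pullback_zeroForm (f : LInfty g n → ℝ) {γ γ' : Cell g n}
    {L : (γ'.Black → ℝ) →L[ℝ] (γ.Black → ℝ)} {c : γ.Black → ℝ} (hL : IsFaceMap L c)
    (h : ∀ y z, z.1 = L y.1 + c → Glue g n ⟨γ', y⟩ ⟨γ, z⟩) :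
    pullback L c (zeroForm f γ) = zeroForm f γ' := by
  funext y
  have hm := hL.mem_cube_iff y
  by_cases hy : y ∈ cube γ'.Black
  · rw [zeroForm_of_mem f hy, pullback, zeroForm_of_mem f (hm.2 hy),
      show toLInfty γ ⟨L y + c, hm.2 hy⟩ = toLInfty γ' ⟨y, hy⟩ from (Quot.sound (h _ _ rfl)).symm]
    rfl
  · rw [zeroForm, dif_neg hy, pullback, zeroForm, dif_neg fun k => hy (hm.1 k)]
    rfl

theorem isOrbiFormOn_zeroForm (h0 : (0:ℝ) ∉ A) (h1 : (1:ℝ) ∉ A) (f : locConst A g n) :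
    IsOrbiFormOn A (zeroForm f.1) where
  form := isFormOn_zeroForm h0 h1 f
  invariant γ γ' φ := pullback_zeroForm f.1 (isFaceMap_reindex _)
    fun y z hz => .iso φ z y (hz.trans (add_zero _))
  zero_face γ e := pullback_zeroForm f.1 (isFaceMap_zero _ _)
    fun y z hz => .zero e z y (hz.trans (add_zero _))
  infty_face γ e := pullback_zeroForm f.1 (isFaceMap_one _ _) fun y z hz => .infty e z y hz

/-- Locally constant functions as orbi-cellular `0`-forms. -/
noncomputable def locConstForm (h0 : (0:ℝ) ∉ A) (h1 : (1:ℝ) ∉ A) :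
    locConst A g n →ₗ[ℝ] orbiFormsOn A g n 0 where
  toFun f := ⟨zeroForm f.1, isOrbiFormOn_zeroForm h0 h1 f⟩
  map_add' f f' := Subtype.ext (funext fun γ => funext fun x =>
    ContinuousAlternatingMap.ext fun v => by
      by_cases hx : x ∈ cube γ.Black <;> simp [zeroForm, hx, constForm_apply])
  map_smul' r f := Subtype.ext (funext fun γ => funext fun x =>
    ContinuousAlternatingMap.ext fun v => by
      by_cases hx : x ∈ cube γ.Black <;> simp [zeroForm, hx, constForm_apply])

theorem locConstForm_injective (h0 : (0:ℝ) ∉ A) (h1 : (1:ℝ) ∉ A) :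
    Function.Injective (locConstForm (g := g) (n := n) h0 h1) := by
  intro f f' h
  refine locConst_ext fun p _ => ?_
  obtain ⟨γ, x, rfl⟩ := exists_toLInfty p
  have h2 : zeroForm f.1 γ x.1 = zeroForm f'.1 γ x.1 :=
    congrFun (congrFun (congrArg Subtype.val h) γ) x.1
  rw [zeroForm_of_mem _ x.2, zeroForm_of_mem _ x.2] at h2
  exact congrArg (fun ω => ω (fun _ => 0)) h2

theorem orbiD_locConstForm (hA : IsClosed A) (h0 : (0:ℝ) ∉ A) (h1 : (1:ℝ) ∉ A)
    (f : locConst A g n) : orbiD hA h0 h1 g n 0 (locConstForm h0 h1 f) = 0 := by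
  refine Subtype.ext (funext fun γ => funext fun x => ?_)
  by_cases hx : x ∈ box A γ.Black
  · have e : extDerivWithin (zeroForm f.1 γ) (cube γ.Black) x = 0 := by
      rw [(zeroForm_eventually h0 h1 f hx).extDerivWithin_eq rfl, extDerivWithin,
        fderivWithin_const_apply]
      exact map_zero (ContinuousAlternatingMap.alternatizeUncurryFinCLM ℝ (γ.Black → ℝ) ℝ (n := 0))
    exact (extD_of_mem hx).trans e
  · exact if_neg hx

/-- In degree zero `dω` determines the full derivative, and components are convex. -/
theorem eq_of_extD_eq_zero {B : Type} [Fintype B] (hA : IsClosed A) {ω : FormField B 0}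
    (hω : IsFormOn A ω) (h : extD A ω = 0) {x y : B → ℝ} (hx : x ∈ box A B)
    (hy : y ∈ boxComp A x) : ω y = ω x := by
  refine (convex_boxComp (A := A) x).is_const_of_fderivWithin_eq_zero (𝕜 := ℝ) (fun z hz =>
    (hω.differentiable (boxComp_subset_box x hz)).mono fun _ k => k.1) (fun z hz => ?_) hy
    (mem_boxComp hx)
  have hz' : z ∈ box A B := boxComp_subset_box x hz
  have h2 : fderivWithin ℝ ω (cube B) z = 0 := by
    have h3 : ContinuousAlternatingMap.alternatizeUncurryFin (fderivWithin ℝ ω (cube B) z) = 0 :=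
      (extD_of_mem hz').symm.trans (congrFun h z)
    refine ContinuousLinearMap.ext fun w => ?_
    rw [← sum_smul_unitVec w, map_sum, map_sum]
    refine Finset.sum_congr rfl fun b _ => ?_
    rw [map_smul, ← iota_alternatize_zero, h3, map_zero]
    simp
  have h4 := (hω.differentiable hz').hasFDerivWithinAt.mono
    (fun _ k => k.1 : boxComp A x ⊆ cube B)
  rw [h4.fderivWithin (uniqueDiffOn_boxComp hA x z hz), h2]

/-- Compatibility with isomorphisms and faces says exactly that the values of a `0`-form descend to
the glued space; closedness makes the resulting function constant on components of boxes. -/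
theorem exists_locConstForm_eq (hA : IsClosed A) (h0 : (0:ℝ) ∉ A) (h1 : (1:ℝ) ∉ A)
    (ω : orbiFormsOn A g n 0) (h : orbiD hA h0 h1 g n 0 ω = 0) :
    ∃ f, locConstForm h0 h1 f = ω := by
  let ev : (Σ γ : Cell g n, cube γ.Black) → ℝ := fun p => ω.1 p.1 p.2.1 fun _ => 0
  have hev : ∀ p q, Glue g n p q → ev p = ev q := fun p q hpq => by
    have aux : ∀ {γ γ' : Cell g n} (L : (γ'.Black → ℝ) →L[ℝ] (γ.Black → ℝ)) (c : γ.Black → ℝ)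
        (y : cube γ'.Black) (z : cube γ.Black), pullback L c (ω.1 γ) = ω.1 γ' → z.1 = L y.1 + c →
        ev ⟨γ', y⟩ = ev ⟨γ, z⟩ := fun {γ γ'} L c y z hL hz => by
      change ω.1 γ' y.1 (fun _ => 0) = ω.1 γ z.1 fun _ => 0
      rw [← hL, hz]
      exact congrArg (ω.1 γ (L y.1 + c)) (Subsingleton.elim _ _)
    cases hpq with
    | iso φ x y h => exact aux _ 0 _ _ (ω.2.invariant _ _ φ) (h.trans (add_zero _).symm)
    | zero e x y h => exact aux _ 0 _ _ (ω.2.zero_face _ e) (h.trans (add_zero _).symm)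
    | infty e x y h => exact aux _ _ _ _ (ω.2.infty_face _ e) h
  let f : LInfty g n → ℝ := Quot.lift ev hev
  have hf : ∀ (γ : Cell g n) (x : cube γ.Black), f (toLInfty γ x) = ω.1 γ x.1 fun _ => 0 :=
    fun _ _ => rfl
  refine ⟨⟨f, fun p hp => ?_, fun p hp => ?_⟩, Subtype.ext (funext fun γ => funext fun x => ?_)⟩
  · obtain ⟨γ, x, rfl⟩ := exists_toLInfty p
    rw [hf, (ω.2.form γ).zero_off _ fun k => hp ((toLInfty_mem_avoid h0 h1).2 k)]
    rfl
  · refine eventually_eq_of_boxComp hA h0 h1 (fun γ x y hx hy => ?_) hp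
    rw [hf, hf, eq_of_extD_eq_zero hA (ω.2.form γ) (congrFun (congrArg Subtype.val h) γ) hx hy]
  · change zeroForm f γ x = _
    by_cases hx : x ∈ cube γ.Black
    · rw [zeroForm_of_mem f hx, hf]
      refine ContinuousAlternatingMap.ext fun v => (constForm_apply _ _).trans ?_
      exact congrArg (ω.1 γ x) (Subsingleton.elim _ _)
    · rw [zeroForm, dif_neg hx, (ω.2.form γ).zero_off x fun k => hx k.1]

/-- The radial primitives on the cubes form an orbi-cellular form, since the contraction is natural
for face maps when `A` is nonempty. -/
theorem exists_orbiD_eq_of_nonempty (hA : IsClosed A) (h0 : (0:ℝ) ∉ A) (h1 : (1:ℝ) ∉ A)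
    (hAI : A ⊆ Icc 0 1) (hne : A.Nonempty) {k : ℕ} (ω : orbiFormsOn A g n (k + 1))
    (h : orbiD hA h0 h1 g n (k + 1) ω = 0) : ∃ η, orbiD hA h0 h1 g n k η = ω := by
  refine ⟨⟨fun γ => contractBox A (ω.1 γ), ω.2.map (fun _ _ => contractBox A)
    (fun _ _ hω => hω.contractBox hA)
    (fun _ _ _ _ _ _ _ hL hω => pullback_contractBox h0 h1 hAI hne hL hω)⟩,
    Subtype.ext (funext fun γ => ?_)⟩
  have h2 := contractBox_homotopy hA (ω.2.form γ)
  have h3 : extD A (ω.1 γ) = 0 := congrFun (congrArg Subtype.val h) γ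
  have h4 : contractBox A (0 : FormField γ.Black (k + 1 + 1)) = 0 := by
    funext x
    by_cases hx : x ∈ box A γ.Black
    · rw [contractBox_of_mem hx]
      have h5 : ∀ s : ℝ, radial (baseVec A x) (0 : FormField γ.Black (k + 1 + 1)) (x, s) = 0 :=
        fun s => by simp [radial]
      simp only [h5, intervalIntegral.integral_zero, Pi.zero_apply]
    · exact if_neg hx
  rw [h3, h4, add_zero] at h2
  exact h2

local instance (k : ℕ) (S : Submodule ℝ (∀ γ : Cell g n, FormField γ.Black k)) : AddCommGroup S :=
  Submodule.addCommGroup S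

variable {ι : Type} [Fintype ι] (K : Cutoffs ι)

/-- The restriction maps of the sheaf of locally constant functions. -/
noncomputable def sheafRes (g n : ℕ) (s t : Set ι) (h : s ⊆ t) :
    locConst (K.cut s) g n →ₗ[ℝ] locConst (K.cut t) g n :=
  locConstRes (isOpen_avoid (K.isClosed_cut t) (K.zero_notMem t) (K.one_notMem t)) (K.cut_mono h)

theorem sheafRes_of_mem {s t : Set ι} (h : s ⊆ t) (f : locConst (K.cut s) g n) {p : LInfty g n}
    (hp : p ∈ avoid (K.cut t) g n) : (sheafRes K g n s t h f).1 p = f.1 p :=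
  locConstRes_of_mem _ _ f hp

theorem sheafRes_sheafRes (s t u : Set ι) (h : s ⊆ t) (h' : t ⊆ u) (f : locConst (K.cut s) g n) :
    sheafRes K g n t u h' (sheafRes K g n s t h f) = sheafRes K g n s u (h.trans h') f :=
  locConst_ext fun p hp => by
    rw [sheafRes_of_mem K _ _ hp, sheafRes_of_mem K _ _ hp,
      sheafRes_of_mem K _ _ (avoid_anti (K.cut_mono h') hp)]

/-- Orbi-cellular forms compute the Čech cohomology of the sheaf of locally constant functions. -/
theorem nonempty_homology_iso_forms (hK : 6 * g + 3 * n < Fintype.card ι) (m : ℕ) :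
    Nonempty ((cpx (M := fun q => orbiFormsOn (K.cut ∅) g n q)
      (fun q => orbiD (K.isClosed_cut ∅) (K.zero_notMem ∅) (K.one_notMem ∅) g n q)
      (fun q => orbiD_orbiD _ _ _)).homology m ≅
      (cpx (M := fun p => Cech (fun s => locConst (K.cut s) g n) (p + 1))
        (fun p => cechD (sheafRes K g n) (p + 1))
        (fun p => cechD_cechD (sheafRes_sheafRes K) (p + 1))).homology m) := by
  refine nonempty_homology_iso_cech (F := fun q s => orbiFormsOn (K.cut s) g n q)
    (res := fun q s t h => orbiRes K g n q s t h)
    (d := fun q s => orbiD (K.isClosed_cut s) (K.zero_notMem s) (K.one_notMem s) g n q)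
    (fun q s t u h h' ω => Subtype.ext (funext fun γ => restrictForm_restrictForm (K.cut_mono h') _))
    (fun q ω => Subtype.ext (funext fun γ => funext fun x => ?_))
    (fun q s => orbiD_orbiD _ _ _)
    (fun q s t h ω => Subtype.ext (funext fun γ => extD_restrictForm (K.isClosed_cut t) (K.cut_mono h) _))
    (fun q j s => orbiExt K hK q j s)
    (fun q j s t h ω => Subtype.ext (funext fun γ => ?_))
    (fun q s ω => Subtype.ext (funext fun γ => ?_))
    (sheafRes_sheafRes K)
    (fun s => locConstForm (K.zero_notMem s) (K.one_notMem s))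
    (fun s t h f => Subtype.ext (funext fun γ => funext fun x => ?_))
    (fun s f _ => orbiD_locConstForm _ _ _ f)
    (fun s _ => locConstForm_injective _ _)
    (fun s ω _ h => exists_locConstForm_eq _ _ _ ω h)
    (fun q s ω hs h => exists_orbiD_eq_of_nonempty _ _ _ (K.cut_subset s) (hs.image _) ω h) m
  · change restrictForm (K.cut ∅) (ω.1 γ) x = ω.1 γ x
    by_cases hx : x ∈ box (K.cut ∅) γ.Black
    · exact restrictForm_of_mem hx
    · rw [restrictForm, if_neg hx, (ω.2.form γ).zero_off x hx]
  · change restrictForm (K.cut t) (partMul K j (ω.1 γ)) =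
      partMul K j (restrictForm (K.cut (insert j t)) (ω.1 γ))
    exact partMul_restrictForm K j t _
  · have h1 : ∀ (u : Finset ι) (f : ι → orbiFormsOn (K.cut s) g n q),
      (∑ j ∈ u, f j).1 γ = ∑ j ∈ u, (f j).1 γ := fun u f => by
        rw [Submodule.coe_sum, Finset.sum_apply]
    exact (h1 _ _).trans (sum_partMul K (γ.card_black_le.trans_lt hK) (ω.2.form γ))
  · change zeroForm (sheafRes K g n s t h f).1 γ x = restrictForm (K.cut t) (zeroForm f.1 γ) x
    by_cases hx : x ∈ box (K.cut t) γ.Black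
    · rw [restrictForm_of_mem hx, zeroForm_of_mem _ hx.1, zeroForm_of_mem _ hx.1,
        sheafRes_of_mem K h f ((toLInfty_mem_avoid (K.zero_notMem t) (K.one_notMem t)).2 hx)]
    · rw [restrictForm, if_neg hx]
      exact (isFormOn_zeroForm (K.zero_notMem t) (K.one_notMem t) _ γ).zero_off x hx

end LocConstForms

end OrbiCell

namespace OrbiCell

open Set Filter Topology

/-! ### Singular cochains on a class of simplices closed under faces. -/

section Simplices

/-- Singular simplices with `m` vertices. -/
abbrev Sing (m : ℕ) (X : Type*) [TopologicalSpace X] := C(stdSimplex ℝ (Fin m), X)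

/-- The face of the standard simplex opposite to a vertex. -/
noncomputable def faceS {m : ℕ} (i : Fin (m + 1)) :
    C(stdSimplex ℝ (Fin m), stdSimplex ℝ (Fin (m + 1))) :=
  ⟨stdSimplex.map i.succAbove, stdSimplex.continuous_map _⟩

theorem faceS_apply {m : ℕ} (i : Fin (m + 1)) (x : stdSimplex ℝ (Fin m)) :
    faceS i x = stdSimplex.map i.succAbove x := rfl

theorem faceS_self {m : ℕ} (i : Fin (m + 1)) (x : stdSimplex ℝ (Fin m)) : faceS i x i = 0 := by
  rw [faceS_apply, stdSimplex.map_coe, FunOnFinite.linearMap_apply_apply]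
  refine Finset.sum_eq_zero fun j hj => ?_
  exact absurd (Finset.mem_filter.1 hj).2 (Fin.succAbove_ne i j)

theorem faceS_succAbove {m : ℕ} (i : Fin (m + 1)) (x : stdSimplex ℝ (Fin m)) (j : Fin m) :
    faceS i x (i.succAbove j) = x j := by
  rw [faceS_apply, stdSimplex.map_coe, FunOnFinite.linearMap_apply_apply]
  have : (Finset.univ.filter fun l => i.succAbove l = i.succAbove j) = {j} := by
    ext l
    simp
  rw [this, Finset.sum_singleton]

theorem faceS_comp_faceS {m : ℕ} (i k : Fin (m + 1)) (h : i ≤ k) :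
    (faceS i.castSucc).comp (faceS k) = (faceS k.succ).comp (faceS i) := by
  ext1 x
  simp only [ContinuousMap.comp_apply, faceS_apply, stdSimplex.map_comp_apply]
  rw [succAbove_succAbove i k h]

variable {X : Type 1} [TopologicalSpace X]

/-- Real functions on the singular simplices with the property `P`. -/
abbrev SimpFun (P : ∀ m, Sing m X → Prop) (q : ℕ) : Type 1 := {σ : Sing (q + 1) X // P _ σ} → ℝ

variable {P P' : ∀ m, Sing m X → Prop}

/-- The coboundary of singular cochains. -/
noncomputable def simpD (hP : ∀ m σ i, P (m + 1) σ → P m (σ.comp (faceS i))) (q : ℕ) :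
    SimpFun P q →ₗ[ℝ] SimpFun P (q + 1) where
  toFun f σ := ∑ i : Fin (q + 2), (-1 : ℝ) ^ (i : ℕ) • f ⟨σ.1.comp (faceS i), hP _ _ _ σ.2⟩
  map_add' f f' := by
    funext σ
    simp only [Pi.add_apply, smul_add, Finset.sum_add_distrib]
  map_smul' r f := by
    funext σ
    simp only [Pi.smul_apply, RingHom.id_apply, Finset.smul_sum, smul_comm r]

theorem simpD_apply (hP : ∀ m σ i, P (m + 1) σ → P m (σ.comp (faceS i))) {q : ℕ} (f : SimpFun P q)
    (σ : {σ : Sing (q + 2) X // P _ σ}) : simpD hP q f σ =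
      ∑ i : Fin (q + 2), (-1 : ℝ) ^ (i : ℕ) • f ⟨σ.1.comp (faceS i), hP _ _ _ σ.2⟩ := rfl

theorem simpD_simpD (hP : ∀ m σ i, P (m + 1) σ → P m (σ.comp (faceS i))) (q : ℕ)
    (f : SimpFun P q) : simpD hP (q + 1) (simpD hP q f) = 0 := by
  funext σ
  refine alternating_double_sum (m := q + 1)
    (fun i k => f ⟨(σ.1.comp (faceS i)).comp (faceS k), hP _ _ _ (hP _ _ _ σ.2)⟩) fun i k h => ?_
  refine congrArg f (Subtype.ext ?_)
  exact congrArg (fun φ => σ.1.comp φ) (faceS_comp_faceS i k h)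

/-- Restriction of functions to fewer simplices. -/
noncomputable def simpRes (h : ∀ m σ, P' m σ → P m σ) (q : ℕ) :
    SimpFun P q →ₗ[ℝ] SimpFun P' q :=
  LinearMap.funLeft ℝ ℝ fun σ => ⟨σ.1, h _ _ σ.2⟩

end Simplices

/-! ### Cones over singular simplices from families of paths. -/

section Cone

/-- The join of the vertex `0` with the opposite face. -/
noncomputable def joinMap (m : ℕ) : C(unitInterval × stdSimplex ℝ (Fin m), stdSimplex ℝ (Fin (m + 1))) where
  toFun p := ⟨Fin.cons (1 - (p.1 : ℝ)) fun i => (p.1 : ℝ) * p.2 i, fun i => by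
      refine Fin.cases ?_ (fun i => ?_) i
      · exact sub_nonneg.2 p.1.2.2
      · exact mul_nonneg p.1.2.1 (p.2.2.1 i), by
      rw [Fin.sum_univ_succ]
      simp only [Fin.cons_zero, Fin.cons_succ]
      rw [← Finset.mul_sum, stdSimplex.sum_eq_one]
      ring⟩
  continuous_toFun := by
    refine Continuous.subtype_mk (continuous_pi fun i => ?_) _
    refine Fin.cases ?_ (fun i => ?_) i
    · simp only [Fin.cons_zero]
      fun_prop
    · simp only [Fin.cons_succ]
      refine Continuous.mul (by fun_prop) ?_
      exact (continuous_apply i).comp (continuous_subtype_val.comp continuous_snd)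

theorem joinMap_zero {m : ℕ} (u : unitInterval) (x : stdSimplex ℝ (Fin m)) : joinMap m (u, x) 0 = 1 - u := rfl

theorem joinMap_succ {m : ℕ} (u : unitInterval) (x : stdSimplex ℝ (Fin m)) (i : Fin m) :
    joinMap m (u, x) i.succ = u * x i := rfl

theorem joinMap_surjective (m : ℕ) : Function.Surjective (joinMap (m + 1)) := by
  intro t
  have h0 : (0:ℝ) ≤ 1 - t 0 := sub_nonneg.2 (stdSimplex.le_one t 0)
  have hs : ∑ i : Fin (m + 1), t i.succ = 1 - t 0 := by
    rw [eq_sub_iff_add_eq', ← Fin.sum_univ_succ, stdSimplex.sum_eq_one]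
  let u : unitInterval := ⟨1 - t 0, h0, by linarith [stdSimplex.zero_le t 0]⟩
  by_cases hu : 1 - t 0 = 0
  · refine ⟨(u, Classical.arbitrary _), stdSimplex.ext (funext fun i => ?_)⟩
    refine Fin.cases ?_ (fun i => ?_) i
    · rw [joinMap_zero]
      simp [u]
    · rw [joinMap_succ]
      rw [hu] at hs
      rw [(Finset.sum_eq_zero_iff_of_nonneg fun i _ => stdSimplex.zero_le t _).1 hs i
        (Finset.mem_univ i)]
      simp [u, hu]
  · refine ⟨(u, ⟨fun i => t i.succ / (1 - t 0), fun i => div_nonneg (stdSimplex.zero_le t _) h0, ?_⟩),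
      stdSimplex.ext (funext fun i => ?_)⟩
    · rw [← Finset.sum_div, hs, div_self hu]
    · refine Fin.cases ?_ (fun i => ?_) i
      · rw [joinMap_zero]
        simp [u]
      · rw [joinMap_succ]
        exact mul_div_cancel₀ _ hu

/-- A continuous surjection from a compact to a Hausdorff space is a quotient map. So a map on the
cone can be given by join coordinates, with no separate check of continuity at the apex. -/
theorem isQuotientMap_joinMap (m : ℕ) : IsQuotientMap (joinMap (m + 1)) :=
  (joinMap (m + 1)).continuous.isClosedMap.isQuotientMap (joinMap (m + 1)).continuous
    (joinMap_surjective m)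

variable {X : Type*} [TopologicalSpace X] {m : ℕ}

/-- A family of paths as a map on the product. -/
noncomputable def pathFamily (Ψ : C(stdSimplex ℝ (Fin m), C(unitInterval, X))) :
    C(unitInterval × stdSimplex ℝ (Fin m), X) :=
  Ψ.uncurry.comp ⟨fun p => (p.2, p.1), continuous_swap⟩

theorem pathFamily_factorsThrough (Ψ : C(stdSimplex ℝ (Fin m), C(unitInterval, X)))
    (h : ∀ x y, Ψ x 0 = Ψ y 0) : Function.FactorsThrough (pathFamily Ψ) (joinMap m) := by
  rintro ⟨u, x⟩ ⟨u', x'⟩ e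
  change Ψ x u = Ψ x' u'
  have hu : u = u' := Subtype.ext (by
    have := congrArg (fun t : stdSimplex ℝ (Fin (m + 1)) => t 0) e
    simp only [joinMap_zero] at this
    linarith)
  subst hu
  by_cases h0 : u = 0
  · rw [h0, h x x']
  · have : x = x' := stdSimplex.ext (funext fun i => by
      have h1 := congrArg (fun t : stdSimplex ℝ (Fin (m + 1)) => t i.succ) e
      simp only [joinMap_succ] at h1
      exact mul_left_cancel₀ (fun k => h0 (Subtype.ext k)) h1)
    rw [this]

/-- The cone given by a family of paths with the same starting point. -/
noncomputable def coneSimplex (Ψ : C(stdSimplex ℝ (Fin (m + 1)), C(unitInterval, X)))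
    (h : ∀ x y, Ψ x 0 = Ψ y 0) : Sing (m + 2) X :=
  (isQuotientMap_joinMap m).lift (pathFamily Ψ) (pathFamily_factorsThrough Ψ h)

theorem coneSimplex_joinMap (Ψ : C(stdSimplex ℝ (Fin (m + 1)), C(unitInterval, X)))
    (h : ∀ x y, Ψ x 0 = Ψ y 0) (u : unitInterval) (x : stdSimplex ℝ (Fin (m + 1))) :
    coneSimplex Ψ h (joinMap (m + 1) (u, x)) = Ψ x u :=
  DFunLike.congr_fun ((isQuotientMap_joinMap m).lift_comp (pathFamily Ψ)
    (pathFamily_factorsThrough Ψ h)) (u, x)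

theorem faceS_zero_eq (x : stdSimplex ℝ (Fin m)) : faceS 0 x = joinMap m (1, x) := by
  refine stdSimplex.ext (funext fun i => ?_)
  refine Fin.cases ?_ (fun i => ?_) i
  · rw [faceS_self, joinMap_zero]
    simp
  · rw [joinMap_succ]
    have := faceS_succAbove 0 x i
    rw [Fin.zero_succAbove] at this
    rw [this]
    simp

theorem faceS_succ_joinMap (i : Fin (m + 1)) (u : unitInterval) (x : stdSimplex ℝ (Fin m)) :
    faceS i.succ (joinMap m (u, x)) = joinMap (m + 1) (u, faceS i x) := by
  refine stdSimplex.ext (funext fun j => ?_)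
  rcases Fin.eq_self_or_eq_succAbove i.succ j with rfl | ⟨l, rfl⟩
  · rw [faceS_self, joinMap_succ, faceS_self, mul_zero]
  · rw [faceS_succAbove]
    refine Fin.cases ?_ (fun l => ?_) l
    · rw [Fin.succ_succAbove_zero]
      rfl
    · rw [Fin.succ_succAbove_succ, joinMap_succ, joinMap_succ, faceS_succAbove]

theorem coneSimplex_face_zero (Ψ : C(stdSimplex ℝ (Fin (m + 1)), C(unitInterval, X)))
    (h : ∀ x y, Ψ x 0 = Ψ y 0) (x : stdSimplex ℝ (Fin (m + 1))) :
    (coneSimplex Ψ h).comp (faceS 0) x = Ψ x 1 := by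
  rw [ContinuousMap.comp_apply, faceS_zero_eq, coneSimplex_joinMap]

theorem coneSimplex_face_succ (Ψ : C(stdSimplex ℝ (Fin (m + 2)), C(unitInterval, X)))
    (h : ∀ x y, Ψ x 0 = Ψ y 0) (i : Fin (m + 2)) :
    (coneSimplex Ψ h).comp (faceS i.succ) =
      coneSimplex (Ψ.comp (faceS i)) (fun _ _ => h _ _) := by
  ext1 t
  obtain ⟨⟨u, x⟩, rfl⟩ := joinMap_surjective m t
  rw [ContinuousMap.comp_apply, faceS_succ_joinMap, coneSimplex_joinMap, coneSimplex_joinMap,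
    ContinuousMap.comp_apply]

theorem coneSimplex_face_one (Ψ : C(stdSimplex ℝ (Fin 1), C(unitInterval, X)))
    (h : ∀ x y, Ψ x 0 = Ψ y 0) (x : stdSimplex ℝ (Fin 1)) :
    (coneSimplex Ψ h).comp (faceS 1) x = Ψ x 0 := by
  have : faceS 1 x = joinMap 1 (0, x) := by
    refine stdSimplex.ext (funext fun i => ?_)
    refine Fin.cases ?_ (fun i => ?_) i
    · rw [joinMap_zero]
      have := faceS_succAbove 1 x 0
      rw [Fin.one_succAbove_zero] at this
      rw [this, stdSimplex.eq_one_of_unique]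
      simp
    · rw [joinMap_succ, Subsingleton.elim i 0]
      exact (faceS_self 1 x).trans (by simp)
  rw [ContinuousMap.comp_apply, this, coneSimplex_joinMap]

theorem coneSimplex_mem {U : Set X} (Ψ : C(stdSimplex ℝ (Fin (m + 1)), C(unitInterval, X)))
    (h : ∀ x y, Ψ x 0 = Ψ y 0) (hU : ∀ x u, Ψ x u ∈ U) (t : stdSimplex ℝ (Fin (m + 2))) :
    coneSimplex Ψ h t ∈ U := by
  obtain ⟨⟨u, x⟩, rfl⟩ := joinMap_surjective m t
  rw [coneSimplex_joinMap]
  exact hU x u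

end Cone

/-! ### Singular cochains of a set that contracts onto a discrete set. -/

section LocallyContractible

variable {X : Type 1} [TopologicalSpace X]

/-- A contraction of `U` onto a discrete set. -/
structure DiscreteContraction (U : Set X) where
  path : C(U, C(unitInterval, X))
  mem : ∀ p u, path p u ∈ U
  one : ∀ p, path p 1 = p
  zero : ∀ p, ∀ᶠ p' in 𝓝 p, path p' 0 = path p 0

variable {U : Set X} (E : DiscreteContraction U) {m : ℕ}

namespace DiscreteContraction

/-- The paths from the points of a simplex. -/
noncomputable def pathOn (σ : Sing m X) (h : ∀ t, σ t ∈ U) : C(stdSimplex ℝ (Fin m), C(unitInterval, X)) :=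
  E.path.comp ⟨fun x => ⟨σ x, h x⟩, σ.continuous.subtype_mk h⟩

/-- The starting point of the path is locally constant, and a simplex is connected. -/
theorem pathOn_zero (σ : Sing (m + 1) X) (h : ∀ t, σ t ∈ U) (x y : stdSimplex ℝ (Fin (m + 1))) :
    E.pathOn σ h x 0 = E.pathOn σ h y 0 := by
  have h1 : IsLocallyConstant fun x => E.pathOn σ h x 0 := by
    refine (IsLocallyConstant.iff_eventually_eq _).2 fun x => ?_
    have hc : ContinuousAt (fun x => (⟨σ x, h x⟩ : U)) x :=
      (σ.continuous.subtype_mk h).continuousAt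
    exact hc.eventually (E.zero ⟨σ x, h x⟩)
  exact h1.apply_eq_of_preconnectedSpace x y

/-- The cone over a simplex. -/
noncomputable def cone (σ : Sing (m + 1) X) (h : ∀ t, σ t ∈ U) : Sing (m + 2) X :=
  coneSimplex (E.pathOn σ h) (E.pathOn_zero σ h)

theorem cone_mem (σ : Sing (m + 1) X) (h : ∀ t, σ t ∈ U) (t : stdSimplex ℝ (Fin (m + 2))) :
    E.cone σ h t ∈ U :=
  coneSimplex_mem _ _ (fun _ _ => E.mem _ _) t

theorem cone_face_zero (σ : Sing (m + 1) X) (h : ∀ t, σ t ∈ U) :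
    (E.cone σ h).comp (faceS 0) = σ := by
  ext1 x
  exact (coneSimplex_face_zero _ _ x).trans (E.one _)

theorem cone_face_succ (σ : Sing (m + 2) X) (h : ∀ t, σ t ∈ U) (i : Fin (m + 2)) :
    (E.cone σ h).comp (faceS i.succ) = E.cone (σ.comp (faceS i)) fun _ => h _ :=
  coneSimplex_face_succ _ _ i

variable {P : ∀ m, Sing m X → Prop} (hP : ∀ m σ i, P (m + 1) σ → P m (σ.comp (faceS i)))

/-- The zeroth face of a cone is the given simplex and the others are the cones over its faces. So
evaluating a cocycle on cones gives a primitive. -/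
theorem exists_simpD_eq (E : DiscreteContraction U) (hPU : ∀ m σ, P (m + 1) σ ↔ ∀ t, σ t ∈ U)
    {q : ℕ} (f : SimpFun P (q + 1)) (hf : simpD hP (q + 1) f = 0) :
    ∃ z, simpD hP q z = f := by
  refine ⟨fun σ => f ⟨E.cone σ.1 ((hPU _ _).1 σ.2), (hPU _ _).2 (E.cone_mem _ _)⟩,
    funext fun σ => ?_⟩
  have h1 := congrFun hf ⟨E.cone σ.1 ((hPU _ _).1 σ.2), (hPU _ _).2 (E.cone_mem _ _)⟩
  rw [simpD_apply, Fin.sum_univ_succ] at h1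
  simp only [cone_face_zero, cone_face_succ, Fin.val_zero, pow_zero, one_smul, Fin.val_succ,
    pow_succ, mul_neg, mul_one, neg_smul, Finset.sum_neg_distrib, Pi.zero_apply] at h1
  rw [simpD_apply]
  exact (add_neg_eq_zero.1 h1).symm

/-- A cocycle of degree zero takes equal values at the two ends of each contracting path, and the
starting points are locally constant. -/
theorem exists_locallyConstant (E : DiscreteContraction U)
    (hPU : ∀ m σ, P (m + 1) σ ↔ ∀ t, σ t ∈ U) (f : SimpFun P 0) (hf : simpD hP 0 f = 0) :
    ∃ v : U → ℝ, (∀ p, ∀ᶠ p' in 𝓝 p, v p' = v p) ∧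
      ∀ σ, f σ = v ⟨σ.1 default, (hPU _ _).1 σ.2 _⟩ := by
  let pt : U → {σ : Sing 1 X // P _ σ} := fun p => ⟨.const _ p.1, (hPU _ _).2 fun _ => p.2⟩
  have h1 : ∀ p : U, f (pt p) = f (pt ⟨E.path p 0, E.mem p 0⟩) := fun p => by
    let Ψ : C(stdSimplex ℝ (Fin 1), C(unitInterval, X)) := .const _ (E.path p)
    have hc : P 2 (coneSimplex Ψ fun _ _ => rfl) :=
      (hPU _ _).2 (coneSimplex_mem _ _ fun _ u => E.mem p u)
    have h2 := congrFun hf ⟨_, hc⟩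
    rw [simpD_apply, Fin.sum_univ_two] at h2
    have e0 : (coneSimplex Ψ fun _ _ => rfl).comp (faceS 0) = .const _ p.1 := by
      ext1 x
      exact (coneSimplex_face_zero _ _ x).trans (E.one p)
    have e1 : (coneSimplex Ψ fun _ _ => rfl).comp (faceS 1) = .const _ (E.path p 0) := by
      ext1 x
      exact coneSimplex_face_one _ _ x
    simp only [e0, e1] at h2
    simpa [add_neg_eq_zero] using h2
  refine ⟨fun p => f (pt p), fun p => ?_, fun σ => congrArg f (Subtype.ext ?_)⟩
  · filter_upwards [E.zero p] with p' hp'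
    rw [h1, h1 p]
    exact congrArg (fun q => f (pt q)) (Subtype.ext hp')
  · ext1 x
    change σ.1 x = σ.1 default
    rw [Subsingleton.elim x default]

end DiscreteContraction

end LocallyContractible

end OrbiCell

namespace OrbiCell

open Set Filter Topology

/-! ### The contraction of the intersections of the cover in the glued space. -/

section Contraction

variable {g n : ℕ} {A : Set ℝ}

open Classical in
/-- The segment from the base point of its component to a point of the box. -/
noncomputable def segCell (A : Set ℝ) {B : Type} [Fintype B] (x : cube B) :
    C(unitInterval, cube B) :=
  if hx : x.1 ∈ box A B then
    ⟨fun u => ⟨baseVec A x.1 + (u : ℝ) • (x.1 - baseVec A x.1),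
      (segment_mem_box hx (mem_boxComp hx) u.2).1⟩,
      Continuous.subtype_mk (by fun_prop) _⟩
  else .const _ x

theorem segCell_of_mem {B : Type} [Fintype B] {x : cube B} (hx : x.1 ∈ box A B)
    (u : unitInterval) :
    (segCell A x u).1 = baseVec A x.1 + (u : ℝ) • (x.1 - baseVec A x.1) := by
  rw [segCell, dif_pos hx]
  rfl

theorem segCell_faceMap (h0 : (0:ℝ) ∉ A) (h1 : (1:ℝ) ∉ A) (hA : A ⊆ Icc 0 1) (hne : A.Nonempty)
    {B B' : Type} [Fintype B] [Fintype B'] {L : (B' → ℝ) →L[ℝ] (B → ℝ)} {c : B → ℝ}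
    (h : IsFaceMap L c) {x : cube B} {y : cube B'} (e : x.1 = L y.1 + c) (u : unitInterval) :
    (segCell A x u).1 = L (segCell A y u).1 + c := by
  have hm := h.mem_box_iff h0 h1 y.1
  by_cases hy : y.1 ∈ box A B'
  · have hx : x.1 ∈ box A B := by rw [e]; exact hm.2 hy
    rw [segCell_of_mem hx, segCell_of_mem hy, e, baseVec_faceMap h0 h1 hA hne h]
    simp only [map_add, map_smul, map_sub]
    module
  · have hx : x.1 ∉ box A B := by rw [e]; exact fun k => hy (hm.1 k)
    rw [segCell, segCell, dif_neg hx, dif_neg hy]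
    exact e

/-- The path from the base point of its component to a point of `L^∞_{g,n}`. -/
noncomputable def pathTo (h0 : (0:ℝ) ∉ A) (h1 : (1:ℝ) ∉ A) (hA : A ⊆ Icc 0 1) (hne : A.Nonempty) :
    LInfty g n → C(unitInterval, LInfty g n) :=
  Quot.lift (fun p => (⟨toLInfty p.1, continuous_toLInfty p.1⟩ : C(_, LInfty g n)).comp
    (segCell A p.2)) fun p q hpq => by
      obtain ⟨L, c, hL, e, hg⟩ := hpq.exists_isFaceMap
      ext1 u
      exact Quot.sound (hg _ _ (segCell_faceMap h0 h1 hA hne hL e u))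

/-- On the component of `x` the base point is fixed, so the segments depend jointly continuously on
the end point and the parameter. -/
theorem continuousAt_pathTo (hc : IsClosed A) (h0 : (0:ℝ) ∉ A) (h1 : (1:ℝ) ∉ A)
    (hA : A ⊆ Icc 0 1) (hne : A.Nonempty) {γ : Cell g n} {x : cube γ.Black}
    (hx : x.1 ∈ box A γ.Black) :
    ContinuousAt (fun y => pathTo h0 h1 hA hne (toLInfty γ y)) x := by
  let W : Set (cube γ.Black) := {y | y.1 ∈ boxComp A x.1}
  have hW : W ∈ 𝓝 x := by
    have h2 := boxComp_mem_nhdsWithin hc hx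
    rw [nhdsWithin_eq_map_subtype_coe hx.1] at h2
    exact h2
  refine ContinuousOn.continuousAt (s := W) (continuousOn_iff_continuous_domRestrict.2 ?_) hW
  refine ContinuousMap.continuous_of_continuous_uncurry _ ?_
  have h3 : Continuous fun p : W × unitInterval => (⟨baseVec A x.1 + (p.2 : ℝ) • (p.1.1.1 -
      baseVec A x.1), (segment_mem_box hx p.1.2 p.2.2).1⟩ : cube γ.Black) :=
    Continuous.subtype_mk (by fun_prop) _
  refine ((continuous_toLInfty γ).comp h3).congr fun p => ?_
  refine congrArg (toLInfty γ) (Subtype.ext ?_)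
  rw [segCell_of_mem (boxComp_subset_box x.1 p.1.2), baseVec_eq p.1.2]

/-- Preimages of open sets are tested on the cubes, because the space carries the quotient topology;
there the paths are segments. -/
theorem continuousOn_pathTo (hc : IsClosed A) (h0 : (0:ℝ) ∉ A) (h1 : (1:ℝ) ∉ A)
    (hA : A ⊆ Icc 0 1) (hne : A.Nonempty) :
    ContinuousOn (pathTo h0 h1 hA hne) (avoid A g n) := by
  refine (continuousOn_open_iff (isOpen_avoid hc h0 h1)).2 fun O hO => ?_
  refine isOpen_coinduced.2 (isOpen_sigma_iff.2 fun γ => isOpen_iff_mem_nhds.2 fun x hx => ?_)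
  have hx' : x.1 ∈ box A γ.Black := (toLInfty_mem_avoid h0 h1).1 hx.1
  have h2 := (continuousAt_pathTo hc h0 h1 hA hne hx').preimage_mem_nhds (hO.mem_nhds hx.2)
  have h3 := (continuous_toLInfty γ).continuousAt.preimage_mem_nhds
    ((isOpen_avoid hc h0 h1).mem_nhds hx.1)
  exact inter_mem h3 h2

/-- The contraction of `avoid A` onto the base points. -/
noncomputable def avoidContraction (hc : IsClosed A) (h0 : (0:ℝ) ∉ A) (h1 : (1:ℝ) ∉ A)
    (hA : A ⊆ Icc 0 1) (hne : A.Nonempty) : DiscreteContraction (avoid A g n) where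
  path := ⟨fun p => pathTo h0 h1 hA hne p.1,
    continuousOn_iff_continuous_domRestrict.1 (continuousOn_pathTo hc h0 h1 hA hne)⟩
  mem := by
    rintro ⟨_, γ, x, hx, rfl⟩ u
    refine ⟨γ, segCell A x u, ?_, rfl⟩
    rw [segCell_of_mem hx]
    exact boxComp_subset_box x.1 (segment_mem_box hx (mem_boxComp hx) u.2)
  one := by
    rintro ⟨_, γ, x, hx, rfl⟩
    refine congrArg (toLInfty γ) (Subtype.ext ?_)
    rw [segCell_of_mem hx]
    simp
  zero p := by
    refine continuous_subtype_val.continuousAt.eventually (eventually_eq_of_boxComp hc h0 h1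
      (f := fun p => pathTo h0 h1 hA hne p 0) (fun γ x y hx hy => ?_) p.2)
    refine congrArg (toLInfty γ) (Subtype.ext ?_)
    rw [segCell_of_mem hx, segCell_of_mem (boxComp_subset_box x.1 hy), baseVec_eq hy]
    simp

end Contraction

/-! ### Small singular simplices and the Čech complex. -/

section SmallSimplices

variable {g n : ℕ} {ι : Type} [Fintype ι] (K : Cutoffs ι)

theorem mem_avoid_insert {j : ι} {s : Set ι} {p : LInfty g n} (hs : p ∈ avoid (K.cut s) g n)
    (hj : p ∈ avoid (K.cut {j}) g n) : p ∈ avoid (K.cut (insert j s)) g n := by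
  obtain ⟨γ, x, hx, rfl⟩ := hs
  rw [toLInfty_mem_avoid (K.zero_notMem _) (K.one_notMem _)] at hj ⊢
  by_contra hc
  obtain ⟨b, hb⟩ := K.exists_eq_of_not_mem_box hx hc
  exact hj.2 b ⟨j, rfl, hb.symm⟩

/-- There are more cut points than coordinates, so some bump function is one at the point; it would
be zero if a coordinate were `a j`. -/
theorem exists_mem_avoid (hK : 6 * g + 3 * n < Fintype.card ι) (p : LInfty g n) :
    ∃ j, p ∈ avoid (K.cut {j}) g n := by
  obtain ⟨γ, x, rfl⟩ := exists_toLInfty p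
  obtain ⟨j, hj⟩ := K.exists_bump_eq_one (γ.card_black_le.trans_lt hK) x.1
  refine ⟨j, γ, x, ⟨x.2, fun b => ?_⟩, rfl⟩
  rintro ⟨_, rfl, hb⟩
  rw [(K.eventually_bump _ hb.symm).self_of_nhds] at hj
  exact zero_ne_one hj

/-- The simplices contained in one of the sets of the cover. -/
def IsSmall {X ι : Type*} [TopologicalSpace X] (V : ι → Set X) {m : ℕ} (σ : Sing m X) : Prop :=
  ∃ j, ∀ t, σ t ∈ V j

/-- The small simplices contained in the intersection indexed by `s`. -/
def SmallOn (s : Set ι) (m : ℕ) (σ : Sing m (LInfty g n)) : Prop :=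
  IsSmall (fun j => avoid (K.cut {j}) g n) σ ∧ ∀ t, σ t ∈ avoid (K.cut s) g n

theorem smallOn_face (s : Set ι) (m : ℕ) (σ : Sing (m + 1) (LInfty g n)) (i : Fin (m + 1))
    (h : SmallOn K s (m + 1) σ) : SmallOn K s m (σ.comp (faceS i)) :=
  ⟨h.1.imp fun _ hj _ => hj _, fun _ => h.2 _⟩

theorem smallOn_anti {s t : Set ι} (h : s ⊆ t) (m : ℕ) (σ : Sing m (LInfty g n))
    (hσ : SmallOn K t m σ) : SmallOn K s m σ :=
  ⟨hσ.1, fun x => avoid_anti (K.cut_mono h) (hσ.2 x)⟩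

theorem smallOn_iff {s : Set ι} (hs : s.Nonempty) (m : ℕ) (σ : Sing (m + 1) (LInfty g n)) :
    SmallOn K s (m + 1) σ ↔ ∀ t, σ t ∈ avoid (K.cut s) g n :=
  ⟨fun h => h.2, fun h => ⟨⟨hs.some, fun t =>
    avoid_anti (K.cut_mono (singleton_subset_iff.2 hs.some_mem)) (h t)⟩, h⟩⟩

/-- `j` is the index chosen for the small simplex `σ`. -/
def Chosen (j : ι) {m : ℕ} (σ : Sing m (LInfty g n)) : Prop :=
  ∃ h : IsSmall (fun j => avoid (K.cut {j}) g n) σ, h.choose = j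

theorem Chosen.smallOn {j : ι} {s : Set ι} {m : ℕ} {σ : Sing m (LInfty g n)} (h : Chosen K j σ)
    (hσ : SmallOn K s m σ) : SmallOn K (insert j s) m σ := by
  obtain ⟨h, rfl⟩ := h
  exact ⟨hσ.1, fun t => mem_avoid_insert K (hσ.2 t) (h.choose_spec t)⟩

open Classical in
/-- Extension by zero of functions on simplices. -/
noncomputable def simpExt (q : ℕ) (j : ι) (s : Set ι) :
    SimpFun (SmallOn (g := g) (n := n) K (insert j s)) q →ₗ[ℝ]
      SimpFun (SmallOn (g := g) (n := n) K s) q where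
  toFun f σ := if h : Chosen K j σ.1 then f ⟨σ.1, h.smallOn K σ.2⟩ else 0
  map_add' f f' := funext fun σ => by
    by_cases h : Chosen K j σ.1 <;> simp [h]
  map_smul' r f := funext fun σ => by
    by_cases h : Chosen K j σ.1 <;> simp [h]

/-- A locally constant function as a function on the `0`-simplices. -/
noncomputable def locConstSimp (s : Set ι) :
    locConst (K.cut s) g n →ₗ[ℝ] SimpFun (SmallOn (g := g) (n := n) K s) 0 where
  toFun f σ := f.1 (σ.1 default)
  map_add' _ _ := rfl
  map_smul' _ _ := rfl

theorem simpD_locConstSimp (s : Set ι) (f : locConst (K.cut s) g n) :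
    simpD (smallOn_face K s) 0 (locConstSimp K s f) = 0 := by
  funext σ
  have h1 : IsLocallyConstant fun t => f.1 (σ.1 t) :=
    (IsLocallyConstant.iff_eventually_eq _).2 fun t =>
      σ.1.continuous.continuousAt.eventually (f.2.2 _ (σ.2.2 t))
  rw [simpD_apply, Fin.sum_univ_two]
  have h2 : ∀ i : Fin 2, locConstSimp K s f ⟨σ.1.comp (faceS i), smallOn_face K s _ _ _ σ.2⟩ =
      f.1 (σ.1 (faceS 0 default)) := fun i => h1.apply_eq_of_preconnectedSpace _ _
  rw [h2, h2]
  simp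

/-- Small simplices compute the Čech cohomology of the sheaf of locally constant functions. -/
theorem nonempty_homology_iso_small (m : ℕ) :
    Nonempty ((cpx (M := fun q => SimpFun (SmallOn (g := g) (n := n) K ∅) q)
      (fun q => simpD (smallOn_face K ∅) q) (fun q => simpD_simpD _ q)).homology m ≅
      (cpx (M := fun p => Cech (fun s => locConst (K.cut s) g n) (p + 1))
        (fun p => cechD (sheafRes K g n) (p + 1))
        (fun p => cechD_cechD (sheafRes_sheafRes K) (p + 1))).homology m) := by
  have hE : ∀ s : Set ι, s.Nonempty → DiscreteContraction (avoid (K.cut s) g n) := fun s hs =>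
    avoidContraction (K.isClosed_cut s) (K.zero_notMem s) (K.one_notMem s) (K.cut_subset s)
      (hs.image _)
  refine nonempty_homology_iso_cech (F := fun q s => SimpFun (SmallOn (g := g) (n := n) K s) q)
    (res := fun q s t h => simpRes (smallOn_anti K h) q)
    (d := fun q s => simpD (smallOn_face K s) q)
    (fun q s t u h h' f => rfl) (fun q f => rfl) (fun q s => simpD_simpD _ q)
    (fun q s t h f => rfl)
    (fun q j s => simpExt K q j s)
    (fun q j s t h f => rfl)
    (fun q s f => funext fun σ => ?_)
    (sheafRes_sheafRes K)
    (fun s => locConstSimp K s)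
    (fun s t h f => funext fun σ => sheafRes_of_mem K h f (σ.2.2 _))
    (fun s f _ => simpD_locConstSimp K s f)
    (fun s hs f f' h => locConst_ext fun p hp => ?_)
    (fun s f hs hf => ?_)
    (fun q s f hs hf => (hE s hs).exists_simpD_eq _ (smallOn_iff K hs) f hf) m
  -- The partition of unity on small simplices: exactly the summand of the index chosen for the
  -- simplex is nonzero.
  · rw [Finset.sum_apply, Finset.sum_eq_single σ.2.1.choose]
    · exact dif_pos ⟨σ.2.1, rfl⟩
    · intro j _ hj
      refine dif_neg ?_
      rintro ⟨h, rfl⟩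
      exact hj rfl
    · exact fun h => absurd (Finset.mem_univ _) h
  · exact congrFun h ⟨.const _ p, (smallOn_iff K hs _ _).2 fun _ => hp⟩
  · obtain ⟨v, hv, hfv⟩ := (hE s hs).exists_locallyConstant _ (smallOn_iff K hs) f hf
    classical
    refine ⟨⟨fun p => if h : p ∈ avoid (K.cut s) g n then v ⟨p, h⟩ else 0, fun p hp => dif_neg hp,
      fun p hp => ?_⟩, funext fun σ => (dif_pos (σ.2.2 _)).trans (hfv σ).symm⟩
    have h1 := hv ⟨p, hp⟩
    have ho := isOpen_avoid (g := g) (n := n) (K.isClosed_cut s) (K.zero_notMem s) (K.one_notMem s)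
    have e : map Subtype.val (𝓝 (⟨p, hp⟩ : avoid (K.cut s) g n)) = 𝓝 p :=
      ho.isOpenEmbedding_subtypeVal.map_nhds_eq ⟨p, hp⟩
    rw [← e, eventually_map]
    filter_upwards [h1] with q hq
    rw [dif_pos q.2, dif_pos hp]
    exact hq

end SmallSimplices

end OrbiCell

namespace OrbiCell

open Set Filter Topology

/-! ### Affine simplices, barycenters and distances. -/

section AffineSimplices

variable {m k l : ℕ}

/-- The affine map of simplices with given values on the vertices. -/
noncomputable def affMap (p : Fin m → stdSimplex ℝ (Fin k)) :
    C(stdSimplex ℝ (Fin m), stdSimplex ℝ (Fin k)) where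
  toFun t := ⟨fun j => ∑ i, t i * p i j,
    fun j => Finset.sum_nonneg fun i _ => mul_nonneg (t.2.1 i) ((p i).2.1 j), by
      rw [Finset.sum_comm]
      simp only [← Finset.mul_sum, stdSimplex.sum_eq_one, mul_one]⟩
  continuous_toFun := Continuous.subtype_mk (continuous_pi fun j => continuous_finsetSum _
    fun i _ => ((continuous_apply i).comp continuous_subtype_val).mul continuous_const) _

theorem affMap_apply (p : Fin m → stdSimplex ℝ (Fin k)) (t : stdSimplex ℝ (Fin m)) (j : Fin k) :
    affMap p t j = ∑ i, t i * p i j := rfl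

theorem affMap_affMap (p : Fin m → stdSimplex ℝ (Fin k)) (r : Fin l → stdSimplex ℝ (Fin m)) :
    (affMap p).comp (affMap r) = affMap (affMap p ∘ r) := by
  ext1 t
  refine stdSimplex.ext (funext fun j => ?_)
  rw [ContinuousMap.comp_apply, affMap_apply, affMap_apply]
  simp only [affMap_apply, Function.comp_apply, Finset.sum_mul, Finset.mul_sum]
  rw [Finset.sum_comm]
  exact Finset.sum_congr rfl fun i _ => Finset.sum_congr rfl fun i' _ => mul_assoc _ _ _

/-- The vertices of the standard simplex. -/
noncomputable def vert (m : ℕ) (i : Fin m) : stdSimplex ℝ (Fin m) := stdSimplex.vertex i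

theorem vert_apply (i j : Fin m) : vert m i j = if j = i then 1 else 0 := by
  change (Pi.single i 1 : Fin m → ℝ) j = _
  rw [Pi.single_apply]

theorem affMap_vert (p : Fin m → stdSimplex ℝ (Fin k)) (i : Fin m) : affMap p (vert m i) = p i := by
  refine stdSimplex.ext (funext fun j => ?_)
  rw [affMap_apply]
  simp [vert_apply]

theorem affMap_vert_eq_id : affMap (vert m) = ContinuousMap.id _ := by
  ext1 t
  refine stdSimplex.ext (funext fun j => ?_)
  rw [affMap_apply]
  simp [vert_apply]

theorem faceS_eq_affMap (i : Fin (m + 1)) : faceS i = affMap (vert (m + 1) ∘ i.succAbove) := by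
  ext1 t
  refine stdSimplex.ext (funext fun j => ?_)
  rw [affMap_apply]
  simp only [Function.comp_apply, vert_apply]
  rcases Fin.eq_self_or_eq_succAbove i j with rfl | ⟨l, rfl⟩
  · rw [faceS_self]
    exact (Finset.sum_eq_zero fun l _ => by rw [if_neg (Fin.succAbove_ne j l).symm, mul_zero]).symm
  · rw [faceS_succAbove]
    simp

theorem affMap_faceS (p : Fin (m + 1) → stdSimplex ℝ (Fin k)) (i : Fin (m + 1)) :
    (affMap p).comp (faceS i) = affMap (p ∘ i.succAbove) := by
  rw [faceS_eq_affMap, affMap_affMap]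
  congr 1
  funext j
  exact affMap_vert p _

/-- The barycenter of a simplex. -/
noncomputable def bary (p : Fin (m + 1) → stdSimplex ℝ (Fin k)) : stdSimplex ℝ (Fin k) :=
  affMap p stdSimplex.barycenter

theorem affMap_bary (r : Fin k → stdSimplex ℝ (Fin l)) (p : Fin (m + 1) → stdSimplex ℝ (Fin k)) :
    affMap r (bary p) = bary (affMap r ∘ p) :=
  DFunLike.congr_fun (affMap_affMap r p) _

theorem dist_affMap_le (p : Fin m → stdSimplex ℝ (Fin k)) (t : stdSimplex ℝ (Fin m))
    (y : stdSimplex ℝ (Fin k)) {d : ℝ} (h : ∀ i, dist y (p i) ≤ d) : dist y (affMap p t) ≤ d := by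
  have hd : 0 ≤ d := by
    cases m with
    | zero =>
      have h1 := stdSimplex.sum_eq_one t
      rw [Fin.sum_univ_zero] at h1
      exact absurd h1 zero_ne_one
    | succ m => exact dist_nonneg.trans (h 0)
  refine (dist_pi_le_iff hd).2 fun j => ?_
  have h1 : y j - affMap p t j = ∑ i, t i * (y j - p i j) := by
    rw [affMap_apply]
    simp only [mul_sub, Finset.sum_sub_distrib]
    rw [← Finset.sum_mul, stdSimplex.sum_eq_one, one_mul]
  rw [Real.dist_eq]
  change |y j - affMap p t j| ≤ d
  rw [h1]
  refine (Finset.abs_sum_le_sum_abs _ _).trans ?_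
  calc ∑ i, |t i * (y j - p i j)| ≤ ∑ i, t i * d := Finset.sum_le_sum fun i _ => by
        rw [abs_mul, abs_of_nonneg (stdSimplex.zero_le t i)]
        refine mul_le_mul_of_nonneg_left ?_ (stdSimplex.zero_le t i)
        exact (dist_le_pi_dist (y : Fin k → ℝ) (p i) j).trans (h i)
    _ = d := by rw [← Finset.sum_mul, stdSimplex.sum_eq_one, one_mul]

/-- The difference is the mean of the `m + 1` differences `p a - p i`, one of which is zero. -/
theorem dist_bary_le (p : Fin (m + 1) → stdSimplex ℝ (Fin k)) (i : Fin (m + 1)) {d : ℝ}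
    (hd : 0 ≤ d) (h : ∀ a b, dist (p a) (p b) ≤ d) :
    dist (bary p) (p i) ≤ m / (m + 1) * d := by
  have hm : (0:ℝ) < m + 1 := by positivity
  refine (dist_pi_le_iff (by positivity)).2 fun j => ?_
  have h1 : bary p j - p i j = (m + 1 : ℝ)⁻¹ * ∑ a, (p a j - p i j) := by
    rw [bary, affMap_apply, Finset.sum_sub_distrib, mul_sub, Finset.mul_sum]
    have h2 : ∀ a : Fin (m + 1), (stdSimplex.barycenter : stdSimplex ℝ (Fin (m + 1))) a =
        (m + 1 : ℝ)⁻¹ := fun a => by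
      refine (stdSimplex.barycenter_apply a).trans ?_
      simp
    simp only [h2, Finset.sum_const, Finset.card_univ, Fintype.card_fin, nsmul_eq_mul]
    push_cast
    rw [← mul_assoc, inv_mul_cancel₀ hm.ne', one_mul]
  rw [Real.dist_eq]
  change |bary p j - p i j| ≤ _
  rw [h1, abs_mul, abs_of_nonneg (by positivity), div_mul_eq_mul_div, inv_mul_eq_div]
  refine div_le_div_of_nonneg_right ?_ hm.le
  refine (Finset.abs_sum_le_sum_abs _ _).trans ?_
  rw [Fin.sum_univ_succAbove _ i, sub_self, abs_zero, zero_add]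
  refine (Finset.sum_le_card_nsmul _ _ d fun a _ => ?_).trans ?_
  · exact (dist_le_pi_dist (p (i.succAbove a) : Fin k → ℝ) (p i) j).trans (h _ _)
  · simp

end AffineSimplices

/-! ### Barycentric subdivision of chains of tuples of points. -/

section Chains

variable {m k l : ℕ}

/-- Chains of tuples of points. -/
abbrev Tup (m : ℕ) (Y : Type) : Type := (Fin m → Y) →₀ ℝ

variable {Y Y' : Type}

/-- The boundary of a chain of tuples. -/
noncomputable def bdT (m : ℕ) : Tup (m + 1) Y →ₗ[ℝ] Tup m Y :=
  Finsupp.linearCombination ℝ fun y =>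
    ∑ i : Fin (m + 1), (-1 : ℝ) ^ (i : ℕ) • Finsupp.single (y ∘ i.succAbove) 1

theorem bdT_single (y : Fin (m + 1) → Y) : bdT m (Finsupp.single y 1) =
    ∑ i : Fin (m + 1), (-1 : ℝ) ^ (i : ℕ) • Finsupp.single (y ∘ i.succAbove) 1 := by
  rw [bdT, Finsupp.linearCombination_single, one_smul]

theorem tup_hom_ext {M : Type*} [AddCommGroup M] [Module ℝ M] {f f' : Tup m Y →ₗ[ℝ] M}
    (h : ∀ y, f (Finsupp.single y 1) = f' (Finsupp.single y 1)) (c : Tup m Y) : f c = f' c :=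
  LinearMap.congr_fun (Finsupp.lhom_ext' fun y => LinearMap.ext_ring (h y)) c

theorem bdT_bdT (c : Tup (m + 2) Y) : bdT m (bdT (m + 1) c) = 0 := by
  refine tup_hom_ext (f := bdT m ∘ₗ bdT (m + 1)) (f' := 0) (fun y => ?_) c
  rw [LinearMap.comp_apply, bdT_single, map_sum]
  simp only [map_smul, bdT_single]
  refine alternating_double_sum (fun i k => Finsupp.single ((y ∘ i.succAbove) ∘ k.succAbove) 1)
    fun i k h => ?_
  rw [Function.comp_assoc, succAbove_succAbove i k h, Function.comp_assoc]

/-- The cone of a chain of tuples. -/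
noncomputable def coneT (b : Y) (m : ℕ) : Tup m Y →ₗ[ℝ] Tup (m + 1) Y :=
  Finsupp.lmapDomain ℝ ℝ fun y => (Fin.cons b y : Fin (m + 1) → Y)

theorem coneT_single (b : Y) (y : Fin m → Y) :
    coneT b m (Finsupp.single y 1) = Finsupp.single (Fin.cons b y : Fin (m + 1) → Y) 1 := by
  rw [coneT, Finsupp.lmapDomain_apply, Finsupp.mapDomain_single]

theorem bdT_coneT (b : Y) (c : Tup (m + 1) Y) :
    bdT (m + 1) (coneT b (m + 1) c) = c - coneT b m (bdT m c) := by
  refine tup_hom_ext (f := bdT (m + 1) ∘ₗ coneT b (m + 1))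
    (f' := LinearMap.id - coneT b m ∘ₗ bdT m) (fun y => ?_) c
  rw [LinearMap.comp_apply, LinearMap.sub_apply, LinearMap.comp_apply, LinearMap.id_apply,
    coneT_single, bdT_single, bdT_single, Fin.sum_univ_succ, map_sum, sub_eq_add_neg,
    ← Finset.sum_neg_distrib]
  refine congrArg₂ (· + ·) ?_ (Finset.sum_congr rfl fun i _ => ?_)
  · rw [Fin.val_zero, pow_zero, one_smul]
    rfl
  · rw [map_smul, coneT_single, Fin.val_succ, pow_succ, mul_neg_one, neg_smul]
    congr 3
    funext j
    refine Fin.cases ?_ (fun j => ?_) j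
    · simp
    · simp

/-- The image of a chain of tuples under a map. -/
noncomputable def mapT (φ : Y → Y') (m : ℕ) : Tup m Y →ₗ[ℝ] Tup m Y' :=
  Finsupp.lmapDomain ℝ ℝ fun y => φ ∘ y

theorem mapT_single (φ : Y → Y') (y : Fin m → Y) :
    mapT φ m (Finsupp.single y 1) = Finsupp.single (φ ∘ y) 1 := by
  rw [mapT, Finsupp.lmapDomain_apply, Finsupp.mapDomain_single]

theorem bdT_mapT (φ : Y → Y') (c : Tup (m + 1) Y) :
    bdT m (mapT φ (m + 1) c) = mapT φ m (bdT m c) := by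
  refine tup_hom_ext (f := bdT m ∘ₗ mapT φ (m + 1)) (f' := mapT φ m ∘ₗ bdT m) (fun y => ?_) c
  rw [LinearMap.comp_apply, LinearMap.comp_apply, mapT_single, bdT_single, bdT_single, map_sum]
  refine Finset.sum_congr rfl fun i _ => ?_
  rw [map_smul, mapT_single]
  rfl

theorem coneT_mapT (φ : Y → Y') (b : Y) (c : Tup m Y) :
    coneT (φ b) m (mapT φ m c) = mapT φ (m + 1) (coneT b m c) := by
  refine tup_hom_ext (f := coneT (φ b) m ∘ₗ mapT φ m) (f' := mapT φ (m + 1) ∘ₗ coneT b m)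
    (fun y => ?_) c
  rw [LinearMap.comp_apply, LinearMap.comp_apply, mapT_single, coneT_single, coneT_single,
    mapT_single]
  congr 1
  funext j
  refine Fin.cases ?_ (fun j => ?_) j
  · simp
  · simp

/-- Barycentric subdivision. -/
noncomputable def sd (k : ℕ) : ∀ m, Tup m (stdSimplex ℝ (Fin k)) →ₗ[ℝ] Tup m (stdSimplex ℝ (Fin k))
  | 0 => LinearMap.id
  | m + 1 => Finsupp.linearCombination ℝ fun p =>
      coneT (bary p) m (sd k m (bdT m (Finsupp.single p 1)))

/-- The chain homotopy between the identity and barycentric subdivision. -/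
noncomputable def sdT (k : ℕ) :
    ∀ m, Tup m (stdSimplex ℝ (Fin k)) →ₗ[ℝ] Tup (m + 1) (stdSimplex ℝ (Fin k))
  | 0 => 0
  | m + 1 => Finsupp.linearCombination ℝ fun p =>
      coneT (bary p) (m + 1) (Finsupp.single p 1 - sdT k m (bdT m (Finsupp.single p 1)))

theorem sd_single (p : Fin (m + 1) → stdSimplex ℝ (Fin k)) : sd k (m + 1) (Finsupp.single p 1) =
    coneT (bary p) m (sd k m (bdT m (Finsupp.single p 1))) := by
  rw [sd, Finsupp.linearCombination_single, one_smul]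

theorem sdT_single (p : Fin (m + 1) → stdSimplex ℝ (Fin k)) : sdT k (m + 1) (Finsupp.single p 1) =
    coneT (bary p) (m + 1) (Finsupp.single p 1 - sdT k m (bdT m (Finsupp.single p 1))) := by
  rw [sdT, Finsupp.linearCombination_single, one_smul]

/-- By the boundary formula for cones, what has to be coned off is the boundary of `p - T ∂p`. By
induction and `∂∂ = 0` it is the subdivision of `∂p`. -/
theorem bdT_sdT (c : Tup (m + 1) (stdSimplex ℝ (Fin k))) :
    bdT (m + 1) (sdT k (m + 1) c) + sdT k m (bdT m c) = c - sd k (m + 1) c := by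
  induction m with
  | zero =>
    refine tup_hom_ext (f := bdT 1 ∘ₗ sdT k 1 + sdT k 0 ∘ₗ bdT 0)
      (f' := LinearMap.id - sd k 1) (fun p => ?_) c
    simp only [LinearMap.add_apply, LinearMap.sub_apply, LinearMap.comp_apply, LinearMap.id_apply]
    rw [sdT_single, sd_single, bdT_coneT]
    simp [sdT, sd]
  | succ m ih =>
    refine tup_hom_ext (f := bdT (m + 2) ∘ₗ sdT k (m + 2) + sdT k (m + 1) ∘ₗ bdT (m + 1))
      (f' := LinearMap.id - sd k (m + 2)) (fun p => ?_) c
    simp only [LinearMap.add_apply, LinearMap.sub_apply, LinearMap.comp_apply, LinearMap.id_apply]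
    have h := ih (bdT (m + 1) (Finsupp.single p 1))
    rw [bdT_bdT, map_zero, add_zero] at h
    rw [sdT_single, sd_single, bdT_coneT, map_sub, h]
    abel_nf

theorem sd_mapT {φ : stdSimplex ℝ (Fin k) → stdSimplex ℝ (Fin l)}
    (hφ : ∀ m (p : Fin (m + 1) → stdSimplex ℝ (Fin k)), φ (bary p) = bary (φ ∘ p))
    (c : Tup m (stdSimplex ℝ (Fin k))) : sd l m (mapT φ m c) = mapT φ m (sd k m c) := by
  induction m with
  | zero => rfl
  | succ m ih =>
    refine tup_hom_ext (f := sd l (m + 1) ∘ₗ mapT φ (m + 1))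
      (f' := mapT φ (m + 1) ∘ₗ sd k (m + 1)) (fun p => ?_) c
    rw [LinearMap.comp_apply, LinearMap.comp_apply, mapT_single, sd_single, sd_single,
      ← coneT_mapT, ← ih, ← bdT_mapT, mapT_single, hφ]

theorem sdT_mapT {φ : stdSimplex ℝ (Fin k) → stdSimplex ℝ (Fin l)}
    (hφ : ∀ m (p : Fin (m + 1) → stdSimplex ℝ (Fin k)), φ (bary p) = bary (φ ∘ p))
    (c : Tup m (stdSimplex ℝ (Fin k))) : sdT l m (mapT φ m c) = mapT φ (m + 1) (sdT k m c) := by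
  induction m with
  | zero => exact (map_zero _).symm
  | succ m ih =>
    refine tup_hom_ext (f := sdT l (m + 1) ∘ₗ mapT φ (m + 1))
      (f' := mapT φ (m + 2) ∘ₗ sdT k (m + 1)) (fun p => ?_) c
    rw [LinearMap.comp_apply, LinearMap.comp_apply, mapT_single, sdT_single, sdT_single,
      ← coneT_mapT, (mapT φ (m + 1)).map_sub, ← ih, ← bdT_mapT, mapT_single, hφ]

/-- Apply the boundary to the homotopy formula for `c`, and the homotopy formula to the boundary of
`c`. -/
theorem sd_bdT (c : Tup (m + 2) (stdSimplex ℝ (Fin k))) :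
    sd k (m + 1) (bdT (m + 1) c) = bdT (m + 1) (sd k (m + 2) c) := by
  have h1 := congrArg (bdT (m + 1)) (bdT_sdT c)
  have h2 := bdT_sdT (bdT (m + 1) c)
  rw [map_add, bdT_bdT, zero_add, map_sub] at h1
  rw [bdT_bdT, map_zero, add_zero] at h2
  exact sub_right_injective (h2.symm.trans h1)

/-- The chain homotopy between the identity and the iterated subdivision. -/
noncomputable def sdH (k N m : ℕ) :
    Tup m (stdSimplex ℝ (Fin k)) →ₗ[ℝ] Tup (m + 1) (stdSimplex ℝ (Fin k)) :=
  ∑ i ∈ Finset.range N, sdT k m ∘ₗ (sd k m) ^ i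

theorem sd_pow_bdT (i : ℕ) (c : Tup (m + 2) (stdSimplex ℝ (Fin k))) :
    ((sd k (m + 1)) ^ i) (bdT (m + 1) c) = bdT (m + 1) (((sd k (m + 2)) ^ i) c) := by
  induction i with
  | zero => rfl
  | succ i ih => rw [pow_succ', pow_succ', Module.End.mul_apply, Module.End.mul_apply, ih, sd_bdT]

theorem bdT_sdH (N : ℕ) (c : Tup (m + 2) (stdSimplex ℝ (Fin k))) :
    bdT (m + 2) (sdH k N (m + 2) c) + sdH k N (m + 1) (bdT (m + 1) c) =
      c - ((sd k (m + 2)) ^ N) c := by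
  induction N with
  | zero => simp [sdH]
  | succ N ih =>
    have e : ∀ l (x : Tup l (stdSimplex ℝ (Fin k))), sdH k (N + 1) l x =
        sdH k N l x + sdT k l (((sd k l) ^ N) x) := fun l x => by
      rw [sdH, Finset.sum_range_succ, LinearMap.add_apply, LinearMap.comp_apply]
      rfl
    have h := bdT_sdT (((sd k (m + 2)) ^ N) c)
    rw [e, e, map_add, sd_pow_bdT, add_add_add_comm, ih, h, pow_succ', Module.End.mul_apply]
    abel

theorem sd_pow_mapT {φ : stdSimplex ℝ (Fin k) → stdSimplex ℝ (Fin l)}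
    (hφ : ∀ m (p : Fin (m + 1) → stdSimplex ℝ (Fin k)), φ (bary p) = bary (φ ∘ p)) (i : ℕ)
    (c : Tup m (stdSimplex ℝ (Fin k))) :
    ((sd l m) ^ i) (mapT φ m c) = mapT φ m (((sd k m) ^ i) c) := by
  induction i with
  | zero => rfl
  | succ i ih =>
    rw [pow_succ', pow_succ', Module.End.mul_apply, Module.End.mul_apply, ih, sd_mapT hφ]

theorem sdH_mapT {φ : stdSimplex ℝ (Fin k) → stdSimplex ℝ (Fin l)}
    (hφ : ∀ m (p : Fin (m + 1) → stdSimplex ℝ (Fin k)), φ (bary p) = bary (φ ∘ p)) (N : ℕ)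
    (c : Tup m (stdSimplex ℝ (Fin k))) :
    sdH l N m (mapT φ m c) = mapT φ (m + 1) (sdH k N m c) := by
  simp only [sdH, LinearMap.sum_apply, LinearMap.comp_apply, map_sum, sd_pow_mapT hφ, sdT_mapT hφ]

end Chains

/-! ### The mesh of iterated subdivisions. -/

section Mesh

variable {m k : ℕ}

/-- The distances between the points of a tuple are at most `d`. -/
def Mesh {m k : ℕ} (d : ℝ) (p : Fin m → stdSimplex ℝ (Fin k)) : Prop := ∀ a b, dist (p a) (p b) ≤ d

/-- The two properties are proved together: points of a subdivided face lie in the simplex, so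
convexity bounds their distance from the barycenter by that of the vertices, while distances within
the face shrink by induction. -/
theorem sd_single_mem_supported (p : Fin m → stdSimplex ℝ (Fin k)) {d : ℝ} (hd : 0 ≤ d)
    (hp : Mesh d p) : sd k m (Finsupp.single p 1) ∈ Finsupp.supported ℝ ℝ
      {r : Fin m → stdSimplex ℝ (Fin k) | (∀ a, r a ∈ range (affMap p)) ∧
        Mesh (m / (m + 1) * d) r} := by
  induction m with
  | zero => exact Finsupp.single_mem_supported ℝ _ ⟨fun a => a.elim0, fun a => a.elim0⟩
  | succ m ih =>
    -- Here `m` counts vertices, so the ratio is not the optimal one; being increasing and less than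
    -- one is all that is needed.
    have hm : (m : ℝ) / (m + 1) * d ≤ ((m + 1 : ℕ) : ℝ) / ((m + 1 : ℕ) + 1) * d := by
      refine mul_le_mul_of_nonneg_right ?_ hd
      rw [div_le_div_iff₀ (by positivity) (by positivity)]
      push_cast
      nlinarith
    rw [sd_single, bdT_single, map_sum, map_sum]
    refine Submodule.sum_mem _ fun i _ => ?_
    rw [map_smul, map_smul]
    refine Submodule.smul_mem _ _ ?_
    have h1 := ih (p ∘ i.succAbove) fun a b => hp _ _
    rw [Finsupp.mem_supported] at h1 ⊢
    intro r hr
    obtain ⟨r', hr', rfl⟩ := Finset.mem_image.1 (Finsupp.mapDomain_support hr)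
    obtain ⟨h2, h3⟩ := h1 hr'
    have h4 : ∀ a, r' a ∈ range (affMap p) := fun a => by
      obtain ⟨t, ht⟩ := h2 a
      exact ⟨faceS i t, by rw [← ht, ← affMap_faceS]; rfl⟩
    have h5 : ∀ a, dist (bary p) (r' a) ≤ ((m + 1 : ℕ) : ℝ) / ((m + 1 : ℕ) + 1) * d := fun a => by
      obtain ⟨t, ht⟩ := h4 a
      rw [← ht]
      exact (dist_affMap_le p t _ fun j => dist_bary_le p j hd hp).trans hm
    refine ⟨fun a => ?_, fun a b => ?_⟩
    · refine Fin.cases ?_ (fun a => ?_) a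
      · exact ⟨_, rfl⟩
      · exact h4 a
    · refine Fin.cases ?_ (fun a => ?_) a <;> refine Fin.cases ?_ (fun b => ?_) b
      · simp only [Fin.cons_zero, dist_self]
        positivity
      · exact h5 b
      · simp only [Fin.cons_zero, Fin.cons_succ]
        rw [dist_comm]
        exact h5 a
      · exact (h3 a b).trans hm

theorem map_mem_supported {α β : Type} (f : (α →₀ ℝ) →ₗ[ℝ] β →₀ ℝ) {S : Set α} {S' : Set β}
    (h : ∀ a ∈ S, f (Finsupp.single a 1) ∈ Finsupp.supported ℝ ℝ S') {c : α →₀ ℝ}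
    (hc : c ∈ Finsupp.supported ℝ ℝ S) : f c ∈ Finsupp.supported ℝ ℝ S' := by
  rw [Finsupp.supported_eq_span_single] at hc
  refine Submodule.span_le (p := (Finsupp.supported ℝ ℝ S').comap f) |>.2 ?_ hc
  rintro _ ⟨a, ha, rfl⟩
  exact h a ha

theorem sd_pow_mem_supported (p : Fin m → stdSimplex ℝ (Fin k)) (hp : Mesh 1 p) (N : ℕ) :
    ((sd k m) ^ N) (Finsupp.single p 1) ∈ Finsupp.supported ℝ ℝ
      {r : Fin m → stdSimplex ℝ (Fin k) | Mesh ((m / (m + 1) : ℝ) ^ N) r} := by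
  induction N with
  | zero => exact Finsupp.single_mem_supported ℝ _ (by simpa using hp)
  | succ N ih =>
    rw [pow_succ' (sd k m), Module.End.mul_apply]
    refine map_mem_supported _ (fun r hr => ?_) ih
    refine Finsupp.supported_mono (fun r' hr' => ?_)
      (sd_single_mem_supported r (by positivity) hr)
    simpa only [pow_succ', mem_ofPred_eq] using hr'.2

theorem mesh_one (p : Fin m → stdSimplex ℝ (Fin k)) : Mesh 1 p := fun a b => by
  refine (dist_pi_le_iff zero_le_one).2 fun j => ?_
  rw [Real.dist_eq, abs_le]
  have h1 := stdSimplex.zero_le (p a) j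
  have h2 := stdSimplex.le_one (p a) j
  have h3 := stdSimplex.zero_le (p b) j
  have h4 := stdSimplex.le_one (p b) j
  change -1 ≤ p a j - p b j ∧ p a j - p b j ≤ 1
  constructor <;> linarith

theorem dist_faceS (i : Fin (m + 1)) (x y : stdSimplex ℝ (Fin m)) :
    dist (faceS i x) (faceS i y) ≤ dist x y := by
  refine (dist_pi_le_iff dist_nonneg).2 fun j => ?_
  change dist (faceS i x j) (faceS i y j) ≤ _
  rcases Fin.eq_self_or_eq_succAbove i j with rfl | ⟨l, rfl⟩
  · rw [faceS_self, faceS_self, dist_self]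
    exact dist_nonneg
  · rw [faceS_succAbove, faceS_succAbove]
    exact dist_le_pi_dist (x : Fin m → ℝ) y l

end Mesh

end OrbiCell

namespace OrbiCell

open Set Filter Topology

/-! ### Acyclicity of the cochains that vanish on small simplices. -/

section SmallCochains

variable {X : Type*} [TopologicalSpace X] {ι : Type*} (V : ι → Set X) {k l m : ℕ}

/-- Affine simplices of the mesh of the `N`-th subdivision are small. -/
def Fine (σ : Sing m X) (N : ℕ) : Prop := ∀ (l : ℕ) (p : Fin (l + 1) → stdSimplex ℝ (Fin m)),
  Mesh ((m / (m + 1) : ℝ) ^ N) p → IsSmall V (σ.comp (affMap p))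

variable {V}

/-- Eventually the mesh is below a Lebesgue number of the cover pulled back to the simplex. -/
theorem exists_fine (hV : ∀ j, IsOpen (V j)) (hc : ∀ p, ∃ j, p ∈ V j) (σ : Sing m X) :
    ∃ N, Fine V σ N := by
  obtain ⟨δ, hδ, h⟩ := lebesgue_number_lemma_of_metric (s := (univ : Set (stdSimplex ℝ (Fin m))))
    (c := fun j => σ ⁻¹' V j) isCompact_univ (fun j => (hV j).preimage σ.continuous)
    fun x _ => mem_iUnion.2 (hc (σ x))
  obtain ⟨N, hN⟩ := exists_pow_lt_of_lt_one hδ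
    ((div_lt_one (by positivity)).2 (by linarith) : (m / (m + 1) : ℝ) < 1)
  refine ⟨N, fun l p hp => ?_⟩
  obtain ⟨j, hj⟩ := h (p 0) trivial
  refine ⟨j, fun t => hj ?_⟩
  rw [Metric.mem_ball, dist_comm]
  exact (dist_affMap_le p t (p 0) fun i => hp 0 i).trans_lt hN

theorem Fine.mono {σ : Sing m X} {N N' : ℕ} (h : Fine V σ N) (hN : N ≤ N') : Fine V σ N' :=
  fun l p hp => h l p fun a b => (hp a b).trans (pow_le_pow_of_le_one (by positivity)
    ((div_le_one (by positivity)).2 (by linarith)) hN)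

theorem IsSmall.comp {σ : Sing m X} (h : IsSmall V σ) (φ : C(stdSimplex ℝ (Fin l), stdSimplex ℝ (Fin m))) :
    IsSmall V (σ.comp φ) := h.imp fun _ hj _ => hj _

theorem faceS_comp_affMap (i : Fin (m + 1)) (p : Fin l → stdSimplex ℝ (Fin m)) :
    (faceS i).comp (affMap p) = affMap (faceS i ∘ p) := by
  rw [faceS_eq_affMap, affMap_affMap]

theorem faceS_bary (i : Fin (m + 1)) (l : ℕ) (p : Fin (l + 1) → stdSimplex ℝ (Fin m)) :
    faceS i (bary p) = bary (faceS i ∘ p) := by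
  rw [faceS_eq_affMap]
  exact affMap_bary _ _

theorem faceS_comp_vert (i : Fin (m + 1)) : faceS i ∘ vert m = vert (m + 1) ∘ i.succAbove := by
  rw [faceS_eq_affMap]
  exact funext fun j => affMap_vert _ j

theorem Fine.face {σ : Sing (m + 1) X} {N : ℕ} (h : Fine V σ N) (i : Fin (m + 1)) :
    Fine V (σ.comp (faceS i)) N := fun l p hp => by
  rw [ContinuousMap.comp_assoc, faceS_comp_affMap]
  refine h l _ fun a b => (dist_faceS i _ _).trans ((hp a b).trans ?_)
  refine pow_le_pow_left₀ (by positivity) ?_ N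
  rw [div_le_div_iff₀ (by positivity) (by positivity)]
  push_cast
  nlinarith

/-- The value of a function of simplices on a chain of affine simplices. -/
noncomputable def evalC (f : Sing m X → ℝ) (σ : Sing k X) :
    Tup m (stdSimplex ℝ (Fin k)) →ₗ[ℝ] ℝ :=
  Finsupp.linearCombination ℝ fun p => f (σ.comp (affMap p))

theorem evalC_single (f : Sing m X → ℝ) (σ : Sing k X) (p : Fin m → stdSimplex ℝ (Fin k)) :
    evalC f σ (Finsupp.single p 1) = f (σ.comp (affMap p)) := by
  rw [evalC, Finsupp.linearCombination_single, one_smul]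

theorem evalC_eq_zero {f : Sing m X → ℝ} (hf : ∀ σ, IsSmall V σ → f σ = 0) {σ : Sing k X}
    {c : Tup m (stdSimplex ℝ (Fin k))}
    (hc : c ∈ Finsupp.supported ℝ ℝ {p | IsSmall V (σ.comp (affMap p))}) : evalC f σ c = 0 := by
  rw [evalC, Finsupp.linearCombination_apply]
  refine Finset.sum_eq_zero fun p hp => ?_
  change c p • f (σ.comp (affMap p)) = 0
  rw [hf _ (hc hp), smul_zero]

theorem evalC_bdT (f : Sing m X → ℝ) (σ : Sing k X) (p : Fin (m + 1) → stdSimplex ℝ (Fin k)) :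
    evalC f σ (bdT m (Finsupp.single p 1)) =
      ∑ i : Fin (m + 1), (-1 : ℝ) ^ (i : ℕ) • f ((σ.comp (affMap p)).comp (faceS i)) := by
  rw [bdT_single, map_sum]
  refine Finset.sum_congr rfl fun i _ => ?_
  rw [map_smul, evalC_single, ContinuousMap.comp_assoc, affMap_faceS]

theorem evalC_bdT_eq_zero {f : Sing m X → ℝ}
    (hf : ∀ σ : Sing (m + 1) X, ∑ i : Fin (m + 1), (-1 : ℝ) ^ (i : ℕ) • f (σ.comp (faceS i)) = 0)
    (σ : Sing k X) (c : Tup (m + 1) (stdSimplex ℝ (Fin k))) : evalC f σ (bdT m c) = 0 :=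
  tup_hom_ext (f := evalC f σ ∘ₗ bdT m) (f' := 0) (fun p => (evalC_bdT f σ p).trans (hf _)) c

theorem evalC_mapT (f : Sing m X → ℝ) (σ : Sing (k + 1) X) (i : Fin (k + 1))
    (c : Tup m (stdSimplex ℝ (Fin k))) :
    evalC f σ (mapT (faceS i) m c) = evalC f (σ.comp (faceS i)) c := by
  refine tup_hom_ext (f := evalC f σ ∘ₗ mapT (faceS i) m) (f' := evalC f (σ.comp (faceS i)))
    (fun p => ?_) c
  rw [LinearMap.comp_apply, mapT_single, evalC_single, evalC_single, ContinuousMap.comp_assoc,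
    faceS_comp_affMap]

/-- By naturality the homotopy applied to an affine simplex is the image of the homotopy on the
standard simplex. All its terms therefore factor through that small simplex. -/
theorem sdT_mem_supported {σ : Sing k X} {c : Tup m (stdSimplex ℝ (Fin k))}
    (hc : c ∈ Finsupp.supported ℝ ℝ {p | IsSmall V (σ.comp (affMap p))}) :
    sdT k m c ∈ Finsupp.supported ℝ ℝ {p | IsSmall V (σ.comp (affMap p))} := by
  refine map_mem_supported _ (fun p hp => ?_) hc
  have h1 : (Finsupp.single p 1 : Tup m (stdSimplex ℝ (Fin k))) =
      mapT (affMap p) m (Finsupp.single (vert m) 1) := by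
    rw [mapT_single]
    congr 1
    exact funext fun i => (affMap_vert p i).symm
  rw [h1, sdT_mapT fun _ _ => affMap_bary _ _, Finsupp.mem_supported]
  intro r hr
  obtain ⟨r', -, rfl⟩ := Finset.mem_image.1 (Finsupp.mapDomain_support hr)
  change IsSmall V (σ.comp (affMap (affMap p ∘ r')))
  rw [← affMap_affMap, ← ContinuousMap.comp_assoc]
  exact IsSmall.comp hp _

theorem sd_pow_mem_of_fine {σ : Sing k X} {N : ℕ} (h : Fine V σ N) (hk : m + 1 = k)
    (p : Fin (m + 1) → stdSimplex ℝ (Fin k)) :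
    ((sd k (m + 1)) ^ N) (Finsupp.single p 1) ∈
      Finsupp.supported ℝ ℝ {p | IsSmall V (σ.comp (affMap p))} := by
  subst hk
  exact Finsupp.supported_mono (fun r hr => h m r hr) (sd_pow_mem_supported p (mesh_one p) N)

/-- Further subdivisions add only small simplices to the homotopy. So the number of subdivisions may
depend on the simplex. -/
theorem evalC_sdH_eq {f : Sing (m + 2) X → ℝ} (hf : ∀ σ, IsSmall V σ → f σ = 0)
    {σ : Sing (m + 1) X} {N N' : ℕ} (h : Fine V σ N) (hN : N ≤ N') :
    evalC f σ (sdH (m + 1) N' (m + 1) (Finsupp.single (vert (m + 1)) 1)) =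
      evalC f σ (sdH (m + 1) N (m + 1) (Finsupp.single (vert (m + 1)) 1)) := by
  induction N', hN using Nat.le_induction with
  | base => rfl
  | succ N' hN ih =>
    rw [← ih, sdH, Finset.sum_range_succ, LinearMap.add_apply, map_add, LinearMap.comp_apply,
      evalC_eq_zero hf (sdT_mem_supported (sd_pow_mem_of_fine (h.mono hN) rfl _)), add_zero]
    rfl

/-- The complex of cochains vanishing on the small simplices is acyclic. -/
theorem exists_vanishing_cochain (hV : ∀ j, IsOpen (V j)) (hc : ∀ p, ∃ j, p ∈ V j) {q : ℕ}
    (f : Sing (q + 2) X → ℝ)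
    (hf : ∀ σ : Sing (q + 3) X, ∑ i : Fin (q + 3), (-1 : ℝ) ^ (i : ℕ) • f (σ.comp (faceS i)) = 0)
    (hs : ∀ σ, IsSmall V σ → f σ = 0) : ∃ z : Sing (q + 1) X → ℝ, (∀ σ, IsSmall V σ → z σ = 0) ∧
      ∀ σ : Sing (q + 2) X, ∑ i : Fin (q + 2), (-1 : ℝ) ^ (i : ℕ) • z (σ.comp (faceS i)) = f σ := by
  classical
  let N : ∀ {m}, Sing m X → ℕ := fun σ => Nat.find (exists_fine hV hc σ)
  have hN : ∀ {m} (σ : Sing m X), Fine V σ (N σ) := fun σ => Nat.find_spec (exists_fine hV hc σ)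
  -- The primitive evaluates `f` on the homotopy from a simplex to its first sufficiently fine
  -- subdivision. A small simplex needs none, so the value there is zero.
  refine ⟨fun σ => evalC f σ (sdH (q + 1) (N σ) (q + 1) (Finsupp.single (vert (q + 1)) 1)),
    fun σ hσ => ?_, fun σ => ?_⟩
  · have h0 : N σ = 0 := (Nat.find_eq_zero _).2 fun l p _ => hσ.comp _
    simp [h0, sdH]
  · have h1 := congrArg (evalC f σ) (bdT_sdH (N σ) (Finsupp.single (vert (q + 2)) 1))
    rw [map_add, map_sub, evalC_bdT_eq_zero hf, zero_add,
      evalC_eq_zero hs (sd_pow_mem_of_fine (hN σ) rfl _), sub_zero, evalC_single, affMap_vert_eq_id,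
      ContinuousMap.comp_id, bdT_single, map_sum, map_sum] at h1
    rw [← h1]
    refine Finset.sum_congr rfl fun i _ => ?_
    -- A face may need fewer subdivisions than the simplex itself; `evalC_sdH_eq` makes up for the
    -- difference.
    rw [map_smul, map_smul, ← faceS_comp_vert, ← mapT_single, sdH_mapT (faceS_bary i), evalC_mapT,
      evalC_sdH_eq hs (hN _) (Nat.find_min' (exists_fine hV hc _) ((hN σ).face i))]

end SmallCochains

end OrbiCell

namespace OrbiCell

open Set

/-! ### From small to all simplices, and to the singular cochain complex. -/

section Comparison

theorem nonempty_homology_iso_of_quasiIso {C D : CochainComplex (ModuleCat.{1} ℝ) ℕ} (f : C ⟶ D)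
    (hf : QuasiIso f) (m : ℕ) : Nonempty (C.homology m ≅ D.homology m) :=
  ⟨isoOfQuasiIsoAt f m⟩

/-- All singular simplices. -/
def AllSimp {X : Type 1} [TopologicalSpace X] (m : ℕ) (_ : Sing m X) : Prop := True

theorem allSimp_face {X : Type 1} [TopologicalSpace X] (m : ℕ) (σ : Sing (m + 1) X)
    (i : Fin (m + 1)) (_ : AllSimp (m + 1) σ) : AllSimp m (σ.comp (faceS i)) := trivial

/-- The inclusion of the small simplices induces an isomorphism in cohomology. -/
theorem quasiIso_simpRes {X : Type 1} [TopologicalSpace X] {ι : Type} {V : ι → Set X}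
    (hV : ∀ j, IsOpen (V j)) (hc : ∀ p, ∃ j, p ∈ V j) {P : ∀ m, Sing m X → Prop}
    (hP : ∀ m σ i, P (m + 1) σ → P m (σ.comp (faceS i))) (hPV : ∀ m σ, P m σ ↔ IsSmall V σ) :
    QuasiIso (cpxMap (hd := fun q => simpD_simpD (P := AllSimp (X := X)) allSimp_face q)
      (he := fun q => simpD_simpD hP q) (fun q => simpRes (fun _ _ _ => trivial) q)
      fun _ _ => rfl) := by
  classical
  refine quasiIso_cpxMap_of_surjective _ _ (fun q f => ?_) (fun f _ hf => ?_) fun q f hd hf => ?_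
  · refine ⟨fun σ => if h : P _ σ.1 then f ⟨σ.1, h⟩ else 0, funext fun σ => dif_pos σ.2⟩
  · funext σ
    obtain ⟨j, hj⟩ := hc (σ.1 default)
    exact congrFun hf ⟨σ.1, (hPV _ _).2 ⟨j, fun t => by rwa [Subsingleton.elim t default]⟩⟩
  · obtain ⟨z, hz, hz'⟩ := exists_vanishing_cochain hV hc (fun σ => f ⟨σ, trivial⟩)
      (fun σ => congrFun hd ⟨σ, trivial⟩) fun σ h => congrFun hf ⟨σ, (hPV _ _).2 h⟩
    exact ⟨fun σ => z σ.1, funext fun σ => hz _ ((hPV _ _).1 σ.2), funext fun σ => hz' σ.1⟩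

/-- A singular cochain as a function on the singular set. -/
noncomputable def toSingular (X : TopCat.{1}) (q : ℕ) :
    ModuleCat.of ℝ (SimpFun (AllSimp (X := X)) q) ⟶ (singularCochains X).X q :=
  ModuleCat.ofHom (LinearMap.funLeft ℝ ℝ fun s : (TopCat.toSSet.obj X).obj
    (Opposite.op (SimplexCategory.mk q)) =>
      (⟨X.toSSetObjEquiv _ s, trivial⟩ : {σ : Sing (q + 1) X // AllSimp _ σ}))

theorem toSingular_isIso (X : TopCat.{1}) (q : ℕ) : IsIso (toSingular X q) := by
  let e : (TopCat.toSSet.obj X).obj (Opposite.op (SimplexCategory.mk q)) ≃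
      {σ : Sing (q + 1) X // AllSimp _ σ} :=
    (X.toSSetObjEquiv _).trans (Equiv.subtypeUnivEquiv fun _ => trivial).symm
  exact (LinearEquiv.funCongrLeft ℝ ℝ e).toModuleIso.isIso_hom

/-- Evaluation of a map between spaces of functions at a function and a point. -/
def evalHom {S T : Type 1} (φ : S → ℝ) (t : T) :
    (ModuleCat.of ℝ (S → ℝ) ⟶ ModuleCat.of ℝ (T → ℝ)) →+ ℝ :=
  AddMonoidHom.mk' (fun f => (f.hom φ : T → ℝ) t) fun _ _ => rfl

theorem objD_apply (S : SSet.{1}) (q : ℕ) (φ : S.obj (Opposite.op (SimplexCategory.mk q)) → ℝ)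
    (s : S.obj (Opposite.op (SimplexCategory.mk (q + 1)))) :
    evalHom φ s (AlgebraicTopology.AlternatingCofaceMapComplex.objD
      (S.rightOp ⋙ functionsFunctor) q) =
      ∑ i : Fin (q + 2), (-1 : ℝ) ^ (i : ℕ) • φ (S.δ i s) := by
  refine (map_sum (evalHom φ s) _ _).trans (Finset.sum_congr rfl fun i _ => ?_)
  refine (map_zsmul (evalHom φ s) _ _).trans ?_
  rw [zsmul_eq_mul, smul_eq_mul]
  push_cast
  rfl

theorem toSingular_comm (X : TopCat.{1}) (q : ℕ) :
    toSingular X q ≫ (singularCochains X).d q (q + 1) =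
      ModuleCat.ofHom (simpD (allSimp_face (X := X)) q) ≫ toSingular X (q + 1) := by
  have e : (singularCochains X).d q (q + 1) =
      AlgebraicTopology.AlternatingCofaceMapComplex.objD
        ((TopCat.toSSet.obj X).rightOp ⋙ functionsFunctor) q := by
    change (AlgebraicTopology.AlternatingCofaceMapComplex.obj _).d q (q + 1) = _
    simp only [AlgebraicTopology.AlternatingCofaceMapComplex.obj, CochainComplex.of_d]
  rw [e]
  exact ModuleCat.hom_ext (LinearMap.ext fun f => funext fun s =>
    objD_apply (TopCat.toSSet.obj X) q ((toSingular X q).hom f) s)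

/-- The singular cohomology in terms of functions on the singular simplices. -/
theorem nonempty_homology_iso_singular (X : TopCat.{1}) (m : ℕ) :
    Nonempty ((cpx (fun q => simpD (allSimp_face (X := X)) q)
      fun q => simpD_simpD _ q).homology m ≅ (singularCochains X).homology m) := by
  let f : cpx (fun q => simpD (allSimp_face (X := X)) q) (fun q => simpD_simpD _ q) ⟶
      singularCochains X :=
    CochainComplex.ofHom (X := cpx (fun q => simpD (allSimp_face (X := X)) q)
      (fun q => simpD_simpD _ q)) (Y := singularCochains X) (fun q => toSingular X q) fun q => by
        rw [cpx_d]
        exact toSingular_comm X q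
  have : ∀ q, IsIso (f.f q) := toSingular_isIso X
  have : IsIso f := HomologicalComplex.Hom.isIso_of_components f
  exact ⟨asIso (HomologicalComplex.homologyMap f m)⟩

end Comparison

/-! ### Assembly of both halves. -/

section Main

variable {g n : ℕ} {ι : Type} [Fintype ι] [LinearOrder ι] (K : Cutoffs ι)

theorem smallOn_empty_iff (m : ℕ) (σ : Sing m (LInfty g n)) :
    SmallOn K ∅ m σ ↔ IsSmall (fun j => avoid (K.cut {j}) g n) σ := by
  refine ⟨fun h => h.1, fun h => ⟨h, fun t => ?_⟩⟩
  obtain ⟨j, hj⟩ := h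
  exact avoid_anti (K.cut_mono (empty_subset _)) (hj t)

variable (g n) in
/-- The complex of orbi-cellular forms. -/
noncomputable abbrev formCpx : CochainComplex (ModuleCat.{1} ℝ) ℕ :=
  cpx (M := fun q => orbiFormsOn ∅ g n q) (fun q => formD g n q) (fun q => orbiD_orbiD _ _ _)

/-- The orbi-cellular forms compute the singular cohomology. -/
theorem nonempty_homology_iso_singularCochains (K : Cutoffs ι)
    (hK : 6 * g + 3 * n < Fintype.card ι) (m : ℕ) :
    Nonempty ((formCpx g n).homology m ≅
      (singularCochains (TopCat.of (LInfty g n))).homology m) := by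
  -- The set of cut points of the empty index set equals `∅` only by a proof, so the complex is
  -- carried along this equality.
  have transport : ∀ (A : Set ℝ) (hA : IsClosed A) (h0 : (0:ℝ) ∉ A) (h1 : (1:ℝ) ∉ A), A = ∅ →
      Nonempty ((formCpx g n).homology m ≅
        (cpx (M := fun q => orbiFormsOn A g n q) (fun q => orbiD hA h0 h1 g n q)
          (fun q => orbiD_orbiD _ _ _)).homology m) := by
    rintro _ hA h0 h1 rfl
    exact ⟨Iso.refl _⟩
  obtain ⟨i1⟩ := transport (K.cut ∅) (K.isClosed_cut ∅) (K.zero_notMem ∅) (K.one_notMem ∅)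
    (image_empty _)
  obtain ⟨i2⟩ := nonempty_homology_iso_forms (g := g) (n := n) K hK m
  obtain ⟨i3⟩ := nonempty_homology_iso_small (g := g) (n := n) K m
  obtain ⟨i4⟩ := nonempty_homology_iso_of_quasiIso _ (quasiIso_simpRes
    (fun j => isOpen_avoid (g := g) (n := n) (K.isClosed_cut {j}) (K.zero_notMem {j})
      (K.one_notMem {j}))
    (exists_mem_avoid K hK) (smallOn_face K ∅) (smallOn_empty_iff K)) m
  obtain ⟨i5⟩ := nonempty_homology_iso_singular (TopCat.of (LInfty g n)) m
  exact ⟨i1 ≪≫ i2 ≪≫ i3.symm ≪≫ i4.symm ≪≫ i5⟩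

variable (g n)

/-- The identification of two descriptions of the orbi-cellular forms. -/
noncomputable def orbiFormsEquiv (k : ℕ) : orbiForms g n k ≃ₗ[ℝ] orbiFormsOn ∅ g n k :=
  LinearEquiv.ofEq _ _ (orbiForms_eq g n k)

/-- The exterior derivative of orbi-cellular forms. -/
noncomputable def dOmega (k : ℕ) : orbiForms g n k →ₗ[ℝ] orbiForms g n (k + 1) :=
  (orbiFormsEquiv g n (k + 1)).symm.toLinearMap ∘ₗ formD g n k ∘ₗ
    (orbiFormsEquiv g n k).toLinearMap

theorem orbiFormsEquiv_dOmega (k : ℕ) (ω : orbiForms g n k) :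
    orbiFormsEquiv g n (k + 1) (dOmega g n k ω) = formD g n k (orbiFormsEquiv g n k ω) := rfl

theorem dOmega_dOmega (k : ℕ) (ω : orbiForms g n k) :
    dOmega g n (k + 1) (dOmega g n k ω) = 0 := by
  refine (orbiFormsEquiv g n (k + 2)).injective ?_
  rw [orbiFormsEquiv_dOmega, orbiFormsEquiv_dOmega, orbiD_orbiD, map_zero]

theorem dOmega_apply (k : ℕ) (ω : orbiForms g n k) (γ : Cell g n) :
    (dOmega g n k ω).1 γ = cubeD (ω.1 γ) := (cubeD_eq_extD _).symm

theorem cochainDLM_cochainDLM (k : ℕ) (c : cochains g n k) :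
    cochainDLM g n (k + 1) (cochainDLM g n k c) = 0 :=
  Subtype.ext (cochainD_cochainD c.2)

/-- Integration of orbi-cellular forms. -/
noncomputable def integral (k : ℕ) : orbiForms g n k →ₗ[ℝ] cochains g n k :=
  integrateLM g n k ∘ₗ (orbiFormsEquiv g n k).toLinearMap

theorem integral_dOmega (k : ℕ) (ω : orbiForms g n k) :
    integral g n (k + 1) (dOmega g n k ω) = cochainDLM g n k (integral g n k ω) :=
  Subtype.ext (integrate_formD (orbiFormsEquiv g n k ω))

/-- Integration is surjective by Whitney forms, and its kernel is acyclic by the homotopy argument.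
-/
theorem quasiIso_integral :
    QuasiIso (cpxMap (M := fun k => orbiForms g n k) (N := fun k => cochains g n k)
      (d := dOmega g n) (e := cochainDLM g n) (hd := dOmega_dOmega g n)
      (he := cochainDLM_cochainDLM g n) (integral g n) (integral_dOmega g n)) := by
  refine quasiIso_cpxMap_of_surjective _ _ (fun k => ?_) (fun ω hd hI => ?_) fun k ω hd hI => ?_
  · exact (integrateLM_surjective g n k).comp (orbiFormsEquiv g n k).surjective
  · exact (map_eq_zero_iff _ (orbiFormsEquiv g n 0).injective).1
      (eq_zero_of_formD_eq_zero Cell.card_black_le _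
        (by rw [← orbiFormsEquiv_dOmega, hd, map_zero]) hI)
  · obtain ⟨η, h1, h2⟩ := exists_formD_eq Cell.card_black_le (orbiFormsEquiv g n (k + 1) ω)
      (by rw [← orbiFormsEquiv_dOmega, hd, map_zero]) hI
    exact ⟨(orbiFormsEquiv g n k).symm η, h1, (orbiFormsEquiv g n (k + 1)).injective h2⟩

/-- With `6g + 3n + 1` cut points there are more of them than black edges in any cell. -/
theorem nonempty_homology_iso_dOmega (m : ℕ) :
    Nonempty ((cpx (M := fun k => orbiForms g n k) (dOmega g n) (dOmega_dOmega g n)).homology m ≅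
      (singularCochains (TopCat.of (LInfty g n))).homology m) := by
  obtain ⟨K⟩ := nonempty_cutoffs (6 * g + 3 * n + 1)
  obtain ⟨i1⟩ := nonempty_homology_iso_of_quasiIso _ (quasiIso_cpxMap_of_bijective
    (M := fun k => orbiForms g n k) (N := fun k => orbiFormsOn ∅ g n k) (d := dOmega g n)
    (e := fun k => formD g n k) (hd := dOmega_dOmega g n) (he := fun k => orbiD_orbiD _ _ _)
    (fun k => (orbiFormsEquiv g n k).toLinearMap) (fun _ _ => rfl)
    fun k => (orbiFormsEquiv g n k).bijective) m
  obtain ⟨i2⟩ := nonempty_homology_iso_singularCochains (g := g) (n := n) K (by simp) m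
  exact ⟨i1 ≪≫ i2⟩

end Main

end OrbiCell
theorem mainTheorem4 (g n : ℕ) (hn : 1 ≤ n) (hgn : 2 < 2 * g + n) :
    ∃ (dΩ : ∀ k : ℕ, ModuleCat.of ℝ (OrbiCell.orbiForms g n k) ⟶
          ModuleCat.of ℝ (OrbiCell.orbiForms g n (k + 1)))
      (dC : ∀ k : ℕ, ModuleCat.of ℝ (OrbiCell.cochains g n k) ⟶
          ModuleCat.of ℝ (OrbiCell.cochains g n (k + 1)))
      (hΩ : ∀ k, dΩ k ≫ dΩ (k + 1) = 0) (hC : ∀ k, dC k ≫ dC (k + 1) = 0)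
      (I : CochainComplex.of (fun k => ModuleCat.of ℝ (OrbiCell.orbiForms g n k)) dΩ hΩ ⟶
          CochainComplex.of (fun k => ModuleCat.of ℝ (OrbiCell.cochains g n k)) dC hC),
      (∀ (k : ℕ) (ω : OrbiCell.orbiForms g n k) (γ : OrbiCell.Cell g n),
        ((dΩ k).hom ω).1 γ = OrbiCell.cubeD (ω.1 γ)) ∧
      (∀ (k : ℕ) (c : OrbiCell.cochains g n k),
        ((dC k).hom c).1 = OrbiCell.cochainD c.1) ∧
      (∀ (k : ℕ) (ω : OrbiCell.orbiForms g n k),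
        ((I.f k).hom ω : OrbiCell.cochains g n k).1 = OrbiCell.integrate ω.1) ∧
      QuasiIso I ∧
      ∀ k : ℕ, Nonempty
        ((CochainComplex.of (fun k => ModuleCat.of ℝ (OrbiCell.orbiForms g n k)) dΩ hΩ).homology k ≅
          (OrbiCell.singularCochains (TopCat.of (OrbiCell.LInfty g n))).homology k) :=
  ⟨fun k => ModuleCat.ofHom (OrbiCell.dOmega g n k),
    fun k => ModuleCat.ofHom (OrbiCell.cochainDLM g n k),
    fun k => ModuleCat.hom_ext (LinearMap.ext (OrbiCell.dOmega_dOmega g n k)),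
    fun k => ModuleCat.hom_ext (LinearMap.ext (OrbiCell.cochainDLM_cochainDLM g n k)),
    OrbiCell.cpxMap (M := fun k => OrbiCell.orbiForms g n k)
      (N := fun k => OrbiCell.cochains g n k) (d := OrbiCell.dOmega g n)
      (e := OrbiCell.cochainDLM g n) (hd := OrbiCell.dOmega_dOmega g n)
      (he := OrbiCell.cochainDLM_cochainDLM g n)
      (OrbiCell.integral g n) (OrbiCell.integral_dOmega g n),
    fun k ω γ => OrbiCell.dOmega_apply g n k ω γ, fun _ _ => rfl, fun _ _ => rfl,
    OrbiCell.quasiIso_integral g n, OrbiCell.nonempty_homology_iso_dOmega g n⟩
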